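/- Let $\mathbf k$ be a field, $e>1$ an integer and $0\le k<e$. Let $\Gamma_e$ be the cyclic quiver with vertex set $I=\mathbb Z/e\mathbb Z$ and one arrow $i\to i+1$ for each $i$, and let $\overline I=\mathbb Z/(e+1)\mathbb Z$ be the vertex set of $\Gamma_{e+1}$. **KLR algebras.** Let $h_{i,j}$ be the number of arrows $i\to j$, and put $Q_{i,i}=0$, $Q_{i,j}(u,v)=(v-u)^{h_{i,j}}(u-v)^{h_{j,i}}$ for $i\ne j$. For a finite quiver without loops, with vertex set $I$, the algebra $R_d$ over $\mathbf k$ has generators $e(\mathbf i)$ ($\mathbf i\in I^d$), $x_1,\dots,x_d$, $\tau_1,\dots,\tau_{d-1}$ and relations: the $e(\mathbf i)$ are orthogonal idempotents with sum $1$; $x_re(\mathbf i)=e(\mathbf i)x_r$; $\tau_re(\mathbf i)=e(s_r\mathbf i)\tau_r$; $x_rx_s=x_sx_r$; $\tau_rx_{r+1}e(\mathbf i)=(x_r\tau_r+\delta_{i_r,i_{r+1}})e(\mathbf i)$; $x_{r+1}\tau_re(\mathbf i)=(\tau_rx_r+\delta_{i_r,i_{r+1}})e(\mathbf i)$; $\tau_rx_s=x_s\tau_r$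 for $s\neq r,r+1$; $\tau_r\tau_s=\tau_s\tau_r$ for $|r-s|>1$; $\tau_r^2e(\mathbf i)=Q_{i_r,i_{r+1}}(x_r,x_{r+1})e(\mathbf i)$; and $(\tau_{r+1}\tau_r\tau_{r+1}-\tau_r\tau_{r+1}\tau_r)e(\mathbf i)$ equals $(x_{r+2}-x_r)^{-1}\bigl(Q_{i_r,i_{r+1}}(x_{r+2},x_{r+1})-Q_{i_r,i_{r+1}}(x_r,x_{r+1})\bigr)e(\mathbf i)$ if $i_r=i_{r+2}$ and $0$ otherwise. For $\alpha=(\alpha_i)\in\mathbb N^I$ with $|\alpha|=\sum_i\alpha_i=d$, let $I^\alpha\subset I^d$ be the set of sequences in which each $i$ occurs $\alpha_i$ times, and $R_\alpha=e(\alpha)R_d$ with $e(\alpha)=\sum_{\mathbf i\in I^\alpha}e(\mathbf i)$. **Categorical representations.** Let $\alpha_i=\varepsilon_i-\varepsilon_{i+1}\in\mathbb Z^I$. A categorical representation of $\widetilde{\mathfrak{sl}}_e=\mathfrak{sl}_e[t,t^{-1}]\oplus\mathbb C\mathbf 1$ in a $\mathrm{Hom}$-finite $\mathbf k$-linear abelian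 category $\mathcal C$ consists of a decomposition $\mathcal C=\bigoplus_{\mu\in\mathbb Z^I}\mathcal C_\mu$, a pair of biadjoint exact ($\mathbf k$-linear) endofunctors $(E,F)$, morphisms of functors $x\colon F\to F$ and $\tau\colon F^2\to F^2$, and decompositions $E=\bigoplus_{i\in I}E_i$, $F=\bigoplus_{i\in I}F_i$, such that: (a) $E_i(\mathcal C_\mu)\subset\mathcal C_{\mu+\alpha_i}$ and $F_i(\mathcal C_\mu)\subset\mathcal C_{\mu-\alpha_i}$; (b) for each $d\ge0$ there is an algebra homomorphism $\psi_d\colon R_d(\Gamma_e)\to\mathrm{End}(F^d)^{\mathrm{op}}$ sending $e(\mathbf i)$ to the projector to $F_{\mathbf i}=F_{i_d}\cdots F_{i_1}$, $x_r$ to $F^{d-r}xF^{r-1}$ and $\tau_r$ to $F^{d-r-1}\tau F^{r-1}$; (c) for each $M$ the endomorphism of $F(M)$ induced by $x$ is nilpotent. For $\alpha\in\mathbb N^I$ with $|\alpha|=d$ let $\psi_\alpha\colon R_\alpha\to\mathrm{End}(F_\alpha)^{\mathrm{op}}$ be the $\alpha$-component of $\psi_d$, where $F_\alpha=\bigoplus_{\mathbf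 i\in I^\alpha}F_{\mathbf i}$. **Doubling the vertex $k$.** For $i\in[0,e-1]$ put $i'=i$ if $i\le k$ and $i'=i+1$ if $i>k$ (in $\overline I$). Let $\phi$ be the map from sequences in $I$ to sequences in $\overline I$, compatible with concatenation, with $\phi(k)=(k,k+1)$ and $\phi(i)=(i')$ for $i\neq k$; let $\overline\alpha=\phi(\alpha)$ be the corresponding dimension vector; on weights let $\overline\mu=\phi(\mu)$ with $\phi(\varepsilon_i)=\varepsilon_{i'}$, that is, $\overline\mu=(\mu_1,\dots,\mu_k,0,\mu_{k+1},\dots,\mu_e)$, with coordinates indexed by $1,\dots,e$ and $1,\dots,e+1$ modulo $e$ and $e+1$. A sequence in $\overline I$ is well-ordered if each entry $k$ is immediately followed by an entry $k+1$, and unordered if some initial part contains more entries $k+1$ than $k$. With $\mathbf e$ the sum of the $e(\mathbf i)$ over the well-ordered $\mathbf i\in\overline I^{\overline\alpha}$, put $$S_{\overline\alpha}=\mathbf eR_{\overline\alpha}(\Gamma_{e+1})\mathbf e\Big/\sum_{\mathbf i\in\overline I^{\overline\alpha}\text{ unordered}}\mathbf eR_{\overline\alpha}(\Gamma_{e+1})e(\mathbf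 i)R_{\overline\alpha}(\Gamma_{e+1})\mathbf e .$$ **Theorem.** Let $\overline{\mathcal C}$ be a $\mathrm{Hom}$-finite $\mathbf k$-linear abelian category with a categorical representation of $\widetilde{\mathfrak{sl}}_{e+1}$, with functors $\overline E_i,\overline F_i$ ($i\in\overline I$) and homomorphisms $\overline\psi_d$, such that $\overline{\mathcal C}_\mu=0$ whenever $\mu\in\mathbb Z^{\overline I}$ has a negative entry. Let $\mathcal C_\mu=\overline{\mathcal C}_{\overline\mu}$ for $\mu\in\mathbb Z^I$ and let $\mathcal C=\bigoplus_{\mu}\mathcal C_\mu\subset\overline{\mathcal C}$. Then $\mathcal C$ is a $\mathrm{Hom}$-finite abelian category, stable under $\overline E_i,\overline F_i$ for $i\ne k,k+1$ and under $\overline E_k\overline E_{k+1}$ and $\overline F_{k+1}\overline F_k$, and there is a categorical representation of $\widetilde{\mathfrak{sl}}_e$ in $\mathcal C$ with weight subcategories $\mathcal C_\mu$ and functors $$E_i=\overline E_i|_{\mathcal C},\ F_i=\overline F_i|_{\mathcal C}\ (0\le i<k),\qquad E_k=\overline E_k\overline E_{k+1}|_{\mathcal C},\ F_k=\overline F_{k+1}\overline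 F_k|_{\mathcal C},\qquad E_i=\overline E_{i+1}|_{\mathcal C},\ F_i=\overline F_{i+1}|_{\mathcal C}\ (k<i<e),$$ whose homomorphisms $\psi_\alpha$ are as follows. For each $\alpha\in\mathbb N^I$ there is an isomorphism of algebras $\Phi_\alpha\colon R_\alpha(\Gamma_e)\to S_{\overline\alpha}$ such that, for all $\mathbf i\in I^\alpha$ and all $r$, $$e(\mathbf i)\mapsto e(\phi(\mathbf i)),\qquad x_re(\mathbf i)\mapsto x_{r'}e(\phi(\mathbf i)),\qquad \tau_re(\mathbf i)\mapsto\tau^*_re(\phi(\mathbf i)),$$ where $r'$ is one more than the length of $\phi(i_1,\dots,i_{r-1})$ and $\tau_r^*e(\phi(\mathbf i))$ is the product of $e(\phi(\mathbf i))$ on the left with: $\tau_{r'}$ if $i_r,i_{r+1}\ne k$; $\tau_{r'}\tau_{r'+1}$ if $i_r=k\neq i_{r+1}$; $\tau_{r'+1}\tau_{r'}$ if $i_r\ne k=i_{r+1}$; $-\tau_{r'+1}\tau_{r'+2}\tau_{r'}\tau_{r'+1}$ if $i_r=i_{r+1}=k$. The action of $\mathbf eR_{\overline\alpha}(\Gamma_{e+1})\mathbf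 e$ on $F_\alpha=\bigoplus_{\mathbf i\in I^\alpha}\overline F_{\phi(\mathbf i)}|_{\mathcal C}$ given by $\overline\psi$ factors through a homomorphism $\overline\psi'_{\overline\alpha}\colon S_{\overline\alpha}\to\mathrm{End}(F_\alpha)^{\mathrm{op}}$, and $\psi_\alpha=\overline\psi'_{\overline\alpha}\circ\Phi_\alpha$. -/

import Mathlib

open CategoryTheory CategoryTheory.Limits

/-! ## Corner algebras `ε A ε` -/

namespace KLRCat

section Corner

variable {K A : Type*} [CommRing K] [Ring A] [Algebra K A] {ε : A}

/-- The element `ε a ε` of the corner ring `ε A ε`. -/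
def toCorner (hε : IsIdempotentElem ε) (a : A) : hε.Corner := ⟨ε * a * ε, a, rfl⟩

instance cornerSMul (hε : IsIdempotentElem ε) : SMul K hε.Corner where
  smul c a := ⟨c • a.1, by
    obtain ⟨b, hb⟩ := a.2
    refine ⟨c • b, ?_⟩
    rw [← hb]
    simp⟩

/-- The corner `ε A ε` of a `K`-algebra `A` is a `K`-algebra with unit `ε`. -/
instance cornerAlgebra (hε : IsIdempotentElem ε) : Algebra K hε.Corner where
  algebraMap :=
    { toFun := fun c => ⟨c • ε, c • (1 : A), by simp [hε.eq]⟩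
      map_one' := Subtype.ext (one_smul K ε)
      map_zero' := Subtype.ext (zero_smul K ε)
      map_add' := fun a b => Subtype.ext (add_smul a b ε)
      map_mul' := fun a b => Subtype.ext (by
        change (a * b) • ε = (a • ε) * (b • ε)
        rw [smul_mul_smul_comm, hε.eq]) }
  commutes' := fun c a => Subtype.ext (by
    change (c • ε) * a.1 = a.1 * (c • ε)
    obtain ⟨h1, h2⟩ := (Subsemigroup.mem_corner_iff hε).mp a.2
    rw [smul_mul_assoc, mul_smul_comm, h1, h2])
  smul_def' := fun c a => Subtype.ext (by
    change c • a.1 = (c • ε) * a.1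
    rw [smul_mul_assoc, ((Subsemigroup.mem_corner_iff hε).mp a.2).1])

end Corner

/-! ## KLR algebras of a finite quiver without loops

A quiver is given by its finite vertex set `I` and the numbers `h i j` of arrows from `i` to `j`.
A sequence `(i₁, …, i_d)` of vertices is an element of `List.Vector I d`; positions are numbered
from `0` in the code. -/

section KLR

/-- Exchange the entries at the positions `r` and `r + 1`. -/
def swapAt {I : Type*} : ℕ → List I → List I
  | 0, a :: b :: l => b :: a :: l
  | r + 1, a :: l => a :: swapAt r l
  | _, l => l

theorem length_swapAt {I : Type*} (r : ℕ) (l : List I) : (swapAt r l).length = l.length := by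
  fun_induction swapAt r l <;> simp_all

/-- The sequence `s_r(i)`. -/
def swapVec {I : Type*} {d : ℕ} (r : ℕ) (v : List.Vector I d) : List.Vector I d :=
  ⟨swapAt r v.1, (length_swapAt r v.1).trans v.2⟩

/-- `Q_{i,j}(u,v) = (v-u)^{h_{i,j}} (u-v)^{h_{j,i}}` for `i ≠ j`, and `Q_{i,i} = 0`. -/
def klrQ {I A : Type*} [DecidableEq I] [Ring A] (h : I → I → ℕ) (i j : I) (u v : A) : A :=
  if i = j then 0 else (v - u) ^ h i j * (u - v) ^ h j i

/-- The polynomial `(w-u)⁻¹ (Q_{i,j}(w,v) - Q_{i,j}(u,v))`; see `mul_klrQDiff`. -/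
def klrQDiff {I A : Type*} [DecidableEq I] [Ring A] (h : I → I → ℕ) (i j : I) (u v w : A) : A :=
  if i = j then 0 else
    (-1) ^ h i j * ∑ s ∈ Finset.range (h i j + h j i),
      (w - v) ^ s * (u - v) ^ (h i j + h j i - 1 - s)

theorem mul_klrQDiff {I A : Type*} [DecidableEq I] [CommRing A] (h : I → I → ℕ) (i j : I)
    (u v w : A) : (w - u) * klrQDiff h i j u v w = klrQ h i j w v - klrQ h i j u v := by
  unfold klrQDiff klrQ
  split_ifs
  · simp
  · have key := geom_sum₂_mul (w - v) (u - v) (h i j + h j i)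
    have e1 : ∀ t : A, (v - t) ^ h i j = (-1) ^ h i j * (t - v) ^ h i j := fun t => by
      rw [← mul_pow]; ring
    rw [e1, e1, mul_assoc, mul_assoc, ← pow_add, ← pow_add, ← mul_sub, ← key]
    ring

variable (K : Type*) [Field K] {I : Type*} [Fintype I] [DecidableEq I]

/-- The generators `e(i)`, `x_r`, `τ_r`. -/
inductive KLRGen (I : Type*) (d : ℕ)
  | idem (v : List.Vector I d)
  | dot (r : ℕ) (hr : r < d)
  | cross (r : ℕ) (hr : r + 1 < d)

/-- The generator `e(i)` in the free algebra. -/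
def genE {d : ℕ} (v : List.Vector I d) : FreeAlgebra K (KLRGen I d) :=
  FreeAlgebra.ι K (KLRGen.idem v)

/-- The generator `x_r` in the free algebra, for `r < d` (and `0` for `r ≥ d`). -/
def genX (I : Type*) (d r : ℕ) : FreeAlgebra K (KLRGen I d) :=
  if hr : r < d then FreeAlgebra.ι K (KLRGen.dot r hr) else 0

/-- The generator `τ_r` in the free algebra, for `r + 1 < d` (and `0` otherwise). -/
def genT (I : Type*) (d r : ℕ) : FreeAlgebra K (KLRGen I d) :=
  if hr : r + 1 < d then FreeAlgebra.ι K (KLRGen.cross r hr) else 0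

/-- The defining relations of the KLR algebra. -/
inductive KLRRel (h : I → I → ℕ) (d : ℕ) :
    FreeAlgebra K (KLRGen I d) → FreeAlgebra K (KLRGen I d) → Prop
  | e_idem (v : List.Vector I d) : KLRRel h d (genE K v * genE K v) (genE K v)
  | e_orth (v w : List.Vector I d) (hvw : v ≠ w) : KLRRel h d (genE K v * genE K w) 0
  | e_sum : KLRRel h d (∑ v : List.Vector I d, genE K v) 1
  | x_e (r : ℕ) (hr : r < d) (v : List.Vector I d) :
      KLRRel h d (genX K I d r * genE K v) (genE K v * genX K I d r)
  | t_e (r : ℕ) (hr : r + 1 < d) (v : List.Vector I d) :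
      KLRRel h d (genT K I d r * genE K v) (genE K (swapVec r v) * genT K I d r)
  | x_x (r s : ℕ) (hr : r < d) (hs : s < d) :
      KLRRel h d (genX K I d r * genX K I d s) (genX K I d s * genX K I d r)
  | t_x_succ (r : ℕ) (hr : r + 1 < d) (v : List.Vector I d) :
      KLRRel h d (genT K I d r * genX K I d (r + 1) * genE K v)
        ((genX K I d r * genT K I d r +
          if v.get ⟨r, Nat.lt_of_succ_lt hr⟩ = v.get ⟨r + 1, hr⟩ then 1 else 0) * genE K v)
  | x_succ_t (r : ℕ) (hr : r + 1 < d) (v : List.Vector I d) :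
      KLRRel h d (genX K I d (r + 1) * genT K I d r * genE K v)
        ((genT K I d r * genX K I d r +
          if v.get ⟨r, Nat.lt_of_succ_lt hr⟩ = v.get ⟨r + 1, hr⟩ then 1 else 0) * genE K v)
  | t_x (r s : ℕ) (hr : r + 1 < d) (hs : s < d) (h1 : s ≠ r) (h2 : s ≠ r + 1) :
      KLRRel h d (genT K I d r * genX K I d s) (genX K I d s * genT K I d r)
  | t_t (r s : ℕ) (hr : r + 1 < d) (hs : s + 1 < d) (hrs : r + 1 < s ∨ s + 1 < r) :
      KLRRel h d (genT K I d r * genT K I d s) (genT K I d s * genT K I d r)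
  | t_sq (r : ℕ) (hr : r + 1 < d) (v : List.Vector I d) :
      KLRRel h d (genT K I d r * genT K I d r * genE K v)
        (klrQ h (v.get ⟨r, Nat.lt_of_succ_lt hr⟩) (v.get ⟨r + 1, hr⟩)
          (genX K I d r) (genX K I d (r + 1)) * genE K v)
  | braid (r : ℕ) (hr : r + 2 < d) (v : List.Vector I d) :
      KLRRel h d
        ((genT K I d (r + 1) * genT K I d r * genT K I d (r + 1)
          - genT K I d r * genT K I d (r + 1) * genT K I d r) * genE K v)
        (if v.get ⟨r, by omega⟩ = v.get ⟨r + 2, hr⟩ then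
          klrQDiff h (v.get ⟨r, by omega⟩) (v.get ⟨r + 1, by omega⟩)
            (genX K I d r) (genX K I d (r + 1)) (genX K I d (r + 2)) * genE K v
        else 0)

/-- The KLR algebra `R_{d,K}(Γ)`. -/
abbrev KLR (h : I → I → ℕ) (d : ℕ) : Type _ := RingQuot (KLRRel K h d)

/-- `e(i) ∈ R_d`. -/
def klrE (h : I → I → ℕ) {d : ℕ} (v : List.Vector I d) : KLR K h d :=
  RingQuot.mkAlgHom K (KLRRel K h d) (genE K v)

/-- `x_r ∈ R_d`. -/
def klrX (h : I → I → ℕ) (d r : ℕ) : KLR K h d :=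
  RingQuot.mkAlgHom K (KLRRel K h d) (genX K I d r)

/-- `τ_r ∈ R_d`. -/
def klrT (h : I → I → ℕ) (d r : ℕ) : KLR K h d :=
  RingQuot.mkAlgHom K (KLRRel K h d) (genT K I d r)

/-- The sum of the idempotents `e(i)` over a finite set of sequences `i`. -/
def idemSum (h : I → I → ℕ) {d : ℕ} (s : Finset (List.Vector I d)) : KLR K h d :=
  ∑ v ∈ s, klrE K h v

theorem isIdempotentElem_idemSum (h : I → I → ℕ) {d : ℕ} (s : Finset (List.Vector I d)) :
    IsIdempotentElem (idemSum K h s) := by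
  have h1 : ∀ v : List.Vector I d, klrE K h v * klrE K h v = klrE K h v := fun v => by
    unfold klrE
    rw [← map_mul]
    exact RingQuot.mkAlgHom_rel K (KLRRel.e_idem v)
  have h2 : ∀ v w : List.Vector I d, v ≠ w → klrE K h v * klrE K h w = 0 := fun v w hvw => by
    unfold klrE
    rw [← map_mul, RingQuot.mkAlgHom_rel K (KLRRel.e_orth v w hvw), map_zero]
  unfold IsIdempotentElem idemSum
  rw [Finset.sum_mul_sum]
  refine Finset.sum_congr rfl fun v hv => ?_
  rw [Finset.sum_eq_single_of_mem v hv fun w _ hw => h2 v w (Ne.symm hw), h1]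

/-- The algebra `ε R_d ε`, where `ε` is the sum of the `e(i)` with `i ∈ s`. -/
abbrev KLRCorner (h : I → I → ℕ) {d : ℕ} (s : Finset (List.Vector I d)) : Type _ :=
  (isIdempotentElem_idemSum K h s).Corner

/-- The set `I^α`, for a dimension vector `α ∈ Q_I⁺` with height `|α| = ∑ i, α i`. -/
def seqsOf (α : I → ℕ) : Finset (List.Vector I (∑ i, α i)) :=
  Finset.univ.filter fun v => ∀ i, v.1.count i = α i

/-- `R_α = e(α) R_d`, where `d = |α|` and `e(α) = ∑_{i ∈ I^α} e(i)`. As the idempotent `e(α)` is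
central, this is the corner `e(α) R_d e(α)`. -/
abbrev KLRAlpha (h : I → I → ℕ) (α : I → ℕ) : Type _ := KLRCorner K h (seqsOf α)

end KLR

/-! ## The cyclic quiver `Γ_e`, and the passage from `Γ_e` to `Γ_{e+1}` -/

section Doubling

/-- The quiver `Γ_e` has vertex set `ℤ/eℤ` and one arrow `i → i + 1` for each `i`. -/
def cyc (e : ℕ) (i j : ZMod e) : ℕ := if j = i + 1 then 1 else 0

variable {e : ℕ} (k : ℕ)

/-- The vertex `i'` of `Γ_{e+1}`: for `i ∈ [0, e-1]` it is `i` if `i ≤ k`, and `i + 1` if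
`i > k`. -/
def up (i : ZMod e) : ZMod (e + 1) :=
  if i.val ≤ k then (i.val : ZMod (e + 1)) else (i.val : ZMod (e + 1)) + 1

/-- The map `φ` on vertices: `φ(k) = (k, k+1)`, and `φ(i) = (i')` for `i ≠ k`. -/
def phiVertex (i : ZMod e) : List (ZMod (e + 1)) :=
  if i = (k : ZMod e) then [(k : ZMod (e + 1)), (k : ZMod (e + 1)) + 1] else [up k i]

/-- The map `φ` on sequences of vertices, compatible with concatenation. -/
def phi : List (ZMod e) → List (ZMod (e + 1))
  | [] => []
  | i :: l => phiVertex k i ++ phi l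

/-- The map `φ` on dimension vectors: `ᾱ = φ(α)`, with
`φ(α_k) = α_k + α_{k+1}` and `φ(α_i) = α_{i'}` for `i ≠ k`. -/
def phiDim [NeZero e] (α : ZMod e → ℕ) : ZMod (e + 1) → ℕ :=
  fun j => ∑ i, α i * (phiVertex k i).count j

/-- The map `φ` on weights: `φ(ε_i) = ε_{i'}`. It inserts a `0` at the vertex `k + 1`. -/
def phiWt [NeZero e] (μ : ZMod e → ℤ) : ZMod (e + 1) → ℤ :=
  ∑ i, Pi.single (up k i) (μ i)

theorem length_eq_of_count {I : Type*} [Fintype I] [DecidableEq I] {α : I → ℕ} {l : List I}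
    (hl : ∀ i, l.count i = α i) : l.length = ∑ i, α i := by
  rw [← Finset.sum_congr rfl fun i _ => hl i]
  have := Multiset.sum_count_eq_card (s := (Finset.univ : Finset I)) (m := (l : Multiset I))
    (fun a _ => Finset.mem_univ a)
  simpa using this.symm

theorem count_phi [NeZero e] (l : List (ZMod e)) (j : ZMod (e + 1)) :
    (phi k l).count j = ∑ i, l.count i * (phiVertex k i).count j := by
  induction l with
  | nil => simp [phi]
  | cons a l ih =>
    simp only [phi, List.count_append, ih, List.count_cons, add_mul, Finset.sum_add_distrib]
    rw [add_comm]
    congr 1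
    simp

theorem mem_seqsOf {I : Type*} [Fintype I] [DecidableEq I] {α : I → ℕ}
    {v : List.Vector I (∑ i, α i)} : v ∈ seqsOf α ↔ ∀ i, v.1.count i = α i := by
  simp [seqsOf]

/-- The map `φ : I^α → Ī^ᾱ`. -/
def phiVec [NeZero e] {α : ZMod e → ℕ} (v : List.Vector (ZMod e) (∑ i, α i))
    (hv : v ∈ seqsOf α) : List.Vector (ZMod (e + 1)) (∑ j, phiDim k α j) :=
  ⟨phi k v.1, length_eq_of_count fun j => by
    rw [count_phi]
    exact Finset.sum_congr rfl fun i _ => by rw [mem_seqsOf.mp hv i]⟩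

/-- A sequence in `Ī` is well-ordered if each entry `k` is followed by an entry `k + 1`. -/
def WellOrdered (l : List (ZMod (e + 1))) : Prop :=
  ∀ a : ℕ, l[a]? = some (k : ZMod (e + 1)) → l[a + 1]? = some ((k : ZMod (e + 1)) + 1)

/-- A sequence in `Ī` is unordered if some initial part of it contains more entries `k + 1` than
entries `k`. -/
def Unordered (l : List (ZMod (e + 1))) : Prop :=
  ∃ r : ℕ, (l.take r).count (k : ZMod (e + 1)) < (l.take r).count ((k : ZMod (e + 1)) + 1)

open Classical in
/-- The set `Ī^ᾱ_ord` of well-ordered sequences. -/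
noncomputable def ordSeqs (β : ZMod (e + 1) → ℕ) :
    Finset (List.Vector (ZMod (e + 1)) (∑ j, β j)) :=
  (seqsOf β).filter fun v => WellOrdered k v.1

variable (K : Type*) [Field K]

/-- The algebra `𝐞 R_β(Γ_{e+1}) 𝐞`, where `𝐞` is the sum of the `e(i)` over the well-ordered
sequences `i` of dimension vector `β`. (It lies in the block `R_β = e(β) R_{|β|}` since
`𝐞 = e(β) 𝐞 = 𝐞 e(β)`.) -/
abbrev OrdCorner (β : ZMod (e + 1) → ℕ) : Type _ :=
  KLRCorner K (cyc (e + 1)) (ordSeqs k β)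

/-- Kill the elements `𝐞 a e(i) b 𝐞`, where `i` is an unordered sequence of dimension
vector `β`. -/
inductive BalancedRel (β : ZMod (e + 1) → ℕ) : OrdCorner k K β → OrdCorner k K β → Prop
  | unord (v : List.Vector (ZMod (e + 1)) (∑ j, β j)) (hv : v ∈ seqsOf β)
      (hun : Unordered k v.1) (a b : KLR K (cyc (e + 1)) (∑ j, β j)) :
      BalancedRel β
        (toCorner (isIdempotentElem_idemSum K (cyc (e + 1)) (ordSeqs k β))
          (a * klrE K (cyc (e + 1)) v * b)) 0

/-- The balanced KLR algebra `S_β(Γ_{e+1}) = 𝐞 R_β 𝐞 / ∑_{i unordered} 𝐞 R_β e(i) R_β 𝐞`. -/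
abbrev BalancedKLR (β : ZMod (e + 1) → ℕ) : Type _ := RingQuot (BalancedRel k K β)

/-- The quotient map `𝐞 R_β 𝐞 → S_β`. -/
noncomputable def toBalanced (β : ZMod (e + 1) → ℕ) :
    OrdCorner k K β →ₐ[K] BalancedKLR k K β :=
  RingQuot.mkAlgHom K (BalancedRel k K β)

/-- The class of `𝐞 a 𝐞` in `S_β`. -/
noncomputable def balancedClass (β : ZMod (e + 1) → ℕ) (a : KLR K (cyc (e + 1)) (∑ j, β j)) :
    BalancedKLR k K β :=
  toBalanced k K β (toCorner (isIdempotentElem_idemSum K (cyc (e + 1)) (ordSeqs k β)) a)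

/-- The element `ε a ε` of `R_α`, with `ε = e(α)` the unit of `R_α`. -/
def alphaClass [NeZero e] (α : ZMod e → ℕ) (a : KLR K (cyc e) (∑ i, α i)) :
    KLRAlpha K (cyc e) α :=
  toCorner (isIdempotentElem_idemSum K (cyc e) (seqsOf α)) a

/-- The position `r'` in `φ(i)` at which `φ(i_r)` starts. -/
def shiftPos (l : List (ZMod e)) (r : ℕ) : ℕ := (phi k (l.take r)).length

/-- The word in the crossings `τ` which replaces the crossing of two adjacent strands with labels
`i` and `j`, when `φ(i)` starts at the position `p`. -/
def crossStar (d p : ℕ) (i j : ZMod e) : KLR K (cyc (e + 1)) d :=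
  let t := klrT K (cyc (e + 1)) d
  if i = (k : ZMod e) then
    if j = (k : ZMod e) then -(t (p + 1) * t (p + 2) * t p * t (p + 1))
    else t p * t (p + 1)
  else
    if j = (k : ZMod e) then t (p + 1) * t p
    else t p

/-- `Φ : R_α(Γ_e) → S_ᾱ(Γ_{e+1})` has the prescribed values
`e(i) ↦ e(φ(i))`, `x_r e(i) ↦ x_{r'} e(φ(i))`, `τ_r e(i) ↦ τ*_r e(φ(i))` on generators. -/
structure IsPhi [NeZero e] (α : ZMod e → ℕ)
    (Φ : KLRAlpha K (cyc e) α ≃ₐ[K] BalancedKLR k K (phiDim k α)) : Prop where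
  map_e : ∀ (v : List.Vector (ZMod e) (∑ i, α i)) (hv : v ∈ seqsOf α),
    Φ (alphaClass K α (klrE K (cyc e) v)) =
      balancedClass k K (phiDim k α) (klrE K (cyc (e + 1)) (phiVec k v hv))
  map_x : ∀ (v : List.Vector (ZMod e) (∑ i, α i)) (hv : v ∈ seqsOf α) (r : ℕ),
    r < ∑ i, α i →
    Φ (alphaClass K α (klrX K (cyc e) _ r * klrE K (cyc e) v)) =
      balancedClass k K (phiDim k α)
        (klrX K (cyc (e + 1)) _ (shiftPos k v.1 r) * klrE K (cyc (e + 1)) (phiVec k v hv))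
  map_t : ∀ (v : List.Vector (ZMod e) (∑ i, α i)) (hv : v ∈ seqsOf α) (r : ℕ)
    (hr : r + 1 < ∑ i, α i),
    Φ (alphaClass K α (klrT K (cyc e) _ r * klrE K (cyc e) v)) =
      balancedClass k K (phiDim k α)
        (crossStar k K _ (shiftPos k v.1 r)
            (v.get ⟨r, Nat.lt_of_succ_lt hr⟩) (v.get ⟨r + 1, hr⟩) *
          klrE K (cyc (e + 1)) (phiVec k v hv))

end Doubling

/-! ## Categorical representations -/

section CatRep

universe v u

/-- `X` is the direct sum of the finite family `f`, by means of inclusions `ι` and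
projections `π`. -/
structure SumDecomposition {C : Type u} [Category.{v} C] [Preadditive C] {J : Type*} [Fintype J]
    (X : C) (f : J → C) where
  ι : ∀ j, f j ⟶ X
  π : ∀ j, X ⟶ f j
  ι_π_self : ∀ j, ι j ≫ π j = 𝟙 (f j)
  ι_π_ne : ∀ i j, i ≠ j → ι i ≫ π j = 0
  sum_π_ι : ∑ j, π j ≫ ι j = 𝟙 X

/-- The objects of `⨁_μ C_μ`: the finite direct sums of objects of the full subcategories
`C_μ` (at most one summand for each `μ`). -/
def directSum {C : Type u} [Category.{v} C] [Preadditive C] {X : Type*}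
    (wt : X → ObjectProperty C) : ObjectProperty C := fun M =>
  ∃ (s : Finset X) (N : s → C), (∀ μ : s, wt μ (N μ)) ∧ Nonempty (SumDecomposition M N)

/-- A decomposition `C = ⨁_μ C_μ` into full, isomorphism-closed subcategories. -/
structure IsWeightDecomposition {C : Type u} [Category.{v} C] [Preadditive C] {X : Type*}
    (wt : X → ObjectProperty C) : Prop where
  closed_iso : ∀ μ, (wt μ).IsClosedUnderIsomorphisms
  contains_zero : ∀ μ, (wt μ).ContainsZero
  hom_eq_zero : ∀ μ ν, μ ≠ ν → ∀ M N, wt μ M → wt ν N → ∀ f : M ⟶ N, f = 0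
  decomp : ∀ M, directSum wt M

/-- The preadditive category `C` is abelian. -/
def IsAbelianCategory (C : Type u) [Category.{v} C] [P : Preadditive C] : Prop :=
  ∃ A : Abelian C, A.toPreadditive = P

variable {C : Type u} [Category.{v} C]

/-- `F^d`, recursively as `F^{d+1} = F^d F` (first `F`, then `F^d`). -/
def iter (F : C ⥤ C) : ℕ → (C ⥤ C)
  | 0 => 𝟭 C
  | d + 1 => F ⋙ iter F d

/-- The endomorphism `F^{d-1-r} x F^r` of `F^d`, for `r < d` (positions `r` start at `0`). -/
def iterX {F : C ⥤ C} (x : F ⟶ F) : ∀ d : ℕ, ℕ → (iter F d ⟶ iter F d)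
  | 0, _ => 𝟙 _
  | d + 1, 0 => Functor.whiskerRight x (iter F d)
  | d + 1, r + 1 => Functor.whiskerLeft F (iterX x d r)

/-- The endomorphism `F^{d-2-r} τ F^r` of `F^d`, for `r + 1 < d` (positions `r` start
at `0`). -/
def iterT {F : C ⥤ C} (τ : F ⋙ F ⟶ F ⋙ F) : ∀ d : ℕ, ℕ → (iter F d ⟶ iter F d)
  | 0, _ => 𝟙 _
  | 1, _ => 𝟙 _
  | d + 2, 0 => (Functor.associator F F (iter F d)).inv ≫ Functor.whiskerRight τ (iter F d) ≫
      (Functor.associator F F (iter F d)).hom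
  | d + 2, r + 1 => Functor.whiskerLeft F (iterT τ (d + 1) r)

/-- `F_i = F_{i_d} ⋯ F_{i_1}` for `i = (i_1, …, i_d)` (first `F_{i_1}` is applied). -/
def seqF {I : Type*} (Fi : I → (C ⥤ C)) : List I → (C ⥤ C)
  | [] => 𝟭 C
  | i :: l => Fi i ⋙ seqF Fi l

variable [Preadditive C] {I : Type*} [Fintype I]

/-- The inclusion of the direct summand `F_{i_d} ⋯ F_{i_1}` of `F^d`. -/
def seqIncl {F : C ⥤ C} {Fi : I → (C ⥤ C)} (D : SumDecomposition F Fi) :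
    ∀ (d : ℕ) (l : List I), l.length = d → (seqF Fi l ⟶ iter F d)
  | _, [], rfl => 𝟙 _
  | _, i :: l, rfl => D.ι i ◫ seqIncl D _ l rfl

/-- The projection onto the direct summand `F_{i_d} ⋯ F_{i_1}` of `F^d`. -/
def seqProj {F : C ⥤ C} {Fi : I → (C ⥤ C)} (D : SumDecomposition F Fi) :
    ∀ (d : ℕ) (l : List I), l.length = d → (iter F d ⟶ seqF Fi l)
  | _, [], rfl => 𝟙 _
  | _, i :: l, rfl => D.π i ◫ seqProj D _ l rfl

/-- The weight `α_i = ε_i - ε_{i+1}`. -/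
def simpleRoot {e : ℕ} (i : ZMod e) : ZMod e → ℤ := Pi.single i 1 - Pi.single (i + 1) 1

variable (K : Type*) [Field K] [Linear K C]

/-- A categorical representation of the affine Lie algebra of type `A_{e-1}^{(1)}` (the Kac-Moody
algebra of the quiver `Γ_e`) in the `K`-linear category `C`, with weight subcategories `C_μ`
(`μ ∈ ℤ^{ℤ/eℤ}`) given by `wt`, and with the functors `E_i` and `F_i`. -/
structure CategoricalRep (e : ℕ) [NeZero e] (wt : (ZMod e → ℤ) → ObjectProperty C)
    (Ei Fi : ZMod e → (C ⥤ C)) where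
  /-- the decomposition of `C` -/
  weights : IsWeightDecomposition wt
  E : C ⥤ C
  F : C ⥤ C
  E_additive : E.Additive
  F_additive : F.Additive
  E_linear : E.Linear K
  F_linear : F.Linear K
  E_left_exact : PreservesFiniteLimits E
  E_right_exact : PreservesFiniteColimits E
  F_left_exact : PreservesFiniteLimits F
  F_right_exact : PreservesFiniteColimits F
  adjEF : E ⊣ F
  adjFE : F ⊣ E
  x : F ⟶ F
  τ : F ⋙ F ⟶ F ⋙ F
  decE : SumDecomposition E Ei
  decF : SumDecomposition F Fi
  E_wt : ∀ i μ M, wt μ M → wt (μ + simpleRoot i) ((Ei i).obj M)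
  F_wt : ∀ i μ M, wt μ M → wt (μ - simpleRoot i) ((Fi i).obj M)
  /-- the action of the KLR algebras on the powers of `F` -/
  ψ : ∀ d : ℕ, KLR K (cyc e) d →ₐ[K] (End (iter F d))ᵐᵒᵖ
  ψ_e : ∀ (d : ℕ) (v : List.Vector (ZMod e) d), ψ d (klrE K (cyc e) v) =
    MulOpposite.op (seqProj decF d v.1 v.2 ≫ seqIncl decF d v.1 v.2 : End (iter F d))
  ψ_x : ∀ d r : ℕ, r < d → ψ d (klrX K (cyc e) d r) = MulOpposite.op (iterX x d r : End (iter F d))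
  ψ_t : ∀ d r : ℕ, r + 1 < d →
    ψ d (klrT K (cyc e) d r) = MulOpposite.op (iterT τ d r : End (iter F d))
  x_nilpotent : ∀ M, IsNilpotent (show End (F.obj M) from x.app M)

/-- The matrix entry `F_i ⟶ F_j` of the endomorphism `ψ_d(a)` of `F^d`. -/
def CategoricalRep.entry {K : Type*} [Field K] [Linear K C] {e : ℕ} [NeZero e]
    {wt : (ZMod e → ℤ) → ObjectProperty C} {Ei Fi : ZMod e → (C ⥤ C)}
    (R : CategoricalRep K e wt Ei Fi) {d : ℕ} (a : KLR K (cyc e) d)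
    (v w : List.Vector (ZMod e) d) : seqF Fi v.1 ⟶ seqF Fi w.1 :=
  seqIncl R.decF d v.1 v.2 ≫ (show iter R.F d ⟶ iter R.F d from (R.ψ d a).unop) ≫
    seqProj R.decF d w.1 w.2

end CatRep

/-! ## The restricted functors -/

section Restrict

universe v u

variable {C : Type u} [Category.{v} C] {e : ℕ} (k : ℕ)

/-- `F̄_{i'}` for `i ≠ k`, and `F̄_{k+1} F̄_k` for `i = k`. -/
def doubledF (Fi : ZMod (e + 1) → (C ⥤ C)) (i : ZMod e) : C ⥤ C := seqF Fi (phiVertex k i)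

/-- `Ē_{i'}` for `i ≠ k`, and `Ē_k Ē_{k+1}` for `i = k`. -/
def doubledE (Ei : ZMod (e + 1) → (C ⥤ C)) (i : ZMod e) : C ⥤ C :=
  seqF Ei (phiVertex k i).reverse

theorem doubledF_self (Fi : ZMod (e + 1) → (C ⥤ C)) :
    doubledF k Fi (k : ZMod e) = Fi k ⋙ Fi (k + 1) := by
  simp [doubledF, phiVertex, seqF, Functor.comp_id]

theorem doubledF_of_ne (Fi : ZMod (e + 1) → (C ⥤ C)) (i : ZMod e) (hi : i ≠ k) :
    doubledF k Fi i = Fi (up k i) := by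
  simp [doubledF, phiVertex, seqF, hi, Functor.comp_id]

theorem doubledE_self (Ei : ZMod (e + 1) → (C ⥤ C)) :
    doubledE k Ei (k : ZMod e) = Ei (k + 1) ⋙ Ei k := by
  simp [doubledE, phiVertex, seqF, Functor.comp_id]

theorem doubledE_of_ne (Ei : ZMod (e + 1) → (C ⥤ C)) (i : ZMod e) (hi : i ≠ k) :
    doubledE k Ei i = Ei (up k i) := by
  simp [doubledE, phiVertex, seqF, hi, Functor.comp_id]

/-- The functor induced by `G` on a full subcategory which is stable under `G`. -/
def restrict (P : ObjectProperty C) (G : C ⥤ C) (hG : ∀ M, P M → P (G.obj M)) :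
    P.FullSubcategory ⥤ P.FullSubcategory :=
  P.lift (P.ι ⋙ G) fun M => hG M.obj M.property

/-- The objects of `⨁_{μ ∈ ℤ^e} C̄_{φ(μ)}`. -/
def subProp [Preadditive C] [NeZero e] (wt : (ZMod (e + 1) → ℤ) → ObjectProperty C) :
    ObjectProperty C :=
  directSum fun μ : ZMod e → ℤ => wt (phiWt k μ)

/-- The canonical isomorphism from `F̄_{(l, l')}` to `F̄_{l'} F̄_l` for a concatenated sequence. -/
def seqFAppend {I : Type*} (Fi : I → (C ⥤ C)) :
    ∀ l l' : List I, seqF Fi (l ++ l') ≅ seqF Fi l ⋙ seqF Fi l'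
  | [], l' => (Functor.leftUnitor (seqF Fi l')).symm
  | i :: l, l' => Functor.isoWhiskerLeft (Fi i) (seqFAppend Fi l l') ≪≫
      (Functor.associator (Fi i) (seqF Fi l) (seqF Fi l')).symm

/-- The canonical identification of `F_i = F_{i_d} ⋯ F_{i_1}` with the restriction of `F̄_{φ(i)}`,
where `F_j` is the restriction of `doubledF k Fi j`. -/
def restrictIso (P : ObjectProperty C) (Fi : ZMod (e + 1) → (C ⥤ C))
    (hF : ∀ (i : ZMod e) (M : C), P M → P ((doubledF k Fi i).obj M)) :
    ∀ l : List (ZMod e),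
      seqF (fun i => restrict P (doubledF k Fi i) (hF i)) l ⋙ P.ι ≅ P.ι ⋙ seqF Fi (phi k l)
  | [] => Functor.leftUnitor P.ι ≪≫ (Functor.rightUnitor P.ι).symm
  | i :: l =>
      Functor.associator _ _ _ ≪≫
      Functor.isoWhiskerLeft (restrict P (doubledF k Fi i) (hF i)) (restrictIso P Fi hF l) ≪≫
      (Functor.associator _ _ _).symm ≪≫
      Functor.isoWhiskerRight
        (P.liftCompιIso (P.ι ⋙ doubledF k Fi i) fun M => hF i M.obj M.property)
        (seqF Fi (phi k l)) ≪≫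
      Functor.associator _ _ _ ≪≫
      Functor.isoWhiskerLeft P.ι (seqFAppend Fi (phiVertex k i) (phi k l)).symm

end Restrict

end KLRCat

open KLRCat

/-!
The proof compares polynomial representations of the two KLR algebras and then transports the
comparison to the functors.

Each KLR algebra acts on the polynomials indexed by its sequences, a crossing of equal labels acting
by a Demazure operator. The words of reduced expressions span the algebra over the polynomials
(`klr_span_induction`), and they act independently, since the leading terms are distinct
automorphisms of a field of rational functions (`wordPol_independent`). So the polynomial
representation is faithful (`mul_klrE_eq_zero`).

Identifying the two variables of each doubled strand defines a specialisation map `evalPhi` from the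
polynomial representation for `Γ_{e + 1}` to the one for `Γ_e`. It intertwines the product of
crossings which replaces a crossing of `Γ_e` with this crossing (`specialise_starWord`). Two elements
of the algebras are called `Related` if the specialisation intertwines their actions. Every element of
`R_α(Γ_e)` is related to an element of the corner at the well-ordered sequences, and an element
which factors through an unordered sequence is related to zero (`related_zero_unordered`).
Conversely, a permutation between two well-ordered sequences either crosses the two strands of some
pair `(k, k + 1)`, and then its word factors through an unordered sequence, or permutes the pairs as
blocks (`desc_or_exists_thickPos`). The two variables of a pair differ by the square of its crossing,
which also factors through an unordered sequence (`polX_sub_mem_nilSpan`). Hence the quotient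
`S_φ(α)` is spanned by the same normal forms as `R_α(Γ_e)` (`exists_thick_normalForm`), and by
independence these are related to zero only if they vanish (`mem_nilSpan_of_related_zero`). The
isomorphism `Φ_α` sends an element to the class of the elements related to it (`exists_isPhi`).

On the side of categories, the weights `φ(μ)` vanish at the coordinate between `k` and `k + 1`. An
initial part of an unordered sequence makes this coordinate negative at some point, so the functors
of unordered sequences vanish on `C` (`isZero_of_unordered`). This makes the action of the corner
factor through `S_φ(α)`. The functors `E_i` and `F_i` are composites of summands of the biadjoint
functors of the given representation: the summands are biadjoint because the mixed components of
the units and counits vanish for reasons of weight (`adjunctionComponent`), and the direct sums of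
the `E_i` and of the `F_i` are therefore biadjoint again (`adjunctionOfSum`).

The dot and the crossing of the new representation are defined through their matrix entries, which
are the images of the elements prescribed for `Φ_α`. Every noncommutative polynomial in the
generators then acts with the same entries as some element related to it (`exists_intertwines`). The
two sides of a defining relation have the same class in `R_α(Γ_e)`, so the corresponding elements of
the corner agree in `S_φ(α)` and have the same entries; this proves the relations on the functors
(`freeAction_rel`). The same comparison of entries identifies `ψ_α` with the composite of `Φ_α` and
the given action (`entry_restricted`).
-/

set_option linter.unusedSectionVars false
namespace KLRCat

/-! ### Words in the simple transpositions acting on lists -/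

section Lists

variable {α β : Type*}

theorem swapAt_append (m : List α) (r : ℕ) (l : List α) :
    swapAt (m.length + r) (m ++ l) = m ++ swapAt r l := by
  induction m with
  | nil => simp
  | cons a m ih =>
    have : (a :: m).length + r = (m.length + r) + 1 := by simp; omega
    rw [this, List.cons_append, swapAt, ih, List.cons_append]

theorem swapAt_append_pair (m : List α) (a b : α) (l : List α) :
    swapAt m.length (m ++ a :: b :: l) = m ++ b :: a :: l := by
  simpa [swapAt] using swapAt_append m 0 (a :: b :: l)

/-- A list with entries at the positions `r` and `r + 1`, split at these two entries. -/
theorem exists_split_pair (l : List α) (r : ℕ) (hr : r + 1 < l.length) :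
    ∃ m a b n, l = m ++ a :: b :: n ∧ m.length = r := by
  refine ⟨l.take r, l[r], l[r + 1], l.drop (r + 2), ?_, by simp; omega⟩
  rw [List.getElem_cons_drop, List.getElem_cons_drop, List.take_append_drop]

theorem exists_split_triple (l : List α) (r : ℕ) (hr : r + 2 < l.length) :
    ∃ m a b c n, l = m ++ a :: b :: c :: n ∧ m.length = r := by
  refine ⟨l.take r, l[r], l[r + 1], l[r + 2], l.drop (r + 3), ?_, by simp; omega⟩
  rw [List.getElem_cons_drop, List.getElem_cons_drop, List.getElem_cons_drop,
    List.take_append_drop]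

theorem swapAt_of_le (r : ℕ) (l : List α) (h : l.length ≤ r + 1) : swapAt r l = l := by
  induction l generalizing r with
  | nil => cases r <;> rfl
  | cons a l ih =>
    cases r with
    | zero => cases l with
      | nil => rfl
      | cons b l => simp at h
    | succ r => rw [swapAt, ih r (by simpa using h)]

theorem swapAt_swapAt (r : ℕ) (l : List α) : swapAt r (swapAt r l) = l := by
  by_cases h : r + 1 < l.length
  · obtain ⟨m, a, b, n, rfl, rfl⟩ := exists_split_pair l r h
    rw [swapAt_append_pair, swapAt_append_pair]
  · rw [swapAt_of_le r l (by omega), swapAt_of_le r l (by omega)]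

theorem swapAt_perm (r : ℕ) (l : List α) : (swapAt r l).Perm l := by
  fun_induction swapAt r l with
  | case1 a b l => exact List.Perm.swap _ _ _
  | case2 r a l ih => exact ih.cons a
  | case3 => exact List.Perm.refl _

theorem map_swapAt (f : α → β) (r : ℕ) (l : List α) :
    (swapAt r l).map f = swapAt r (l.map f) := by
  by_cases h : r + 1 < l.length
  · obtain ⟨m, a, b, n, rfl, rfl⟩ := exists_split_pair l r h
    rw [swapAt_append_pair]
    simpa using (swapAt_append_pair (m.map f) (f a) (f b) (n.map f)).symm
  · rw [swapAt_of_le r l (by omega), swapAt_of_le r _ (by simp; omega)]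

theorem swapAt_comm (r s : ℕ) (h : r + 1 < s) (l : List α) :
    swapAt r (swapAt s l) = swapAt s (swapAt r l) := by
  by_cases hr : r + 1 < l.length
  · obtain ⟨m, a, b, n, rfl, rfl⟩ := exists_split_pair l r hr
    obtain ⟨t, rfl⟩ : ∃ t, s = m.length + (t + 2) := ⟨s - m.length - 2, by omega⟩
    rw [swapAt_append, swapAt_append_pair, swapAt_append]
    simp [swapAt, swapAt_append_pair]
  · rw [swapAt_of_le s l (by omega), swapAt_of_le r l (by omega), swapAt_of_le s l (by omega)]

theorem swapAt_braid (r : ℕ) (l : List α) (h : r + 2 < l.length) :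
    swapAt r (swapAt (r + 1) (swapAt r l)) = swapAt (r + 1) (swapAt r (swapAt (r + 1) l)) := by
  obtain ⟨m, a, b, c, n, rfl, rfl⟩ := exists_split_triple l r h
  have h0 := fun l : List α => swapAt_append m 0 l
  have h1 := fun l : List α => swapAt_append m 1 l
  simp only [add_zero] at h0
  simp only [h0, h1, swapAt]

/-- Exchanging two adjacent entries precomposes the indexing by a transposition. -/
theorem getElem?_swapAt (r : ℕ) (l : List α) (h : r + 1 < l.length) (j : ℕ) :
    (swapAt r l)[j]? = l[Equiv.swap r (r + 1) j]? := by
  obtain ⟨m, a, b, n, rfl, rfl⟩ := exists_split_pair l r h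
  rw [swapAt_append_pair]
  rcases lt_trichotomy j m.length with hj | rfl | hj
  · rw [Equiv.swap_apply_of_ne_of_ne (by omega) (by omega), List.getElem?_append_left hj,
      List.getElem?_append_left hj]
  · rw [Equiv.swap_apply_left]; simp
  · obtain ⟨i, rfl⟩ : ∃ i, j = m.length + (i + 1) := ⟨j - m.length - 1, by omega⟩
    rcases i with _ | i
    · rw [zero_add, Equiv.swap_apply_right]; simp
    · rw [Equiv.swap_apply_of_ne_of_ne (by omega) (by omega)]
      rw [List.getElem?_append_right (by omega), List.getElem?_append_right (by omega)]
      simp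

/-- The action of a word `r₁ ⋯ rₙ` in the simple transpositions on lists; the last letter acts
first. -/
def act (u : List ℕ) (l : List α) : List α := u.foldr swapAt l

@[simp] theorem act_nil (l : List α) : act [] l = l := rfl

@[simp] theorem act_cons (r : ℕ) (u : List ℕ) (l : List α) :
    act (r :: u) l = swapAt r (act u l) := rfl

theorem act_append (u v : List ℕ) (l : List α) : act (u ++ v) l = act u (act v l) := by
  simp [act]

@[simp] theorem length_act (u : List ℕ) (l : List α) : (act u l).length = l.length := by
  induction u with
  | nil => rfl
  | cons r u ih => rw [act_cons, length_swapAt, ih]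

theorem act_perm (u : List ℕ) (l : List α) : (act u l).Perm l := by
  induction u with
  | nil => rfl
  | cons r u ih => exact (swapAt_perm _ _).trans ih

theorem map_act (f : α → β) (u : List ℕ) (l : List α) : (act u l).map f = act u (l.map f) := by
  induction u with
  | nil => rfl
  | cons r u ih => rw [act_cons, map_swapAt, ih, act_cons]

theorem act_reverse_act (u : List ℕ) (l : List α) : act u.reverse (act u l) = l := by
  induction u with
  | nil => rfl
  | cons r u ih => rw [List.reverse_cons, act_append, act_cons, act_cons, act_nil, swapAt_swapAt, ih]

theorem act_injective (u : List ℕ) : Function.Injective (act u : List α → List α) := fun l l' h => by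
  rw [← act_reverse_act u l, h, act_reverse_act]

/-- The permutation of positions given by a word. -/
def wordPerm (u : List ℕ) : Equiv.Perm ℕ := (u.map fun r => Equiv.swap r (r + 1)).prod

@[simp] theorem wordPerm_nil : wordPerm [] = 1 := rfl

@[simp] theorem wordPerm_cons (r : ℕ) (u : List ℕ) :
    wordPerm (r :: u) = Equiv.swap r (r + 1) * wordPerm u := by simp [wordPerm]

theorem getElem?_act (u : List ℕ) (l : List α) (h : ∀ r ∈ u, r + 1 < l.length) (j : ℕ) :
    (act u l)[j]? = l[(wordPerm u)⁻¹ j]? := by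
  induction u generalizing j with
  | nil => simp
  | cons r u ih =>
    rw [act_cons, getElem?_swapAt r _ (by rw [length_act]; exact h r (by simp)),
      ih (fun s hs => h s (by simp [hs]))]
    simp

theorem act_eq_of_wordPerm (u u' : List ℕ) (l : List α) (h : ∀ r ∈ u, r + 1 < l.length)
    (h' : ∀ r ∈ u', r + 1 < l.length) (e : wordPerm u = wordPerm u') : act u l = act u' l :=
  List.ext_getElem? fun j => by rw [getElem?_act u l h, getElem?_act u' l h', e]

/-! ### Inversions -/

/-- The number of inversions of a list of numbers. -/
def invCount : List ℕ → ℕ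
  | [] => 0
  | a :: l => l.countP (· < a) + invCount l

/-- The list `t` has a descent at the position `r`. -/
def Desc (r : ℕ) (t : List ℕ) : Prop :=
  ∃ m a b n, t = m ++ a :: b :: n ∧ m.length = r ∧ b < a

theorem Desc.lt {r : ℕ} {t : List ℕ} (h : Desc r t) : r + 1 < t.length := by
  obtain ⟨m, a, b, n, rfl, rfl, _⟩ := h
  simp

theorem invCount_pair (m : List ℕ) (a b : ℕ) (n : List ℕ) (h : b < a) :
    invCount (m ++ a :: b :: n) = invCount (m ++ b :: a :: n) + 1 := by
  induction m with
  | nil =>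
    have : ¬ a < b := by omega
    simp [invCount, h, this]; omega
  | cons c m ih =>
    have : (m ++ a :: b :: n).countP (· < c) = (m ++ b :: a :: n).countP (· < c) :=
      List.Perm.countP_eq _ (List.Perm.append_left _ (List.Perm.swap _ _ _))
    simp only [List.cons_append, invCount, ih, this]; omega

theorem Desc.inv_swapAt {r : ℕ} {t : List ℕ} (h : Desc r t) : invCount t = invCount (swapAt r t) + 1 := by
  obtain ⟨m, a, b, n, rfl, rfl, hab⟩ := h
  rw [swapAt_append_pair, invCount_pair _ _ _ _ hab]

theorem desc_or_desc (r : ℕ) (t : List ℕ) (ht : t.Nodup) (hr : r + 1 < t.length) :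
    Desc r t ∨ Desc r (swapAt r t) := by
  obtain ⟨m, a, b, n, rfl, rfl⟩ := exists_split_pair t r hr
  have : a ≠ b := by
    rintro rfl
    have := (List.nodup_append.mp ht).2.1
    simp at this
  rcases lt_or_gt_of_ne this with h | h
  · right; exact ⟨m, b, a, n, swapAt_append_pair _ _ _ _, rfl, h⟩
  · left; exact ⟨m, a, b, n, rfl, rfl, h⟩

theorem inv_swapAt_le (r : ℕ) (t : List ℕ) : invCount (swapAt r t) ≤ invCount t + 1 ∧
    invCount t ≤ invCount (swapAt r t) + 1 := by
  by_cases hr : r + 1 < t.length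
  · obtain ⟨m, a, b, n, rfl, rfl⟩ := exists_split_pair t r hr
    rw [swapAt_append_pair]
    rcases lt_trichotomy a b with h | rfl | h
    · have := invCount_pair m b a n h; omega
    · omega
    · have := invCount_pair m a b n h; omega
  · rw [swapAt_of_le r t (by omega)]; omega

theorem inv_le_inv_act (u : List ℕ) (t : List ℕ) : invCount t ≤ invCount (act u t) + u.length := by
  induction u with
  | nil => simp
  | cons r u ih =>
    have := (inv_swapAt_le r (act u t)).2
    rw [act_cons, List.length_cons]; omega

theorem Desc.of_inv_lt {r : ℕ} {t : List ℕ} (ht : t.Nodup) (h : invCount (swapAt r t) < invCount t) :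
    Desc r t := by
  by_cases hr : r + 1 < t.length
  · rcases desc_or_desc r t ht hr with h' | h'
    · exact h'
    · have := h'.inv_swapAt
      rw [swapAt_swapAt] at this; omega
  · rw [swapAt_of_le r t (by omega)] at h; omega

theorem inv_eq_zero_iff {t : List ℕ} (ht : t.Nodup) : invCount t = 0 ↔ t.Pairwise (· < ·) := by
  induction t with
  | nil => simp [invCount]
  | cons a l ih =>
    rw [List.nodup_cons] at ht
    rw [invCount, Nat.add_eq_zero_iff, ih ht.2, List.pairwise_cons, List.countP_eq_zero]
    refine and_congr_left fun _ => forall₂_congr fun b hb => ?_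
    have : b ≠ a := fun h => ht.1 (h ▸ hb)
    simp; omega

theorem exists_desc_of_inv_pos {t : List ℕ} (ht : t.Nodup) (h : 0 < invCount t) : ∃ r, Desc r t := by
  by_contra! hd
  have : t.Pairwise (· < ·) := by
    rw [← List.isChain_iff_pairwise, List.isChain_iff_getElem]
    intro i hi
    by_contra! hlt
    obtain ⟨m, a, b, n, rfl, rfl⟩ := exists_split_pair t i hi
    have hab : a ≠ b := by
      rintro rfl
      have := (List.nodup_append.mp ht).2.1
      simp at this
    exact hd m.length ⟨m, a, b, n, rfl, rfl, by simp at hlt; omega⟩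
  rw [(inv_eq_zero_iff ht).mpr this] at h
  omega

theorem perm_range_nodup {d : ℕ} {t : List ℕ} (ht : t.Perm (List.range d)) : t.Nodup :=
  ht.nodup_iff.mpr List.nodup_range

theorem perm_range_swapAt {d : ℕ} {t : List ℕ} (ht : t.Perm (List.range d)) (r : ℕ) :
    (swapAt r t).Perm (List.range d) := (swapAt_perm r t).trans ht

theorem perm_range_length {d : ℕ} {t : List ℕ} (ht : t.Perm (List.range d)) : t.length = d := by
  simpa using ht.length_eq

theorem eq_range_of_inv_eq_zero {d : ℕ} {t : List ℕ} (ht : t.Perm (List.range d))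
    (h : invCount t = 0) : t = List.range d :=
  ht.eq_of_pairwise (le := (· < ·)) (fun a b _ _ h1 h2 => absurd h1 (by omega))
    ((inv_eq_zero_iff (perm_range_nodup ht)).mp h) List.pairwise_lt_range

theorem inv_range (d : ℕ) : invCount (List.range d) = 0 :=
  (inv_eq_zero_iff List.nodup_range).mpr List.pairwise_lt_range

/-- A word sorting `t` has at least as many letters as `t` has inversions, since each letter
changes the number of inversions by at most one. -/
theorem length_ge_of_act_eq_range {d : ℕ} {t u : List ℕ} (h : act u t = List.range d) :
    invCount t ≤ u.length := by
  simpa [h, inv_range] using inv_le_inv_act u t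

/-- `u` is a reduced word sorting the permutation `t` of `0, …, d - 1`. -/
structure Sorts (d : ℕ) (u t : List ℕ) : Prop where
  act_eq : act u t = List.range d
  length_eq : u.length = invCount t

theorem Sorts.perm {d : ℕ} {u t : List ℕ} (h : Sorts d u t) : t.Perm (List.range d) :=
  h.act_eq ▸ (act_perm u t).symm

theorem Sorts.append_of_desc {d r : ℕ} {u t : List ℕ} (hr : Desc r t)
    (h : Sorts d u (swapAt r t)) : Sorts d (u ++ [r]) t :=
  ⟨by simp [act_append, h.act_eq], by simp [h.length_eq, hr.inv_swapAt]⟩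

theorem Sorts.of_append {d r : ℕ} {u t : List ℕ} (h : Sorts d (u ++ [r]) t) :
    Desc r t ∧ Sorts d u (swapAt r t) := by
  have h1 : act u (swapAt r t) = List.range d := by simpa [act_append] using h.act_eq
  have h2 := length_ge_of_act_eq_range h1
  have h3 := h.length_eq
  simp only [List.length_append, List.length_singleton] at h3
  have h4 := (inv_swapAt_le r t).2
  exact ⟨Desc.of_inv_lt (perm_range_nodup h.perm) (by omega), h1, by omega⟩

theorem exists_sorts {d : ℕ} {t : List ℕ} (ht : t.Perm (List.range d)) : ∃ u, Sorts d u t := by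
  induction hn : invCount t generalizing t with
  | zero => exact ⟨[], eq_range_of_inv_eq_zero ht hn, hn.symm⟩
  | succ n ih =>
    obtain ⟨r, hr⟩ := exists_desc_of_inv_pos (perm_range_nodup ht) (by omega)
    have := hr.inv_swapAt
    obtain ⟨u, hu⟩ := ih (perm_range_swapAt ht r) (by omega)
    exact ⟨u ++ [r], hu.append_of_desc hr⟩

end Lists

/-! ### Demazure operators -/

section Demazure

open MvPolynomial

variable (K : Type*) [Field K]

/-- Polynomials in countably many variables; the strand at the position `r` carries `X r`. -/
abbrev Pol : Type _ := MvPolynomial ℕ K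

/-- The field of rational functions in which identities of Demazure operators are checked. -/
abbrev RatFun : Type _ := FractionRing (Pol K)

/-- The exchange of the variables at `r` and `r + 1`. -/
noncomputable def polSwap (r : ℕ) : Pol K →ₐ[K] Pol K := rename (Equiv.swap r (r + 1))

variable {K}

theorem polSwap_X (r j : ℕ) : polSwap K r (X j) = X (Equiv.swap r (r + 1) j) := rename_X _ _

theorem X_sub_X_ne_zero {i j : ℕ} (h : i ≠ j) : (X i - X j : Pol K) ≠ 0 :=
  sub_ne_zero.mpr fun e => h (X_injective e)

/-- The difference `g - s_r g` is divisible by `X (r + 1) - X r`; it suffices to follow the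
multiplication by a variable. -/
theorem exists_divDiff (r : ℕ) (g : Pol K) :
    ∃ q : Pol K, (X (r + 1) - X r) * q = g - polSwap K r g := by
  induction g using MvPolynomial.induction_on with
  | C a => exact ⟨0, by simp [polSwap]⟩
  | add p q hp hq =>
    obtain ⟨p', hp⟩ := hp
    obtain ⟨q', hq⟩ := hq
    exact ⟨p' + q', by rw [mul_add, hp, hq, map_add]; ring⟩
  | mul_X p j hp =>
    obtain ⟨p', hp⟩ := hp
    rw [map_mul, polSwap_X]
    by_cases h1 : j = r
    · subst h1
      rw [Equiv.swap_apply_left]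
      exact ⟨p' * X (j + 1) - p, by linear_combination X (j + 1) * hp⟩
    · by_cases h2 : j = r + 1
      · subst h2
        rw [Equiv.swap_apply_right]
        exact ⟨p' * X r + p, by linear_combination X r * hp⟩
      · rw [Equiv.swap_apply_of_ne_of_ne h1 h2]
        exact ⟨p' * X j, by linear_combination X j * hp⟩

/-- The Demazure operator `f ↦ (f - s_r f) / (X (r + 1) - X r)`. -/
noncomputable def divDiff (r : ℕ) : Pol K →ₗ[K] Pol K where
  toFun g := (exists_divDiff r g).choose
  map_add' f g := by
    apply mul_left_cancel₀ (X_sub_X_ne_zero (K := K) (i := r + 1) (j := r) (by omega))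
    rw [mul_add, (exists_divDiff r _).choose_spec, (exists_divDiff r _).choose_spec,
      (exists_divDiff r _).choose_spec, map_add]
    ring
  map_smul' c g := by
    apply mul_left_cancel₀ (X_sub_X_ne_zero (K := K) (i := r + 1) (j := r) (by omega))
    rw [(exists_divDiff r _).choose_spec, RingHom.id_apply, mul_smul_comm,
      (exists_divDiff r _).choose_spec, map_smul, smul_sub]

theorem mul_divDiff (r : ℕ) (g : Pol K) :
    (X (r + 1) - X r) * divDiff r g = g - polSwap K r g :=
  (exists_divDiff r g).choose_spec

variable {I : Type*} [DecidableEq I] (h : I → I → ℕ)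

/-- The action on polynomials of the crossing `(a, b) → (b, a)` at the positions `r`, `r + 1`. The
two ways across a pair of vertices are normalised so that their composite is `Q_{a,b}`, and the
factor is put on the crossing against the arrow. -/
noncomputable def demazure (a b : I) (r : ℕ) : Pol K →ₗ[K] Pol K :=
  if a = b then divDiff r
  else LinearMap.mulLeft K ((X (r + 1) - X r) ^ h b a) ∘ₗ (polSwap K r).toLinearMap

theorem demazure_self (a : I) (r : ℕ) : demazure (K := K) h a a r = divDiff r := if_pos rfl

theorem demazure_of_ne {a b : I} (hab : a ≠ b) (r : ℕ) (g : Pol K) :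
    demazure h a b r g = (X (r + 1) - X r) ^ h b a * polSwap K r g := by
  simp [demazure, hab]

/-- The variables, as rational functions. -/
noncomputable def ratX (K : Type*) [Field K] (r : ℕ) : RatFun K := algebraMap (Pol K) (RatFun K) (X r)

theorem ratX_sub_ne_zero {i j : ℕ} (hij : i ≠ j) : ratX K i - ratX K j ≠ 0 := by
  rw [ratX, ratX, ← map_sub, map_ne_zero_iff _ (IsFractionRing.injective (Pol K) (RatFun K))]
  exact X_sub_X_ne_zero hij

/-- The exchange of two variables in rational functions. -/
noncomputable def ratSwap (r : ℕ) : RatFun K →+* RatFun K :=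
  IsFractionRing.map (A := Pol K) (B := Pol K) (j := (polSwap K r).toRingHom)
    (rename_injective _ (Equiv.swap r (r + 1)).injective)

theorem ratSwap_algebraMap (r : ℕ) (g : Pol K) :
    ratSwap r (algebraMap (Pol K) (RatFun K) g) = algebraMap (Pol K) (RatFun K) (polSwap K r g) := by
  exact IsLocalization.map_eq (M := nonZeroDivisors (Pol K)) (T := nonZeroDivisors (Pol K))
    (nonZeroDivisors_le_comap_nonZeroDivisors_of_injective _
      (rename_injective _ (Equiv.swap r (r + 1)).injective)) g

theorem ratSwap_ratX (r j : ℕ) : ratSwap r (ratX K j) = ratX K (Equiv.swap r (r + 1) j) := by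
  rw [ratX, ratSwap_algebraMap, polSwap_X, ratX]

theorem ratSwap_left (r : ℕ) : ratSwap r (ratX K r) = ratX K (r + 1) := by
  rw [ratSwap_ratX, Equiv.swap_apply_left]

theorem ratSwap_right (r : ℕ) : ratSwap r (ratX K (r + 1)) = ratX K r := by
  rw [ratSwap_ratX, Equiv.swap_apply_right]

theorem ratSwap_of_ne {r j : ℕ} (h1 : j ≠ r) (h2 : j ≠ r + 1) :
    ratSwap r (ratX K j) = ratX K j := by
  rw [ratSwap_ratX, Equiv.swap_apply_of_ne_of_ne h1 h2]

/-- Two compositions of exchanges agree on rational functions if they agree on positions. -/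
theorem ratHom_ext {f g : RatFun K →+* RatFun K}
    (hf : ∀ c : K, f (algebraMap (Pol K) (RatFun K) (C c)) = g (algebraMap (Pol K) (RatFun K) (C c)))
    (hX : ∀ j, f (ratX K j) = g (ratX K j)) : f = g := by
  apply IsLocalization.ringHom_ext (nonZeroDivisors (Pol K))
  exact MvPolynomial.ringHom_ext (fun c => hf c) hX

theorem ratSwap_C (r : ℕ) (c : K) : ratSwap r (algebraMap (Pol K) (RatFun K) (C c)) =
    algebraMap (Pol K) (RatFun K) (C c) := by
  rw [ratSwap_algebraMap, polSwap, rename_C]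

theorem ratSwap_ratSwap (r : ℕ) (g : RatFun K) : ratSwap r (ratSwap r g) = g := by
  have : (ratSwap r).comp (ratSwap r) = RingHom.id (RatFun K) :=
    ratHom_ext (by simp [ratSwap_C]) (by simp [ratSwap_ratX])
  exact congrArg (fun f : RatFun K →+* RatFun K => f g) this

theorem ratSwap_comm {r s : ℕ} (hrs : r + 1 < s) (g : RatFun K) :
    ratSwap r (ratSwap s g) = ratSwap s (ratSwap r g) := by
  have : (ratSwap r).comp (ratSwap s) = ((ratSwap s).comp (ratSwap r) : RatFun K →+* RatFun K) :=
    ratHom_ext (by simp [ratSwap_C]) fun j => by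
      simp only [RingHom.comp_apply, ratSwap_ratX, Equiv.swap_apply_def]
      congr 1
      split_ifs <;> omega
  exact congrArg (fun f : RatFun K →+* RatFun K => f g) this

theorem ratSwap_braid (r : ℕ) (g : RatFun K) :
    ratSwap r (ratSwap (r + 1) (ratSwap r g)) =
      ratSwap (r + 1) (ratSwap r (ratSwap (r + 1) g)) := by
  have : (ratSwap r).comp ((ratSwap (r + 1)).comp (ratSwap r)) =
      ((ratSwap (r + 1)).comp ((ratSwap r).comp (ratSwap (r + 1))) : RatFun K →+* RatFun K) :=
    ratHom_ext (by simp [ratSwap_C]) fun j => by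
      simp only [RingHom.comp_apply, ratSwap_ratX, Equiv.swap_apply_def]
      congr 1
      split_ifs <;> omega
  exact congrArg (fun f : RatFun K →+* RatFun K => f g) this

/-- The extension of `demazure` to rational functions. -/
noncomputable def ratDem (a b : I) (r : ℕ) (g : RatFun K) : RatFun K :=
  if a = b then (g - ratSwap r g) / (ratX K (r + 1) - ratX K r)
  else (ratX K (r + 1) - ratX K r) ^ h b a * ratSwap r g

theorem algebraMap_demazure (a b : I) (r : ℕ) (g : Pol K) :
    algebraMap (Pol K) (RatFun K) (demazure h a b r g) =
      ratDem h a b r (algebraMap (Pol K) (RatFun K) g) := by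
  by_cases hab : a = b
  · subst hab
    rw [demazure_self, ratDem, if_pos rfl,
      eq_div_iff (ratX_sub_ne_zero (by omega)), mul_comm, ratX, ratX, ← map_sub, ← map_mul,
      mul_divDiff, map_sub, ratSwap_algebraMap]
  · rw [demazure_of_ne h hab, ratDem, if_neg hab, map_mul, map_pow, map_sub, ratSwap_algebraMap,
      ratX, ratX]

theorem ratDem_X_succ (a b : I) (r : ℕ) (g : RatFun K) :
    ratDem h a b r (ratX K (r + 1) * g) =
      ratX K r * ratDem h a b r g + if a = b then g else 0 := by
  have := ratX_sub_ne_zero (K := K) (i := r + 1) (j := r) (by omega)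
  unfold ratDem
  rw [map_mul, ratSwap_right]
  split_ifs
  · field_simp; ring
  · ring

theorem X_succ_ratDem (a b : I) (r : ℕ) (g : RatFun K) :
    ratX K (r + 1) * ratDem h a b r g =
      ratDem h a b r (ratX K r * g) + if a = b then g else 0 := by
  have := ratX_sub_ne_zero (K := K) (i := r + 1) (j := r) (by omega)
  unfold ratDem
  rw [map_mul, ratSwap_left]
  split_ifs
  · field_simp; ring
  · ring

theorem ratDem_X_of_ne (a b : I) {r s : ℕ} (h1 : s ≠ r) (h2 : s ≠ r + 1) (g : RatFun K) :
    ratDem h a b r (ratX K s * g) = ratX K s * ratDem h a b r g := by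
  unfold ratDem
  rw [map_mul, ratSwap_of_ne h1 h2]
  split_ifs <;> ring

theorem ratDem_comm (a b c d : I) {r s : ℕ} (hrs : r + 1 < s) (g : RatFun K) :
    ratDem h a b r (ratDem h c d s g) = ratDem h c d s (ratDem h a b r g) := by
  unfold ratDem
  have e1 : ratSwap r (ratX K s) = ratX K s := ratSwap_of_ne (by omega) (by omega)
  have e2 : ratSwap r (ratX K (s + 1)) = ratX K (s + 1) := ratSwap_of_ne (by omega) (by omega)
  have e3 : ratSwap s (ratX K r) = ratX K r := ratSwap_of_ne (by omega) (by omega)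
  have e4 : ratSwap s (ratX K (r + 1)) = ratX K (r + 1) := ratSwap_of_ne (by omega) (by omega)
  split_ifs <;> simp only [map_mul, map_pow, map_sub, map_div₀, e1, e2, e3, e4,
    ratSwap_comm hrs] <;> ring

/-- The quadratic relation on rational functions. -/
theorem ratDem_sq (a b : I) (r : ℕ) (g : RatFun K) :
    ratDem h b a r (ratDem h a b r g) = klrQ h a b (ratX K r) (ratX K (r + 1)) * g := by
  unfold ratDem klrQ
  by_cases hab : a = b
  · subst hab
    have := ratX_sub_ne_zero (K := K) (i := r + 1) (j := r) (by omega)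
    have h2 := ratX_sub_ne_zero (K := K) (i := r) (j := r + 1) (by omega)
    simp only [if_true, map_div₀, map_sub, ratSwap_ratSwap, ratSwap_left, ratSwap_right]
    field_simp
    ring
  · simp only [hab, Ne.symm hab, if_false, map_mul, map_pow, map_sub, ratSwap_ratSwap,
      ratSwap_left, ratSwap_right]
    ring

/-- The braid relation on rational functions. Once the exchanges of variables are moved past the
coefficients, both sides are combinations of `g` and its images under products of exchanges, and
the coefficients are compared in the field. -/
theorem ratDem_braid (a b c : I) (r : ℕ) (g : RatFun K) :
    ratDem h a b (r + 1) (ratDem h a c r (ratDem h b c (r + 1) g)) -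
      ratDem h b c r (ratDem h a c (r + 1) (ratDem h a b r g)) =
    if a = c then klrQDiff h a b (ratX K r) (ratX K (r + 1)) (ratX K (r + 2)) * g else 0 := by
  have n1 := ratX_sub_ne_zero (K := K) (i := r + 1) (j := r) (by omega)
  have n2 := ratX_sub_ne_zero (K := K) (i := r + 2) (j := r + 1) (by omega)
  have n3 := ratX_sub_ne_zero (K := K) (i := r + 2) (j := r) (by omega)
  have n4 := ratX_sub_ne_zero (K := K) (i := r + 1) (j := r + 2) (by omega)
  have n5 := ratX_sub_ne_zero (K := K) (i := r) (j := r + 1) (by omega)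
  have e1 : ratSwap r (ratX K (r + 2)) = ratX K (r + 2) := ratSwap_of_ne (by omega) (by omega)
  have e2 : ratSwap (r + 1) (ratX K r) = ratX K r := ratSwap_of_ne (by omega) (by omega)
  have e3 : ratSwap (r + 1) (ratX K (r + 1)) = ratX K (r + 2) := ratSwap_left _
  have e4 : ratSwap (r + 1) (ratX K (r + 2)) = ratX K (r + 1) := ratSwap_right _
  have key : a = c → klrQDiff h a b (ratX K r) (ratX K (r + 1)) (ratX K (r + 2)) =
      (klrQ h a b (ratX K (r + 2)) (ratX K (r + 1)) - klrQ h a b (ratX K r) (ratX K (r + 1))) /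
        (ratX K (r + 2) - ratX K r) := fun _ => by
    rw [eq_div_iff n3, mul_comm, mul_klrQDiff]
  by_cases hac : a = c
  · rw [if_pos hac, key hac]
    subst hac
    unfold ratDem klrQ
    by_cases hab : a = b
    · subst hab
      simp only [if_true, map_div₀, map_sub, ratSwap_ratSwap, ratSwap_left, ratSwap_right,
        e1, e2, e3, e4, ratSwap_braid, add_assoc, Nat.reduceAdd]
      field_simp
      ring
    · simp only [hab, Ne.symm hab, if_false, if_true, map_mul, map_pow, map_div₀, map_sub,
        ratSwap_ratSwap, ratSwap_left, ratSwap_right,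
        e1, e2, e3, e4, ratSwap_braid, add_assoc, Nat.reduceAdd]
      generalize ratX K r = x at *
      generalize ratX K (r + 1) = y at *
      generalize ratX K (r + 2) = z at *
      generalize h a b = p at *
      generalize h b a = q at *
      generalize ratSwap (r + 1) (ratSwap r (ratSwap (r + 1) g)) = G
      -- `klrQ` contains both `(y - x) ^ q` and `(x - y) ^ p`; only powers of `y - x` are kept
      have : (x - y) ^ p = (-1) ^ p * (y - x) ^ p := by rw [← mul_pow]; ring
      field_simp
      ring
  · rw [if_neg hac, sub_eq_zero]
    unfold ratDem
    by_cases hab : a = b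
    · subst hab
      simp only [hac, if_false, if_true, map_mul, map_pow, map_div₀, map_sub,
        ratSwap_left, ratSwap_right,
        e1, e2, e3, e4, ratSwap_braid, add_assoc, Nat.reduceAdd]
      ring
    · by_cases hbc : b = c
      · subst hbc
        simp only [hac, if_false, if_true, map_mul, map_pow, map_div₀, map_sub,
          ratSwap_left, ratSwap_right,
          e1, e2, e3, e4, ratSwap_braid, add_assoc, Nat.reduceAdd]
        ring
      · simp only [hac, hab, hbc, if_false, map_mul, map_pow, map_sub,
          ratSwap_left, ratSwap_right,
          e1, e2, e3, e4, ratSwap_braid, add_assoc, Nat.reduceAdd]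
        ring

theorem algebraMap_rat_injective : Function.Injective (algebraMap (Pol K) (RatFun K)) :=
  IsFractionRing.injective _ _

theorem map_klrQ {A B : Type*} [Ring A] [Ring B] (f : A →+* B) (a b : I) (u v : A) :
    f (klrQ h a b u v) = klrQ h a b (f u) (f v) := by
  unfold klrQ; split_ifs <;> simp

theorem map_klrQDiff {A B : Type*} [Ring A] [Ring B] (f : A →+* B) (a b : I) (u v w : A) :
    f (klrQDiff h a b u v w) = klrQDiff h a b (f u) (f v) (f w) := by
  unfold klrQDiff; split_ifs <;> simp

theorem demazure_X_succ (a b : I) (r : ℕ) (g : Pol K) :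
    demazure h a b r (X (r + 1) * g) = X r * demazure h a b r g + if a = b then g else 0 := by
  apply algebraMap_rat_injective
  have := ratDem_X_succ h a b r (algebraMap (Pol K) (RatFun K) g)
  rw [algebraMap_demazure, map_mul, map_add, map_mul, algebraMap_demazure]
  split_ifs at this ⊢ <;> simpa [ratX] using this

theorem X_succ_demazure (a b : I) (r : ℕ) (g : Pol K) :
    X (r + 1) * demazure h a b r g = demazure h a b r (X r * g) + if a = b then g else 0 := by
  apply algebraMap_rat_injective
  have := X_succ_ratDem h a b r (algebraMap (Pol K) (RatFun K) g)
  rw [map_mul, map_add, algebraMap_demazure, algebraMap_demazure, map_mul]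
  split_ifs at this ⊢ <;> simpa [ratX] using this

theorem demazure_X_of_ne (a b : I) {r s : ℕ} (h1 : s ≠ r) (h2 : s ≠ r + 1) (g : Pol K) :
    demazure h a b r (X s * g) = X s * demazure h a b r g := by
  apply algebraMap_rat_injective
  rw [algebraMap_demazure, map_mul, map_mul, algebraMap_demazure]
  exact ratDem_X_of_ne h a b h1 h2 _

theorem demazure_comm (a b c d : I) {r s : ℕ} (hrs : r + 1 < s) (g : Pol K) :
    demazure h a b r (demazure h c d s g) = demazure h c d s (demazure h a b r g) := by
  apply algebraMap_rat_injective
  simp only [algebraMap_demazure]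
  exact ratDem_comm h a b c d hrs _

theorem demazure_sq (a b : I) (r : ℕ) (g : Pol K) :
    demazure h b a r (demazure h a b r g) = klrQ h a b (X r) (X (r + 1)) * g := by
  apply algebraMap_rat_injective
  rw [algebraMap_demazure, algebraMap_demazure, ratDem_sq, map_mul, map_klrQ]
  rfl

theorem demazure_braid (a b c : I) (r : ℕ) (g : Pol K) :
    demazure h a b (r + 1) (demazure h a c r (demazure h b c (r + 1) g)) -
      demazure h b c r (demazure h a c (r + 1) (demazure h a b r g)) =
    if a = c then klrQDiff h a b (X r) (X (r + 1)) (X (r + 2)) * g else 0 := by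
  apply algebraMap_rat_injective
  have := ratDem_braid h a b c r (algebraMap (Pol K) (RatFun K) g)
  rw [map_sub]
  simp only [algebraMap_demazure]
  rw [this]
  split_ifs
  · rw [map_mul, map_klrQDiff]; rfl
  · simp

end Demazure

/-! ### The polynomial representation -/

section PolRep

open MvPolynomial

variable {K : Type*} [Field K] {I : Type*} [DecidableEq I] (h : I → I → ℕ)

/-- The crossing at the positions `r`, `r + 1` of strands with labels `l`, acting on
polynomials. -/
noncomputable def crossPol (l : List I) (r : ℕ) : Pol K →ₗ[K] Pol K :=
  if hr : r + 1 < l.length then demazure h l[r] l[r + 1] r else 0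

theorem crossPol_append (m : List I) (a b : I) (n : List I) :
    crossPol (K := K) h (m ++ a :: b :: n) m.length = demazure h a b m.length := by
  rw [crossPol, dif_pos (by simp)]
  simp

theorem crossPol_split {m : List I} {a b : I} {n l : List I} {r : ℕ} (hl : l = m ++ a :: b :: n)
    (hr : m.length = r) : crossPol (K := K) h l r = demazure h a b r := by
  subst hl hr
  exact crossPol_append h m a b n

theorem crossPol_of_le (l : List I) (r : ℕ) (hr : l.length ≤ r + 1) :
    crossPol (K := K) h l r = 0 := dif_neg (by omega)

@[simp] theorem swapVec_val {d : ℕ} (r : ℕ) (v : List.Vector I d) :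
    (swapVec r v).1 = swapAt r v.1 := rfl

theorem swapVec_swapVec {d : ℕ} (r : ℕ) (v : List.Vector I d) : swapVec r (swapVec r v) = v :=
  Subtype.ext (swapAt_swapAt r v.1)

variable [Fintype I]

variable (K I) in
/-- The space of the polynomial representation: one polynomial for each sequence. -/
abbrev PolSeq (d : ℕ) : Type _ := List.Vector I d → Pol K

/-- The polynomial `g` placed at the sequence `v`. -/
noncomputable def polAt {d : ℕ} (v : List.Vector I d) : Pol K →ₗ[K] PolSeq K I d :=
  LinearMap.single K (fun _ => Pol K) v

theorem polAt_self {d : ℕ} (v : List.Vector I d) (g : Pol K) : polAt v g v = g := by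
  simp [polAt]

theorem polAt_ne {d : ℕ} {v w : List.Vector I d} (hw : w ≠ v) (g : Pol K) : polAt v g w = 0 := by
  simp [polAt, hw]

theorem sum_polAt {d : ℕ} (F : PolSeq K I d) : ∑ v, polAt v (F v) = F := by
  simpa [polAt] using Finset.univ_sum_single F

theorem polSeq_hom_ext {d : ℕ} {M : Type*} [AddCommMonoid M] [Module K M]
    {f g : PolSeq K I d →ₗ[K] M} (hfg : ∀ v p, f (polAt v p) = g (polAt v p)) : f = g :=
  LinearMap.pi_ext hfg

/-- The action of `e(v)`. -/
noncomputable def opE (K : Type*) [Field K] {d : ℕ} (v : List.Vector I d) :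
    Module.End K (PolSeq K I d) := polAt v ∘ₗ LinearMap.proj v

/-- The action of polynomials by multiplication. -/
noncomputable def opPol (K : Type*) [Field K] (I : Type*) [DecidableEq I] [Fintype I] (d : ℕ) :
    Pol K →ₐ[K] Module.End K (PolSeq K I d) := Algebra.lsmul K K (PolSeq K I d)

/-- The action of `τ_r`. -/
noncomputable def opT (K : Type*) [Field K] (d r : ℕ) : Module.End K (PolSeq K I d) :=
  LinearMap.pi fun w => crossPol h (swapAt r w.1) r ∘ₗ LinearMap.proj (swapVec r w)

theorem opE_polAt {d : ℕ} (v w : List.Vector I d) (g : Pol K) :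
    opE K v (polAt w g) = if v = w then polAt w g else 0 := by
  rw [opE, LinearMap.comp_apply, LinearMap.proj_apply]
  split_ifs with hvw
  · rw [hvw, polAt_self]
  · rw [polAt_ne hvw, map_zero]

theorem opPol_polAt {d : ℕ} (p : Pol K) (w : List.Vector I d) (g : Pol K) :
    opPol K I d p (polAt w g) = polAt w (p * g) := by
  funext v
  change p * polAt w g v = _
  by_cases hvw : v = w
  · rw [hvw, polAt_self, polAt_self]
  · rw [polAt_ne hvw, polAt_ne hvw, mul_zero]

theorem opT_polAt {d : ℕ} (r : ℕ) (v : List.Vector I d) (g : Pol K) :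
    opT h K d r (polAt v g) = polAt (swapVec r v) (crossPol h v.1 r g) := by
  funext w
  change crossPol h (swapAt r w.1) r (polAt v g (swapVec r w)) = _
  by_cases hw : w = swapVec r v
  · rw [hw, swapVec_swapVec, polAt_self, polAt_self, swapVec_val, swapAt_swapAt]
  · rw [polAt_ne hw, polAt_ne, map_zero]
    rintro rfl
    exact hw (swapVec_swapVec r w).symm

/-- The action of the generators. -/
noncomputable def genOp (d : ℕ) : KLRGen I d → Module.End K (PolSeq K I d)
  | .idem v => opE K v
  | .dot r _ => opPol K I d (X r)
  | .cross r _ => opT h K d r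

/-- The action of the free algebra on the generators. -/
noncomputable def freeRep (d : ℕ) :
    FreeAlgebra K (KLRGen I d) →ₐ[K] Module.End K (PolSeq K I d) :=
  FreeAlgebra.lift K (genOp h d)

theorem freeRep_genE {d : ℕ} (v : List.Vector I d) : freeRep h d (genE K v) = opE K v := by
  simp [freeRep, genE, genOp]

theorem freeRep_genX {d r : ℕ} (hr : r < d) :
    freeRep h d (genX K I d r) = opPol K I d (X r) := by
  simp [freeRep, genX, genOp, hr]

theorem freeRep_genT {d r : ℕ} (hr : r + 1 < d) :
    freeRep h d (genT K I d r) = opT h K d r := by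
  simp [freeRep, genT, genOp, hr]

theorem vec_get_split {d : ℕ} {v : List.Vector I d} {m n : List I} {a : I} {r : ℕ}
    (hv : v.1 = m ++ a :: n) (hm : m.length = r) (hr : r < d) : v.get ⟨r, hr⟩ = a := by
  subst hm
  rw [List.Vector.get_eq_get_toList]
  change v.1[m.length]'_ = a
  simp [hv]

/-- The operators on polynomials satisfy the defining relations. Each relation is evaluated on a
polynomial placed at one sequence `w`, where it becomes an identity of Demazure operators. -/
theorem freeRep_rel {d : ℕ} {a b : FreeAlgebra K (KLRGen I d)} (hab : KLRRel K h d a b) :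
    freeRep h d a = freeRep h d b := by
  refine polSeq_hom_ext fun w g => ?_
  induction hab with
  | e_idem v =>
    rw [map_mul, freeRep_genE, Module.End.mul_apply, opE_polAt]
    split_ifs with hvw
    · rw [opE_polAt, if_pos hvw]
    · rw [map_zero]
  | e_orth v v' hvv =>
    rw [map_mul, freeRep_genE, freeRep_genE, Module.End.mul_apply, opE_polAt, map_zero]
    split_ifs with hvw
    · rw [opE_polAt, if_neg (fun e => hvv (e.trans hvw.symm))]; rfl
    · rw [map_zero]; rfl
  | e_sum =>
    rw [map_sum, map_one, LinearMap.sum_apply, Finset.sum_eq_single w]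
    · rw [freeRep_genE, opE_polAt, if_pos rfl]; rfl
    · intro v _ hv
      rw [freeRep_genE, opE_polAt, if_neg hv]
    · simp
  | x_e r hr v =>
    rw [map_mul, map_mul, freeRep_genE, freeRep_genX h hr, Module.End.mul_apply,
      Module.End.mul_apply, opE_polAt, opPol_polAt, opE_polAt]
    split_ifs
    · rw [opPol_polAt]
    · rw [map_zero]
  | t_e r hr v =>
    rw [map_mul, map_mul, freeRep_genE, freeRep_genE, freeRep_genT h hr, Module.End.mul_apply,
      Module.End.mul_apply, opE_polAt, opT_polAt, opE_polAt]
    by_cases hvw : v = w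
    · rw [if_pos hvw, if_pos (by rw [hvw]), opT_polAt]
    · rw [if_neg hvw, map_zero, if_neg]
      intro e
      apply hvw
      rw [← swapVec_swapVec r v, e, swapVec_swapVec]
  | x_x r s hr hs =>
    rw [map_mul, map_mul, freeRep_genX h hr, freeRep_genX h hs, ← map_mul, mul_comm, map_mul]
  | t_x_succ r hr v =>
    simp only [map_mul, map_add, freeRep_genE, freeRep_genT h hr, freeRep_genX h hr,
      freeRep_genX h (show r < d by omega), Module.End.mul_apply, LinearMap.add_apply, opE_polAt]
    by_cases hvw : v = w
    · subst hvw
      obtain ⟨m, a, b, n, hv, hm⟩ := exists_split_pair v.1 r (by rw [v.2]; exact hr)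
      rw [vec_get_split hv hm, vec_get_split (v := v) (r := r + 1) (m := m ++ [a]) (a := b) (n := n)
        (by simpa using hv) (by simp [hm])]
      simp only [if_true, opPol_polAt, opT_polAt, crossPol_split h hv hm, demazure_X_succ, map_add]
      congr 1
      -- a crossing of strands with equal labels keeps the sequence
      have hs : a = b → swapVec r v = v := fun e => Subtype.ext (by
        rw [swapVec_val, hv, ← hm, swapAt_append_pair, e])
      split_ifs with e
      · rw [hs e, map_one]; rfl
      · simp
    · simp [hvw]
  | x_succ_t r hr v =>
    simp only [map_mul, map_add, freeRep_genE, freeRep_genT h hr, freeRep_genX h hr,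
      freeRep_genX h (show r < d by omega), Module.End.mul_apply, LinearMap.add_apply, opE_polAt]
    by_cases hvw : v = w
    · subst hvw
      obtain ⟨m, a, b, n, hv, hm⟩ := exists_split_pair v.1 r (by rw [v.2]; exact hr)
      rw [vec_get_split hv hm, vec_get_split (v := v) (r := r + 1) (m := m ++ [a]) (a := b) (n := n)
        (by simpa using hv) (by simp [hm])]
      simp only [if_true, opPol_polAt, opT_polAt, crossPol_split h hv hm, X_succ_demazure, map_add]
      congr 1
      have hs : a = b → swapVec r v = v := fun e => Subtype.ext (by
        rw [swapVec_val, hv, ← hm, swapAt_append_pair, e])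
      split_ifs with e
      · rw [hs e, map_one]; rfl
      · simp
    · simp [hvw]
  | t_x r s hr hs h1 h2 =>
    obtain ⟨m, a, b, n, hv, hm⟩ := exists_split_pair w.1 r (by rw [w.2]; exact hr)
    rw [map_mul, map_mul, freeRep_genT h hr, freeRep_genX h hs, Module.End.mul_apply,
      Module.End.mul_apply, opPol_polAt, opT_polAt, opT_polAt, opPol_polAt,
      crossPol_split h hv hm, demazure_X_of_ne h a b h1 h2]
  | t_t r s hr hs hrs =>
    -- the two positions play symmetric roles
    have key : ∀ r s, r + 1 < s → s + 1 < d → opT h K d r (opT h K d s (polAt w g)) =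
        opT h K d s (opT h K d r (polAt w g)) := by
      intro r s hrs hs
      have e : swapVec r (swapVec s w) = swapVec s (swapVec r w) :=
        Subtype.ext (swapAt_comm r s hrs w.1)
      obtain ⟨m, a, b, n, hv, hm⟩ := exists_split_pair w.1 r (by rw [w.2]; omega)
      obtain ⟨t, rfl⟩ : ∃ t, s = m.length + (t + 2) := ⟨s - m.length - 2, by omega⟩
      have hl := congrArg List.length hv
      rw [w.2] at hl
      simp only [List.length_append, List.length_cons] at hl
      obtain ⟨m', a', b', n', hv', hm'⟩ := exists_split_pair n t (by omega)
      have f1 : w.1 = (m ++ a :: b :: m') ++ a' :: b' :: n' := by rw [hv, hv']; simp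
      have f2 : (swapVec r w).1 = (m ++ b :: a :: m') ++ a' :: b' :: n' := by
        rw [swapVec_val, hv, ← hm, swapAt_append_pair, hv']; simp
      have f3 : (swapVec (m.length + (t + 2)) w).1 = m ++ a :: b :: (m' ++ b' :: a' :: n') := by
        rw [swapVec_val, hv, swapAt_append, ← hm', hv']
        simp [swapAt, swapAt_append_pair]
      rw [opT_polAt, opT_polAt, opT_polAt, opT_polAt, e, crossPol_split h f1 (by simp; omega),
        crossPol_split h f2 (by simp; omega), crossPol_split h f3 hm, crossPol_split h hv hm,
        demazure_comm _ _ _ _ _ hrs]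
    rw [map_mul, map_mul, freeRep_genT h hr, freeRep_genT h hs, Module.End.mul_apply,
      Module.End.mul_apply]
    rcases hrs with hrs | hrs
    · exact key r s hrs hs
    · exact (key s r hrs hr).symm
  | t_sq r hr v =>
    have hq : ∀ a b, freeRep h d (klrQ h a b (genX K I d r) (genX K I d (r + 1))) =
        opPol K I d (klrQ h a b (X r) (X (r + 1))) := fun a b => by
      have h1 := map_klrQ h (freeRep (K := K) h d).toRingHom a b
        (genX K I d r) (genX K I d (r + 1))
      have h2 := map_klrQ h (opPol K I d).toRingHom a b (X r) (X (r + 1))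
      simp only [AlgHom.toRingHom_eq_coe, RingHom.coe_coe, freeRep_genX h hr,
        freeRep_genX h (show r < d by omega)] at h1 h2
      rw [h1, h2]
    simp only [map_mul, freeRep_genE, freeRep_genT h hr, hq, Module.End.mul_apply, opE_polAt]
    by_cases hvw : v = w
    · subst hvw
      obtain ⟨m, a, b, n, hv, hm⟩ := exists_split_pair v.1 r (by rw [v.2]; exact hr)
      rw [vec_get_split hv hm, vec_get_split (v := v) (r := r + 1) (m := m ++ [a]) (a := b) (n := n)
        (by simpa using hv) (by simp [hm])]
      have hv' : (swapVec r v).1 = m ++ b :: a :: n := by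
        rw [swapVec_val, hv, ← hm, swapAt_append_pair]
      simp only [if_true, opPol_polAt, opT_polAt, crossPol_split h hv hm, crossPol_split h hv' hm,
        demazure_sq, swapVec_swapVec]
    · simp [hvw]
  | braid r hr v =>
    have hq : ∀ a b, freeRep h d (klrQDiff h a b (genX K I d r) (genX K I d (r + 1))
        (genX K I d (r + 2))) =
        opPol K I d (klrQDiff h a b (X r) (X (r + 1)) (X (r + 2))) := fun a b => by
      have h1 := map_klrQDiff h (freeRep (K := K) h d).toRingHom a b
        (genX K I d r) (genX K I d (r + 1)) (genX K I d (r + 2))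
      have h2 := map_klrQDiff h (opPol K I d).toRingHom a b (X r) (X (r + 1)) (X (r + 2))
      simp only [AlgHom.toRingHom_eq_coe, RingHom.coe_coe, freeRep_genX h hr,
        freeRep_genX h (show r < d by omega), freeRep_genX h (show r + 1 < d by omega)] at h1 h2
      rw [h1, h2]
    have hq2 : ∀ (P : Prop) [Decidable P] (y : FreeAlgebra K (KLRGen I d)),
        freeRep h d (if P then y else 0) = if P then freeRep h d y else 0 := by
      intro P _ y; split_ifs <;> simp
    simp only [map_mul, map_sub, freeRep_genE, freeRep_genT h (show r + 1 < d by omega),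
      freeRep_genT h (show r + 1 + 1 < d by omega), hq2, hq, Module.End.mul_apply,
      LinearMap.sub_apply, opE_polAt]
    by_cases hvw : v = w
    · subst hvw
      obtain ⟨m, a, b, c, n, hv, hm⟩ := exists_split_triple v.1 r (by rw [v.2]; exact hr)
      rw [vec_get_split hv hm, vec_get_split (v := v) (r := r + 1) (m := m ++ [a]) (a := b)
        (n := c :: n) (by simpa using hv) (by simp [hm]),
        vec_get_split (v := v) (r := r + 2) (m := m ++ [a, b]) (a := c)
        (n := n) (by simpa using hv) (by simp [hm])]
      have s0 := fun l : List I => swapAt_append m 0 l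
      have s1 := fun l : List I => swapAt_append m 1 l
      simp only [add_zero, hm] at s0 s1
      have e : swapVec (r + 1) (swapVec r (swapVec (r + 1) v)) =
          swapVec r (swapVec (r + 1) (swapVec r v)) := Subtype.ext (by
        simp only [swapVec_val]
        rw [swapAt_braid r v.1 (by rw [v.2]; exact hr)])
      -- the sequences met along both sides of the braid relation
      have f1 : v.1 = (m ++ [a]) ++ b :: c :: n := by simpa using hv
      have f2 : (swapVec (r + 1) v).1 = m ++ a :: c :: b :: n := by
        simp only [swapVec_val, hv, s1, swapAt]
      have f3 : (swapVec r (swapVec (r + 1) v)).1 = (m ++ [c]) ++ a :: b :: n := by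
        rw [swapVec_val, f2]; simp [s0, swapAt]
      have f4 : (swapVec r v).1 = (m ++ [b]) ++ a :: c :: n := by
        simp [hv, s0, swapAt]
      have f5 : (swapVec (r + 1) (swapVec r v)).1 = m ++ b :: c :: a :: n := by
        rw [swapVec_val, swapVec_val, hv, s0]; simp [s1, swapAt]
      have l1 : ∀ x : I, (m ++ [x]).length = r + 1 := by simp [hm]
      simp only [if_true, opT_polAt, crossPol_split h f1 (l1 a), crossPol_split h f2 hm,
        crossPol_split h f3 (l1 c), crossPol_split h hv hm, crossPol_split h f4 (l1 b),
        crossPol_split h f5 hm, e]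
      rw [← map_sub, demazure_braid]
      split_ifs with hac
      · rw [Module.End.mul_apply, opE_polAt, if_pos rfl, opPol_polAt]
        refine congrArg (fun w => polAt w _) (Subtype.ext ?_)
        rw [swapVec_val, f5, s0, hv]
        simp [swapAt, hac]
      · simp
    · simp only [hvw, if_false, map_zero, sub_zero]
      split_ifs
      · rw [Module.End.mul_apply, opE_polAt, if_neg hvw, map_zero]
      · simp

/-- The polynomial representation of the KLR algebra. -/
noncomputable def polRep (d : ℕ) : KLR K h d →ₐ[K] Module.End K (PolSeq K I d) :=
  RingQuot.liftAlgHom K ⟨freeRep h d, fun _ _ hab => freeRep_rel h hab⟩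

theorem polRep_mk (d : ℕ) (a : FreeAlgebra K (KLRGen I d)) :
    polRep h d (RingQuot.mkAlgHom K (KLRRel K h d) a) = freeRep h d a :=
  RingQuot.liftAlgHom_mkAlgHom_apply K _ _ _

theorem polRep_klrE {d : ℕ} (v : List.Vector I d) : polRep h d (klrE K h v) = opE K v := by
  rw [klrE, polRep_mk, freeRep_genE]

theorem polRep_klrX {d r : ℕ} (hr : r < d) :
    polRep h d (klrX K h d r) = opPol K I d (X r) := by
  rw [klrX, polRep_mk, freeRep_genX h hr]

theorem klrX_of_le {d r : ℕ} (hr : d ≤ r) : klrX K h d r = 0 := by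
  rw [klrX, genX, dif_neg (by omega), map_zero]

theorem klrT_of_le {d r : ℕ} (hr : d ≤ r + 1) : klrT K h d r = 0 := by
  rw [klrT, genT, dif_neg (by omega), map_zero]

theorem polRep_klrT (d r : ℕ) : polRep h d (klrT K h d r) = opT h K d r := by
  by_cases hr : r + 1 < d
  · rw [klrT, polRep_mk, freeRep_genT h hr]
  · rw [klrT_of_le h (by omega), map_zero]
    refine polSeq_hom_ext fun v p => ?_
    rw [opT_polAt, crossPol_of_le h v.1 r (by rw [v.2]; omega)]
    simp

end PolRep

/-! ### A spanning set of the KLR algebra -/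

section Spanning

open MvPolynomial
open scoped IsMulCommutative

variable {K : Type*} [Field K] {I : Type*} [DecidableEq I] [Fintype I] (h : I → I → ℕ)

theorem klr_induction {d : ℕ} {P : KLR K h d → Prop}
    (hc : ∀ c : K, P (algebraMap K _ c)) (hE : ∀ v, P (klrE K h v))
    (hX : ∀ r, r < d → P (klrX K h d r)) (hT : ∀ r, r + 1 < d → P (klrT K h d r))
    (hadd : ∀ a b, P a → P b → P (a + b)) (hmul : ∀ a b, P a → P b → P (a * b)) (a) : P a := by
  obtain ⟨y, rfl⟩ := RingQuot.mkAlgHom_surjective K (KLRRel K h d) a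
  induction y using FreeAlgebra.induction with
  | grade0 c => rw [AlgHom.commutes]; exact hc c
  | grade1 g =>
    cases g with
    | idem v => exact hE v
    | dot r hr => simpa [klrX, genX, hr] using hX r hr
    | cross r hr => simpa [klrT, genT, hr] using hT r hr
  | mul a b ha hb => rw [map_mul]; exact hmul _ _ ha hb
  | add a b ha hb => rw [map_add]; exact hadd _ _ ha hb

variable {h}

theorem klr_neg_mul {d : ℕ} (a b : KLR K h d) : -a * b = -(a * b) := neg_mul a b

theorem klr_mul_neg {d : ℕ} (a b : KLR K h d) : a * -b = -(a * b) := mul_neg a b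

theorem klrE_mul_self {d : ℕ} (v : List.Vector I d) : klrE K h v * klrE K h v = klrE K h v := by
  unfold klrE
  rw [← map_mul]
  exact RingQuot.mkAlgHom_rel K (KLRRel.e_idem v)

theorem klrE_mul_of_ne {d : ℕ} {v w : List.Vector I d} (hvw : v ≠ w) :
    klrE K h v * klrE K h w = 0 := by
  unfold klrE
  rw [← map_mul, RingQuot.mkAlgHom_rel K (KLRRel.e_orth v w hvw), map_zero]

theorem sum_klrE (d : ℕ) : ∑ v : List.Vector I d, klrE K h v = 1 := by
  unfold klrE
  rw [← map_sum, RingQuot.mkAlgHom_rel K KLRRel.e_sum, map_one]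

theorem klrX_mul_klrE {d : ℕ} (r : ℕ) (v : List.Vector I d) :
    klrX K h d r * klrE K h v = klrE K h v * klrX K h d r := by
  by_cases hr : r < d
  · unfold klrE klrX
    rw [← map_mul, RingQuot.mkAlgHom_rel K (KLRRel.x_e r hr v), map_mul]
  · rw [klrX_of_le h (by omega), mul_zero, zero_mul]

theorem klrT_mul_klrE {d : ℕ} (r : ℕ) (v : List.Vector I d) :
    klrT K h d r * klrE K h v = klrE K h (swapVec r v) * klrT K h d r := by
  by_cases hr : r + 1 < d
  · unfold klrE klrT
    rw [← map_mul, RingQuot.mkAlgHom_rel K (KLRRel.t_e r hr v), map_mul]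
  · rw [klrT_of_le h (by omega), mul_zero, zero_mul]

theorem klrX_comm {d : ℕ} (r s : ℕ) :
    klrX K h d r * klrX K h d s = klrX K h d s * klrX K h d r := by
  by_cases hr : r < d
  · by_cases hs : s < d
    · unfold klrX
      rw [← map_mul, RingQuot.mkAlgHom_rel K (KLRRel.x_x r s hr hs), map_mul]
    · rw [klrX_of_le h (r := s) (by omega), mul_zero, zero_mul]
  · rw [klrX_of_le h (r := r) (by omega), mul_zero, zero_mul]

theorem klrX_mul_klrT_of_ne {d : ℕ} {r s : ℕ} (h1 : s ≠ r) (h2 : s ≠ r + 1) :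
    klrX K h d s * klrT K h d r = klrT K h d r * klrX K h d s := by
  by_cases hr : r + 1 < d
  · by_cases hs : s < d
    · unfold klrX klrT
      rw [← map_mul, ← RingQuot.mkAlgHom_rel K (KLRRel.t_x r s hr hs h1 h2), map_mul]
    · rw [klrX_of_le h (r := s) (by omega), mul_zero, zero_mul]
  · rw [klrT_of_le h (r := r) (by omega), mul_zero, zero_mul]

theorem klrT_comm {d : ℕ} {r s : ℕ} (hrs : r + 1 < s) :
    klrT K h d r * klrT K h d s = klrT K h d s * klrT K h d r := by
  by_cases hs : s + 1 < d
  · unfold klrT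
    rw [← map_mul, RingQuot.mkAlgHom_rel K (KLRRel.t_t r s (by omega) hs (Or.inl hrs)), map_mul]
  · rw [klrT_of_le h (r := s) (by omega), mul_zero, zero_mul]

theorem klrX_mul_klrT {d : ℕ} {r : ℕ} (hr : r + 1 < d) (v : List.Vector I d) : ∃ c : K,
    klrX K h d r * (klrT K h d r * klrE K h v) =
      klrT K h d r * klrX K h d (r + 1) * klrE K h v - c • klrE K h v := by
  refine ⟨if v.get ⟨r, Nat.lt_of_succ_lt hr⟩ = v.get ⟨r + 1, hr⟩ then 1 else 0, ?_⟩
  have := RingQuot.mkAlgHom_rel K (KLRRel.t_x_succ (K := K) (h := h) r hr v)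
  unfold klrE klrX klrT
  rw [map_mul, map_mul] at this
  rw [this, map_mul, map_add, map_mul, add_mul, mul_assoc]
  split_ifs <;> simp

theorem klrX_succ_mul_klrT {d : ℕ} {r : ℕ} (hr : r + 1 < d) (v : List.Vector I d) : ∃ c : K,
    klrX K h d (r + 1) * (klrT K h d r * klrE K h v) =
      klrT K h d r * klrX K h d r * klrE K h v + c • klrE K h v := by
  refine ⟨if v.get ⟨r, Nat.lt_of_succ_lt hr⟩ = v.get ⟨r + 1, hr⟩ then 1 else 0, ?_⟩
  have := RingQuot.mkAlgHom_rel K (KLRRel.x_succ_t (K := K) (h := h) r hr v)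
  unfold klrE klrX klrT
  rw [map_mul, map_mul] at this
  rw [← mul_assoc, this, map_mul, map_add, map_mul, add_mul]
  split_ifs <;> simp

variable (h)

/-- The polynomials in the elements `x_r` of the KLR algebra. Variables out of range go to `0`. -/
noncomputable def polX (d : ℕ) : Pol K →ₐ[K] KLR K h d :=
  have := Algebra.isMulCommutative_adjoin K (s := Set.range (klrX K h d)) (by
      rintro _ ⟨r, rfl⟩ _ ⟨s, rfl⟩
      exact klrX_comm r s)
  (Algebra.adjoin K (Set.range (klrX K h d))).val.comp
    (aeval fun r => (⟨klrX K h d r, Algebra.subset_adjoin ⟨r, rfl⟩⟩ :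
      Algebra.adjoin K (Set.range (klrX K h d))))

variable {h}

theorem polX_X (d r : ℕ) : polX h d (X r) = klrX K h d r := by
  have := Algebra.isMulCommutative_adjoin K (s := Set.range (klrX K h d)) (by
      rintro _ ⟨r, rfl⟩ _ ⟨s, rfl⟩
      exact klrX_comm r s)
  exact congrArg Subtype.val (aeval_X (fun r => (⟨klrX K h d r, Algebra.subset_adjoin ⟨r, rfl⟩⟩ :
      Algebra.adjoin K (Set.range (klrX K h d)))) r)

theorem polX_mul_klrE {d : ℕ} (f : Pol K) (v : List.Vector I d) :
    polX h d f * klrE K h v = klrE K h v * polX h d f := by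
  induction f using MvPolynomial.induction_on with
  | C c => rw [← MvPolynomial.algebraMap_eq, AlgHom.commutes, Algebra.commutes]
  | add p q hp hq => rw [map_add, add_mul, mul_add, hp, hq]
  | mul_X p r hp => rw [map_mul, polX_X, mul_assoc, klrX_mul_klrE, ← mul_assoc, hp, mul_assoc]

/-- A polynomial moves past a crossing, at the price of a term without the crossing. -/
theorem exists_polX_mul_klrT {d : ℕ} {r : ℕ} (hr : r + 1 < d) (v : List.Vector I d) (f : Pol K) :
    ∃ f' : Pol K, polX h d f * (klrT K h d r * klrE K h v) =
      klrT K h d r * polX h d (polSwap K r f) * klrE K h v + polX h d f' * klrE K h v := by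
  induction f using MvPolynomial.induction_on with
  | C c =>
    refine ⟨0, ?_⟩
    have : polSwap K r (C c) = C c := by rw [polSwap, rename_C]
    rw [this, ← MvPolynomial.algebraMap_eq, AlgHom.commutes, map_zero, zero_mul, add_zero,
      ← mul_assoc, Algebra.commutes]
  | add p q hp hq =>
    obtain ⟨p', hp⟩ := hp
    obtain ⟨q', hq⟩ := hq
    refine ⟨p' + q', ?_⟩
    simp only [map_add, add_mul, hp, hq, mul_add]
    abel
  | mul_X p j hp =>
    obtain ⟨p', hp⟩ := hp
    have mv : ∀ j, polX h d p * (klrT K h d r * klrX K h d j * klrE K h v) =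
        klrT K h d r * polX h d (polSwap K r p * X j) * klrE K h v +
          polX h d (p' * X j) * klrE K h v := fun j => by
      rw [mul_assoc, klrX_mul_klrE, ← mul_assoc, ← mul_assoc, mul_assoc (polX h d p), hp, add_mul,
        mul_assoc _ (klrE K h v), ← klrX_mul_klrE, mul_assoc _ (klrE K h v), ← klrX_mul_klrE,
        map_mul, map_mul, polX_X]
      simp only [mul_assoc]
    have hs : ∀ c : K, polX h d p * (c • klrE K h v) = polX h d (c • p) * klrE K h v := fun c => by
      rw [map_smul, mul_smul_comm, smul_mul_assoc]
    rw [map_mul, map_mul, polX_X, polSwap_X, mul_assoc]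
    by_cases h1 : j = r
    · subst h1
      obtain ⟨c, hc⟩ := klrX_mul_klrT (K := K) (h := h) hr v
      rw [Equiv.swap_apply_left, hc, mul_sub, mv, hs]
      refine ⟨p' * X (j + 1) - c • p, ?_⟩
      rw [map_sub, sub_mul]; abel
    · by_cases h2 : j = r + 1
      · subst h2
        obtain ⟨c, hc⟩ := klrX_succ_mul_klrT (K := K) (h := h) hr v
        rw [Equiv.swap_apply_right, hc, mul_add, mv, hs]
        refine ⟨p' * X r + c • p, ?_⟩
        rw [map_add, add_mul]; abel
      · rw [Equiv.swap_apply_of_ne_of_ne h1 h2, ← mul_assoc (klrX K h d j),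
          klrX_mul_klrT_of_ne h1 h2, mv]
        exact ⟨_, rfl⟩

theorem klrT_sq {d r : ℕ} {v : List.Vector I d} {m n : List I} {a b : I}
    (hv : v.1 = m ++ a :: b :: n) (hm : m.length = r) :
    klrT K h d r * klrT K h d r * klrE K h v =
      polX h d (klrQ h a b (X r) (X (r + 1))) * klrE K h v := by
  have hr : r + 1 < d := by
    have := congrArg List.length hv
    rw [v.2] at this; simp at this; omega
  have := RingQuot.mkAlgHom_rel K (KLRRel.t_sq (K := K) (h := h) r hr v)
  rw [vec_get_split hv hm, vec_get_split (v := v) (r := r + 1) (m := m ++ [a]) (a := b) (n := n)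
        (by simpa using hv) (by simp [hm])] at this
  have h1 := map_klrQ h (RingQuot.mkAlgHom K (KLRRel K h d)).toRingHom a b
    (genX K I d r) (genX K I d (r + 1))
  have h2 := map_klrQ h (polX (K := K) h d).toRingHom a b (X r) (X (r + 1))
  simp only [AlgHom.toRingHom_eq_coe, RingHom.coe_coe, polX_X] at h1 h2
  rw [map_mul, map_mul, map_mul, h1] at this
  rw [h2]
  exact this

theorem klrT_braid {d r : ℕ} (hr : r + 2 < d) (v : List.Vector I d) : ∃ f : Pol K,
    (klrT K h d (r + 1) * klrT K h d r * klrT K h d (r + 1) -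
      klrT K h d r * klrT K h d (r + 1) * klrT K h d r) * klrE K h v =
      polX h d f * klrE K h v := by
  have := RingQuot.mkAlgHom_rel K (KLRRel.braid (K := K) (h := h) r hr v)
  rw [map_mul, map_sub, map_mul, map_mul, map_mul, map_mul] at this
  split_ifs at this with hac
  · refine ⟨klrQDiff h (v.get ⟨r, by omega⟩) (v.get ⟨r + 1, by omega⟩) (X r) (X (r + 1))
      (X (r + 2)), ?_⟩
    have h1 := map_klrQDiff h (RingQuot.mkAlgHom K (KLRRel K h d)).toRingHom
      (v.get ⟨r, by omega⟩) (v.get ⟨r + 1, by omega⟩)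
      (genX K I d r) (genX K I d (r + 1)) (genX K I d (r + 2))
    have h2 := map_klrQDiff h (polX (K := K) h d).toRingHom
      (v.get ⟨r, by omega⟩) (v.get ⟨r + 1, by omega⟩) (X r) (X (r + 1)) (X (r + 2))
    simp only [AlgHom.toRingHom_eq_coe, RingHom.coe_coe, polX_X] at h1 h2
    rw [map_mul, h1] at this
    rw [h2]
    exact this
  · refine ⟨0, ?_⟩
    rw [map_zero] at this
    rw [map_zero, zero_mul]
    exact this

variable (K h) in
/-- The product of crossings along a word. -/
noncomputable def tauWord (d : ℕ) (u : List ℕ) : KLR K h d := (u.map (klrT K h d)).prod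

@[simp] theorem tauWord_nil (d : ℕ) : tauWord K h d [] = 1 := rfl

@[simp] theorem tauWord_cons (d r : ℕ) (u : List ℕ) :
    tauWord K h d (r :: u) = klrT K h d r * tauWord K h d u := by simp [tauWord]

@[simp] theorem tauWord_append (d : ℕ) (u v : List ℕ) :
    tauWord K h d (u ++ v) = tauWord K h d u * tauWord K h d v := by simp [tauWord]

/-- The sequence obtained from `v` by a word. -/
def actVec {d : ℕ} (u : List ℕ) (v : List.Vector I d) : List.Vector I d :=
  ⟨act u v.1, (length_act u v.1).trans v.2⟩

theorem tauWord_mul_klrE {d : ℕ} (u : List ℕ) (v : List.Vector I d) :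
    tauWord K h d u * klrE K h v = klrE K h (actVec u v) * tauWord K h d u := by
  induction u with
  | nil =>
    rw [tauWord_nil, one_mul, mul_one]; rfl
  | cons r u ih =>
    rw [tauWord_cons, mul_assoc, ih, ← mul_assoc, klrT_mul_klrE, mul_assoc]; rfl

variable (K h) in
/-- The span of the elements `τ_u f(x) e(v)`, where the word `u` has less than `n` letters. -/
noncomputable def tauFil {d : ℕ} (v : List.Vector I d) (n : ℕ) : Submodule K (KLR K h d) :=
  Submodule.span K {x | ∃ (u : List ℕ) (f : Pol K), u.length < n ∧
    x = tauWord K h d u * polX h d f * klrE K h v}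

theorem mem_tauFil {d : ℕ} {v : List.Vector I d} {n : ℕ} (u : List ℕ) (f : Pol K)
    (hu : u.length < n) : tauWord K h d u * polX h d f * klrE K h v ∈ tauFil K h v n :=
  Submodule.subset_span ⟨u, f, hu, rfl⟩

theorem tauFil_mono {d : ℕ} (v : List.Vector I d) {m n : ℕ} (hmn : m ≤ n) :
    tauFil K h v m ≤ tauFil K h v n :=
  Submodule.span_mono fun _ ⟨u, f, hu, hx⟩ => ⟨u, f, by omega, hx⟩

theorem tauFil_mul_polX {d : ℕ} {v : List.Vector I d} {n : ℕ} {x : KLR K h d}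
    (hx : x ∈ tauFil K h v n) (f : Pol K) : x * polX h d f ∈ tauFil K h v n := by
  induction hx using Submodule.span_induction with
  | mem x hx =>
    obtain ⟨u, g, hu, rfl⟩ := hx
    rw [mul_assoc, ← polX_mul_klrE, ← mul_assoc, mul_assoc (tauWord K h d u), ← map_mul]
    exact mem_tauFil u _ hu
  | zero => rw [zero_mul]; exact zero_mem _
  | add x y _ _ hx hy => rw [add_mul]; exact add_mem hx hy
  | smul c x _ hx => rw [smul_mul_assoc]; exact Submodule.smul_mem _ _ hx

theorem tauFil_mul_klrE {d : ℕ} {v : List.Vector I d} {n : ℕ} {x : KLR K h d}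
    (hx : x ∈ tauFil K h v n) : x * klrE K h v = x := by
  induction hx using Submodule.span_induction with
  | mem x hx =>
    obtain ⟨u, g, hu, rfl⟩ := hx
    rw [mul_assoc, klrE_mul_self]
  | zero => rw [zero_mul]
  | add x y _ _ hx hy => rw [add_mul, hx, hy]
  | smul c x _ hx => rw [smul_mul_assoc, hx]

/-- Multiplication by a crossing adds one letter to the words. -/
theorem tauFil_mul_klrT {d : ℕ} {v : List.Vector I d} {n r : ℕ} {x : KLR K h d}
    (hx : x ∈ tauFil K h (swapVec r v) n) :
    x * klrT K h d r * klrE K h v ∈ tauFil K h v (n + 1) := by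
  induction hx using Submodule.span_induction with
  | mem x hx =>
    obtain ⟨u, g, hu, rfl⟩ := hx
    by_cases hr : r + 1 < d
    · obtain ⟨f', hf⟩ := exists_polX_mul_klrT (h := h) hr v g
      have : tauWord K h d u * polX h d g * klrE K h (swapVec r v) * klrT K h d r * klrE K h v =
          tauWord K h d (u ++ [r]) * polX h d (polSwap K r g) * klrE K h v +
            tauWord K h d u * polX h d f' * klrE K h v := by
        rw [mul_assoc _ (klrE K h (swapVec r v)), ← klrT_mul_klrE]
        simp only [mul_assoc, klrE_mul_self]
        rw [hf]
        simp only [tauWord_append, tauWord_cons, tauWord_nil, mul_one, mul_add, mul_assoc]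
      rw [this]
      exact add_mem (mem_tauFil _ _ (by simpa using hu)) (mem_tauFil _ _ (by omega))
    · rw [klrT_of_le h (by omega), mul_zero, zero_mul]
      exact zero_mem _
  | zero => rw [zero_mul, zero_mul]; exact zero_mem _
  | add x y _ _ hx hy => rw [add_mul, add_mul]; exact add_mem hx hy
  | smul c x _ hx => rw [smul_mul_assoc, smul_mul_assoc]; exact Submodule.smul_mem _ _ hx

theorem desc_iff {r : ℕ} {t : List ℕ} :
    Desc r t ↔ ∃ a b, t[r]? = some a ∧ t[r + 1]? = some b ∧ b < a := by
  constructor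
  · rintro ⟨m, a, b, n, rfl, rfl, hab⟩
    exact ⟨a, b, by simp, by simp, hab⟩
  · rintro ⟨a, b, ha, hb, hab⟩
    obtain ⟨hb', -⟩ := List.getElem?_eq_some_iff.mp hb
    obtain ⟨m, a', b', n, rfl, rfl⟩ := exists_split_pair t r hb'
    simp at ha hb
    subst ha hb
    exact ⟨m, a', b', n, rfl, rfl, hab⟩

theorem Desc.swapAt_of_far {r s : ℕ} {t : List ℕ} (hs : Desc s t) (hr : r + 1 < t.length)
    (hrs : r + 1 < s ∨ s + 1 < r) : Desc s (swapAt r t) := by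
  rw [desc_iff] at hs ⊢
  rw [getElem?_swapAt r t hr, getElem?_swapAt r t hr,
    Equiv.swap_apply_of_ne_of_ne (by omega) (by omega),
    Equiv.swap_apply_of_ne_of_ne (by omega) (by omega)]
  exact hs

/-- A comparison of two words persists when the same crossing is applied before both. -/
theorem tauWord_sub_mem_of_last {d n r : ℕ} {u u' : List ℕ} {v : List.Vector I d}
    (hu : (tauWord K h d u - tauWord K h d u') * klrE K h (swapVec r v) ∈
      tauFil K h (swapVec r v) n) :
    (tauWord K h d (u ++ [r]) - tauWord K h d (u' ++ [r])) * klrE K h v ∈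
      tauFil K h v (n + 1) := by
  have := tauFil_mul_klrT hu
  rw [mul_assoc _ (klrE K h (swapVec r v)), ← klrT_mul_klrE] at this
  simp only [mul_assoc, klrE_mul_self] at this
  simpa only [tauWord_append, tauWord_cons, tauWord_nil, mul_one, ← sub_mul, mul_assoc] using this

/-- Two reduced words of the same permutation give the same product of crossings, up to products
of fewer crossings. -/
theorem tauWord_sub_mem {d : ℕ} (n : ℕ) : ∀ {t u u' : List ℕ}, Sorts d u t → Sorts d u' t →
    invCount t = n → ∀ v : List.Vector I d,
    (tauWord K h d u - tauWord K h d u') * klrE K h v ∈ tauFil K h v n := by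
  induction n with
  | zero =>
    intro t u u' hu hu' hn v
    rw [List.length_eq_zero_iff.mp (hu.length_eq.trans hn),
      List.length_eq_zero_iff.mp (hu'.length_eq.trans hn), sub_self, zero_mul]
    exact zero_mem _
  | succ n ih =>
    -- reduced words with the same first crossing differ by lower terms
    have same : ∀ {r : ℕ} {t u u' : List ℕ}, Sorts d (u ++ [r]) t → Sorts d (u' ++ [r]) t →
        invCount t = n + 1 → ∀ v : List.Vector I d,
        (tauWord K h d (u ++ [r]) - tauWord K h d (u' ++ [r])) * klrE K h v ∈
          tauFil K h v (n + 1) := by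
      intro r t u u' hu hu' hn v
      have h1 := hu.of_append.1.inv_swapAt
      exact tauWord_sub_mem_of_last
        (ih hu.of_append.2 hu'.of_append.2 (by omega) (swapVec r v))
    -- words starting with different crossings are compared through a common continuation
    have key : ∀ {r s : ℕ} {t u u' : List ℕ}, r < s → Sorts d (u ++ [r]) t →
        Sorts d (u' ++ [s]) t → invCount t = n + 1 → ∀ v : List.Vector I d,
        (tauWord K h d (u ++ [r]) - tauWord K h d (u' ++ [s])) * klrE K h v ∈
          tauFil K h v (n + 1) := by
      intro r s t u u' hrs hu hu' hn v
      have ht := perm_range_length hu.perm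
      obtain ⟨hr, -⟩ := hu.of_append
      obtain ⟨hs, -⟩ := hu'.of_append
      have hsl := hs.lt
      have hrl := hr.lt
      -- it suffices to compare one reduced word ending in `r` with one ending in `s`
      suffices hw : ∃ w w', Sorts d (w ++ [r]) t ∧ Sorts d (w' ++ [s]) t ∧
          (tauWord K h d (w ++ [r]) - tauWord K h d (w' ++ [s])) * klrE K h v ∈
            tauFil K h v (n + 1) by
        obtain ⟨w, w', hw, hw', hww⟩ := hw
        have e1 := same hu hw hn v
        have e2 := same hw' hu' hn v
        have := add_mem (add_mem e1 hww) e2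
        rw [← add_mul, ← add_mul] at this
        convert this using 2
        abel
      -- distant crossings commute; for adjacent ones the braid relation has an error term, which
      -- is a product of fewer crossings
      rcases Nat.lt_or_ge (r + 1) s with hfar | hnear
      · have e : swapAt s (swapAt r t) = swapAt r (swapAt s t) := (swapAt_comm r s hfar t).symm
        obtain ⟨w, hw⟩ := exists_sorts
          (perm_range_swapAt (perm_range_swapAt hu.perm r) s)
        refine ⟨w ++ [s], w ++ [r], ?_, ?_, ?_⟩
        · exact Sorts.append_of_desc hr (hw.append_of_desc (hs.swapAt_of_far hrl (Or.inl hfar)))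
        · rw [e] at hw
          exact Sorts.append_of_desc hs (hw.append_of_desc (hr.swapAt_of_far hsl (Or.inr hfar)))
        · simp only [tauWord_append, tauWord_cons, tauWord_nil, mul_one, mul_assoc]
          rw [klrT_comm hfar, sub_self, zero_mul]
          exact zero_mem _
      · obtain rfl : s = r + 1 := by omega
        have e := swapAt_braid r t hsl
        obtain ⟨a, b, ha, hb, hab⟩ := desc_iff.mp hr
        obtain ⟨b', c, hb', hc, hbc⟩ := desc_iff.mp hs
        obtain rfl : b = b' := by rw [hb] at hb'; exact Option.some.inj hb'
        obtain ⟨w, hw⟩ := exists_sorts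
          (perm_range_swapAt (perm_range_swapAt (perm_range_swapAt hu.perm r) (r + 1)) r)
        have g := fun j => getElem?_swapAt r t hrl j
        have g' := fun j => getElem?_swapAt (r + 1) t hsl j
        have n1 : Equiv.swap r (r + 1) (r + 2) = r + 2 :=
          Equiv.swap_apply_of_ne_of_ne (by omega) (by omega)
        have n2 : Equiv.swap (r + 1) (r + 2) r = r :=
          Equiv.swap_apply_of_ne_of_ne (by omega) (by omega)
        -- the entries `a > b > c` at `r`, `r + 1`, `r + 2` are sorted in either order
        have d1 : Desc (r + 1) (swapAt r t) := desc_iff.mpr ⟨a, c, by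
          rw [g, Equiv.swap_apply_right, ha], by rw [g, n1, hc], by omega⟩
        have d2 : Desc r (swapAt (r + 1) (swapAt r t)) := desc_iff.mpr ⟨b, c, by
          rw [getElem?_swapAt _ _ (by rw [length_swapAt]; exact hsl), n2, g,
            Equiv.swap_apply_left, hb], by
          rw [getElem?_swapAt _ _ (by rw [length_swapAt]; exact hsl), Equiv.swap_apply_left, g,
            n1, hc], hbc⟩
        have d3 : Desc r (swapAt (r + 1) t) := desc_iff.mpr ⟨a, c, by
          rw [g', n2, ha], by rw [g', Equiv.swap_apply_left, hc], by omega⟩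
        have d4 : Desc (r + 1) (swapAt r (swapAt (r + 1) t)) := desc_iff.mpr ⟨a, b, by
          rw [getElem?_swapAt _ _ (by rw [length_swapAt]; exact hrl), Equiv.swap_apply_right, g',
            n2, ha], by
          rw [getElem?_swapAt _ _ (by rw [length_swapAt]; exact hrl), n1, g',
            Equiv.swap_apply_right, hb], hab⟩
        refine ⟨w ++ [r] ++ [r + 1], w ++ [r + 1] ++ [r], ?_, ?_, ?_⟩
        · exact Sorts.append_of_desc hr ((hw.append_of_desc d2).append_of_desc d1)
        · rw [e] at hw
          exact Sorts.append_of_desc hs ((hw.append_of_desc d4).append_of_desc d3)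
        · obtain ⟨f, hf⟩ := klrT_braid (h := h) (K := K) (d := d) (r := r) (by omega) v
          have hlen : w.length < n + 1 := by
            have h1 := hr.inv_swapAt
            have h2 := d1.inv_swapAt
            have h3 := d2.inv_swapAt
            rw [hw.length_eq]; omega
          have : (tauWord K h d (w ++ [r] ++ [r + 1] ++ [r]) -
              tauWord K h d (w ++ [r + 1] ++ [r] ++ [r + 1])) * klrE K h v =
              tauWord K h d w * polX h d (-f) * klrE K h v := by
            rw [map_neg, klr_mul_neg, klr_neg_mul, mul_assoc, ← hf]
            simp only [tauWord_append, tauWord_cons, tauWord_nil, mul_one, mul_assoc, sub_mul,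
              mul_sub, neg_sub]
          rw [this]
          exact mem_tauFil _ _ hlen
    intro t u u' hu hu' hn v
    rcases List.eq_nil_or_concat u with rfl | ⟨u, r, rfl⟩
    · have := hu.length_eq; simp at this; omega
    rcases List.eq_nil_or_concat u' with rfl | ⟨u', s, rfl⟩
    · have := hu'.length_eq; simp at this; omega
    rw [List.concat_eq_append] at hu hu' ⊢
    rw [List.concat_eq_append]
    rcases lt_trichotomy r s with hrs | rfl | hrs
    · exact key hrs hu hu' hn v
    · exact same hu hu' hn v
    · have := neg_mem (key hrs hu' hu hn v)
      rwa [← klr_neg_mul, neg_sub] at this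

/-- A product of crossings along a word which is not reduced is a combination of products of fewer
crossings. -/
theorem tauWord_mem_of_not_reduced {d : ℕ} (u : List ℕ) : ∀ {t : List ℕ},
    act u t = List.range d → invCount t < u.length → ∀ v : List.Vector I d,
    tauWord K h d u * klrE K h v ∈ tauFil K h v u.length := by
  induction u using List.reverseRecOn with
  | nil => intro t _ ht; simp at ht
  | append_singleton u r ih =>
    intro t hu ht v
    have hmul : ∀ x : KLR K h d, x * klrE K h (swapVec r v) * klrT K h d r * klrE K h v =
        x * klrT K h d r * klrE K h v := fun x => by
      rw [mul_assoc x, ← klrT_mul_klrE]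
      simp only [mul_assoc, klrE_mul_self]
    rw [act_append, act_cons, act_nil] at hu
    simp only [List.length_append, List.length_singleton] at ht ⊢
    have htr : t.Perm (List.range d) := by
      have := (act_perm u (swapAt r t)).symm
      rw [hu] at this
      exact (swapAt_perm r t).symm.trans this
    -- if `u` is reduced, it is compared with a reduced word ending in `r`, and then the quadratic
    -- relation removes two crossings
    by_cases hr : r + 1 < d
    · rcases Nat.lt_or_ge (invCount (swapAt r t)) u.length with hlt | hge
      · have := tauFil_mul_klrT (ih hu hlt (swapVec r v))
        rw [hmul] at this
        simpa using this
      · have hlen : u.length = invCount (swapAt r t) := le_antisymm hge (length_ge_of_act_eq_range hu)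
        rcases desc_or_desc r t (perm_range_nodup htr)
          (by rw [perm_range_length htr]; exact hr) with hd | hd
        · have := hd.inv_swapAt; omega
        · have hinv := hd.inv_swapAt
          rw [swapAt_swapAt] at hinv
          obtain ⟨w, hw⟩ := exists_sorts htr
          have hw' : Sorts d (w ++ [r]) (swapAt r t) :=
            Sorts.append_of_desc hd (by rwa [swapAt_swapAt])
          have := tauFil_mul_klrT
            (tauWord_sub_mem (h := h) (K := K) _ ⟨hu, hlen⟩ hw' rfl (swapVec r v))
          rw [hmul, ← hlen] at this
          obtain ⟨m, a, b, n, hv, hm⟩ := exists_split_pair v.1 r (by rw [v.2]; exact hr)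
          have h2 : tauWord K h d (w ++ [r]) * klrT K h d r * klrE K h v ∈
              tauFil K h v (u.length + 1) := by
            have e : tauWord K h d (w ++ [r]) * klrT K h d r * klrE K h v =
                tauWord K h d w * (klrT K h d r * klrT K h d r * klrE K h v) := by
              simp [mul_assoc]
            rw [e, klrT_sq hv hm, ← mul_assoc]
            refine mem_tauFil _ _ ?_
            rw [hw.length_eq]; omega
          have h3 := add_mem this h2
          rw [← add_mul, ← add_mul, sub_add_cancel] at h3
          simpa using h3
    · rw [tauWord_append, tauWord_cons, klrT_of_le h (by omega), zero_mul, mul_zero, zero_mul]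
      exact zero_mem _

/-- The products `τ_u f(x) e(w)`, for arbitrary words `u`, span the left ideal generated by
`e(w)`. -/
theorem mul_klrE_mem_iSup {d : ℕ} (a : KLR K h d) (w : List.Vector I d) :
    a * klrE K h w ∈ ⨆ n, tauFil K h w n := by
  have up : ∀ (w : List.Vector I d) {n x}, x ∈ tauFil K h w n → x ∈ ⨆ n, tauFil K h w n :=
    fun w n x hx => Submodule.mem_iSup_of_mem n hx
  have hmem : ∀ (w : List.Vector I d) {x}, x ∈ ⨆ n, tauFil K h w n → ∃ n, x ∈ tauFil K h w n :=
    fun w x hx => (Submodule.mem_iSup_of_directed _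
      (Monotone.directed_le fun m n hmn => tauFil_mono w hmn)).mp hx
  -- the union of the filtrations is stable under right multiplication by the generators
  have main : ∀ a : KLR K h d, ∀ v w : List.Vector I d, ∀ x ∈ ⨆ n, tauFil K h v n,
      x * a * klrE K h w ∈ ⨆ n, tauFil K h w n := by
    have hE : ∀ v w : List.Vector I d, ∀ x ∈ ⨆ n, tauFil K h v n,
        x * klrE K h w ∈ ⨆ n, tauFil K h w n := by
      intro v w x hx
      obtain ⟨n, hn⟩ := hmem v hx
      by_cases hvw : v = w
      · subst hvw; rwa [tauFil_mul_klrE hn]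
      · rw [← tauFil_mul_klrE hn, mul_assoc, klrE_mul_of_ne hvw, mul_zero]; exact zero_mem _
    refine klr_induction h ?_ ?_ ?_ ?_ ?_ ?_
    · intro c v w x hx
      rw [← Algebra.commutes, ← Algebra.smul_def, smul_mul_assoc]
      exact Submodule.smul_mem _ _ (hE v w x hx)
    · intro u v w x hx
      exact hE u w _ (hE v u x hx)
    · intro r _ v w x hx
      rw [mul_assoc, klrX_mul_klrE, ← mul_assoc]
      obtain ⟨n, hn⟩ := hmem w (hE v w x hx)
      have := tauFil_mul_polX hn (X r)
      rw [polX_X] at this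
      exact up w this
    · intro r _ v w x hx
      obtain ⟨n, hn⟩ := hmem _ (hE v (swapVec r w) x hx)
      have := tauFil_mul_klrT hn
      rw [mul_assoc x, ← klrT_mul_klrE] at this
      simp only [mul_assoc, klrE_mul_self] at this
      rw [mul_assoc]
      exact up w this
    · intro a b ha hb v w x hx
      rw [mul_add, add_mul]
      exact add_mem (ha v w x hx) (hb v w x hx)
    · intro a b ha hb v w x hx
      have : x * (a * b) * klrE K h w = ∑ u, x * a * klrE K h u * b * klrE K h w := by
        rw [← Finset.sum_mul, ← Finset.sum_mul, ← Finset.mul_sum, sum_klrE, mul_one]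
        simp only [mul_assoc]
      rw [this]
      exact Submodule.sum_mem _ fun u _ => hb u w _ (ha v u x hx)
  have : a * klrE K h w = ∑ v, klrE K h v * a * klrE K h w := by
    rw [← Finset.sum_mul, ← Finset.sum_mul, sum_klrE, one_mul]
  rw [this]
  refine Submodule.sum_mem _ fun v _ => main a v w _ (up v (n := 1) ?_)
  simpa using mem_tauFil (h := h) (K := K) (v := v) (n := 1) [] 1 (by simp)

/-- A subspace which contains, for every permutation, the elements `τ_u f(x) e(v)` for one reduced
word `u`, contains the left ideal generated by `e(v)`. -/
theorem klr_span_induction {d : ℕ} (U : Submodule K (KLR K h d)) (v : List.Vector I d)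
    (hU : ∀ t : List ℕ, t.Perm (List.range d) → ∃ u, Sorts d u t ∧
      ∀ f, tauWord K h d u * polX h d f * klrE K h v ∈ U) (a : KLR K h d) :
    a * klrE K h v ∈ U := by
  suffices hle : ∀ n, tauFil K h v n ≤ U from (iSup_le hle) (mul_klrE_mem_iSup a v)
  intro n
  induction n with
  | zero =>
    rw [tauFil, Submodule.span_le]
    rintro _ ⟨u, f, hu, rfl⟩
    simp at hu
  | succ n ih =>
    rw [tauFil, Submodule.span_le]
    rintro _ ⟨u, f, hu, rfl⟩
    have hact : act u (act u.reverse (List.range d)) = List.range d := by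
      simpa using act_reverse_act u.reverse (List.range d)
    -- the permutation sorted by `u`
    set t := act u.reverse (List.range d) with ht
    have hperm : t.Perm (List.range d) := act_perm _ _
    have comm : ∀ u : List ℕ, tauWord K h d u * polX h d f * klrE K h v =
        tauWord K h d u * klrE K h v * polX h d f := fun u => by
      rw [mul_assoc, polX_mul_klrE, mul_assoc]
    rcases (length_ge_of_act_eq_range hact).lt_or_eq with hlt | heq
    · rw [SetLike.mem_coe, comm]
      exact ih (tauFil_mono v (by omega)
        (tauFil_mul_polX (tauWord_mem_of_not_reduced u hact hlt v) f))
    · obtain ⟨u', hu', hf⟩ := hU t hperm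
      have := tauFil_mul_polX (tauWord_sub_mem (h := h) (K := K) _ ⟨hact, heq.symm⟩ hu' rfl v) f
      have := add_mem (ih (tauFil_mono v (by omega) this)) (hf f)
      rwa [sub_mul, sub_mul, ← comm, ← comm, sub_add_cancel] at this

end Spanning

/-! ### Linear independence of the crossing operators -/

section Independence

open MvPolynomial

variable {K : Type*} [Field K] {I : Type*} [DecidableEq I] (h : I → I → ℕ)

theorem Sorts.lt_of_mem {d : ℕ} {u t : List ℕ} (hu : Sorts d u t) : ∀ r ∈ u, r + 1 < d := by
  induction u using List.reverseRecOn generalizing t with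
  | nil => simp
  | append_singleton u s ih =>
    obtain ⟨hs, hu'⟩ := hu.of_append
    have := hs.lt
    rw [perm_range_length hu.perm] at this
    intro r hr
    rcases List.mem_append.mp hr with hr | hr
    · exact ih hu' r hr
    · rwa [List.mem_singleton.mp hr]

/-- The action of a word of crossings on polynomials, starting from the labels `l`. -/
noncomputable def wordPol (K : Type*) [Field K] (l : List I) : List ℕ → Pol K →ₗ[K] Pol K
  | [] => LinearMap.id
  | r :: u => crossPol h (act u l) r ∘ₗ wordPol K l u

theorem polRep_tauWord_polAt [Fintype I] {d : ℕ} (u : List ℕ) (v : List.Vector I d) (g : Pol K) :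
    polRep h d (tauWord K h d u) (polAt v g) = polAt (actVec u v) (wordPol h K v.1 u g) := by
  induction u with
  | nil => simp [wordPol]; rfl
  | cons r u ih =>
    rw [tauWord_cons, map_mul, Module.End.mul_apply, ih, polRep_klrT, opT_polAt]
    rfl

variable (K) in
/-- A permutation of the variables, as a homomorphism from polynomials to rational functions. -/
noncomputable def permHom (π : Equiv.Perm ℕ) : Pol K →* RatFun K :=
  ((algebraMap (Pol K) (RatFun K)).comp (rename π : Pol K →ₐ[K] Pol K).toRingHom).toMonoidHom

theorem permHom_apply (π : Equiv.Perm ℕ) (g : Pol K) :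
    permHom K π g = algebraMap (Pol K) (RatFun K) (rename π g) := rfl

theorem permHom_injective : Function.Injective (permHom K) := by
  intro π ρ hπ
  ext j
  have := congrArg (fun f : Pol K →* RatFun K => f (X j)) hπ
  simp only [permHom_apply, rename_X] at this
  exact X_injective (algebraMap_rat_injective this)

/-- The linear independence of characters, for the permutations of the variables. -/
theorem linearIndependent_permHom :
    LinearIndependent (RatFun K) fun π => (permHom K π : Pol K → RatFun K) :=
  (linearIndependent_monoidHom (Pol K) (RatFun K)).comp _ permHom_injective

theorem ratSwap_permHom (r : ℕ) (π : Equiv.Perm ℕ) (g : Pol K) :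
    ratSwap r (permHom K π g) = permHom K (Equiv.swap r (r + 1) * π) g := by
  rw [permHom_apply, permHom_apply, ratSwap_algebraMap, polSwap, rename_rename]
  rfl

/-- A crossing acts as a combination of the identity and of the exchange of two variables, the
coefficient of the latter being nonzero. -/
theorem exists_demazure_eq (a b : I) (r : ℕ) : ∃ A B : RatFun K, B ≠ 0 ∧ ∀ g : Pol K,
    algebraMap (Pol K) (RatFun K) (demazure h a b r g) =
      A * algebraMap (Pol K) (RatFun K) g + B * ratSwap r (algebraMap (Pol K) (RatFun K) g) := by
  have hne := ratX_sub_ne_zero (K := K) (i := r + 1) (j := r) (by omega)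
  by_cases hab : a = b
  · refine ⟨(ratX K (r + 1) - ratX K r)⁻¹, -(ratX K (r + 1) - ratX K r)⁻¹, by simpa using hne,
      fun g => ?_⟩
    rw [algebraMap_demazure, ratDem, if_pos hab]
    field_simp
    ring
  · refine ⟨0, (ratX K (r + 1) - ratX K r) ^ h b a, pow_ne_zero _ hne, fun g => ?_⟩
    rw [algebraMap_demazure, ratDem, if_neg hab, zero_mul, zero_add]

variable (K) in
/-- The span of the permutations of variables given by words with less than `n` letters in the
transpositions of `d` positions. -/
noncomputable def permFil (d n : ℕ) : Submodule (RatFun K) (Pol K → RatFun K) :=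
  Submodule.span (RatFun K) {F | ∃ u : List ℕ, (∀ r ∈ u, r + 1 < d) ∧ u.length < n ∧
    F = permHom K (wordPerm u)}

theorem permFil_mono (d : ℕ) {m n : ℕ} (hmn : m ≤ n) : permFil K d m ≤ permFil K d n :=
  Submodule.span_mono fun _ ⟨u, hu, hl, hF⟩ => ⟨u, hu, by omega, hF⟩

theorem ratSwap_mem_permFil {d n r : ℕ} (hr : r + 1 < d) {F : Pol K → RatFun K}
    (hF : F ∈ permFil K d n) : (fun g => ratSwap r (F g)) ∈ permFil K d (n + 1) := by
  induction hF using Submodule.span_induction with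
  | mem F hF =>
    obtain ⟨u, hu, hl, rfl⟩ := hF
    refine Submodule.subset_span ⟨r :: u, ?_, by simpa using hl, ?_⟩
    · intro s hs
      rcases List.mem_cons.mp hs with rfl | hs
      exacts [hr, hu s hs]
    · funext g
      rw [ratSwap_permHom, wordPerm_cons]
  | zero =>
    convert zero_mem (permFil K d (n + 1)) using 1
    funext g
    simp
  | add F G _ _ hF hG =>
    convert add_mem hF hG using 1
    funext g
    simp
  | smul c F _ hF =>
    convert Submodule.smul_mem _ (ratSwap r c) hF using 1
    funext g
    simp

/-- The leading term of a product of crossings is a nonzero multiple of the permutation of the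
variables given by the word. -/
theorem exists_wordPol_eq (l : List I) (u : List ℕ) (hu : ∀ r ∈ u, r + 1 < l.length) :
    ∃ p : RatFun K, p ≠ 0 ∧ ∃ F ∈ permFil K l.length u.length, ∀ g : Pol K,
      algebraMap (Pol K) (RatFun K) (wordPol h K l u g) = p * permHom K (wordPerm u) g + F g := by
  induction u with
  | nil =>
    refine ⟨1, one_ne_zero, 0, zero_mem _, fun g => ?_⟩
    simp [wordPol, permHom_apply]
  | cons r u ih =>
    obtain ⟨p, hp, F, hF, hg⟩ := ih fun s hs => hu s (by simp [hs])
    have hr : r + 1 < l.length := hu r (by simp)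
    obtain ⟨m, a, b, n, hl, hm⟩ := exists_split_pair (act u l) r (by rw [length_act]; exact hr)
    obtain ⟨A, B, hB, hAB⟩ := exists_demazure_eq (K := K) h a b r
    refine ⟨B * ratSwap r p, mul_ne_zero hB (by simpa using hp),
      (A * p) • (permHom K (wordPerm u) : Pol K → RatFun K) + A • F +
        B • (fun g => ratSwap r (F g)), ?_, fun g => ?_⟩
    · refine add_mem (add_mem (Submodule.smul_mem _ _ (Submodule.subset_span
        ⟨u, fun s hs => hu s (by simp [hs]), by simp, rfl⟩)) ?_) ?_
      · exact Submodule.smul_mem _ _ (permFil_mono _ (by simp) hF)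
      · exact Submodule.smul_mem _ _ (ratSwap_mem_permFil hr hF)
    · rw [wordPol, LinearMap.comp_apply, crossPol_split h hl hm, hAB, hg, map_add, map_mul,
        ratSwap_permHom, wordPerm_cons]
      simp only [Pi.add_apply, Pi.smul_apply, smul_eq_mul]
      ring

/-- The operators `g ↦ τ_{W t} (f_t g)`, for a choice of a reduced word `W t` of each permutation
`t`, are linearly independent over the polynomials `f_t`. -/
theorem wordPol_independent {d : ℕ} (l : List I) (hl : l.length = d) (W : List ℕ → List ℕ)
    (T : Finset (List ℕ)) (hW : ∀ t ∈ T, Sorts d (W t) t) (f : List ℕ → Pol K)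
    (h0 : ∀ g, ∑ t ∈ T, wordPol h K l (W t) (f t * g) = 0) : ∀ t ∈ T, f t = 0 := by
  classical
  subst hl
  by_contra! hne
  -- the term of a permutation of maximal length cannot be cancelled by the other ones
  obtain ⟨t₀, ht₀, hmax⟩ := Finset.exists_max_image (T.filter fun t => f t ≠ 0) invCount
    (by obtain ⟨t, ht, hft⟩ := hne; exact ⟨t, by simp [ht, hft]⟩)
  obtain ⟨hT₀, hf₀⟩ := Finset.mem_filter.mp ht₀
  have hs₀ := hW t₀ hT₀
  have hlen := perm_range_length hs₀.perm
  set S : Submodule (RatFun K) (Pol K → RatFun K) := Submodule.span (RatFun K)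
    ((fun π => (permHom K π : Pol K → RatFun K)) '' {π | π ≠ wordPerm (W t₀)}) with hS
  have memS : ∀ π, π ≠ wordPerm (W t₀) → (permHom K π : Pol K → RatFun K) ∈ S :=
    fun π hπ => Submodule.subset_span ⟨π, hπ, rfl⟩
  have hnot : (permHom K (wordPerm (W t₀)) : Pol K → RatFun K) ∉ S :=
    linearIndependent_permHom.notMem_span_image (by simp)
  -- permutations given by words shorter than a reduced word of `t₀` differ from `t₀`
  have low : ∀ n ≤ invCount t₀, ∀ F ∈ permFil K l.length n, ∀ q : Pol K,
      (fun g => F (q * g)) ∈ S := by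
    intro n hn F hF q
    induction hF using Submodule.span_induction with
    | mem F hF =>
      obtain ⟨u, hu, hul, rfl⟩ := hF
      have : (fun g => permHom K (wordPerm u) (q * g)) =
          permHom K (wordPerm u) q • (permHom K (wordPerm u) : Pol K → RatFun K) := by
        funext g; simp
      rw [this]
      refine Submodule.smul_mem _ _ (memS _ fun e => ?_)
      have := act_eq_of_wordPerm u (W t₀) t₀ (by rwa [hlen])
        (by rw [hlen]; exact hs₀.lt_of_mem) e
      rw [hs₀.act_eq] at this
      have := length_ge_of_act_eq_range this
      omega
    | zero => exact zero_mem S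
    | add F G _ _ hF hG => exact add_mem hF hG
    | smul c F _ hF => exact Submodule.smul_mem _ c hF
  have lead : ∀ t ∈ T, f t ≠ 0 → ∃ p : RatFun K, p ≠ 0 ∧ ∃ F ∈ S,
      (fun g => algebraMap (Pol K) (RatFun K) (wordPol h K l (W t) (f t * g))) =
        p • (permHom K (wordPerm (W t)) : Pol K → RatFun K) + F := by
    intro t ht hft
    obtain ⟨p, hp, F, hF, hg⟩ := exists_wordPol_eq (K := K) h l (W t) (hW t ht).lt_of_mem
    refine ⟨p * permHom K (wordPerm (W t)) (f t), mul_ne_zero hp ?_, _,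
      low _ ?_ F hF (f t), ?_⟩
    · rw [permHom_apply]
      exact (map_ne_zero_iff _ algebraMap_rat_injective).mpr
        ((map_ne_zero_iff _ (rename_injective _ (wordPerm (W t)).injective)).mpr hft)
    · rw [(hW t ht).length_eq]
      exact hmax t (by simp [ht, hft])
    · funext g
      simp [hg, mul_assoc]
  obtain ⟨p, hp, F, hF, e⟩ := lead t₀ hT₀ hf₀
  -- leading terms of different permutations are different characters
  have others : ∀ t ∈ T.erase t₀,
      (fun g => algebraMap (Pol K) (RatFun K) (wordPol h K l (W t) (f t * g))) ∈ S := by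
    intro t ht
    obtain ⟨hne, ht⟩ := Finset.mem_erase.mp ht
    by_cases hft : f t = 0
    · simp only [hft, zero_mul, map_zero]; exact zero_mem S
    · obtain ⟨p, -, F, hF, e⟩ := lead t ht hft
      rw [e]
      refine add_mem (Submodule.smul_mem _ _ (memS _ fun e => hne ?_)) hF
      have hs := hW t ht
      have := act_eq_of_wordPerm (W t) (W t₀) t₀ (by rw [hlen]; exact hs.lt_of_mem)
        (by rw [hlen]; exact hs₀.lt_of_mem) e
      rw [hs₀.act_eq, ← hs.act_eq] at this
      exact (act_injective _ this).symm
  have hsum := Submodule.sum_mem S others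
  have htot : (fun g => algebraMap (Pol K) (RatFun K) (wordPol h K l (W t₀) (f t₀ * g))) =
      -∑ t ∈ T.erase t₀,
        fun g => algebraMap (Pol K) (RatFun K) (wordPol h K l (W t) (f t * g)) := by
    rw [eq_neg_iff_add_eq_zero, Finset.add_sum_erase T (fun t => fun g =>
      algebraMap (Pol K) (RatFun K) (wordPol h K l (W t) (f t * g))) hT₀]
    funext g
    rw [Finset.sum_apply, ← map_sum, h0, map_zero]; rfl
  rw [e] at htot
  have hmem : p • (permHom K (wordPerm (W t₀)) : Pol K → RatFun K) ∈ S := by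
    rw [← eq_sub_iff_add_eq] at htot
    rw [htot]
    exact sub_mem (neg_mem hsum) hF
  exact hnot ((Submodule.smul_mem_iff S hp).mp hmem)

end Independence

/-! ### Doubling a vertex of the cyclic quiver -/

section Vertices

variable {e k : ℕ} [NeZero e]

theorem natCast_inj_of_le {a b : ℕ} (ha : a ≤ e) (hb : b ≤ e)
    (hab : (a : ZMod (e + 1)) = b) : a = b := by
  have := congrArg ZMod.val hab
  rwa [ZMod.val_natCast_of_lt (by omega), ZMod.val_natCast_of_lt (by omega)] at this

theorem up_eq_natCast (i : ZMod e) :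
    ∃ a ≤ e, up k i = (a : ZMod (e + 1)) ∧ a ≠ k + 1 ∧ (a = k ↔ i.val = k) ∧
      (a ≤ k → a = i.val) ∧ (k < a → a = i.val + 1) := by
  have := ZMod.val_lt i
  by_cases h : i.val ≤ k
  · exact ⟨i.val, by omega, by rw [up, if_pos h], by omega, by omega, by omega, by omega⟩
  · exact ⟨i.val + 1, by omega, by rw [up, if_neg h]; push_cast; rfl, by omega, by omega, by omega,
      by omega⟩

theorem up_injective : Function.Injective (up k : ZMod e → ZMod (e + 1)) := by
  intro i j hij
  obtain ⟨a, ha, ea, a1, a2, a3, a4⟩ := up_eq_natCast (k := k) i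
  obtain ⟨b, hb, eb, b1, b2, b3, b4⟩ := up_eq_natCast (k := k) j
  have := natCast_inj_of_le ha hb (by rw [← ea, ← eb, hij])
  apply ZMod.val_injective e
  rcases Nat.lt_or_ge k a with h | h
  · have := a4 h; have := b4 (by omega); omega
  · have := a3 h; have := b3 (by omega); omega

variable (hk : k < e)
include hk

theorem up_ne_succ (i : ZMod e) : up k i ≠ (k : ZMod (e + 1)) + 1 := by
  obtain ⟨a, ha, ea, a1, -⟩ := up_eq_natCast (k := k) i
  rw [ea]
  intro h
  exact a1 (natCast_inj_of_le ha (by omega) (by push_cast; exact h))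

theorem up_self : up k (k : ZMod e) = (k : ZMod (e + 1)) := by
  rw [up, ZMod.val_natCast_of_lt hk, if_pos le_rfl]

theorem succ_ne_self : (k : ZMod (e + 1)) + 1 ≠ k := fun h =>
  up_ne_succ hk (k : ZMod e) ((up_self hk).trans h.symm)

theorem up_ne_of_ne {i : ZMod e} (hi : i ≠ k) : up k i ≠ (k : ZMod (e + 1)) := fun h =>
  hi (up_injective (h.trans (up_self hk).symm))

theorem up_succ {i : ZMod e} (hi : i ≠ k) : up k (i + 1) = up k i + 1 := by
  have hlt := ZMod.val_lt i
  have hik : i.val ≠ k := fun h => hi (by rw [← h, ZMod.natCast_zmod_val])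
  by_cases hlast : i.val + 1 = e
  · have h0 : i + 1 = 0 := by
      rw [← ZMod.natCast_zmod_val i, ← Nat.cast_succ, Nat.succ_eq_add_one, hlast,
        ZMod.natCast_self]
    rw [h0, up, up, ZMod.val_zero, if_pos (Nat.zero_le _), if_neg (by omega)]
    have h2 : ((i.val + 1 + 1 : ℕ) : ZMod (e + 1)) = ((e + 1 : ℕ) : ZMod (e + 1)) :=
      congrArg _ (by omega)
    rw [ZMod.natCast_self] at h2
    push_cast at h2
    rw [h2, Nat.cast_zero]
  · have hv : (i + 1).val = i.val + 1 := by
      rw [← ZMod.val_natCast_of_lt (n := e) (a := i.val + 1) (by omega), Nat.cast_succ,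
        ZMod.natCast_zmod_val]
    rw [up, up, hv]
    split_ifs <;> first | omega | push_cast; ring

theorem up_succ_self : up k ((k : ZMod e) + 1) = (k : ZMod (e + 1)) + 1 + 1 := by
  by_cases hlast : k + 1 = e
  · have h0 : (k : ZMod e) + 1 = 0 := by
      rw [← Nat.cast_succ, Nat.succ_eq_add_one, hlast, ZMod.natCast_self]
    rw [h0, up, ZMod.val_zero, if_pos (Nat.zero_le _)]
    have : ((k : ZMod (e + 1)) + 1 + 1) = ((e + 1 : ℕ) : ZMod (e + 1)) := by
      rw [← hlast]; push_cast; ring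
    rw [this, ZMod.natCast_self, Nat.cast_zero]
  · have hv : ((k : ZMod e) + 1).val = k + 1 := by
      rw [← Nat.cast_succ, ZMod.val_natCast_of_lt (by omega)]
    rw [up, hv, if_neg (by omega)]
    push_cast; ring

theorem exists_up_eq {j : ZMod (e + 1)} (hj : j ≠ (k : ZMod (e + 1)) + 1) :
    ∃ i : ZMod e, up k i = j := by
  have hlt := ZMod.val_lt j
  have hjv : (j.val : ZMod (e + 1)) = j := ZMod.natCast_zmod_val j
  rcases Nat.lt_or_ge k j.val with h | h
  · have hne : j.val ≠ k + 1 := fun h => hj (by rw [← hjv, h]; push_cast; rfl)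
    refine ⟨((j.val - 1 : ℕ) : ZMod e), ?_⟩
    rw [up, ZMod.val_natCast_of_lt (by omega), if_neg (by omega), ← Nat.cast_succ,
      Nat.succ_eq_add_one, Nat.sub_add_cancel (by omega), hjv]
  · refine ⟨(j.val : ZMod e), ?_⟩
    rw [up, ZMod.val_natCast_of_lt (by omega), if_pos h, hjv]

omit hk in
theorem phiVertex_self : phiVertex k (k : ZMod e) =
    [(k : ZMod (e + 1)), (k : ZMod (e + 1)) + 1] := if_pos rfl

omit hk in
theorem phiVertex_of_ne {i : ZMod e} (hi : i ≠ k) : phiVertex k i = [up k i] := if_neg hi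

omit hk in
theorem length_phiVertex (i : ZMod e) :
    (phiVertex k i).length = if i = (k : ZMod e) then 2 else 1 := by
  unfold phiVertex; split_ifs <;> rfl

theorem count_phiVertex (i j : ZMod e) :
    (phiVertex k i).count (up k j) = if i = j then 1 else 0 := by
  by_cases hi : i = k
  · subst hi
    rw [phiVertex_self, List.count_cons, List.count_singleton, ← up_self hk]
    have : ¬ up k (k : ZMod e) + 1 = up k j := by
      rw [up_self hk]; exact (up_ne_succ hk j).symm
    simp [this, up_injective.eq_iff]
  · rw [phiVertex_of_ne hi, List.count_singleton]
    simp [up_injective.eq_iff]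

theorem count_phiVertex_succ (i : ZMod e) :
    (phiVertex k i).count ((k : ZMod (e + 1)) + 1) = if i = k then 1 else 0 := by
  by_cases hi : i = k
  · subst hi
    rw [phiVertex_self, List.count_cons, List.count_singleton]
    have := (succ_ne_self hk).symm
    simp [this]
  · rw [phiVertex_of_ne hi, List.count_singleton]
    simp [hi, up_ne_succ hk i]

theorem count_phi_up (l : List (ZMod e)) (i : ZMod e) : (phi k l).count (up k i) = l.count i := by
  rw [count_phi]
  simp [count_phiVertex hk]

theorem count_phi_succ (l : List (ZMod e)) :
    (phi k l).count ((k : ZMod (e + 1)) + 1) = l.count (k : ZMod e) := by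
  rw [count_phi]
  simp [count_phiVertex_succ hk]

theorem phiDim_up (α : ZMod e → ℕ) (i : ZMod e) : phiDim k α (up k i) = α i := by
  simp [phiDim, count_phiVertex hk]

theorem phiDim_succ (α : ZMod e → ℕ) : phiDim k α ((k : ZMod (e + 1)) + 1) = α k := by
  simp [phiDim, count_phiVertex_succ hk]

omit hk [NeZero e] in
theorem phi_append (l l' : List (ZMod e)) : phi k (l ++ l') = phi k l ++ phi k l' := by
  induction l with
  | nil => rfl
  | cons a l ih => simp [phi, ih]

omit hk [NeZero e] in
theorem phi_eq_flatMap (l : List (ZMod e)) : phi k l = l.flatMap (phiVertex k) := by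
  induction l with
  | nil => rfl
  | cons a l ih => simp [phi, ih]

omit hk in
theorem wellOrdered_cons {c : ZMod (e + 1)} {l : List (ZMod (e + 1))} :
    WellOrdered k (c :: l) ↔
      (c = (k : ZMod (e + 1)) → l[0]? = some ((k : ZMod (e + 1)) + 1)) ∧ WellOrdered k l := by
  constructor
  · intro h
    exact ⟨fun hc => by simpa using h 0 (by simp [hc]), fun a ha => by simpa using h (a + 1) ha⟩
  · rintro ⟨h0, h⟩ a ha
    rcases a with _ | a
    · simpa using h0 (by simpa using ha)
    · simpa using h a (by simpa using ha)

theorem wellOrdered_phi (l : List (ZMod e)) : WellOrdered k (phi k l) := by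
  induction l with
  | nil => intro a ha; simp [phi] at ha
  | cons i l ih =>
    by_cases hi : i = k
    · subst hi
      simp only [phi, phiVertex_self, List.cons_append, List.nil_append, wellOrdered_cons]
      exact ⟨fun _ => by simp, fun h => absurd h (succ_ne_self hk), ih⟩
    · simp only [phi, phiVertex_of_ne hi, List.cons_append, List.nil_append, wellOrdered_cons]
      exact ⟨fun h => absurd h (up_ne_of_ne hk hi), ih⟩

/-- In a well-ordered sequence each entry `k` is followed by its own entry `k + 1`; the remaining
entries `k + 1` are isolated, and there are none exactly if the sequence is doubled. -/
theorem wellOrdered_count_le (n : ℕ) : ∀ l : List (ZMod (e + 1)), l.length ≤ n →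
    WellOrdered k l → l.count (k : ZMod (e + 1)) ≤ l.count ((k : ZMod (e + 1)) + 1) ∧
    (l.count (k : ZMod (e + 1)) = l.count ((k : ZMod (e + 1)) + 1) → ∃ l', phi k l' = l) := by
  induction n with
  | zero =>
    intro l hl _
    obtain rfl := List.length_eq_zero_iff.mp (Nat.le_zero.mp hl)
    exact ⟨le_rfl, fun _ => ⟨[], rfl⟩⟩
  | succ n ih =>
    intro l hl hw
    rcases l with _ | ⟨c, l⟩
    · exact ⟨le_rfl, fun _ => ⟨[], rfl⟩⟩
    have hne := succ_ne_self hk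
    rw [wellOrdered_cons] at hw
    simp only [List.length_cons] at hl
    by_cases hc : c = k
    · subst hc
      have := hw.1 rfl
      rcases l with _ | ⟨c', l⟩
      · simp at this
      obtain rfl : c' = _ := by simpa using this
      simp only [List.length_cons] at hl
      obtain ⟨h1, h2⟩ := ih l (by omega) (wellOrdered_cons.mp hw.2).2
      simp only [List.count_cons, hne, hne.symm, beq_iff_eq, if_true, if_false, add_zero]
      refine ⟨by omega, fun h => ?_⟩
      obtain ⟨l', rfl⟩ := h2 (by omega)
      exact ⟨k :: l', by simp [phi, phiVertex_self]⟩
    · obtain ⟨h1, h2⟩ := ih l (by omega) hw.2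
      simp only [List.count_cons, beq_iff_eq, hc, if_false, add_zero]
      refine ⟨by omega, fun h => ?_⟩
      by_cases hc' : c = (k : ZMod (e + 1)) + 1
      · rw [if_pos hc'] at h; omega
      · rw [if_neg hc'] at h
        obtain ⟨l', rfl⟩ := h2 (by omega)
        obtain ⟨i, rfl⟩ := exists_up_eq hk hc'
        have hi : i ≠ k := fun h => hc (by rw [h, up_self hk])
        exact ⟨i :: l', by simp [phi, phiVertex_of_ne hi]⟩

/-- The well-ordered sequences of dimension vector `φ(α)` are the sequences `φ(i)` with
`i ∈ I^α`. -/
theorem exists_phi_eq {α : ZMod e → ℕ} {l : List (ZMod (e + 1))} (hw : WellOrdered k l)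
    (hl : ∀ j, l.count j = phiDim k α j) : ∃ l', phi k l' = l ∧ ∀ i, l'.count i = α i := by
  have h1 : l.count (k : ZMod (e + 1)) = l.count ((k : ZMod (e + 1)) + 1) := by
    rw [hl, hl, phiDim_succ hk, ← up_self hk, phiDim_up hk]
  obtain ⟨l', rfl⟩ := (wellOrdered_count_le hk _ l le_rfl hw).2 h1
  exact ⟨l', rfl, fun i => by rw [← count_phi_up hk, hl, phiDim_up hk]⟩

theorem exists_phiVertex_eq_cons (i : ZMod e) : ∃ m, phiVertex k i = up k i :: m := by
  by_cases hi : i = k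
  · exact ⟨_, by rw [hi, phiVertex_self, up_self hk]⟩
  · exact ⟨_, phiVertex_of_ne hi⟩

theorem phi_injective : Function.Injective (phi k : List (ZMod e) → List (ZMod (e + 1))) := by
  intro l
  induction l with
  | nil =>
    intro l' h
    rcases l' with _ | ⟨b, l'⟩
    · rfl
    · obtain ⟨m, hm⟩ := exists_phiVertex_eq_cons hk b
      simp [phi, hm] at h
  | cons a l ih =>
    intro l' h
    obtain ⟨m, hm⟩ := exists_phiVertex_eq_cons hk a
    rcases l' with _ | ⟨b, l'⟩
    · simp [phi, hm] at h
    · obtain ⟨m', hm'⟩ := exists_phiVertex_eq_cons hk b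
      have h' : phiVertex k a ++ phi k l = phiVertex k b ++ phi k l' := h
      have hab : a = b := by
        rw [hm, hm'] at h'
        exact up_injective (List.cons.inj h').1
      subst hab
      rw [ih (List.append_cancel_left h')]

variable (he : 1 < e)
include he

omit hk in
theorem succ_succ_ne : (k : ZMod (e + 1)) + 1 + 1 ≠ k := by
  intro h
  rw [add_assoc, add_eq_left] at h
  have h2 : ((2 : ℕ) : ZMod (e + 1)) = (0 : ℕ) := by push_cast; rw [← h]; norm_num
  have := natCast_inj_of_le (by omega) (by omega) h2
  omega

omit he in
theorem cyc_up_up {i j : ZMod e} (hi : i ≠ k) :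
    cyc (e + 1) (up k i) (up k j) = cyc e i j := by
  unfold cyc
  simp only [← up_succ hk hi, up_injective.eq_iff]

omit he in
theorem cyc_succ_up (j : ZMod e) : cyc (e + 1) ((k : ZMod (e + 1)) + 1) (up k j) = cyc e k j := by
  unfold cyc
  simp only [← up_succ_self hk, up_injective.eq_iff]

omit he in
theorem cyc_self_up (j : ZMod e) : cyc (e + 1) (k : ZMod (e + 1)) (up k j) = 0 :=
  if_neg (up_ne_succ hk j)

omit he in
theorem cyc_up_succ {i : ZMod e} (hi : i ≠ k) :
    cyc (e + 1) (up k i) ((k : ZMod (e + 1)) + 1) = 0 := by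
  unfold cyc
  rw [if_neg]
  intro h
  exact up_ne_of_ne hk hi (add_right_cancel h).symm

omit he hk in
theorem cyc_self_succ : cyc (e + 1) (k : ZMod (e + 1)) ((k : ZMod (e + 1)) + 1) = 1 := if_pos rfl

omit hk in
theorem cyc_succ_self : cyc (e + 1) ((k : ZMod (e + 1)) + 1) (k : ZMod (e + 1)) = 0 :=
  if_neg (succ_succ_ne he).symm

end Vertices

/-! ### Words for crossings of doubled strands -/

section ThickWords

variable {e : ℕ} (k : ℕ)

/-- The word which replaces the crossing of two adjacent strands with labels `i` and `j`, doubled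
if the label is `k`, when the first of them starts at the position `p`. -/
def starWord (p : ℕ) (i j : ZMod e) : List ℕ :=
  if i = (k : ZMod e) then
    if j = (k : ZMod e) then [p + 1, p + 2, p, p + 1] else [p, p + 1]
  else if j = (k : ZMod e) then [p + 1, p] else [p]

/-- The word which replaces the crossing at the position `r` in the sequence `l`. -/
def stepWord (l : List (ZMod e)) (r : ℕ) : List ℕ :=
  if hr : r + 1 < l.length then starWord k (shiftPos k l r) l[r] l[r + 1] else []

/-- The word which replaces a word of crossings, starting from the sequence `l`. -/
def thickWord (l : List (ZMod e)) : List ℕ → List ℕ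
  | [] => []
  | r :: u => stepWord k (act u l) r ++ thickWord l u

theorem shiftPos_append (m n : List (ZMod e)) :
    shiftPos k (m ++ n) m.length = (phi k m).length := by
  simp [shiftPos]

theorem stepWord_append (m : List (ZMod e)) (a b : ZMod e) (n : List (ZMod e)) :
    stepWord k (m ++ a :: b :: n) m.length = starWord k (phi k m).length a b := by
  rw [stepWord, dif_pos (by simp), shiftPos_append]
  simp

variable {β γ : Type*} {k}

theorem length_flatMap_eq {lab : β → ZMod e} {G : β → List γ}
    (hG : ∀ x, (G x).length = if lab x = (k : ZMod e) then 2 else 1) (m : List β) :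
    (m.flatMap G).length = (phi k (m.map lab)).length := by
  induction m with
  | nil => rfl
  | cons x m ih =>
    simp only [List.flatMap_cons, List.length_append, ih, List.map_cons, phi, hG]
    unfold phiVertex
    split_ifs <;> simp

/-- Doubled strands cross as blocks. -/
theorem act_starWord {i j : ZMod e} (M A B N : List γ)
    (hA : A.length = if i = (k : ZMod e) then 2 else 1)
    (hB : B.length = if j = (k : ZMod e) then 2 else 1) :
    act (starWord k M.length i j) (M ++ (A ++ (B ++ N))) = M ++ (B ++ (A ++ N)) := by
  have s0 := fun l : List γ => swapAt_append M 0 l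
  have s1 := fun l : List γ => swapAt_append M 1 l
  have s2 := fun l : List γ => swapAt_append M 2 l
  simp only [add_zero] at s0
  unfold starWord
  split_ifs at hA hB ⊢
  · obtain ⟨a, a', rfl⟩ := List.length_eq_two.mp hA
    obtain ⟨b, b', rfl⟩ := List.length_eq_two.mp hB
    simp [s0, s1, s2, swapAt]
  · obtain ⟨a, a', rfl⟩ := List.length_eq_two.mp hA
    obtain ⟨b, rfl⟩ := List.length_eq_one_iff.mp hB
    simp [s0, s1, swapAt]
  · obtain ⟨a, rfl⟩ := List.length_eq_one_iff.mp hA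
    obtain ⟨b, b', rfl⟩ := List.length_eq_two.mp hB
    simp [s0, s1, swapAt]
  · obtain ⟨a, rfl⟩ := List.length_eq_one_iff.mp hA
    obtain ⟨b, rfl⟩ := List.length_eq_one_iff.mp hB
    simp [s0, swapAt]

theorem act_stepWord_flatMap {lab : β → ZMod e} {G : β → List γ}
    (hG : ∀ x, (G x).length = if lab x = (k : ZMod e) then 2 else 1) (z : List β) (r : ℕ) :
    act (stepWord k (z.map lab) r) (z.flatMap G) = (swapAt r z).flatMap G := by
  by_cases hr : r + 1 < z.length
  · obtain ⟨m, x, y, n, rfl, rfl⟩ := exists_split_pair z r hr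
    rw [swapAt_append_pair]
    have := stepWord_append k (m.map lab) (lab x) (lab y) (n.map lab)
    simp only [List.length_map] at this
    simp only [List.map_append, List.map_cons, List.flatMap_append, List.flatMap_cons]
    rw [this, ← length_flatMap_eq hG]
    exact act_starWord _ _ _ _ (hG x) (hG y)
  · rw [stepWord, dif_neg (by simpa using hr), swapAt_of_le r z (by omega)]
    rfl

theorem act_thickWord_flatMap {lab : β → ZMod e} {G : β → List γ}
    (hG : ∀ x, (G x).length = if lab x = (k : ZMod e) then 2 else 1) (z : List β) (u : List ℕ) :
    act (thickWord k (z.map lab) u) (z.flatMap G) = (act u z).flatMap G := by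
  induction u with
  | nil => rfl
  | cons r u ih =>
    rw [thickWord, act_append, ih, ← map_act, act_stepWord_flatMap hG, act_cons]

theorem act_thickWord_phi [NeZero e] (l : List (ZMod e)) (u : List ℕ) :
    act (thickWord k l u) (phi k l) = phi k (act u l) := by
  have := act_thickWord_flatMap (k := k) (lab := id) (G := phiVertex k) length_phiVertex l u
  rwa [List.map_id, ← phi_eq_flatMap, ← phi_eq_flatMap] at this

variable (k) in
/-- The final positions of a strand: a strand with label `k` is doubled. -/
def thickBlock (x : ZMod e × ℕ) : List ℕ := if x.1 = (k : ZMod e) then [x.2, x.2 + 1] else [x.2]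

variable (k) in
/-- The final positions of the strands of the doubled diagram. -/
def thickPos (z : List (ZMod e × ℕ)) : List ℕ := z.flatMap (thickBlock k)

theorem length_thickBlock (x : ZMod e × ℕ) :
    (thickBlock k x).length = if x.1 = (k : ZMod e) then 2 else 1 := by
  unfold thickBlock; split_ifs <;> rfl

variable (k) in
/-- The blocks of positions of doubled strands do not overlap. -/
def Separated (z : List (ZMod e × ℕ)) : Prop :=
  ∀ x ∈ z, ∀ y ∈ z, x.2 < y.2 → ∀ a ∈ thickBlock k x, a < y.2

theorem le_of_mem_thickBlock {x : ZMod e × ℕ} {a : ℕ} (ha : a ∈ thickBlock k x) : x.2 ≤ a := by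
  unfold thickBlock at ha
  split_ifs at ha <;> simp at ha <;> omega

/-- The length of the word which replaces a crossing is the number of inversions between the two
blocks. -/
theorem invCount_starWord {x y : ZMod e × ℕ} (M N : List ℕ) (hyx : y.2 < x.2)
    (hs : ∀ a ∈ thickBlock k y, a < x.2) (p : ℕ) :
    invCount (M ++ (thickBlock k x ++ (thickBlock k y ++ N))) =
      invCount (M ++ (thickBlock k y ++ (thickBlock k x ++ N))) +
        (starWord k p x.1 y.1).length := by
  unfold thickBlock starWord at *
  split_ifs at hs ⊢
  · simp at hs
    have e1 := invCount_pair (M ++ [x.2]) (x.2 + 1) y.2 ((y.2 + 1) :: N) (by omega)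
    have e2 := invCount_pair M x.2 y.2 ((x.2 + 1) :: (y.2 + 1) :: N) (by omega)
    have e3 := invCount_pair (M ++ [y.2, x.2]) (x.2 + 1) (y.2 + 1) N (by omega)
    have e4 := invCount_pair (M ++ [y.2]) x.2 (y.2 + 1) ((x.2 + 1) :: N) (by omega)
    simp only [List.append_assoc, List.cons_append, List.nil_append, List.length_cons,
      List.length_nil] at *
    omega
  · have e1 := invCount_pair (M ++ [x.2]) (x.2 + 1) y.2 N (by omega)
    have e2 := invCount_pair M x.2 y.2 ((x.2 + 1) :: N) (by omega)
    simp only [List.append_assoc, List.cons_append, List.nil_append, List.length_cons,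
      List.length_nil] at *
    omega
  · simp at hs
    have e1 := invCount_pair M x.2 y.2 ((y.2 + 1) :: N) (by omega)
    have e2 := invCount_pair (M ++ [y.2]) x.2 (y.2 + 1) N (by omega)
    simp only [List.append_assoc, List.cons_append, List.nil_append, List.length_cons,
      List.length_nil] at *
    omega
  · have e1 := invCount_pair M x.2 y.2 N (by omega)
    simp only [List.cons_append, List.nil_append, List.length_cons,
      List.length_nil] at *
    omega

theorem Separated.of_perm {z z' : List (ZMod e × ℕ)} (h : Separated k z) (hp : z'.Perm z) :
    Separated k z' :=
  fun x hx y hy => h x (hp.mem_iff.mp hx) y (hp.mem_iff.mp hy)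

theorem invCount_stepWord {z : List (ZMod e × ℕ)} (hz : Separated k z) {r : ℕ}
    (hr : Desc r (z.map Prod.snd)) :
    invCount (thickPos k z) =
      invCount (thickPos k (swapAt r z)) + (stepWord k (z.map Prod.fst) r).length := by
  have hlt := hr.lt
  rw [List.length_map] at hlt
  obtain ⟨m, x, y, n, rfl, rfl⟩ := exists_split_pair z r hlt
  have hyx : y.2 < x.2 := by
    obtain ⟨a, b, ha, hb, hab⟩ := desc_iff.mp hr
    simp at ha hb
    omega
  rw [swapAt_append_pair]
  have := stepWord_append k (m.map Prod.fst) x.1 y.1 (n.map Prod.fst)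
  simp only [List.length_map] at this
  simp only [List.map_append, List.map_cons]
  rw [this]
  simp only [thickPos, List.flatMap_append, List.flatMap_cons]
  exact invCount_starWord _ _ hyx (hz y (by simp) x (by simp) hyx) _

/-- A word of descents of the blocks is replaced by a word of descents of all the strands. -/
theorem invCount_thickWord {z : List (ZMod e × ℕ)} (hz : Separated k z)
    (hn : (z.map Prod.snd).Nodup) (u : List ℕ)
    (hu : invCount (z.map Prod.snd) = invCount ((act u z).map Prod.snd) + u.length) :
    invCount (thickPos k z) =
      invCount (thickPos k (act u z)) + (thickWord k (z.map Prod.fst) u).length := by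
  induction u with
  | nil => simp [thickWord]
  | cons r u ih =>
    have h1 := inv_le_inv_act u (z.map Prod.snd)
    rw [← map_act] at h1
    have h2 := (inv_swapAt_le r ((act u z).map Prod.snd)).2
    rw [act_cons, map_swapAt, List.length_cons] at hu
    have hd : Desc r ((act u z).map Prod.snd) := by
      refine Desc.of_inv_lt ?_ (by omega)
      rw [map_act]
      exact (act_perm u _).nodup_iff.mpr hn
    rw [ih (by omega), invCount_stepWord (hz.of_perm (act_perm u z)) hd, thickWord, act_cons,
      List.length_append, map_act, add_assoc]

theorem pairwise_thickPos {z : List (ZMod e × ℕ)} (hz : Separated k z)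
    (hp : (z.map Prod.snd).Pairwise (· < ·)) : (thickPos k z).Pairwise (· < ·) := by
  rw [thickPos, List.pairwise_flatMap]
  constructor
  · intro x _
    unfold thickBlock
    split_ifs <;> simp
  · rw [List.pairwise_map] at hp
    exact hp.imp_of_mem fun {x y} hx hy hxy a ha b hb =>
      lt_of_lt_of_le (hz x hx y hy hxy a ha) (le_of_mem_thickBlock hb)

/-- The order type of a list of distinct numbers, as a permutation of `0, …, d - 1`. -/
def standardize (t : List ℕ) : List ℕ := t.map fun a => t.countP (· < a)

theorem countP_lt_iff {t : List ℕ} {a b : ℕ} (ha : a ∈ t) (hb : b ∈ t) :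
    t.countP (· < a) < t.countP (· < b) ↔ a < b := by
  have key : ∀ a b : ℕ, a ∈ t → a < b → t.countP (· < a) < t.countP (· < b) := by
    intro a b ha hab
    obtain ⟨m, n, rfl⟩ := List.append_of_mem ha
    have h1 := List.countP_mono_left (l := m) (p := (· < a)) (q := (· < b))
      (fun x _ hx => by simp at hx ⊢; omega)
    have h2 := List.countP_mono_left (l := n) (p := (· < a)) (q := (· < b))
      (fun x _ hx => by simp at hx ⊢; omega)
    simp only [List.countP_append, List.countP_cons]
    simp [hab]
    omega
  constructor
  · intro h
    by_contra hab
    rcases Nat.lt_or_ge b a with h' | h'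
    · have := key b a hb h'; omega
    · have : a = b := by omega
      subst this; omega
  · exact key a b ha

theorem standardize_perm {t : List ℕ} (ht : t.Nodup) :
    (standardize t).Perm (List.range t.length) := by
  have hnd : (standardize t).Nodup := by
    refine (List.nodup_map_iff_inj_on ht).mpr fun a ha b hb hab => ?_
    have h1 := countP_lt_iff ha hb
    have h2 := countP_lt_iff hb ha
    omega
  have hsub : standardize t ⊆ List.range t.length := by
    intro c hc
    obtain ⟨a, ha, rfl⟩ := List.mem_map.mp hc
    rw [List.mem_range]
    obtain ⟨m, n, rfl⟩ := List.append_of_mem ha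
    have h1 := List.countP_le_length (l := m) (p := (· < a))
    have h2 := List.countP_le_length (l := n) (p := (· < a))
    simp only [List.countP_append, List.countP_cons, List.length_append, List.length_cons]
    simp
    omega
  exact (List.subperm_of_subset hnd hsub).perm_of_length_le (by simp [standardize])

theorem invCount_map {t : List ℕ} (f : ℕ → ℕ) (hf : ∀ a ∈ t, ∀ b ∈ t, f a < f b ↔ a < b) :
    invCount (t.map f) = invCount t := by
  induction t with
  | nil => rfl
  | cons a t ih =>
    rw [List.map_cons, invCount, invCount,
      ih fun x hx y hy => hf x (by simp [hx]) y (by simp [hy]), List.countP_map]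
    congr 1
    refine List.countP_congr fun x hx => ?_
    simpa using hf x (by simp [hx]) a (by simp)

/-- A reduced word of the order type of the starting positions of the blocks yields a reduced word
of the positions of all strands. -/
theorem sorts_thickWord {N : ℕ} {z : List (ZMod e × ℕ)}
    (hz : (thickPos k z).Perm (List.range N)) (hs : Separated k z)
    (hn : (z.map Prod.snd).Nodup) {u : List ℕ}
    (hu : Sorts z.length u (standardize (z.map Prod.snd))) :
    Sorts N (thickWord k (z.map Prod.fst) u) (thickPos k z) := by
  have hmem : ∀ a ∈ act u (z.map Prod.snd), a ∈ z.map Prod.snd := fun a ha =>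
    (act_perm u _).mem_iff.mp ha
  have hsorted : ((act u z).map Prod.snd).Pairwise (· < ·) := by
    have := hu.act_eq
    rw [standardize, ← map_act] at this
    have h2 : ((act u (z.map Prod.snd)).map
        fun a => (z.map Prod.snd).countP (· < a)).Pairwise (· < ·) := by
      rw [this]; exact List.pairwise_lt_range
    rw [List.pairwise_map] at h2
    rw [map_act]
    exact h2.imp_of_mem fun {a b} ha hb hab => (countP_lt_iff (hmem a ha) (hmem b hb)).mp hab
  have hact := act_thickWord_flatMap (k := k) (lab := Prod.fst) (G := thickBlock k)
    length_thickBlock z u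
  have hperm := act_perm u z
  have hpw := pairwise_thickPos (hs.of_perm hperm) hsorted
  have h0 : invCount (thickPos k (act u z)) = 0 :=
    (inv_eq_zero_iff (hpw.imp fun h => by omega)).mpr hpw
  constructor
  · refine (show act _ (thickPos k z) = thickPos k (act u z) from hact).trans ?_
    exact eq_range_of_inv_eq_zero ((hperm.flatMap_right _).trans hz) h0
  · have h1 : invCount ((act u z).map Prod.snd) = 0 :=
      (inv_eq_zero_iff (hsorted.imp fun h => by omega)).mpr hsorted
    have h2 := invCount_map (t := z.map Prod.snd) (fun a => (z.map Prod.snd).countP (· < a))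
      fun a ha b hb => countP_lt_iff ha hb
    have h3 := hu.length_eq
    rw [invCount_thickWord hs hn u (by unfold standardize at h3; omega), h0, zero_add]

/-- Blocks without a common position do not overlap: as they have at most two positions, a later
block cannot start inside an earlier one. -/
theorem separated_of_nodup {z : List (ZMod e × ℕ)} (hz : (thickPos k z).Nodup) :
    Separated k z ∧ (z.map Prod.snd).Nodup := by
  have hself : ∀ x : ZMod e × ℕ, x.2 ∈ thickBlock k x := fun x => by
    unfold thickBlock; split_ifs <;> simp
  have hdisj := (List.nodup_flatMap.mp hz).2
  constructor
  · intro x hx y hy hxy a ha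
    have hne : x ≠ y := by rintro rfl; omega
    have hd : List.Disjoint (thickBlock k x) (thickBlock k y) := by
      have hsymm : Std.Symm fun x y : ZMod e × ℕ =>
        List.Disjoint (thickBlock k x) (thickBlock k y) := ⟨fun _ _ h => h.symm⟩
      exact hdisj.forall hx hy hne
    have h1 : a ≠ y.2 := by
      rintro rfl
      exact hd ha (hself y)
    unfold thickBlock at ha
    split_ifs at ha <;> simp at ha <;> omega
  · rw [List.Nodup, List.pairwise_map]
    refine hdisj.imp fun {x y} hd hxy => ?_
    exact hd (hself x) (hxy ▸ hself y)

end ThickWords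

/-! ### Permutations between well-ordered sequences -/

section Dichotomy

variable {e k : ℕ} [NeZero e]

/-- The sum of the positions of the strands with label `c`. -/
def labelSum {ι : Type*} [DecidableEq ι] (c : ι) (y : List (ι × ℕ)) : ℕ :=
  ((y.filter fun x => x.1 = c).map Prod.snd).sum

theorem labelSum_cons {ι : Type*} [DecidableEq ι] (c : ι) (x : ι × ℕ) (y : List (ι × ℕ)) :
    labelSum c (x :: y) = (if x.1 = c then x.2 else 0) + labelSum c y := by
  unfold labelSum
  by_cases h : x.1 = c <;> simp [h]

theorem labelSum_perm {ι : Type*} [DecidableEq ι] (c : ι) {y y' : List (ι × ℕ)} (h : y.Perm y') :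
    labelSum c y = labelSum c y' :=
  ((h.filter _).map _).sum_eq

variable (hk : k < e)
include hk

/-- Of the two alternatives, either some pair `(k, k + 1)` of strands is inverted or each strand
`k + 1` ends to the right of the strand `k` of its pair, which is an inequality of sums of final
positions; equality forces the strands of each pair to end side by side. -/
theorem labelSum_zip_phi (v : List (ZMod e)) (t : List ℕ) (ht : t.length = (phi k v).length) :
    (∃ v₁ v₂ m a b n, v = v₁ ++ (k : ZMod e) :: v₂ ∧ t = m ++ a :: b :: n ∧
      m.length = (phi k v₁).length ∧ b ≤ a) ∨
    (labelSum (k : ZMod (e + 1)) ((phi k v).zip t) + v.count (k : ZMod e) ≤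
        labelSum ((k : ZMod (e + 1)) + 1) ((phi k v).zip t) ∧
      (labelSum (k : ZMod (e + 1)) ((phi k v).zip t) + v.count (k : ZMod e) =
        labelSum ((k : ZMod (e + 1)) + 1) ((phi k v).zip t) →
        ∃ z : List (ZMod e × ℕ), z.map Prod.fst = v ∧ thickPos k z = t)) := by
  have hne := succ_ne_self hk
  induction v generalizing t with
  | nil =>
    obtain rfl := List.length_eq_zero_iff.mp ht
    exact Or.inr ⟨le_rfl, fun _ => ⟨[], rfl, rfl⟩⟩
  | cons i v ih =>
    by_cases hi : i = k
    · subst hi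
      simp only [phi, phiVertex_self, List.cons_append, List.nil_append, List.length_cons] at ht ⊢
      rcases t with _ | ⟨a, _ | ⟨b, t⟩⟩
      · simp at ht
      · simp at ht
      rcases Nat.lt_or_ge a b with hab | hab
      · rcases ih t (by simpa using ht) with ⟨v₁, v₂, m, c, d, n, rfl, rfl, hm, hcd⟩ | ⟨h1, h2⟩
        · exact Or.inl ⟨k :: v₁, v₂, a :: b :: m, c, d, n, rfl, rfl,
            by simp [phi, phiVertex_self, hm], hcd⟩
        · right
          simp only [List.zip_cons_cons, labelSum_cons, hne, hne.symm, if_true, if_false,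
            List.count_cons_self]
          refine ⟨by omega, fun h => ?_⟩
          obtain ⟨z, rfl, rfl⟩ := h2 (by omega)
          obtain rfl : b = a + 1 := by omega
          exact ⟨(↑k, a) :: z, rfl, by simp [thickPos, thickBlock]⟩
      · exact Or.inl ⟨[], v, [], a, b, t, rfl, rfl, rfl, hab⟩
    · simp only [phi, phiVertex_of_ne hi, List.cons_append, List.nil_append,
        List.length_cons] at ht ⊢
      rcases t with _ | ⟨a, t⟩
      · simp at ht
      rcases ih t (by simpa using ht) with ⟨v₁, v₂, m, c, d, n, rfl, rfl, hm, hcd⟩ | ⟨h1, h2⟩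
      · exact Or.inl ⟨i :: v₁, v₂, a :: m, c, d, n, rfl, rfl,
          by simp [phi, phiVertex_of_ne hi, hm], hcd⟩
      · right
        simp only [List.zip_cons_cons, labelSum_cons, up_ne_of_ne hk hi, up_ne_succ hk i, if_false,
          List.count_cons_of_ne (Ne.symm (Ne.symm hi))]
        refine ⟨by omega, fun h => ?_⟩
        obtain ⟨z, rfl, rfl⟩ := h2 (by omega)
        exact ⟨(i, a) :: z, rfl, by simp [thickPos, thickBlock, hi]⟩

/-- In a doubled sequence the strands of each pair are side by side. -/
theorem labelSum_zip_range (v : List (ZMod e)) (n : ℕ) :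
    labelSum (k : ZMod (e + 1)) ((phi k v).zip (List.range' n (phi k v).length)) +
        v.count (k : ZMod e) =
      labelSum ((k : ZMod (e + 1)) + 1) ((phi k v).zip (List.range' n (phi k v).length)) := by
  have hne := succ_ne_self hk
  induction v generalizing n with
  | nil => rfl
  | cons i v ih =>
    by_cases hi : i = k
    · subst hi
      have := ih (n + 1 + 1)
      simp only [phi, phiVertex_self, List.cons_append, List.nil_append, List.length_cons,
        List.range'_succ, List.zip_cons_cons, labelSum_cons, hne, hne.symm, if_true, if_false,
        List.count_cons_self]
      omega
    · have := ih (n + 1)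
      simp only [phi, phiVertex_of_ne hi, List.cons_append, List.nil_append, List.length_cons,
        List.range'_succ, List.zip_cons_cons, labelSum_cons, up_ne_of_ne hk hi, up_ne_succ hk i,
        if_false, List.count_cons_of_ne (Ne.symm (Ne.symm hi))]
      omega

/-- A permutation of the strands between two well-ordered sequences either inverts a pair
`(k, k + 1)`, or it permutes the blocks of doubled strands. Indeed, if no pair is inverted, then
each strand with label `k + 1` ends to the right of the strand with label `k` of its pair, and the
sums of the final positions show that it ends immediately to the right. -/
theorem desc_or_exists_thickPos {v v' : List (ZMod e)} {t u : List ℕ}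
    (ht : t.Perm (List.range (phi k v).length)) (hu : act u t = List.range (phi k v).length)
    (hv : act u (phi k v) = phi k v') :
    (∃ v₁ v₂, v = v₁ ++ (k : ZMod e) :: v₂ ∧ Desc (phi k v₁).length t) ∨
      ∃ z : List (ZMod e × ℕ), z.map Prod.fst = v ∧ thickPos k z = t := by
  have hlen := perm_range_length ht
  rcases labelSum_zip_phi hk v t hlen with ⟨v₁, v₂, m, a, b, n, hv₁, rfl, hm, hab⟩ | ⟨-, h2⟩
  · refine Or.inl ⟨v₁, v₂, hv₁, m, a, b, n, rfl, hm, lt_of_le_of_ne hab ?_⟩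
    rintro rfl
    have := (List.nodup_append.mp (perm_range_nodup ht)).2.1
    simp at this
  · right
    apply h2
    have hlen' : (phi k v').length = (phi k v).length := by rw [← hv, length_act]
    have hperm : ((phi k v).zip t).Perm ((phi k v').zip (List.range (phi k v).length)) := by
      have : act u ((phi k v).zip t) = (phi k v').zip (List.range (phi k v).length) := by
        apply List.zip_of_prod
        · rw [map_act, List.map_fst_zip (by omega), hv]
        · rw [map_act, List.map_snd_zip (by omega), hu]
      rw [← this]
      exact (act_perm _ _).symm
    have hcount : v.count (k : ZMod e) = v'.count (k : ZMod e) := by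
      rw [← count_phi_up hk, ← count_phi_up hk, ← hv]
      exact ((act_perm _ _).count_eq _).symm
    have := labelSum_zip_range hk v' 0
    rw [← List.range_eq_range', hlen'] at this
    rw [labelSum_perm _ hperm, labelSum_perm _ hperm, hcount, this]

/-- An exchange of the two strands of a pair makes the sequence unordered: up to this pair there
are as many entries `k + 1` as entries `k`. -/
theorem unordered_swapAt (v₁ v₂ : List (ZMod e)) :
    Unordered k (swapAt (phi k v₁).length (phi k (v₁ ++ (k : ZMod e) :: v₂))) := by
  have hne := succ_ne_self hk
  rw [phi_append, phi, phiVertex_self, List.cons_append, List.cons_append, List.nil_append,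
    swapAt_append_pair]
  refine ⟨(phi k v₁).length + 1, ?_⟩
  rw [List.take_append]
  have e1 : List.take ((phi k v₁).length + 1) (phi k v₁) = phi k v₁ :=
    List.take_of_length_le (by omega)
  rw [e1, Nat.add_sub_cancel_left]
  simp only [List.take_succ_cons, List.take_zero, List.count_append, List.count_singleton]
  have h1 := count_phi_up hk v₁ (k : ZMod e)
  rw [up_self hk] at h1
  rw [h1, count_phi_succ hk]
  simp [hne]

end Dichotomy

/-! ### Specialisation of the variables of doubled strands -/

section Specialisation

open MvPolynomial

variable {e : ℕ} [NeZero e] (k : ℕ)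

/-- The strand of the sequence `l` to which the strand at a given position of `φ(l)` belongs. -/
def blockIdx : List (ZMod e) → ℕ → ℕ
  | [], j => j
  | i :: l, j => if j < (phiVertex k i).length then 0 else blockIdx l (j - (phiVertex k i).length) + 1

/-- The position in `φ(l)` at which the block of a given strand of `l` starts. -/
def blockPos : List (ZMod e) → ℕ → ℕ
  | [], r => r
  | _ :: _, 0 => 0
  | i :: l, r + 1 => (phiVertex k i).length + blockPos l r

variable {k}

theorem length_phiVertex_pos (i : ZMod e) : 0 < (phiVertex k i).length := by
  rw [length_phiVertex]; split_ifs <;> omega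

theorem blockIdx_blockPos (l : List (ZMod e)) (r : ℕ) : blockIdx k l (blockPos k l r) = r := by
  induction l generalizing r with
  | nil => rfl
  | cons i l ih =>
    rcases r with _ | r
    · simp [blockPos, blockIdx, length_phiVertex_pos]
    · simp [blockPos, blockIdx, ih]

theorem blockPos_of_le (l : List (ZMod e)) (r : ℕ) (hr : l.length ≤ r) :
    (phi k l).length ≤ blockPos k l r := by
  induction l generalizing r with
  | nil => simp [phi]
  | cons i l ih =>
    rcases r with _ | r
    · simp at hr
    · have := ih r (by simpa using hr)
      simp only [phi, blockPos, List.length_append]; omega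

theorem blockPos_eq_shiftPos (l : List (ZMod e)) (r : ℕ) (hr : r ≤ l.length) :
    blockPos k l r = shiftPos k l r := by
  induction l generalizing r with
  | nil =>
    obtain rfl : r = 0 := by simpa using hr
    rfl
  | cons i l ih =>
    rcases r with _ | r
    · simp [blockPos, shiftPos, phi]
    · have := ih r (by simpa using hr)
      unfold shiftPos at this
      simp [blockPos, shiftPos, phi, this]

theorem blockPos_lt (l : List (ZMod e)) (r : ℕ) (hr : r < l.length) :
    blockPos k l r < (phi k l).length := by
  induction l generalizing r with
  | nil => simp at hr
  | cons i l ih =>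
    have := length_phiVertex_pos (k := k) i
    rcases r with _ | r
    · simp only [phi, blockPos, List.length_append]; omega
    · have := ih r (by simpa using hr)
      simp only [phi, blockPos, List.length_append]; omega

/-- A position of `φ(l)` is the start of a block, or it is the second position of the block of a
vertex `k`. -/
theorem eq_blockPos_or (l : List (ZMod e)) (j : ℕ) : j = blockPos k l (blockIdx k l j) ∨
    ∃ l₁ l₂, l = l₁ ++ (k : ZMod e) :: l₂ ∧ j = (phi k l₁).length + 1 ∧
      blockPos k l (blockIdx k l j) = (phi k l₁).length := by
  induction l generalizing j with
  | nil => exact Or.inl rfl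
  | cons i l ih =>
    by_cases hj : j < (phiVertex k i).length
    · rcases Nat.eq_zero_or_pos j with rfl | hpos
      · left; simp [blockIdx, blockPos, length_phiVertex_pos]
      · right
        rw [length_phiVertex] at hj
        split_ifs at hj with hi
        · subst hi
          obtain rfl : j = 1 := by omega
          refine ⟨[], l, rfl, by simp [phi], ?_⟩
          simp [blockIdx, blockPos, phiVertex_self, phi]
        · omega
    · have e1 : blockPos k (i :: l) (blockIdx k (i :: l) j) = (phiVertex k i).length +
          blockPos k l (blockIdx k l (j - (phiVertex k i).length)) := by
        simp [blockIdx, hj, blockPos]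
      rw [e1]
      rcases ih (j - (phiVertex k i).length) with h | ⟨l₁, l₂, rfl, h1, h2⟩
      · left; omega
      · right
        refine ⟨i :: l₁, l₂, rfl, ?_, ?_⟩ <;> simp only [phi, List.length_append] <;> omega

theorem blockIdx_append_of_lt (m n : List (ZMod e)) (j : ℕ) (hj : j < (phi k m).length) :
    blockIdx k (m ++ n) j = blockIdx k m j ∧ blockIdx k m j < m.length := by
  induction m generalizing j with
  | nil => simp [phi] at hj
  | cons i m ih =>
    simp only [phi, List.length_append] at hj
    by_cases h : j < (phiVertex k i).length
    · simp [blockIdx, h]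
    · obtain ⟨h1, h2⟩ := ih (j - (phiVertex k i).length) (by omega)
      simp [blockIdx, h, h1, h2]

theorem blockIdx_append_add (m n : List (ZMod e)) (j : ℕ) :
    blockIdx k (m ++ n) ((phi k m).length + j) = m.length + blockIdx k n j := by
  induction m generalizing j with
  | nil => simp [phi]
  | cons i m ih =>
    have : (phi k (i :: m)).length + j - (phiVertex k i).length = (phi k m).length + j := by
      simp only [phi, List.length_append]; omega
    have h : ¬ (phi k (i :: m)).length + j < (phiVertex k i).length := by
      simp only [phi, List.length_append]; omega
    rw [List.cons_append, blockIdx, if_neg h, this, ih, List.length_cons]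
    omega

theorem wordPerm_map_add (p : ℕ) (u : List ℕ) (x : ℕ) :
    wordPerm (u.map (p + ·)) (p + x) = p + wordPerm u x := by
  induction u with
  | nil => rfl
  | cons r u ih =>
    rw [List.map_cons, wordPerm_cons, wordPerm_cons, Equiv.Perm.mul_apply, Equiv.Perm.mul_apply,
      ih]
    simp only [Equiv.swap_apply_def]
    split_ifs <;> omega

theorem wordPerm_of_lt (u : List ℕ) (j : ℕ) (h : ∀ r ∈ u, r + 1 < j) : wordPerm u j = j := by
  induction u with
  | nil => rfl
  | cons r u ih =>
    have := h r (by simp)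
    rw [wordPerm_cons, Equiv.Perm.mul_apply, ih fun s hs => h s (by simp [hs]),
      Equiv.swap_apply_of_ne_of_ne (by omega) (by omega)]

theorem starWord_eq_map (p : ℕ) (a b : ZMod e) :
    starWord k p a b = (starWord k 0 a b).map (p + ·) := by
  unfold starWord
  split_ifs <;> simp

/-- The crossing of two blocks induces the crossing of two strands. -/
theorem blockIdx_starWord (m : List (ZMod e)) (a b : ZMod e) (n : List (ZMod e)) (j : ℕ) :
    blockIdx k (m ++ b :: a :: n) (wordPerm (starWord k (phi k m).length a b) j) =
      Equiv.swap m.length (m.length + 1) (blockIdx k (m ++ a :: b :: n) j) := by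
  rcases Nat.lt_or_ge j (phi k m).length with hj | hj
  · obtain ⟨h1, h2⟩ := blockIdx_append_of_lt m (a :: b :: n) j hj
    have h3 := (blockIdx_append_of_lt m (b :: a :: n) j hj).1
    have hfix : ∀ u : List ℕ, (∀ r ∈ u, j < r) → wordPerm u j = j := by
      intro u hu
      induction u with
      | nil => rfl
      | cons r u ih =>
        have := hu r (by simp)
        rw [wordPerm_cons, Equiv.Perm.mul_apply, ih fun s hs => hu s (by simp [hs]),
          Equiv.swap_apply_of_ne_of_ne (by omega) (by omega)]
    by_cases hj1 : ∀ r ∈ starWord k (phi k m).length a b, j < r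
    · rw [hfix _ hj1, h1, h3, Equiv.swap_apply_of_ne_of_ne (by omega) (by omega)]
    · exfalso
      apply hj1
      intro r hr
      unfold starWord at hr
      split_ifs at hr <;> simp at hr <;> omega
  · obtain ⟨j, rfl⟩ := Nat.exists_eq_add_of_le hj
    rw [blockIdx_append_add]
    have key : blockIdx k (b :: a :: n) (wordPerm (starWord k 0 a b) j) =
        Equiv.swap 0 1 (blockIdx k (a :: b :: n) j) := by
      unfold starWord
      have hfar : ∀ x : ℕ, Equiv.swap 0 1 (x + 1 + 1) = x + 1 + 1 := fun x =>
        Equiv.swap_apply_of_ne_of_ne (by omega) (by omega)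
      split_ifs with ha hb hb
      · have l1 : (phiVertex k a).length = 2 := by rw [length_phiVertex, if_pos ha]
        have l2 : (phiVertex k b).length = 2 := by rw [length_phiVertex, if_pos hb]
        rcases j with _ | _ | _ | _ | j
        · rw [show wordPerm [0 + 1, 0 + 2, 0, 0 + 1] 0 = 2 by decide]
          simp [blockIdx, l1, l2]
        · rw [show wordPerm [0 + 1, 0 + 2, 0, 0 + 1] (0 + 1) = 3 by decide]
          simp [blockIdx, l1, l2]
        · rw [show wordPerm [0 + 1, 0 + 2, 0, 0 + 1] (0 + 1 + 1) = 0 by decide]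
          simp [blockIdx, l1, l2]
        · rw [show wordPerm [0 + 1, 0 + 2, 0, 0 + 1] (0 + 1 + 1 + 1) = 1 by decide]
          simp [blockIdx, l1, l2]
        · rw [wordPerm_of_lt _ _ (by simp)]
          simp [blockIdx, l1, l2, hfar]
      · have l1 : (phiVertex k a).length = 2 := by rw [length_phiVertex, if_pos ha]
        have l2 : (phiVertex k b).length = 1 := by rw [length_phiVertex, if_neg hb]
        rcases j with _ | _ | _ | j
        · rw [show wordPerm [0, 0 + 1] 0 = 1 by decide]
          simp [blockIdx, l1, l2]
        · rw [show wordPerm [0, 0 + 1] (0 + 1) = 2 by decide]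
          simp [blockIdx, l1, l2]
        · rw [show wordPerm [0, 0 + 1] (0 + 1 + 1) = 0 by decide]
          simp [blockIdx, l1, l2]
        · rw [wordPerm_of_lt _ _ (by simp)]
          simp [blockIdx, l1, l2, hfar]
      · have l1 : (phiVertex k a).length = 1 := by rw [length_phiVertex, if_neg ha]
        have l2 : (phiVertex k b).length = 2 := by rw [length_phiVertex, if_pos hb]
        rcases j with _ | _ | _ | j
        · rw [show wordPerm [0 + 1, 0] 0 = 2 by decide]
          simp [blockIdx, l1, l2]
        · rw [show wordPerm [0 + 1, 0] (0 + 1) = 0 by decide]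
          simp [blockIdx, l1, l2]
        · rw [show wordPerm [0 + 1, 0] (0 + 1 + 1) = 1 by decide]
          simp [blockIdx, l1, l2]
        · rw [wordPerm_of_lt _ _ (by simp)]
          simp [blockIdx, l1, l2, hfar]
      · have l1 : (phiVertex k a).length = 1 := by rw [length_phiVertex, if_neg ha]
        have l2 : (phiVertex k b).length = 1 := by rw [length_phiVertex, if_neg hb]
        rcases j with _ | _ | j
        · rw [show wordPerm [0] 0 = 1 by decide]
          simp [blockIdx, l1, l2]
        · rw [show wordPerm [0] (0 + 1) = 0 by decide]
          simp [blockIdx, l1, l2]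
        · rw [wordPerm_of_lt _ _ (by simp)]
          simp [blockIdx, l1, l2, hfar]
    rw [starWord_eq_map, wordPerm_map_add, blockIdx_append_add, key]
    generalize blockIdx k (a :: b :: n) j = x
    simp only [Equiv.swap_apply_def]
    split_ifs <;> omega

variable (K : Type*) [Field K]

variable (k) in
/-- The specialisation of polynomials which identifies the variables of doubled strands. -/
noncomputable def specialise (l : List (ZMod e)) : Pol K →ₐ[K] Pol K := rename (blockIdx k l)

variable {K}

theorem specialise_X (l : List (ZMod e)) (j : ℕ) :
    specialise k K l (X j) = X (blockIdx k l j) := rename_X _ _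

theorem specialise_rename_wordPerm (m : List (ZMod e)) (a b : ZMod e) (n : List (ZMod e))
    (F : Pol K) :
    specialise k K (m ++ b :: a :: n)
        (rename (wordPerm (starWord k (phi k m).length a b)) F) =
      polSwap K m.length (specialise k K (m ++ a :: b :: n) F) := by
  rw [specialise, specialise, polSwap, rename_rename, rename_rename]
  congr 2
  funext j
  exact blockIdx_starWord m a b n j

/-- The sign of the word replacing a crossing. -/
def starSign (k : ℕ) (i j : ZMod e) : ℤˣ :=
  if i = (k : ZMod e) ∧ j = (k : ZMod e) then -1 else 1

/-- The sign of the word replacing a word of crossings. -/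
def thickSign (k : ℕ) (l : List (ZMod e)) : List ℕ → ℤˣ
  | [] => 1
  | r :: u => (if hr : r + 1 < (act u l).length then
      starSign k (act u l)[r] (act u l)[r + 1] else 1) * thickSign k l u

theorem divDiff_eq_of_mul {r : ℕ} {f g : Pol K}
    (h : (X (r + 1) - X r) * g = f - polSwap K r f) : g = divDiff r f :=
  mul_left_cancel₀ (X_sub_X_ne_zero (K := K) (i := r + 1) (j := r) (by omega))
    (h.trans (mul_divDiff r f).symm)

variable (hk : k < e)
include hk

/-- The specialisation intertwines the word replacing a crossing with the crossing. -/
theorem specialise_starWord (he : 1 < e) (m : List (ZMod e)) (a b : ZMod e) (n : List (ZMod e))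
    (F : Pol K) :
    (starSign k a b : ℤ) • specialise k K (m ++ b :: a :: n)
        (wordPol (cyc (e + 1)) K (phi k (m ++ a :: b :: n)) (starWord k (phi k m).length a b) F) =
      demazure (cyc e) a b m.length (specialise k K (m ++ a :: b :: n) F) := by
  have hrot := specialise_rename_wordPerm (k := k) m a b n F
  have hne := succ_ne_self hk
  have idx := fun (x : List (ZMod e)) j => blockIdx_append_add (k := k) m x j
  set M := phi k m with hM
  set p := M.length with hp
  set r := m.length with hr
  have s0 := fun l : List (ZMod (e + 1)) => swapAt_append M 0 l
  have s1 := fun l : List (ZMod (e + 1)) => swapAt_append M 1 l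
  have s2 := fun l : List (ZMod (e + 1)) => swapAt_append M 2 l
  simp only [add_zero, ← hp] at s0 s1 s2
  have i0 : ∀ x : List (ZMod e), blockIdx k (m ++ x) p = r + blockIdx k x 0 := fun x => idx x 0
  have i1 := fun x => idx x 1
  have i2 := fun x => idx x 2
  have i3 := fun x => idx x 3
  -- crossings at `p`, `p + 1`, `p + 2` act by the labels found there
  have cp : ∀ (l : List (ZMod (e + 1))) (c c' : ZMod (e + 1)) n,
      l = M ++ c :: c' :: n → crossPol (K := K) (cyc (e + 1)) l p =
        demazure (cyc (e + 1)) c c' p :=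
    fun l c c' n hl => crossPol_split _ hl rfl
  have cp1 : ∀ (l : List (ZMod (e + 1))) (d c c' : ZMod (e + 1)) n,
      l = M ++ d :: c :: c' :: n → crossPol (K := K) (cyc (e + 1)) l (p + 1) =
        demazure (cyc (e + 1)) c c' (p + 1) :=
    fun l d c c' n hl => crossPol_split (m := M ++ [d]) _ (by simpa using hl) (by simp [hp])
  have cp2 : ∀ (l : List (ZMod (e + 1))) (d d' c c' : ZMod (e + 1)) n,
      l = M ++ d :: d' :: c :: c' :: n → crossPol (K := K) (cyc (e + 1)) l (p + 2) =
        demazure (cyc (e + 1)) c c' (p + 2) :=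
    fun l d d' c c' n hl => crossPol_split (m := M ++ [d, d']) _ (by simpa using hl) (by simp [hp])
  by_cases ha : a = k
  · by_cases hb : b = k
    · subst ha hb
      have hφ : phi k (m ++ (k : ZMod e) :: (k : ZMod e) :: n) = M ++ (k : ZMod (e + 1)) ::
          ((k : ZMod (e + 1)) + 1) :: (k : ZMod (e + 1)) :: ((k : ZMod (e + 1)) + 1) ::
            phi k n := by
        simp [phi_append, phi, phiVertex_self, hM]
      have hw : starWord k p (k : ZMod e) (k : ZMod e) = [p + 1, p + 2, p, p + 1] := by
        simp [starWord]
      have hsg : (starSign k (k : ZMod e) (k : ZMod e) : ℤ) = -1 := by simp [starSign]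
      rw [hw] at hrot ⊢
      rw [hsg, demazure_self]
      simp only [wordPol, act_cons, act_nil, LinearMap.comp_apply, LinearMap.id_apply, hφ, s0, s1,
        s2, swapAt]
      rw [cp1 _ _ _ _ _ rfl, cp _ _ _ _ rfl, cp2 _ _ _ _ _ _ rfl, cp1 _ _ _ _ _ rfl,
        demazure_self, demazure_self, demazure_of_ne _ hne.symm, demazure_of_ne _ hne,
        cyc_succ_self he, cyc_self_succ, pow_zero, one_mul, pow_one]
      -- the two outer crossings join different vertices, the two inner ones are divided
      -- differences; the factor of the crossing against the arrow makes `G` vanish when the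
      -- variables of two strands with labels `k` and `k + 1` are identified
      set G : Pol K := (X (p + 1 + 1) - X (p + 1)) * polSwap K (p + 1) F with hG
      set D := divDiff (p + 2) (divDiff p G) with hD
      have sx1 : ∀ j, j ≠ p → j ≠ p + 1 → polSwap K p (X j) = X j := fun j h1 h2 => by
        rw [polSwap_X, Equiv.swap_apply_of_ne_of_ne h1 h2]
      have sx2 : ∀ j, j ≠ p + 2 → j ≠ p + 3 → polSwap K (p + 2) (X j) = X j := fun j h1 h2 => by
        rw [polSwap_X, Equiv.swap_apply_of_ne_of_ne h1 h2]
      -- both divided differences, multiplied out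
      have E1 : (X (p + 1) - X p) * ((X (p + 3) - X (p + 2)) * D) =
          G - polSwap K p G - polSwap K (p + 2) G + polSwap K (p + 2) (polSwap K p G) := by
        have d1 := mul_divDiff p G
        have d2 := mul_divDiff (p + 2) (divDiff p G)
        have d3 := congrArg (polSwap K (p + 2)) d1
        rw [map_mul, map_sub, map_sub, sx2 _ (by omega) (by omega), sx2 _ (by omega) (by omega)]
          at d3
        rw [hD, d2, mul_sub, d1, d3]
        ring
      have l1 : (phiVertex k (k : ZMod e)).length = 2 := by rw [length_phiVertex, if_pos rfl]
      set Θ : Pol K →ₐ[K] Pol K :=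
        (specialise k K (m ++ (k : ZMod e) :: (k : ZMod e) :: n)).comp (polSwap K (p + 1)) with hΘ
      have t0 : Θ (X p) = X r := by
        rw [hΘ, AlgHom.comp_apply, polSwap_X, Equiv.swap_apply_of_ne_of_ne (by omega) (by omega),
          specialise_X, i0]
        simp [blockIdx, l1]
      have t1 : Θ (X (p + 1)) = X (r + 1) := by
        rw [hΘ, AlgHom.comp_apply, polSwap_X, Equiv.swap_apply_left,
          specialise_X, i2]
        simp [blockIdx, l1]
      have t2 : Θ (X (p + 2)) = X r := by
        rw [hΘ, AlgHom.comp_apply, polSwap_X, Equiv.swap_apply_right,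
          specialise_X, i1]
        simp [blockIdx, l1]
      have t3 : Θ (X (p + 3)) = X (r + 1) := by
        rw [hΘ, AlgHom.comp_apply, polSwap_X, Equiv.swap_apply_of_ne_of_ne (by omega) (by omega),
          specialise_X, i3]
        simp [blockIdx, l1]
      have ss : polSwap K (p + 1) (polSwap K (p + 1) F) = F := by
        rw [polSwap, rename_rename, show (⇑(Equiv.swap (p + 1) (p + 1 + 1)) ∘
          ⇑(Equiv.swap (p + 1) (p + 1 + 1))) = id from funext fun x => Equiv.swap_apply_self _ _ _,
          rename_id_apply]
      have g1 : Θ G = (X r - X (r + 1)) *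
          specialise k K (m ++ (k : ZMod e) :: (k : ZMod e) :: n) F := by
        rw [hG, map_mul, map_sub, t2, t1, hΘ, AlgHom.comp_apply, ss]
      have g2 : Θ (polSwap K p G) = 0 := by
        rw [hG, map_mul, map_sub, sx1 _ (by omega) (by omega), polSwap_X, Equiv.swap_apply_right,
          map_mul, map_sub, t2, t0, sub_self, zero_mul]
      have g3 : Θ (polSwap K (p + 2) G) = 0 := by
        have : polSwap K (p + 2) (X (p + 1 + 1)) = (X (p + 3) : Pol K) := by
          rw [polSwap_X, show p + 1 + 1 = p + 2 from rfl, Equiv.swap_apply_left]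
        rw [hG, map_mul, map_sub, sx2 (p + 1) (by omega) (by omega), this,
          map_mul, map_sub, t3, t1, sub_self, zero_mul]
      have g4 : Θ (polSwap K (p + 2) (polSwap K p G)) = (X (r + 1) - X r) *
          polSwap K r (specialise k K (m ++ (k : ZMod e) :: (k : ZMod e) :: n) F) := by
        have e2 : polSwap K (p + 2) (X (p + 1 + 1)) = (X (p + 3) : Pol K) := by
          rw [polSwap_X, show p + 1 + 1 = p + 2 from rfl, Equiv.swap_apply_left]
        rw [← hrot, hG, map_mul, map_sub, sx1 _ (by omega) (by omega), polSwap_X,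
          Equiv.swap_apply_right, map_mul, map_sub, sx2 p (by omega) (by omega), e2,
          map_mul, map_sub, t3, t0]
        congr 1
        rw [hΘ, AlgHom.comp_apply]
        congr 1
        simp only [polSwap, rename_rename, wordPerm_cons, wordPerm_nil, mul_one]
        rfl
      have E2 := congrArg Θ E1
      simp only [map_mul, map_sub, map_add, g1, g2, g3, g4, t0, t1, t2, t3] at E2
      rw [neg_one_zsmul]
      apply divDiff_eq_of_mul
      apply mul_left_cancel₀ (X_sub_X_ne_zero (K := K) (i := r + 1) (j := r) (by omega))
      have : specialise k K (m ++ (k : ZMod e) :: (k : ZMod e) :: n) (polSwap K (p + 1) D) = Θ D :=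
        rfl
      rw [this]
      linear_combination -E2
    · subst ha
      have hφ : phi k (m ++ (k : ZMod e) :: b :: n) = M ++ (k : ZMod (e + 1)) ::
          ((k : ZMod (e + 1)) + 1) :: up k b :: phi k n := by
        simp [phi_append, phi, phiVertex_self, phiVertex_of_ne hb, hM]
      have hw : starWord k p (k : ZMod e) b = [p, p + 1] := by simp [starWord, hb]
      have hsg : (starSign k (k : ZMod e) b : ℤ) = 1 := by simp [starSign, hb]
      rw [hw] at hrot ⊢
      rw [hsg, one_smul, demazure_of_ne _ (Ne.symm hb)]
      simp only [wordPol, act_cons, act_nil, LinearMap.comp_apply, LinearMap.id_apply, hφ, s1,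
        swapAt]
      rw [cp1 _ _ _ _ _ rfl, cp _ _ _ _ rfl, demazure_of_ne _ (up_ne_of_ne hk hb).symm,
        demazure_of_ne _ (up_ne_succ hk b).symm, cyc_up_succ hk hb, pow_zero, one_mul,
        ← up_self hk, cyc_up_up hk hb, map_mul, map_pow, map_sub, specialise_X, specialise_X, i0,
        i1]
      have l1 : (phiVertex k (k : ZMod e)).length = 2 := by rw [length_phiVertex, if_pos rfl]
      have l2 : (phiVertex k b).length = 1 := by rw [length_phiVertex, if_neg hb]
      have j0 : blockIdx k (b :: (k : ZMod e) :: n) 0 = 0 := by simp [blockIdx, l2]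
      have j1 : blockIdx k (b :: (k : ZMod e) :: n) 1 = 1 := by simp [blockIdx, l1, l2]
      rw [j0, j1, add_zero, ← hrot]
      congr 2
      simp only [polSwap, rename_rename, wordPerm_cons, wordPerm_nil, mul_one]
      rfl
  · by_cases hb : b = k
    · subst hb
      have hφ : phi k (m ++ a :: (k : ZMod e) :: n) = M ++ up k a :: (k : ZMod (e + 1)) ::
          ((k : ZMod (e + 1)) + 1) :: phi k n := by
        simp [phi_append, phi, phiVertex_self, phiVertex_of_ne ha, hM]
      have hw : starWord k p a (k : ZMod e) = [p + 1, p] := by simp [starWord, ha]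
      have hsg : (starSign k a (k : ZMod e) : ℤ) = 1 := by simp [starSign, ha]
      rw [hw] at hrot ⊢
      rw [hsg, one_smul, demazure_of_ne _ ha]
      simp only [wordPol, act_cons, act_nil, LinearMap.comp_apply, LinearMap.id_apply, hφ, s0,
        swapAt]
      rw [cp1 _ _ _ _ _ rfl, cp _ _ _ _ rfl, demazure_of_ne _ (up_ne_of_ne hk ha),
        demazure_of_ne _ (up_ne_succ hk a), cyc_succ_up hk, cyc_self_up hk, pow_zero, one_mul,
        map_mul, map_pow, map_sub, specialise_X, specialise_X, i1,
        show p + 1 + 1 = p + 2 from rfl, i2]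
      have l1 : (phiVertex k (k : ZMod e)).length = 2 := by rw [length_phiVertex, if_pos rfl]
      have l2 : (phiVertex k a).length = 1 := by rw [length_phiVertex, if_neg ha]
      have j0 : blockIdx k ((k : ZMod e) :: a :: n) 1 = 0 := by simp [blockIdx, l1]
      have j1 : blockIdx k ((k : ZMod e) :: a :: n) 2 = 1 := by simp [blockIdx, l1, l2]
      rw [j0, j1, add_zero, ← hrot]
      congr 2
      simp only [polSwap, rename_rename, wordPerm_cons, wordPerm_nil, mul_one]
      rfl
    · have hφ : phi k (m ++ a :: b :: n) = M ++ up k a :: up k b :: phi k n := by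
        simp [phi_append, phi, phiVertex_of_ne ha, phiVertex_of_ne hb, hM]
      have hw : starWord k p a b = [p] := by simp [starWord, ha, hb]
      have hsg : (starSign k a b : ℤ) = 1 := by simp [starSign, ha]
      rw [hw] at hrot ⊢
      rw [hsg, one_smul]
      simp only [wordPol, act_nil, LinearMap.comp_apply, LinearMap.id_apply, hφ]
      rw [cp _ _ _ _ rfl]
      have l1 : (phiVertex k a).length = 1 := by rw [length_phiVertex, if_neg ha]
      have l2 : (phiVertex k b).length = 1 := by rw [length_phiVertex, if_neg hb]
      have j0 : blockIdx k (b :: a :: n) 0 = 0 := by simp [blockIdx, l2]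
      have j1 : blockIdx k (b :: a :: n) 1 = 1 := by simp [blockIdx, l1, l2]
      simp only [wordPerm_cons, wordPerm_nil, mul_one] at hrot
      by_cases hab : a = b
      · subst hab
        rw [demazure_self, demazure_self]
        apply divDiff_eq_of_mul
        rw [← hrot]
        have := congrArg (specialise k K (m ++ a :: a :: n)) (mul_divDiff p F)
        rw [map_mul, map_sub, map_sub, specialise_X, specialise_X, i0, i1, j0, j1, add_zero] at this
        exact this
      · rw [demazure_of_ne _ hab, demazure_of_ne _ (fun h => hab (up_injective h)),
          cyc_up_up hk hb, map_mul, map_pow, map_sub, specialise_X, specialise_X, i0, i1, j0, j1,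
          add_zero, ← hrot]
        rfl

omit hk in
theorem wordPol_append {I : Type*} [DecidableEq I] (h : I → I → ℕ) (l : List I) (u u' : List ℕ)
    (F : Pol K) : wordPol h K l (u ++ u') F = wordPol h K (act u' l) u (wordPol h K l u' F) := by
  induction u with
  | nil => rfl
  | cons r u ih =>
    rw [List.cons_append, wordPol, wordPol, LinearMap.comp_apply, LinearMap.comp_apply, ih,
      act_append]

/-- The specialisation intertwines the word replacing a word of crossings with that word. -/
theorem specialise_thickWord (he : 1 < e) (l : List (ZMod e)) (u : List ℕ)
    (hu : ∀ r ∈ u, r + 1 < l.length) (F : Pol K) :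
    (thickSign k l u : ℤ) • specialise k K (act u l)
        (wordPol (cyc (e + 1)) K (phi k l) (thickWord k l u) F) =
      wordPol (cyc e) K l u (specialise k K l F) := by
  induction u with
  | nil => simp [thickSign, thickWord, wordPol]
  | cons r u ih =>
    have hr := hu r (by simp)
    have ih := ih fun s hs => hu s (by simp [hs])
    obtain ⟨m, a, b, n, hl, hm⟩ := exists_split_pair (act u l) r (by rwa [length_act])
    have hs : swapAt r (act u l) = m ++ b :: a :: n := by rw [hl, ← hm, swapAt_append_pair]
    have hsg : thickSign k l (r :: u) = starSign k a b * thickSign k l u := by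
      rw [thickSign, dif_pos (by rwa [length_act])]
      congr 2 <;> simp [hl, ← hm]
    rw [hsg, wordPol, LinearMap.comp_apply, ← ih, crossPol_split _ hl hm, act_cons, hs, thickWord,
      wordPol_append, act_thickWord_phi, hl, ← hm, stepWord_append, map_zsmul,
      ← specialise_starWord hk he, smul_smul, Units.val_mul, mul_comm]

end Specialisation

/-! ### Admissible specialisations and unordered sequences -/

section Admissible

open MvPolynomial

variable {e k : ℕ} [NeZero e]

/-- An identification `θ` of the variables at the positions of `w` is admissible if it separates
the positions with equal labels, and if each position with label `k + 1` is identified with an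
earlier position with label `k`. -/
structure Admissible (k : ℕ) (w : List (ZMod (e + 1))) (θ : ℕ → ℕ) : Prop where
  eq_of_eq : ∀ i j c, w[i]? = some c → w[j]? = some c → θ i = θ j → i = j
  exists_lt : ∀ q, w[q]? = some ((k : ZMod (e + 1)) + 1) →
    ∃ p < q, w[p]? = some (k : ZMod (e + 1)) ∧ θ p = θ q

theorem count_take {α : Type*} [DecidableEq α] (l : List α) (r : ℕ) (c : α) :
    (l.take r).count c = ((Finset.range r).filter fun q => l[q]? = some c).card := by
  induction r with
  | zero => simp
  | succ r ih =>
    rw [List.take_add_one, List.count_append, ih, Finset.range_add_one, Finset.filter_insert]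
    cases h : l[r]? with
    | none => simp
    | some a =>
      by_cases hac : a = c
      · subst hac; simp
      · simp [hac]

/-- An admissible identification maps the entries `k + 1` injectively to earlier entries `k`. -/
theorem Unordered.not_admissible {w : List (ZMod (e + 1))} (hw : Unordered k w) (θ : ℕ → ℕ) :
    ¬ Admissible k w θ := by
  intro hθ
  obtain ⟨r, hr⟩ := hw
  rw [count_take, count_take] at hr
  refine absurd hr (not_lt.mpr ?_)
  choose! p hlt hp hpθ using hθ.exists_lt
  refine Finset.card_le_card_of_injOn p ?_ ?_
  · intro q hq
    simp only [Finset.coe_filter, Finset.mem_range, Set.mem_ofPred_eq] at hq ⊢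
    exact ⟨(hlt q hq.2).trans hq.1, hp q hq.2⟩
  · intro q hq q' hq' hqq
    simp only [Finset.coe_filter, Finset.mem_range, Set.mem_ofPred_eq] at hq hq'
    exact hθ.eq_of_eq q q' _ hq.2 hq'.2 (by rw [← hpθ q hq.2, hqq, hpθ q' hq'.2])

/-- Admissibility persists under an exchange of adjacent strands, unless the exchanged strands
form a pair which the identification joins. -/
theorem Admissible.comp_swap {l : List (ZMod (e + 1))} {r : ℕ} {θ : ℕ → ℕ}
    (hθ : Admissible k (swapAt r l) θ) (hr : r + 1 < l.length)
    (hne : l[r]? = some ((k : ZMod (e + 1)) + 1) → l[r + 1]? = some (k : ZMod (e + 1)) →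
      θ r ≠ θ (r + 1)) : Admissible k l (θ ∘ Equiv.swap r (r + 1)) := by
  have hs : ∀ q, (swapAt r l)[Equiv.swap r (r + 1) q]? = l[q]? := fun q => by
    rw [getElem?_swapAt r l hr, Equiv.swap_apply_self]
  constructor
  · intro i j c hi hj hij
    rw [← hs] at hi hj
    exact (Equiv.swap r (r + 1)).injective (hθ.eq_of_eq _ _ c hi hj hij)
  · intro q hq
    obtain ⟨p, hpq, hp, hpθ⟩ := hθ.exists_lt _ ((hs q).trans hq)
    rw [getElem?_swapAt r l hr] at hp
    refine ⟨Equiv.swap r (r + 1) p, ?_, hp, by simpa using hpθ⟩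
    have hnot : ¬ (p = r ∧ q = r) := by
      rintro ⟨rfl, rfl⟩
      rw [Equiv.swap_apply_left] at hp hpθ
      exact hne hq hp hpθ
    rw [Equiv.swap_apply_def] at hpq ⊢
    split_ifs at hpq ⊢ <;> omega

variable (k) in
/-- The vectors of polynomials which vanish under all admissible identifications. -/
def vanishing (K : Type*) [Field K] (N : ℕ) : Submodule K (PolSeq K (ZMod (e + 1)) N) where
  carrier := {F | ∀ w θ, Admissible k w.1 θ → rename θ (F w) = 0}
  add_mem' := fun {F G} hF hG w θ h => by
    rw [Pi.add_apply, map_add, hF w θ h, hG w θ h, add_zero]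
  zero_mem' := fun w θ _ => by rw [Pi.zero_apply, map_zero]
  smul_mem' := fun c F hF w θ h => by rw [Pi.smul_apply, map_smul, hF w θ h, smul_zero]

variable {K : Type*} [Field K]

/-- The vanishing vectors are stable under crossings: where the exchange is not admissible, the
factor of the crossing against the arrow vanishes. -/
theorem opT_mem_vanishing {N : ℕ} (r : ℕ) {F : PolSeq K (ZMod (e + 1)) N}
    (hF : F ∈ vanishing k K N) : opT (cyc (e + 1)) K N r F ∈ vanishing k K N := by
  intro w θ hθ
  change rename θ (crossPol (cyc (e + 1)) (swapAt r w.1) r (F (swapVec r w))) = 0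
  by_cases hr : r + 1 < w.1.length
  swap
  · rw [crossPol_of_le _ _ _ (by rw [length_swapAt]; omega), LinearMap.zero_apply, map_zero]
  obtain ⟨m, b, a, n, hw, hm⟩ := exists_split_pair w.1 r hr
  have hl : swapAt r w.1 = m ++ a :: b :: n := by rw [hw, ← hm, swapAt_append_pair]
  have hswap : ∀ G : Pol K, rename θ (polSwap K r G) = rename (θ ∘ Equiv.swap r (r + 1)) G :=
    fun G => by rw [polSwap, rename_rename]
  have hadm := Admissible.comp_swap (k := k) (l := swapAt r w.1) (r := r) (θ := θ)
    (by rwa [swapAt_swapAt]) (by rwa [length_swapAt])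
  have e0 : (swapAt r w.1)[r]? = some a := by rw [hl, ← hm]; simp
  have e1 : (swapAt r w.1)[r + 1]? = some b := by rw [hl, ← hm]; simp
  have w0 : w.1[r]? = some b := by simp [hw, ← hm]
  have w1 : w.1[r + 1]? = some a := by simp [hw, ← hm]
  rw [e0, e1] at hadm
  rw [crossPol_split _ hl hm]
  by_cases hab : a = b
  · subst hab
    have hθr : θ (r + 1) ≠ θ r := fun h => by
      have := hθ.eq_of_eq _ _ _ w1 w0 h
      omega
    rw [demazure_self]
    have key := congrArg (rename θ) (mul_divDiff r (F (swapVec r w)))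
    rw [map_mul, map_sub, map_sub, hswap, hF (swapVec r w) θ (by rwa [swapVec_val, hl, ← hw]),
      hF (swapVec r w) _ (hadm fun _ _ h => hθr h.symm), sub_zero, rename_X, rename_X] at key
    exact (mul_eq_zero.mp key).resolve_left (X_sub_X_ne_zero hθr)
  · rw [demazure_of_ne _ hab, map_mul, hswap]
    by_cases hex : a = (k : ZMod (e + 1)) + 1 ∧ b = (k : ZMod (e + 1)) ∧ θ r = θ (r + 1)
    · obtain ⟨rfl, rfl, h⟩ := hex
      rw [cyc_self_succ, pow_one, map_sub, rename_X, rename_X, h, sub_self, zero_mul]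
    · rw [hF (swapVec r w) _ (hadm fun h1 h2 h3 => hex ⟨Option.some.inj h1, Option.some.inj h2, h3⟩),
        mul_zero]

theorem polRep_mem_vanishing {N : ℕ} (c : KLR K (cyc (e + 1)) N) :
    ∀ {F : PolSeq K (ZMod (e + 1)) N}, F ∈ vanishing k K N →
      polRep (cyc (e + 1)) N c F ∈ vanishing k K N := by
  induction c using klr_induction with
  | hc c =>
    intro F hF
    rw [AlgHom.commutes]
    exact Submodule.smul_mem _ c hF
  | hE v =>
    intro F hF w θ hθ
    rw [polRep_klrE]
    change rename θ (polAt v (F v) w) = 0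
    by_cases hw : w = v
    · rw [hw, polAt_self, ← hw]; exact hF w θ hθ
    · rw [polAt_ne hw, map_zero]
  | hX r hr =>
    intro F hF w θ hθ
    rw [polRep_klrX _ hr]
    change rename θ (X r * F w) = 0
    rw [map_mul, hF w θ hθ, mul_zero]
  | hT r hr =>
    intro F hF
    rw [polRep_klrT]
    exact opT_mem_vanishing r hF
  | hadd a b ha hb =>
    intro F hF
    rw [map_add]
    exact add_mem (ha hF) (hb hF)
  | hmul a b ha hb =>
    intro F hF
    rw [map_mul]
    exact ha (hb hF)

theorem klrE_mem_vanishing {N : ℕ} {un : List.Vector (ZMod (e + 1)) N} (hun : Unordered k un.1)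
    (F : PolSeq K (ZMod (e + 1)) N) :
    polRep (cyc (e + 1)) N (klrE K _ un) F ∈ vanishing k K N := by
  intro w θ hθ
  rw [polRep_klrE]
  change rename θ (polAt un (F un) w) = 0
  by_cases hw : w = un
  · rw [hw] at hθ; exact absurd hθ (hun.not_admissible θ)
  · rw [polAt_ne hw, map_zero]

variable (hk : k < e)
include hk

theorem getElem?_phi_blockPos (l : List (ZMod e)) (r : ℕ) :
    (phi k l)[blockPos k l r]? = l[r]?.map (up k) := by
  induction l generalizing r with
  | nil => simp [phi]
  | cons i l ih =>
    rcases r with _ | r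
    · obtain ⟨m, hm⟩ := exists_phiVertex_eq_cons hk i
      simp [phi, blockPos, hm]
    · rw [phi, blockPos, List.getElem?_append_right (by omega), Nat.add_sub_cancel_left, ih,
        List.getElem?_cons_succ]

/-- The specialisation of a doubled sequence is admissible. -/
theorem admissible_blockIdx (l : List (ZMod e)) : Admissible k (phi k l) (blockIdx k l) := by
  have hne := succ_ne_self hk
  have fst : ∀ l₁ l₂, (phi k (l₁ ++ (k : ZMod e) :: l₂))[(phi k l₁).length]? =
      some (k : ZMod (e + 1)) := fun l₁ l₂ => by simp [phi_append, phi, phiVertex_self]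
  have snd : ∀ l₁ l₂, (phi k (l₁ ++ (k : ZMod e) :: l₂))[(phi k l₁).length + 1]? =
      some ((k : ZMod (e + 1)) + 1) := fun l₁ l₂ => by simp [phi_append, phi, phiVertex_self]
  constructor
  · intro i j c hi hj hij
    rcases eq_blockPos_or (k := k) l i with h1 | ⟨l₁, l₂, hl', h1, h1'⟩ <;>
      rcases eq_blockPos_or (k := k) l j with h2 | ⟨l₃, l₄, hl, h2, h2'⟩
    · rw [h1, h2, hij]
    · rw [h1, hij, h2', hl, fst] at hi
      rw [h2, hl, snd, ← hi] at hj
      exact absurd (Option.some.inj hj) hne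
    · rw [h2, ← hij, h1', hl', fst] at hj
      rw [h1, hl', snd, ← hj] at hi
      exact absurd (Option.some.inj hi) hne
    · rw [hij, h2'] at h1'
      omega
  · intro q hq
    rcases eq_blockPos_or (k := k) l q with h1 | ⟨l₁, l₂, rfl, h1, h1'⟩
    · rw [h1, getElem?_phi_blockPos hk] at hq
      obtain ⟨i, -, hi⟩ := Option.map_eq_some_iff.mp hq
      exact absurd hi (up_ne_succ hk i)
    · refine ⟨(phi k l₁).length, by omega, fst l₁ l₂, ?_⟩
      rw [← h1', blockIdx_blockPos]

end Admissible

/-! ### Related elements of the two KLR algebras -/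

section Related

open MvPolynomial

variable {e k : ℕ} [NeZero e] {K : Type*} [Field K] {α : ZMod e → ℕ}

variable (k K α) in
/-- The map between the polynomial representations which specialises the polynomials at the
sequences `φ(v)`, for `v ∈ I^α`, and forgets the others. -/
noncomputable def evalPhi :
    PolSeq K (ZMod (e + 1)) (∑ j, phiDim k α j) →ₗ[K] PolSeq K (ZMod e) (∑ i, α i) :=
  LinearMap.pi fun v => if hv : v ∈ seqsOf α then
    (specialise k K v.1).toLinearMap ∘ₗ LinearMap.proj (phiVec k v hv) else 0

theorem evalPhi_of_mem (F) (v : List.Vector (ZMod e) (∑ i, α i)) (hv : v ∈ seqsOf α) :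
    evalPhi k K α F v = specialise k K v.1 (F (phiVec k v hv)) := by
  rw [evalPhi, LinearMap.pi_apply, dif_pos hv]; rfl

theorem evalPhi_of_notMem (F) (v : List.Vector (ZMod e) (∑ i, α i)) (hv : v ∉ seqsOf α) :
    evalPhi k K α F v = 0 := by
  rw [evalPhi, LinearMap.pi_apply, dif_neg hv]; rfl

variable (k) in
/-- The elements `a` and `b` of the KLR algebras are related if they are intertwined by the
specialisation of the polynomial representations. -/
def Related (α : ZMod e → ℕ) (a : KLR K (cyc e) (∑ i, α i))
    (b : KLR K (cyc (e + 1)) (∑ j, phiDim k α j)) : Prop :=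
  ∀ F, evalPhi k K α (polRep (cyc (e + 1)) _ b F) = polRep (cyc e) _ a (evalPhi k K α F)

variable {a a' : KLR K (cyc e) (∑ i, α i)} {b b' : KLR K (cyc (e + 1)) (∑ j, phiDim k α j)}

theorem Related.mul (h : Related k α a b) (h' : Related k α a' b') :
    Related k α (a * a') (b * b') := fun F => by
  rw [map_mul, map_mul, Module.End.mul_apply, Module.End.mul_apply, h, h']

theorem Related.add (h : Related k α a b) (h' : Related k α a' b') :
    Related k α (a + a') (b + b') := fun F => by
  rw [map_add, map_add, LinearMap.add_apply, LinearMap.add_apply, map_add, h, h']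

theorem Related.smul (c : K) (h : Related k α a b) : Related k α (c • a) (c • b) := fun F => by
  rw [map_smul, map_smul, LinearMap.smul_apply, LinearMap.smul_apply, map_smul, h]

theorem Related.sub (h : Related k α a b) (h' : Related k α a' b') :
    Related k α (a - a') (b - b') := fun F => by
  rw [map_sub, map_sub, LinearMap.sub_apply, LinearMap.sub_apply, map_sub, h, h']

theorem related_zero : Related k α (0 : KLR K (cyc e) (∑ i, α i)) 0 := fun F => by
  rw [map_zero, map_zero, LinearMap.zero_apply, LinearMap.zero_apply, map_zero]

theorem related_one : Related k α (1 : KLR K (cyc e) (∑ i, α i)) 1 := fun F => by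
  rw [map_one, map_one]; rfl

theorem Related.sum {ι : Type*} {s : Finset ι} {a : ι → KLR K (cyc e) (∑ i, α i)}
    {b : ι → KLR K (cyc (e + 1)) (∑ j, phiDim k α j)} (h : ∀ i ∈ s, Related k α (a i) (b i)) :
    Related k α (∑ i ∈ s, a i) (∑ i ∈ s, b i) := by
  classical
  induction s using Finset.induction_on with
  | empty => exact related_zero
  | insert i s hi ih =>
    rw [Finset.sum_insert hi, Finset.sum_insert hi]
    exact (h i (by simp)).add (ih fun j hj => h j (by simp [hj]))

theorem polRep_klrE_apply {I : Type*} [DecidableEq I] [Fintype I] (h : I → I → ℕ) {d : ℕ}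
    (v : List.Vector I d) (F : PolSeq K I d) : polRep h d (klrE K h v) F = polAt v (F v) := by
  rw [polRep_klrE]; rfl

/-- The idempotent `e(α)` acts as the identity on the image of the specialisation. -/
theorem related_mul_idemSum_iff :
    Related k α (a * idemSum K (cyc e) (seqsOf α)) b ↔ Related k α a b := by
  have key : ∀ F, polRep (cyc e) _ (idemSum K (cyc e) (seqsOf α)) (evalPhi k K α F) =
      evalPhi k K α F := fun F => by
    rw [idemSum, map_sum, LinearMap.sum_apply]
    conv_rhs => rw [← sum_polAt (evalPhi k K α F)]
    rw [← Finset.sum_subset (Finset.subset_univ (seqsOf α))]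
    · exact Finset.sum_congr rfl fun v _ => polRep_klrE_apply _ v _
    · intro v _ hv
      rw [evalPhi_of_notMem F v hv, map_zero]
  refine forall_congr' fun F => ?_
  rw [map_mul, Module.End.mul_apply, key]

variable (hk : k < e)
include hk

theorem evalPhi_eq_zero_of_mem_vanishing {F} (hF : F ∈ vanishing k K (∑ j, phiDim k α j)) :
    evalPhi k K α F = 0 := by
  funext v
  by_cases hv : v ∈ seqsOf α
  · rw [evalPhi_of_mem F v hv]
    exact hF _ _ (admissible_blockIdx hk v.1)
  · exact evalPhi_of_notMem F v hv

/-- Elements factoring through unordered sequences are related to zero, since unordered sequences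
have no admissible identifications and the vanishing vectors form a submodule. -/
theorem related_zero_unordered {un : List.Vector (ZMod (e + 1)) (∑ j, phiDim k α j)}
    (hun : Unordered k un.1) (c c' : KLR K (cyc (e + 1)) (∑ j, phiDim k α j)) :
    Related k α 0 (c * klrE K _ un * c') := fun F => by
  rw [map_mul, map_mul, Module.End.mul_apply, Module.End.mul_apply, map_zero,
    LinearMap.zero_apply]
  exact evalPhi_eq_zero_of_mem_vanishing hk (polRep_mem_vanishing c (klrE_mem_vanishing hun _))

theorem phiVec_injective {v w : List.Vector (ZMod e) (∑ i, α i)} {hv : v ∈ seqsOf α}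
    {hw : w ∈ seqsOf α} (h : phiVec k v hv = phiVec k w hw) : v = w :=
  Subtype.ext (phi_injective hk (congrArg Subtype.val h))

theorem evalPhi_polAt (v : List.Vector (ZMod e) (∑ i, α i)) (hv : v ∈ seqsOf α) (g : Pol K) :
    evalPhi k K α (polAt (phiVec k v hv) g) = polAt v (specialise k K v.1 g) := by
  funext w
  by_cases hw : w ∈ seqsOf α
  · rw [evalPhi_of_mem _ w hw]
    by_cases hwv : w = v
    · subst hwv; rw [polAt_self, polAt_self]
    · rw [polAt_ne hwv, polAt_ne (fun h => hwv (phiVec_injective hk h)), map_zero]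
  · rw [evalPhi_of_notMem _ w hw, polAt_ne]
    rintro rfl; exact hw hv

theorem related_mul_klrE_iff (v : List.Vector (ZMod e) (∑ i, α i)) (hv : v ∈ seqsOf α) :
    Related k α (a * klrE K _ v) (b * klrE K _ (phiVec k v hv)) ↔
      ∀ g, evalPhi k K α (polRep (cyc (e + 1)) _ b (polAt (phiVec k v hv) g)) =
        polRep (cyc e) _ a (polAt v (specialise k K v.1 g)) := by
  constructor
  · intro h g
    have := h (polAt (phiVec k v hv) g)
    rwa [map_mul, map_mul, Module.End.mul_apply, Module.End.mul_apply, polRep_klrE_apply,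
      polRep_klrE_apply, polAt_self, evalPhi_polAt hk, polAt_self] at this
  · intro h F
    rw [map_mul, map_mul, Module.End.mul_apply, Module.End.mul_apply, polRep_klrE_apply,
      polRep_klrE_apply, h, evalPhi_of_mem F v hv]

theorem related_klrE (v : List.Vector (ZMod e) (∑ i, α i)) (hv : v ∈ seqsOf α) :
    Related k α (klrE K _ v) (klrE K _ (phiVec k v hv)) := by
  have := (related_mul_klrE_iff (K := K) (a := 1) (b := 1) hk v hv).mpr fun g => by
    rw [map_one, map_one]
    exact evalPhi_polAt hk v hv g
  rwa [one_mul, one_mul] at this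

/-- The truncation of polynomials which kills the variables beyond the first `d`. -/
noncomputable def truncPol (K : Type*) [Field K] (d : ℕ) : Pol K →ₐ[K] Pol K :=
  aeval fun r => if r < d then X r else 0

omit hk in
theorem polRep_polX {I : Type*} [DecidableEq I] [Fintype I] (h : I → I → ℕ) (d : ℕ) (f : Pol K) :
    polRep h d (polX h d f) = opPol K I d (truncPol K d f) := by
  have : (polRep h d).comp (polX h d) = (opPol K I d).comp (truncPol K d) := by
    refine MvPolynomial.algHom_ext fun r => ?_
    rw [AlgHom.comp_apply, AlgHom.comp_apply, polX_X, truncPol, aeval_X]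
    split_ifs with hr
    · exact polRep_klrX h hr
    · rw [klrX_of_le h (by omega), map_zero, map_zero]
  exact congrArg (fun f' => f' f) this

omit hk in
theorem polX_truncPol {I : Type*} [DecidableEq I] [Fintype I] (h : I → I → ℕ) (d : ℕ)
    (f : Pol K) : polX h d (truncPol K d f) = polX h d f := by
  have : (polX h d).comp (truncPol K d) = polX h d := by
    refine MvPolynomial.algHom_ext fun r => ?_
    rw [AlgHom.comp_apply, polX_X, truncPol, aeval_X]
    split_ifs with hr
    · exact polX_X d r
    · rw [klrX_of_le h (by omega), map_zero]
  exact congrArg (fun f' => f' f) this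

omit hk in
theorem specialise_truncPol (v : List.Vector (ZMod e) (∑ i, α i)) (hv : v ∈ seqsOf α)
    (f : Pol K) : specialise k K v.1
      (truncPol K (∑ j, phiDim k α j) (rename (blockPos k v.1) f)) =
        truncPol K (∑ i, α i) f := by
  have hlen : (phi k v.1).length = ∑ j, phiDim k α j := (phiVec k v hv).2
  have : ((specialise k K v.1).comp (truncPol K (∑ j, phiDim k α j))).comp
      (rename (blockPos k v.1)) = truncPol K (∑ i, α i) := by
    refine MvPolynomial.algHom_ext fun r => ?_
    rw [AlgHom.comp_apply, AlgHom.comp_apply, rename_X, truncPol, truncPol, aeval_X, aeval_X]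
    by_cases hr : r < ∑ i, α i
    · have := blockPos_lt (k := k) v.1 r (by rwa [v.2])
      rw [if_pos hr, if_pos (by rwa [← hlen]), specialise_X, blockIdx_blockPos]
    · have := blockPos_of_le (k := k) v.1 r (by rw [v.2]; omega)
      rw [if_neg hr, if_neg (by omega), map_zero]
  exact congrArg (fun f' => f' f) this

omit hk in
theorem klrE_mul_polX_klrE {I : Type*} [DecidableEq I] [Fintype I] {h : I → I → ℕ} {d : ℕ}
    (a : KLR K h d) (f : Pol K) (v : List.Vector I d) :
    a * klrE K h v * (polX h d f * klrE K h v) = a * polX h d f * klrE K h v := by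
  rw [polX_mul_klrE, mul_assoc, ← mul_assoc (klrE K h v), klrE_mul_self, ← polX_mul_klrE,
    mul_assoc]

theorem related_polX (v : List.Vector (ZMod e) (∑ i, α i)) (hv : v ∈ seqsOf α) (f : Pol K) :
    Related k α (polX _ _ f * klrE K _ v)
      (polX _ _ (rename (blockPos k v.1) f) * klrE K _ (phiVec k v hv)) := by
  refine (related_mul_klrE_iff hk v hv).mpr fun g => ?_
  rw [polRep_polX, polRep_polX, opPol_polAt, opPol_polAt, evalPhi_polAt hk, map_mul,
    specialise_truncPol v hv]

theorem related_klrX (v : List.Vector (ZMod e) (∑ i, α i)) (hv : v ∈ seqsOf α) (r : ℕ)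
    (hr : r < ∑ i, α i) :
    Related k α (klrX K _ _ r * klrE K _ v)
      (klrX K _ _ (shiftPos k v.1 r) * klrE K _ (phiVec k v hv)) := by
  have := related_polX (K := K) hk v hv (X r)
  rwa [rename_X, polX_X, polX_X, blockPos_eq_shiftPos (k := k) v.1 r (by rw [v.2]; omega)] at this

omit hk in
theorem actVec_mem_seqsOf {I : Type*} [Fintype I] [DecidableEq I] {α : I → ℕ} (u : List ℕ)
    {v : List.Vector I (∑ i, α i)} (hv : v ∈ seqsOf α) : actVec u v ∈ seqsOf α :=
  mem_seqsOf.mpr fun i => ((act_perm u v.1).count_eq i).trans (mem_seqsOf.mp hv i)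

omit hk in
theorem actVec_thickWord_phiVec (v : List.Vector (ZMod e) (∑ i, α i)) (hv : v ∈ seqsOf α)
    (u : List ℕ) : actVec (thickWord k v.1 u) (phiVec k v hv) =
      phiVec k (actVec u v) (actVec_mem_seqsOf u hv) :=
  Subtype.ext (act_thickWord_phi v.1 u)

/-- A word of crossings is related, up to a sign, to the word of crossings of blocks. -/
theorem related_tauWord (he : 1 < e) (v : List.Vector (ZMod e) (∑ i, α i)) (hv : v ∈ seqsOf α)
    (u : List ℕ) (hu : ∀ r ∈ u, r + 1 < ∑ i, α i) :
    Related k α (tauWord K _ _ u * klrE K _ v)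
      ((((thickSign k v.1 u : ℤ) : K) • tauWord K _ _ (thickWord k v.1 u)) *
        klrE K _ (phiVec k v hv)) := by
  refine (related_mul_klrE_iff hk v hv).mpr fun g => ?_
  rw [map_smul, LinearMap.smul_apply, polRep_tauWord_polAt, polRep_tauWord_polAt, map_smul,
    actVec_thickWord_phiVec v hv, evalPhi_polAt hk, ← map_smul,
    ← specialise_thickWord hk he v.1 u (by rwa [v.2]) g, Int.cast_smul_eq_zsmul]
  rfl

theorem related_tauWord_polX (he : 1 < e) (v : List.Vector (ZMod e) (∑ i, α i))
    (hv : v ∈ seqsOf α) (u : List ℕ) (hu : ∀ r ∈ u, r + 1 < ∑ i, α i) (f : Pol K) :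
    Related k α (tauWord K _ _ u * polX _ _ f * klrE K _ v)
      (((thickSign k v.1 u : ℤ) : K) • (tauWord K _ _ (thickWord k v.1 u) *
        polX _ _ (rename (blockPos k v.1) f) * klrE K _ (phiVec k v hv))) := by
  have := (related_tauWord (K := K) hk he v hv u hu).mul (related_polX hk v hv f)
  rwa [klrE_mul_polX_klrE, smul_mul_assoc, smul_mul_assoc, klrE_mul_polX_klrE] at this

omit hk in
theorem crossStar_eq (d p : ℕ) (i j : ZMod e) :
    crossStar k K d p i j =
      ((starSign k i j : ℤ) : K) • tauWord K (cyc (e + 1)) d (starWord k p i j) := by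
  unfold crossStar starSign starWord
  split_ifs with hi hj hj <;> simp_all [mul_assoc]
  exact (neg_one_smul K _).symm

theorem related_klrT (he : 1 < e) (v : List.Vector (ZMod e) (∑ i, α i)) (hv : v ∈ seqsOf α)
    (r : ℕ) (hr : r + 1 < ∑ i, α i) :
    Related k α (klrT K _ _ r * klrE K _ v)
      (crossStar k K _ (shiftPos k v.1 r) (v.get ⟨r, Nat.lt_of_succ_lt hr⟩) (v.get ⟨r + 1, hr⟩) *
        klrE K _ (phiVec k v hv)) := by
  have := related_tauWord (K := K) hk he v hv [r] (by simpa using hr)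
  have hlen : r + 1 < v.1.length := by rwa [v.2]
  have e1 : thickWord k v.1 [r] = starWord k (shiftPos k v.1 r) v.1[r] v.1[r + 1] := by
    change stepWord k v.1 r ++ [] = _
    rw [List.append_nil, stepWord, dif_pos hlen]
  have e2 : thickSign k v.1 [r] = starSign k v.1[r] v.1[r + 1] := by
    change (if hr : r + 1 < v.1.length then starSign k v.1[r] v.1[r + 1] else 1) * 1 = _
    rw [mul_one, dif_pos hlen]
  rw [e1, e2, ← crossStar_eq, tauWord_cons, tauWord_nil, mul_one] at this
  exact this

end Related

/-! ### Normal forms -/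

section Expansion

variable {K : Type*} [Field K] {I : Type*} [DecidableEq I] [Fintype I] {h : I → I → ℕ}

/-- The set of all permutations of `0, …, d - 1`, as lists. -/
def permsOf (d : ℕ) : Finset (List ℕ) := (List.range d).permutations.toFinset

theorem mem_permsOf {d : ℕ} {t : List ℕ} : t ∈ permsOf d ↔ t.Perm (List.range d) := by
  rw [permsOf, List.mem_toFinset, List.mem_permutations]

/-- A choice of a reduced word for each permutation. -/
noncomputable def redWord (d : ℕ) (t : List ℕ) : List ℕ :=
  open Classical in if ht : t.Perm (List.range d) then (exists_sorts ht).choose else []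

theorem sorts_redWord {d : ℕ} {t : List ℕ} (ht : t.Perm (List.range d)) :
    Sorts d (redWord d t) t := by
  rw [redWord, dif_pos ht]
  exact (exists_sorts ht).choose_spec

variable (K h) in
/-- The linear combination `∑ τ_{u(t)} f_t(x) e(v)` over the permutations `t ∈ T`, where `u(t)` is a
word chosen for `t`. -/
noncomputable def normalForm {d : ℕ} (v : List.Vector I d) (u : List ℕ → List ℕ) :
    (List ℕ → Pol K) →ₗ[K] (Finset (List ℕ) → KLR K h d) where
  toFun f T := ∑ t ∈ T, tauWord K h d (u t) * polX h d (f t) * klrE K h v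
  map_add' f g := by
    funext T
    rw [Pi.add_apply, ← Finset.sum_add_distrib]
    exact Finset.sum_congr rfl fun t _ => by rw [Pi.add_apply, map_add, mul_add, add_mul]
  map_smul' c f := by
    funext T
    rw [Pi.smul_apply, Finset.smul_sum]
    exact Finset.sum_congr rfl fun t _ => by
      rw [Pi.smul_apply, map_smul, mul_smul_comm, smul_mul_assoc]; rfl

theorem normalForm_apply {d : ℕ} (v : List.Vector I d) (u : List ℕ → List ℕ)
    (f : List ℕ → Pol K) (T : Finset (List ℕ)) : normalForm K h v u f T =
      ∑ t ∈ T, tauWord K h d (u t) * polX h d (f t) * klrE K h v := rfl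

theorem normalForm_single {d : ℕ} (v : List.Vector I d) (u : List ℕ → List ℕ) (t : List ℕ)
    (f : Pol K) (T : Finset (List ℕ)) (ht : t ∈ T) : normalForm K h v u (Pi.single t f) T =
      tauWord K h d (u t) * polX h d f * klrE K h v := by
  rw [normalForm_apply, Finset.sum_eq_single_of_mem t ht, Pi.single_eq_same]
  intro s _ hs
  rw [Pi.single_eq_of_ne hs, map_zero, mul_zero, zero_mul]

/-- The elements `τ_w f(x) e(v)`, for one reduced word `w` of each permutation, span. -/
theorem exists_normalForm {d : ℕ} (a : KLR K h d) (v : List.Vector I d) :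
    ∃ f, a * klrE K h v = normalForm K h v (redWord d) f (permsOf d) := by
  obtain ⟨f, hf⟩ := klr_span_induction
    (LinearMap.range (LinearMap.proj (permsOf d) ∘ₗ normalForm K h v (redWord d))) v
    (fun t ht => ⟨_, sorts_redWord ht, fun f =>
      ⟨Pi.single t f, normalForm_single v _ t f _ (mem_permsOf.mpr ht)⟩⟩) a
  exact ⟨f, hf.symm⟩

theorem polRep_normalForm {d : ℕ} (v : List.Vector I d) (u : List ℕ → List ℕ)
    (f : List ℕ → Pol K) (T : Finset (List ℕ)) (g : Pol K) :
    polRep h d (normalForm K h v u f T) (polAt v g) = ∑ t ∈ T, polAt (actVec (u t) v)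
      (wordPol h K v.1 (u t) (truncPol K d (f t) * g)) := by
  rw [normalForm_apply, map_sum, LinearMap.sum_apply]
  refine Finset.sum_congr rfl fun t _ => ?_
  rw [map_mul, map_mul, Module.End.mul_apply, Module.End.mul_apply, polRep_klrE_apply, polAt_self,
    polRep_polX, opPol_polAt, polRep_tauWord_polAt]

/-- The coefficients of a normal form which acts by zero vanish. They are truncated because the
variables beyond the first `d` are sent to `0` in the KLR algebra. -/
theorem truncPol_eq_zero_of_normalForm {d : ℕ} (v : List.Vector I d) (f : List ℕ → Pol K)
    (h0 : ∀ g, polRep h d (normalForm K h v (redWord d) f (permsOf d)) (polAt v g) = 0) :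
    ∀ t ∈ permsOf d, truncPol K d (f t) = 0 := by
  refine wordPol_independent h v.1 v.2 (redWord d) (permsOf d)
    (fun t ht => sorts_redWord (mem_permsOf.mp ht)) (fun t => truncPol K d (f t)) fun g => ?_
  have := h0 g
  rw [polRep_normalForm] at this
  have h1 := congrArg (fun F : PolSeq K I d => ∑ w, F w) this
  simp only [Finset.sum_apply, Pi.zero_apply, Finset.sum_const_zero] at h1
  rw [Finset.sum_comm] at h1
  rw [← h1]
  refine Finset.sum_congr rfl fun t _ => ?_
  rw [Finset.sum_eq_single_of_mem (actVec (redWord d t) v) (Finset.mem_univ _), polAt_self]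
  intro w _ hw
  exact polAt_ne hw _

/-- The polynomial representation is faithful: an element which kills the polynomials at `v` has
vanishing coefficients in its normal form. -/
theorem mul_klrE_eq_zero {d : ℕ} (a : KLR K h d) (v : List.Vector I d)
    (h0 : ∀ g, polRep h d a (polAt v g) = 0) : a * klrE K h v = 0 := by
  obtain ⟨f, hf⟩ := exists_normalForm a v
  have := truncPol_eq_zero_of_normalForm v f fun g => by
    rw [← hf, map_mul, Module.End.mul_apply, polRep_klrE_apply, polAt_self, h0]
  rw [hf, normalForm_apply]
  refine Finset.sum_eq_zero fun t ht => ?_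
  rw [← polX_truncPol, this t ht, map_zero, mul_zero, zero_mul]

theorem klrE_mul_idemSum {d : ℕ} {s : Finset (List.Vector I d)} (v : List.Vector I d) :
    klrE K h v * idemSum K h s = if v ∈ s then klrE K h v else 0 := by
  rw [idemSum, Finset.mul_sum]
  split_ifs with hv
  · rw [Finset.sum_eq_single_of_mem v hv fun w _ hw => klrE_mul_of_ne (Ne.symm hw), klrE_mul_self]
  · exact Finset.sum_eq_zero fun w hw => klrE_mul_of_ne (by rintro rfl; exact hv hw)

theorem idemSum_mul_klrE {d : ℕ} {s : Finset (List.Vector I d)} (v : List.Vector I d) :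
    idemSum K h s * klrE K h v = if v ∈ s then klrE K h v else 0 := by
  rw [idemSum, Finset.sum_mul]
  split_ifs with hv
  · rw [Finset.sum_eq_single_of_mem v hv fun w _ hw => klrE_mul_of_ne hw, klrE_mul_self]
  · exact Finset.sum_eq_zero fun w hw => klrE_mul_of_ne (by rintro rfl; exact hv hw)

/-- The idempotent `e(α)` is central. -/
theorem idemSum_seqsOf_comm (α : I → ℕ) (a : KLR K h (∑ i, α i)) :
    idemSum K h (seqsOf α) * a = a * idemSum K h (seqsOf α) := by
  induction a using klr_induction with
  | hc c => exact (Algebra.commutes c _).symm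
  | hE v => rw [klrE_mul_idemSum, idemSum_mul_klrE]
  | hX r hr =>
    rw [idemSum, Finset.mul_sum, Finset.sum_mul]
    exact Finset.sum_congr rfl fun v _ => (klrX_mul_klrE r v).symm
  | hT r hr =>
    have hmem : ∀ v ∈ seqsOf α, swapVec r v ∈ seqsOf α := fun v hv => mem_seqsOf.mpr fun i =>
      ((swapAt_perm r v.1).count_eq i).trans (mem_seqsOf.mp hv i)
    rw [idemSum, Finset.mul_sum, Finset.sum_mul]
    exact Finset.sum_nbij' (swapVec r) (swapVec r) hmem hmem (fun v _ => swapVec_swapVec r v)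
      (fun v _ => swapVec_swapVec r v) fun v _ => by rw [klrT_mul_klrE, swapVec_swapVec]
  | hadd a b ha hb => rw [mul_add, add_mul, ha, hb]
  | hmul a b ha hb => rw [← mul_assoc, ha, mul_assoc, hb, mul_assoc]

end Expansion

/-! ### The balanced algebra -/

section Balanced

open MvPolynomial

variable {e k : ℕ} [NeZero e] {K : Type*} [Field K] {α : ZMod e → ℕ}

variable (k K) in
/-- The idempotent of the well-ordered sequences. -/
noncomputable abbrev ordIdem (β : ZMod (e + 1) → ℕ) : KLR K (cyc (e + 1)) (∑ j, β j) :=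
  idemSum K (cyc (e + 1)) (ordSeqs k β)

variable (k K) in
/-- The span of the elements factoring through unordered sequences. -/
noncomputable def nilSpan (β : ZMod (e + 1) → ℕ) : Submodule K (KLR K (cyc (e + 1)) (∑ j, β j)) :=
  Submodule.span K {x | ∃ un ∈ seqsOf β, Unordered k un.1 ∧ ∃ a b,
    x = ordIdem k K β * (a * klrE K _ un * b) * ordIdem k K β}

theorem toBalanced_eq_zero {β : ZMod (e + 1) → ℕ} {x} (hx : x ∈ nilSpan k K β) :
    ∀ b : OrdCorner k K β, b.1 = x → toBalanced k K β b = 0 := by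
  suffices ∃ b : OrdCorner k K β, b.1 = x ∧ toBalanced k K β b = 0 by
    obtain ⟨b, rfl, hb⟩ := this
    intro b' hb'
    rwa [Subtype.ext hb']
  induction hx using Submodule.span_induction with
  | mem x hx =>
    obtain ⟨un, hmem, hun, a, b, rfl⟩ := hx
    refine ⟨toCorner (isIdempotentElem_idemSum K (cyc (e + 1)) (ordSeqs k β))
      (a * klrE K _ un * b), rfl, ?_⟩
    rw [toBalanced, RingQuot.mkAlgHom_rel K (BalancedRel.unord un hmem hun a b), map_zero]
  | zero => exact ⟨0, rfl, map_zero _⟩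
  | add x y _ _ hx hy =>
    obtain ⟨b, rfl, hb⟩ := hx
    obtain ⟨b', rfl, hb'⟩ := hy
    exact ⟨b + b', rfl, by rw [map_add, hb, hb', add_zero]⟩
  | smul c x _ hx =>
    obtain ⟨b, rfl, hb⟩ := hx
    exact ⟨c • b, rfl, by rw [map_smul, hb]; exact smul_zero (M := K) (A := BalancedKLR k K β) c⟩

theorem truncPol_rename_blockPos (v : List.Vector (ZMod e) (∑ i, α i)) (hv : v ∈ seqsOf α)
    (f : Pol K) : truncPol K (∑ j, phiDim k α j) (rename (blockPos k v.1) f) =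
      rename (blockPos k v.1) (truncPol K (∑ i, α i) f) := by
  have hlen : (phi k v.1).length = ∑ j, phiDim k α j := (phiVec k v hv).2
  have : (truncPol K (∑ j, phiDim k α j)).comp (rename (blockPos k v.1)) =
      (rename (blockPos k v.1)).comp (truncPol K (∑ i, α i)) := by
    refine MvPolynomial.algHom_ext fun r => ?_
    rw [AlgHom.comp_apply, AlgHom.comp_apply, rename_X, truncPol, truncPol, aeval_X, aeval_X]
    by_cases hr : r < ∑ i, α i
    · have := blockPos_lt (k := k) v.1 r (by rwa [v.2])
      rw [if_pos hr, if_pos (by rwa [← hlen]), rename_X]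
    · have := blockPos_of_le (k := k) v.1 r (by rw [v.2]; omega)
      rw [if_neg hr, if_neg (by omega), map_zero]
  exact congrArg (fun f' => f' f) this

theorem specialise_rename_blockPos (l : List (ZMod e)) (f : Pol K) :
    specialise k K l (rename (blockPos k l) f) = f := by
  rw [specialise, rename_rename, show blockIdx k l ∘ blockPos k l = id from
    funext fun r => blockIdx_blockPos l r, rename_id_apply]

variable (hk : k < e)
include hk

theorem phiVec_mem_ordSeqs (v : List.Vector (ZMod e) (∑ i, α i)) (hv : v ∈ seqsOf α) :
    phiVec k v hv ∈ ordSeqs k (phiDim k α) := by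
  classical
  rw [ordSeqs, Finset.mem_filter, mem_seqsOf]
  refine ⟨fun j => ?_, wellOrdered_phi hk v.1⟩
  change (phi k v.1).count j = _
  rw [count_phi]
  exact Finset.sum_congr rfl fun i _ => by rw [mem_seqsOf.mp hv i]

theorem exists_phiVec_eq {w : List.Vector (ZMod (e + 1)) (∑ j, phiDim k α j)}
    (hw : w ∈ ordSeqs k (phiDim k α)) : ∃ v hv, phiVec k (α := α) v hv = w := by
  classical
  rw [ordSeqs, Finset.mem_filter, mem_seqsOf] at hw
  obtain ⟨l, hl, hc⟩ := exists_phi_eq hk hw.2 hw.1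
  exact ⟨⟨l, length_eq_of_count hc⟩, mem_seqsOf.mpr hc, Subtype.ext hl⟩

theorem ordIdem_eq : ordIdem k K (phiDim k α) =
    ∑ v ∈ (seqsOf α).attach, klrE K (cyc (e + 1)) (phiVec k v.1 v.2) := by
  symm
  refine Finset.sum_bij (fun v _ => phiVec k v.1 v.2) (fun v _ => phiVec_mem_ordSeqs hk _ _)
    (fun v _ w _ h => Subtype.ext (phiVec_injective hk h)) (fun w hw => ?_) fun _ _ => rfl
  obtain ⟨v, hv, rfl⟩ := exists_phiVec_eq hk hw
  exact ⟨⟨v, hv⟩, by simp, rfl⟩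

theorem klrE_phiVec_mul_ordIdem (v : List.Vector (ZMod e) (∑ i, α i)) (hv : v ∈ seqsOf α) :
    klrE K (cyc (e + 1)) (phiVec k v hv) * ordIdem k K (phiDim k α) =
      klrE K (cyc (e + 1)) (phiVec k v hv) := by
  rw [klrE_mul_idemSum, if_pos (phiVec_mem_ordSeqs hk v hv)]

theorem ordIdem_mul_klrE_phiVec (v : List.Vector (ZMod e) (∑ i, α i)) (hv : v ∈ seqsOf α) :
    ordIdem k K (phiDim k α) * klrE K (cyc (e + 1)) (phiVec k v hv) =
      klrE K (cyc (e + 1)) (phiVec k v hv) := by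
  rw [idemSum_mul_klrE, if_pos (phiVec_mem_ordSeqs hk v hv)]

theorem unordered_mem_nilSpan {un : List.Vector (ZMod (e + 1)) (∑ j, phiDim k α j)}
    (hmem : un ∈ seqsOf (phiDim k α)) (hun : Unordered k un.1)
    (v : List.Vector (ZMod e) (∑ i, α i)) (hv : v ∈ seqsOf α)
    (c c' : KLR K (cyc (e + 1)) (∑ j, phiDim k α j)) :
    ordIdem k K (phiDim k α) * (c * klrE K _ un * c' * klrE K _ (phiVec k v hv)) ∈
      nilSpan k K (phiDim k α) := by
  refine Submodule.subset_span ⟨un, hmem, hun, c, c' * klrE K _ (phiVec k v hv), ?_⟩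
  rw [mul_assoc (ordIdem k K _), mul_assoc (c * klrE K _ un), mul_assoc (c * klrE K _ un),
    mul_assoc c', klrE_phiVec_mul_ordIdem hk]

theorem swapVec_phiVec_unordered (v : List.Vector (ZMod e) (∑ i, α i)) (hv : v ∈ seqsOf α)
    {v₁ v₂ : List (ZMod e)} (hl : v.1 = v₁ ++ (k : ZMod e) :: v₂) :
    swapVec (phi k v₁).length (phiVec k v hv) ∈ seqsOf (phiDim k α) ∧
      Unordered k (swapVec (phi k v₁).length (phiVec k v hv)).1 := by
  classical
  constructor
  · have := (Finset.mem_filter.mp (phiVec_mem_ordSeqs hk v hv)).1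
    exact mem_seqsOf.mpr fun j =>
      ((swapAt_perm _ _).count_eq j).trans (mem_seqsOf.mp this j)
  · have := unordered_swapAt hk v₁ v₂
    rw [← hl] at this
    exact this

/-- Modulo the elements factoring through unordered sequences, the variables of a doubled strand
are equal: their difference is the square of the crossing of the two strands. -/
theorem polX_sub_mem_nilSpan (he : 1 < e) (v : List.Vector (ZMod e) (∑ i, α i))
    (hv : v ∈ seqsOf α) (f : Pol K) : ∀ c : KLR K (cyc (e + 1)) (∑ j, phiDim k α j),
    ordIdem k K (phiDim k α) * (c * (polX _ _ f -
      polX _ _ (rename (blockPos k v.1) (specialise k K v.1 f))) * klrE K _ (phiVec k v hv)) ∈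
        nilSpan k K (phiDim k α) := by
  induction f using MvPolynomial.induction_on with
  | C a =>
    intro c
    rw [specialise, rename_C, rename_C, sub_self, mul_zero, zero_mul, mul_zero]
    exact zero_mem _
  | add p q hp hq =>
    intro c
    have := add_mem (hp c) (hq c)
    rw [← mul_add, ← add_mul, ← mul_add] at this
    rwa [map_add, map_add, map_add, map_add, add_sub_add_comm]
  | mul_X p j hp =>
    intro c
    have hX : ∀ c, ordIdem k K (phiDim k α) * (c * (polX (cyc (e + 1)) _ (X j) -
        polX _ _ (rename (blockPos k v.1) (specialise k K v.1 (X j)))) *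
          klrE K _ (phiVec k v hv)) ∈ nilSpan k K (phiDim k α) := by
      intro c
      rw [specialise_X, rename_X]
      -- the variable at the start of a block is not changed; the difference of the two variables of
      -- a pair is `Q_{k,k+1}`, the square of the crossing at the pair
      rcases eq_blockPos_or (k := k) v.1 j with h1 | ⟨v₁, v₂, hl, h1, h2⟩
      · rw [← h1, sub_self, mul_zero, zero_mul, mul_zero]
        exact zero_mem _
      · have hφ : (phiVec k v hv).1 = phi k v₁ ++ (k : ZMod (e + 1)) ::
            ((k : ZMod (e + 1)) + 1) :: phi k v₂ := by
          change phi k v.1 = _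
          simp [hl, phi_append, phi, phiVertex_self]
        have hsq := klrT_sq (K := K) (h := cyc (e + 1)) hφ rfl
        have hQ : klrQ (cyc (e + 1)) (k : ZMod (e + 1)) ((k : ZMod (e + 1)) + 1)
            (X (phi k v₁).length : Pol K) (X ((phi k v₁).length + 1)) =
              X ((phi k v₁).length + 1) - X (phi k v₁).length := by
          rw [klrQ, if_neg (succ_ne_self hk).symm, cyc_self_succ, cyc_succ_self he, pow_one,
            pow_zero, mul_one]
        obtain ⟨hmem, hun⟩ := swapVec_phiVec_unordered hk v hv hl
        have := unordered_mem_nilSpan (K := K) hk hmem hun v hv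
          (c * klrT K _ _ (phi k v₁).length) (klrT K _ _ (phi k v₁).length)
        rw [mul_assoc _ (klrE K _ _) (klrT K _ _ _), ← klrT_mul_klrE, mul_assoc _ _ (klrE K _ _),
          mul_assoc _ (klrE K _ _) (klrE K _ _), klrE_mul_self, mul_assoc c, ← mul_assoc (klrT K _ _ _),
          hsq, hQ] at this
        rwa [h2, h1, ← map_sub, mul_assoc]
    have := add_mem (hX (c * polX _ _ p))
      (hp (c * polX _ _ (rename (blockPos k v.1) (specialise k K v.1 (X j)))))
    rw [← mul_add, ← add_mul] at this
    convert this using 3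
    simp only [map_mul, mul_sub, ← mul_assoc]
    have hcomm : c * polX (cyc (e + 1)) _ (rename (blockPos k v.1) (specialise k K v.1 (X j))) *
        polX _ _ p = c * polX _ _ p *
          polX _ _ (rename (blockPos k v.1) (specialise k K v.1 (X j))) := by
      rw [mul_assoc, ← map_mul, mul_comm _ p, map_mul, ← mul_assoc]
    have hcomm' : c * polX (cyc (e + 1)) (∑ j, phiDim k α j)
          (rename (blockPos k v.1) (specialise k K v.1 (X j))) *
        polX _ _ (rename (blockPos k v.1) (specialise k K v.1 p)) =
        c * polX _ _ (rename (blockPos k v.1) (specialise k K v.1 p)) *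
          polX _ _ (rename (blockPos k v.1) (specialise k K v.1 (X j))) := by
      rw [mul_assoc, ← map_mul, mul_comm, map_mul, ← mul_assoc]
    rw [hcomm, hcomm']
    abel

/-- The corner at the well-ordered sequences is spanned, modulo the elements factoring through
unordered sequences, by the words of thick crossings with polynomials in the variables of the
blocks. -/
theorem exists_thick_normalForm (he : 1 < e) (v : List.Vector (ZMod e) (∑ i, α i))
    (hv : v ∈ seqsOf α) (c : KLR K (cyc (e + 1)) (∑ j, phiDim k α j)) :
    ∃ f : List ℕ → Pol K, ordIdem k K (phiDim k α) * (c * klrE K _ (phiVec k v hv)) -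
      normalForm K (cyc (e + 1)) (phiVec k v hv) (fun t => thickWord k v.1 (redWord (∑ i, α i) t))
        (fun t => rename (blockPos k v.1) (f t)) (permsOf (∑ i, α i)) ∈
          nilSpan k K (phiDim k α) := by
  classical
  set ν : (List ℕ → Pol K) →ₗ[K] KLR K (cyc (e + 1)) (∑ j, phiDim k α j) :=
    LinearMap.proj (permsOf (∑ i, α i)) ∘ₗ normalForm K (cyc (e + 1)) (phiVec k v hv)
      (fun t => thickWord k v.1 (redWord (∑ i, α i) t)) ∘ₗ
        LinearMap.pi fun t => (rename (blockPos k v.1)).toLinearMap ∘ₗ LinearMap.proj t with hν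
  suffices c * klrE K _ (phiVec k v hv) ∈ (LinearMap.range ν ⊔ nilSpan k K (phiDim k α)).comap
      (LinearMap.mulLeft K (ordIdem k K (phiDim k α))) by
    obtain ⟨y, ⟨f, rfl⟩, z, hz, hyz⟩ := Submodule.mem_sup.mp this
    refine ⟨f, ?_⟩
    have hyz' : ordIdem k K (phiDim k α) * (c * klrE K _ (phiVec k v hv)) = ν f + z := hyz.symm
    rw [hyz']
    convert hz using 1
    exact add_sub_cancel_left _ _
  refine klr_span_induction _ _ (fun t ht => ?_) c
  obtain ⟨u, hu⟩ := exists_sorts ht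
  have hβ := (Finset.mem_filter.mp (phiVec_mem_ordSeqs hk v hv)).1
  have hmem := actVec_mem_seqsOf u hβ
  -- words which do not lead to a well-ordered sequence are killed by the idempotent
  by_cases hwo : WellOrdered k (actVec u (phiVec k v hv)).1
  swap
  · refine ⟨u, hu, fun f => ?_⟩
    have hno : actVec u (phiVec k v hv) ∉ ordSeqs k (phiDim k α) := fun h =>
      hwo (Finset.mem_filter.mp h).2
    rw [Submodule.mem_comap, LinearMap.mulLeft_apply, mul_assoc (tauWord K _ _ u), polX_mul_klrE,
      ← mul_assoc (tauWord K _ _ u), tauWord_mul_klrE, ← mul_assoc, ← mul_assoc,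
      idemSum_mul_klrE, if_neg hno, zero_mul, zero_mul]
    exact zero_mem _
  obtain ⟨v', _, hv'⟩ := exists_phiVec_eq hk (Finset.mem_filter.mpr ⟨hmem, hwo⟩)
  have hlen : (phi k v.1).length = ∑ j, phiDim k α j := (phiVec k v hv).2
  -- if a pair is inverted, a reduced word may start with the crossing of the pair and factors
  -- through an unordered sequence; otherwise a reduced word of block crossings is chosen
  rcases desc_or_exists_thickPos (v := v.1) (v' := v'.1) (t := t) (u := u) hk (by rwa [hlen])
    (by rw [hlen, hu.act_eq]) (congrArg Subtype.val hv').symm with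
    ⟨v₁, v₂, hl, hd⟩ | ⟨z, hz, rfl⟩
  · obtain ⟨w, hw⟩ := exists_sorts ((swapAt_perm (phi k v₁).length t).trans ht)
    refine ⟨_, hw.append_of_desc hd, fun f => Submodule.mem_sup_right ?_⟩
    obtain ⟨hmem, hun⟩ := swapVec_phiVec_unordered hk v hv hl
    have := unordered_mem_nilSpan (K := K) hk hmem hun v hv (tauWord K _ _ w)
      (klrT K _ _ (phi k v₁).length * polX _ _ f)
    rw [mul_assoc (tauWord K _ _ w), ← mul_assoc (klrE K _ _) (klrT K _ _ _), ← klrT_mul_klrE,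
      mul_assoc (klrT K _ _ _), ← polX_mul_klrE, ← mul_assoc (klrT K _ _ _),
      mul_assoc (tauWord K _ _ w) _ (klrE K _ _), mul_assoc _ (klrE K _ _) (klrE K _ _),
      klrE_mul_self, ← mul_assoc (tauWord K _ _ w), ← mul_assoc (tauWord K _ _ w)] at this
    rwa [LinearMap.mulLeft_apply, tauWord_append, tauWord_cons, tauWord_nil, mul_one]
  · have hzl : z.length = ∑ i, α i := by rw [← v.2, ← List.length_map (f := Prod.fst), hz]
    have hnd := perm_range_nodup ht
    have hn : (z.map Prod.snd).Nodup := (separated_of_nodup hnd).2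
    set s := standardize (z.map Prod.snd) with hs
    have hsp : s.Perm (List.range (∑ i, α i)) := by
      have := standardize_perm hn
      rwa [List.length_map, hzl] at this
    have hsort := sorts_thickWord ht (separated_of_nodup hnd).1 hn
      (u := redWord (∑ i, α i) s) (by rw [hzl]; exact sorts_redWord hsp)
    rw [hz] at hsort
    refine ⟨_, hsort, fun f => ?_⟩
    have h1 := polX_sub_mem_nilSpan hk he v hv f
      (tauWord K _ _ (thickWord k v.1 (redWord (∑ i, α i) s)))
    have h2 : ordIdem k K (phiDim k α) * (tauWord K _ _ (thickWord k v.1 (redWord (∑ i, α i) s)) *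
        polX _ _ (rename (blockPos k v.1) (specialise k K v.1 f)) * klrE K _ (phiVec k v hv)) =
          ν (Pi.single s (specialise k K v.1 f)) := by
      rw [mul_assoc, polX_mul_klrE, ← mul_assoc (tauWord K _ _ _), tauWord_mul_klrE,
        actVec_thickWord_phiVec, ← mul_assoc, ← mul_assoc, ordIdem_mul_klrE_phiVec hk,
        ← actVec_thickWord_phiVec v hv, ← tauWord_mul_klrE, mul_assoc, ← polX_mul_klrE, ← mul_assoc]
      symm
      have : (fun t => rename (blockPos k v.1) ((Pi.single s (specialise k K v.1 f) : List ℕ → Pol K) t)) =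
          (Pi.single s (rename (blockPos k v.1) (specialise k K v.1 f)) : List ℕ → Pol K) := by
        funext t
        by_cases hts : t = s
        · subst hts; rw [Pi.single_eq_same, Pi.single_eq_same]
        · rw [Pi.single_eq_of_ne hts, Pi.single_eq_of_ne hts, map_zero]
      have hνf : ∀ g, ν g = normalForm K (cyc (e + 1)) (phiVec k v hv)
          (fun t => thickWord k v.1 (redWord (∑ i, α i) t))
          (fun t => rename (blockPos k v.1) (g t)) (permsOf (∑ i, α i)) := fun g => rfl
      rw [hνf, this]
      exact normalForm_single _ _ s _ _ (mem_permsOf.mpr hsp)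
    have h3 := Submodule.add_mem_sup (LinearMap.mem_range_self ν (Pi.single s (specialise k K v.1 f)))
      h1
    rw [← h2, ← mul_add, ← add_mul, ← mul_add, add_sub_cancel] at h3
    exact h3

theorem related_zero_of_mem_nilSpan {x} (hx : x ∈ nilSpan k K (phiDim k α)) :
    Related k α 0 x := by
  induction hx using Submodule.span_induction with
  | mem x hx =>
    obtain ⟨un, -, hun, a, b, rfl⟩ := hx
    have := related_zero_unordered (K := K) hk hun (ordIdem k K (phiDim k α) * a)
      (b * ordIdem k K (phiDim k α))
    rwa [mul_assoc _ a, ← mul_assoc _ b, mul_assoc _ _ b] at this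
  | zero => exact related_zero
  | add x y _ _ hx hy => simpa using hx.add hy
  | smul c x _ hx => simpa using hx.smul c

/-- An element of the KLR algebra of `Γ_{e + 1}` determines the related element of `R_α`, because
the polynomial representation is faithful and the specialisation is surjective. -/
theorem eq_of_related {a a' : KLR K (cyc e) (∑ i, α i)} {b}
    (h : Related k α a b) (h' : Related k α a' b) :
    a * idemSum K _ (seqsOf α) = a' * idemSum K _ (seqsOf α) := by
  rw [← sub_eq_zero, ← sub_mul, idemSum, Finset.mul_sum]
  have h0 : Related k α (a - a') 0 := by simpa using h.sub h'
  refine Finset.sum_eq_zero fun v hv => mul_klrE_eq_zero _ v fun g => ?_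
  have := h0 (polAt (phiVec k v hv) (MvPolynomial.rename (blockPos k v.1) g))
  rw [map_zero, LinearMap.zero_apply, map_zero, evalPhi_polAt hk,
    specialise_rename_blockPos] at this
  exact this.symm

theorem related_idemSum : Related k α (idemSum K _ (seqsOf α)) (ordIdem k K (phiDim k α)) := by
  rw [ordIdem_eq hk, idemSum, ← Finset.sum_attach]
  exact Related.sum fun v _ => related_klrE hk v.1 v.2

/-- A relation is preserved on passing to the corner of the well-ordered sequences. -/
theorem Related.corner {a : KLR K (cyc e) (∑ i, α i)} {b} (h : Related k α a b) :
    Related k α a (ordIdem k K (phiDim k α) * b * ordIdem k K (phiDim k α)) := by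
  have := ((related_idemSum (K := K) hk).mul h).mul (related_idemSum hk)
  rwa [related_mul_idemSum_iff, idemSum_seqsOf_comm, related_mul_idemSum_iff] at this

theorem sum_mul_klrE_phiVec (b : OrdCorner k K (phiDim k α)) :
    ∑ v ∈ (seqsOf α).attach, ordIdem k K (phiDim k α) *
      (b.1 * klrE K _ (phiVec k v.1 v.2)) = b.1 := by
  obtain ⟨h1, h2⟩ := (Subsemigroup.mem_corner_iff
    (isIdempotentElem_idemSum K (cyc (e + 1)) (ordSeqs k (phiDim k α)))).mp b.2
  rw [← Finset.mul_sum, ← Finset.mul_sum, ← ordIdem_eq hk, ← mul_assoc, h1, h2]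

/-- The normal forms of the two KLR algebras are related. -/
theorem related_normalForm (he : 1 < e) (v : List.Vector (ZMod e) (∑ i, α i)) (hv : v ∈ seqsOf α)
    (f : List ℕ → Pol K) : Related k α
      (normalForm K (cyc e) v (redWord (∑ i, α i))
        (fun t => ((thickSign k v.1 (redWord (∑ i, α i) t) : ℤ) : K) • f t)
        (permsOf (∑ i, α i)))
      (normalForm K (cyc (e + 1)) (phiVec k v hv)
        (fun t => thickWord k v.1 (redWord (∑ i, α i) t))
        (fun t => MvPolynomial.rename (blockPos k v.1) (f t)) (permsOf (∑ i, α i))) := by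
  rw [normalForm_apply, normalForm_apply]
  refine Related.sum fun t ht => ?_
  have := (related_tauWord_polX (K := K) hk he v hv (redWord _ t)
    (sorts_redWord (mem_permsOf.mp ht)).lt_of_mem (f t)).smul
      ((thickSign k v.1 (redWord (∑ i, α i) t) : ℤ) : K)
  rw [smul_smul, ← Int.cast_mul, ← Units.val_mul, Int.units_mul_self, Units.val_one, Int.cast_one,
    one_smul] at this
  rwa [map_smul, mul_smul_comm, smul_mul_assoc]

/-- Every element of the corner is related to an element of the KLR algebra of `Γ_e`, by comparison
of the spanning sets. -/
theorem exists_related_of_corner (he : 1 < e) (b : OrdCorner k K (phiDim k α)) :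
    ∃ a, Related k α a b.1 := by
  have key : ∀ v : {v // v ∈ seqsOf α}, ∃ a, Related k α a
      (ordIdem k K (phiDim k α) * (b.1 * klrE K _ (phiVec k v.1 v.2))) := fun v => by
    obtain ⟨f, hf⟩ := exists_thick_normalForm (K := K) hk he v.1 v.2 b.1
    have := (related_zero_of_mem_nilSpan hk hf).add (related_normalForm hk he v.1 v.2 f)
    rw [sub_add_cancel] at this
    exact ⟨_, this⟩
  choose a ha using key
  refine ⟨∑ v ∈ (seqsOf α).attach, a v, ?_⟩
  rw [← sum_mul_klrE_phiVec hk b]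
  exact Related.sum fun v _ => ha v

/-- The elements related to zero are exactly those which factor through unordered sequences: the
thick normal form of such an element is related to a normal form which acts by zero. -/
theorem mem_nilSpan_of_related_zero (he : 1 < e) (b : OrdCorner k K (phiDim k α))
    (hb : Related k α 0 b.1) : b.1 ∈ nilSpan k K (phiDim k α) := by
  rw [← sum_mul_klrE_phiVec hk b]
  refine Submodule.sum_mem _ fun v _ => ?_
  obtain ⟨v, hv⟩ := v
  obtain ⟨f, hf⟩ := exists_thick_normalForm (K := K) hk he v hv b.1
  have h1 := (related_zero_of_mem_nilSpan hk hf).add (related_normalForm hk he v hv f)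
  have h2 := (related_idemSum (K := K) hk).mul (hb.mul (related_klrE hk v hv))
  rw [sub_add_cancel, zero_add] at h1
  rw [zero_mul, mul_zero] at h2
  have h3 := h1.sub h2
  rw [sub_self, sub_zero] at h3
  have h4 := truncPol_eq_zero_of_normalForm v _ fun g => by
    have := h3 (polAt (phiVec k v hv) (MvPolynomial.rename (blockPos k v.1) g))
    rw [map_zero, LinearMap.zero_apply, map_zero, evalPhi_polAt hk,
      specialise_rename_blockPos] at this
    exact this.symm
  have h5 : normalForm K (cyc (e + 1)) (phiVec k v hv)
        (fun t => thickWord k v.1 (redWord (∑ i, α i) t))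
        (fun t => MvPolynomial.rename (blockPos k v.1) (f t)) (permsOf (∑ i, α i)) = 0 := by
    rw [normalForm_apply]
    refine Finset.sum_eq_zero fun t ht => ?_
    have h6 := congrArg (((thickSign k v.1 (redWord (∑ i, α i) t) : ℤ) : K) • ·) (h4 t ht)
    simp only [map_smul, smul_zero] at h6
    rw [smul_smul, ← Int.cast_mul, ← Units.val_mul, Int.units_mul_self, Units.val_one,
      Int.cast_one, one_smul] at h6
    rw [← polX_truncPol, truncPol_rename_blockPos v hv, h6, map_zero, map_zero, mul_zero, zero_mul]
  rwa [h5, sub_zero] at hf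

/-- Every element of the KLR algebra of `Γ_e` has a related element; it suffices to treat the
generators. -/
theorem exists_related (he : 1 < e) (a : KLR K (cyc e) (∑ i, α i)) : ∃ b, Related k α a b := by
  have hsum : ∀ a : KLR K (cyc e) (∑ i, α i),
      (∀ v, ∀ hv : v ∈ seqsOf α, ∃ b, Related k α (a * klrE K _ v) b) → ∃ b, Related k α a b := by
    intro a h
    choose b hb using fun v : {v // v ∈ seqsOf α} => h v.1 v.2
    refine ⟨∑ v ∈ (seqsOf α).attach, b v, related_mul_idemSum_iff.mp ?_⟩
    rw [idemSum, Finset.mul_sum, ← Finset.sum_attach]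
    exact Related.sum fun v _ => hb v
  induction a using klr_induction with
  | hc c =>
    rw [Algebra.algebraMap_eq_smul_one]
    exact ⟨_, related_one.smul c⟩
  | hE v =>
    refine hsum _ fun w hw => ?_
    by_cases hvw : v = w
    · subst hvw
      rw [klrE_mul_self]
      exact ⟨_, related_klrE hk v hw⟩
    · rw [klrE_mul_of_ne hvw]
      exact ⟨0, related_zero⟩
  | hX r hr => exact hsum _ fun w hw => ⟨_, related_klrX hk w hw r hr⟩
  | hT r hr => exact hsum _ fun w hw => ⟨_, related_klrT hk he w hw r hr⟩
  | hadd a a' ha ha' =>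
    obtain ⟨b, hb⟩ := ha
    obtain ⟨b', hb'⟩ := ha'
    exact ⟨_, hb.add hb'⟩
  | hmul a a' ha ha' =>
    obtain ⟨b, hb⟩ := ha
    obtain ⟨b', hb'⟩ := ha'
    exact ⟨_, hb.mul hb'⟩

theorem related_toCorner {a : KLR K (cyc e) (∑ i, α i)} {b} (h : Related k α a b) :
    Related k α (alphaClass K α a).1 (toCorner (isIdempotentElem_idemSum K (cyc (e + 1))
      (ordSeqs k (phiDim k α))) b).1 :=
  ((related_idemSum (K := K) hk).mul h).mul (related_idemSum hk)

theorem corner_eq_of_related {a a' : KLRAlpha K (cyc e) α} {b}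
    (h : Related k α a.1 b) (h' : Related k α a'.1 b) : a = a' := by
  have := eq_of_related hk h h'
  have hc := fun a : KLRAlpha K (cyc e) α => ((Subsemigroup.mem_corner_iff
    (isIdempotentElem_idemSum K (cyc e) (seqsOf α))).mp a.2).2
  rw [hc, hc] at this
  exact Subtype.ext this

theorem exists_corner_related (he : 1 < e) (b : OrdCorner k K (phiDim k α)) :
    ∃ a : KLRAlpha K (cyc e) α, Related k α a.1 b.1 := by
  obtain ⟨a, ha⟩ := exists_related_of_corner hk he b
  refine ⟨alphaClass K α a, ?_⟩
  have := related_toCorner hk ha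
  obtain ⟨h1, h2⟩ := (Subsemigroup.mem_corner_iff
    (isIdempotentElem_idemSum K (cyc (e + 1)) (ordSeqs k (phiDim k α)))).mp b.2
  change Related k α _ (ordIdem k K (phiDim k α) * b.1 * ordIdem k K (phiDim k α)) at this
  rwa [h1, h2] at this

variable (K α) in
/-- The homomorphism which sends an element of the corner at the well-ordered sequences to the
related element of `R_α`. -/
noncomputable def fromCorner (he : 1 < e) :
    OrdCorner k K (phiDim k α) →ₐ[K] KLRAlpha K (cyc e) α where
  toFun b := (exists_corner_related hk he b).choose
  map_one' := corner_eq_of_related hk (exists_corner_related hk he 1).choose_spec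
    (related_idemSum hk)
  map_mul' b b' := corner_eq_of_related hk (exists_corner_related hk he (b * b')).choose_spec
    ((exists_corner_related hk he b).choose_spec.mul (exists_corner_related hk he b').choose_spec)
  map_zero' := corner_eq_of_related hk (exists_corner_related hk he 0).choose_spec related_zero
  map_add' b b' := corner_eq_of_related hk (exists_corner_related hk he (b + b')).choose_spec
    ((exists_corner_related hk he b).choose_spec.add (exists_corner_related hk he b').choose_spec)
  commutes' c := corner_eq_of_related hk (exists_corner_related hk he _).choose_spec
    ((related_idemSum hk).smul c)

theorem related_fromCorner (he : 1 < e) (b : OrdCorner k K (phiDim k α)) :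
    Related k α (fromCorner K α hk he b).1 b.1 := (exists_corner_related hk he b).choose_spec

theorem fromCorner_eq_iff (he : 1 < e) (b : OrdCorner k K (phiDim k α))
    (a : KLRAlpha K (cyc e) α) : fromCorner K α hk he b = a ↔ Related k α a.1 b.1 :=
  ⟨fun h => h ▸ related_fromCorner hk he b,
    fun h => corner_eq_of_related hk (related_fromCorner hk he b) h⟩

/-- The isomorphism `Φ` sends an element of `R_α` to the class of the related elements. -/
theorem exists_isPhi (he : 1 < e) (α : ZMod e → ℕ) :
    ∃ Φ : KLRAlpha K (cyc e) α ≃ₐ[K] BalancedKLR k K (phiDim k α), IsPhi k K α Φ ∧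
      ∀ a b, toBalanced k K (phiDim k α) b = Φ a ↔ Related k α a.1 b.1 := by
  set Ψ : BalancedKLR k K (phiDim k α) →ₐ[K] KLRAlpha K (cyc e) α :=
    RingQuot.liftAlgHom K ⟨fromCorner K α hk he, fun x y hxy => by
      obtain ⟨v, hv, hun, a, b⟩ := hxy
      rw [map_zero, fromCorner_eq_iff]
      exact related_zero_of_mem_nilSpan hk (Submodule.subset_span ⟨v, hv, hun, a, b, rfl⟩)⟩ with hΨ
  have hcl : ∀ b, Ψ (toBalanced k K _ b) = fromCorner K α hk he b := fun b =>
    RingQuot.liftAlgHom_mkAlgHom_apply K _ _ _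
  have hbij : Function.Bijective Ψ := by
    constructor
    · intro x y hxy
      obtain ⟨b, rfl⟩ := RingQuot.mkAlgHom_surjective K (BalancedRel k K (phiDim k α)) x
      obtain ⟨b', rfl⟩ := RingQuot.mkAlgHom_surjective K (BalancedRel k K (phiDim k α)) y
      have h0 : fromCorner K α hk he (b - b') = 0 := by
        rw [map_sub, sub_eq_zero, ← hcl, ← hcl]
        exact hxy
      have h1 := toBalanced_eq_zero (mem_nilSpan_of_related_zero hk he (b - b')
        ((fromCorner_eq_iff hk he _ 0).mp h0)) (b - b') rfl
      change toBalanced k K _ b = toBalanced k K _ b'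
      rw [← sub_add_cancel b b', map_add, h1, zero_add]
    · intro a
      obtain ⟨b, hb⟩ := exists_related hk he a.1
      refine ⟨balancedClass k K _ b, ?_⟩
      rw [balancedClass, hcl, fromCorner_eq_iff]
      exact hb.corner hk
  have hiff : ∀ a b, toBalanced k K (phiDim k α) b = (AlgEquiv.ofBijective Ψ hbij).symm a ↔
      Related k α a.1 b.1 := fun a b => by
    rw [AlgEquiv.eq_symm_apply, ← fromCorner_eq_iff hk he, ← hcl]
    rfl
  refine ⟨(AlgEquiv.ofBijective Ψ hbij).symm, ⟨fun v hv => ?_, fun v hv r hr => ?_,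
    fun v hv r hr => ?_⟩, hiff⟩
  · exact ((hiff _ _).mpr (related_toCorner hk (related_klrE hk v hv))).symm
  · exact ((hiff _ _).mpr (related_toCorner hk (related_klrX hk v hv r hr))).symm
  · exact ((hiff _ _).mpr (related_toCorner hk (related_klrT hk he v hv r hr))).symm

end Balanced

/-! ### Weight decompositions -/

section Weights

universe v u

variable {C : Type u} [Category.{v} C] [Preadditive C]

namespace SumDecomposition

variable {J : Type*} [Fintype J] {X : C} {f : J → C} (D : SumDecomposition X f)
include D

theorem hom_ext_left {Y : C} {g h : X ⟶ Y} (hgh : ∀ j, D.ι j ≫ g = D.ι j ≫ h) : g = h := by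
  rw [← Category.id_comp g, ← Category.id_comp h, ← D.sum_π_ι, Preadditive.sum_comp,
    Preadditive.sum_comp]
  exact Finset.sum_congr rfl fun j _ => by rw [Category.assoc, Category.assoc, hgh]

theorem hom_ext_right {Y : C} {g h : Y ⟶ X} (hgh : ∀ j, g ≫ D.π j = h ≫ D.π j) : g = h := by
  rw [← Category.comp_id g, ← Category.comp_id h, ← D.sum_π_ι, Preadditive.comp_sum,
    Preadditive.comp_sum]
  exact Finset.sum_congr rfl fun j _ => by rw [← Category.assoc, ← Category.assoc, hgh]

/-- The image of a direct sum decomposition under an additive functor. -/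
def map {C' : Type*} [Category* C'] [Preadditive C'] (G : C ⥤ C') [G.Additive] :
    SumDecomposition (G.obj X) fun j => G.obj (f j) where
  ι j := G.map (D.ι j)
  π j := G.map (D.π j)
  ι_π_self j := by rw [← G.map_comp, D.ι_π_self, G.map_id]
  ι_π_ne i j hij := by rw [← G.map_comp, D.ι_π_ne i j hij, G.map_zero]
  sum_π_ι := by
    simp_rw [← G.map_comp]
    rw [← G.map_sum, D.sum_π_ι, G.map_id]

theorem isZero (h : ∀ j, IsZero (f j)) : IsZero X := by
  rw [IsZero.iff_id_eq_zero]
  exact D.hom_ext_left fun j => (h j).eq_of_src _ _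

end SumDecomposition

variable {X Y : Type*} {wt : X → ObjectProperty C} (W : IsWeightDecomposition wt)
  {σ : Y → X} (hσ : Function.Injective σ)
include W hσ

/-- An object lies in the sum of some of the weight subcategories if and only if it receives no
morphism from the other ones. -/
theorem directSum_iff_left (M : C) : directSum (fun y => wt (σ y)) M ↔
    ∀ x, x ∉ Set.range σ → ∀ N, wt x N → ∀ f : N ⟶ M, f = 0 := by
  constructor
  · rintro ⟨s, N, hN, ⟨D⟩⟩ x hx N' hN' f
    refine D.hom_ext_right fun y => ?_
    rw [zero_comp]
    exact W.hom_eq_zero x (σ y) (by rintro rfl; exact hx ⟨_, rfl⟩) _ _ hN' (hN y) _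
  · intro h
    obtain ⟨s, N, hN, ⟨D⟩⟩ := W.decomp M
    have h0 : ∀ x : s, x.1 ∉ Set.range σ → D.ι x = 0 := fun x hx => h x.1 hx _ (hN x) _
    set j : s.preimage σ hσ.injOn → s := fun y => ⟨σ y.1, Finset.mem_preimage.mp y.2⟩ with hj
    have hinj : Function.Injective j := fun a b hab =>
      Subtype.ext (hσ (congrArg Subtype.val hab))
    refine ⟨s.preimage σ hσ.injOn, fun y => N (j y), fun y => hN (j y), ⟨?_⟩⟩
    refine ⟨fun y => D.ι (j y), fun y => D.π (j y), fun y => D.ι_π_self _,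
      fun a b hab => D.ι_π_ne _ _ (hinj.ne hab), ?_⟩
    rw [← D.sum_π_ι]
    refine Fintype.sum_of_injective j hinj _ _ (fun x hx => ?_) fun _ => rfl
    rw [h0 x, comp_zero]
    rintro ⟨y, hy⟩
    exact hx ⟨⟨y, Finset.mem_preimage.mpr (hy ▸ x.2)⟩, Subtype.ext hy⟩

/-- An object lies in the sum of some of the weight subcategories if and only if it has no
morphism to the other ones. -/
theorem directSum_iff_right (M : C) : directSum (fun y => wt (σ y)) M ↔
    ∀ x, x ∉ Set.range σ → ∀ N, wt x N → ∀ f : M ⟶ N, f = 0 := by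
  constructor
  · rintro ⟨s, N, hN, ⟨D⟩⟩ x hx N' hN' f
    refine D.hom_ext_left fun y => ?_
    rw [comp_zero]
    exact W.hom_eq_zero (σ y) x (by rintro rfl; exact hx ⟨_, rfl⟩) _ _ (hN y) hN' _
  · intro h
    rw [directSum_iff_left W hσ]
    intro x hx N hN f
    obtain ⟨s, N', hN', ⟨D⟩⟩ := W.decomp M
    refine D.hom_ext_right fun y => ?_
    rw [zero_comp]
    by_cases hyx : x = y.1
    · rw [h y.1 (hyx ▸ hx) _ (hN' y) (D.π y), comp_zero]
    · exact W.hom_eq_zero x y.1 hyx _ _ hN (hN' y) _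

theorem directSum_of_wt (y : Y) (M : C) (hM : wt (σ y) M) : directSum (fun y => wt (σ y)) M := by
  rw [directSum_iff_left W hσ]
  intro x hx N hN f
  exact W.hom_eq_zero x (σ y) (by rintro rfl; exact hx ⟨_, rfl⟩) _ _ hN hM f

/-- A functor which shifts the weights compatibly preserves the sum of weight subcategories. -/
theorem directSum_obj {G : C ⥤ C} [G.Additive] {s : Y → Y}
    (hG : ∀ y M, wt (σ y) M → wt (σ (s y)) (G.obj M)) {M : C}
    (hM : directSum (fun y => wt (σ y)) M) : directSum (fun y => wt (σ y)) (G.obj M) := by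
  obtain ⟨t, N, hN, ⟨D⟩⟩ := hM
  rw [directSum_iff_left W hσ]
  intro x hx N' hN' f
  refine (D.map G).hom_ext_right fun y => ?_
  rw [zero_comp]
  exact W.hom_eq_zero x _ (by rintro rfl; exact hx ⟨_, rfl⟩) _ _ hN' (hG _ _ (hN y)) _

theorem directSum_isClosedUnderSubobjects :
    (directSum fun y => wt (σ y)).IsClosedUnderSubobjects where
  prop_of_mono i _ hY := by
    rw [directSum_iff_left W hσ] at hY ⊢
    intro x hx N hN f
    rw [← cancel_mono i, zero_comp]
    exact hY x hx N hN _

theorem directSum_isClosedUnderQuotients :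
    (directSum fun y => wt (σ y)).IsClosedUnderQuotients where
  prop_of_epi p _ hX := by
    rw [directSum_iff_right W hσ] at hX ⊢
    intro x hx N hN f
    rw [← cancel_epi p, comp_zero]
    exact hX x hx N hN _

theorem directSum_isClosedUnderFiniteProducts :
    (directSum fun y => wt (σ y)).IsClosedUnderFiniteProducts where
  isClosedUnderLimitsOfShape J _ := ⟨fun M ⟨p⟩ => by
    rw [directSum_iff_left W hσ]
    intro x hx N hN f
    refine p.isLimit.hom_ext fun j => ?_
    rw [zero_comp]
    exact (directSum_iff_left W hσ _).mp (p.prop_diag_obj j) x hx N hN _⟩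

theorem directSum_containsZero [HasZeroObject C] : (directSum fun y => wt (σ y)).ContainsZero where
  exists_zero := by
    obtain ⟨Z, hZ⟩ := HasZeroObject.zero (C := C)
    exact ⟨Z, hZ, (directSum_iff_left W hσ _).mpr fun _ _ _ _ _ => hZ.eq_of_tgt _ _⟩

/-- The decomposition of the sum of some of the weight subcategories. -/
theorem isWeightDecomposition_directSum [HasZeroObject C] : IsWeightDecomposition fun y =>
    (wt (σ y)).inverseImage (directSum fun y => wt (σ y)).ι where
  closed_iso y := ⟨fun e h => (W.closed_iso (σ y)).of_iso
    ((directSum fun y => wt (σ y)).ι.mapIso e) h⟩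
  contains_zero y := by
    obtain ⟨Z, hZ, hZw⟩ := (W.contains_zero (σ y)).exists_zero
    refine ⟨⟨Z, directSum_of_wt W hσ y Z hZw⟩, ?_, hZw⟩
    rw [IsZero.iff_id_eq_zero]
    exact ObjectProperty.hom_ext _ (hZ.eq_of_src _ _)
  hom_eq_zero μ ν hμν M N hM hN f := ObjectProperty.hom_ext _
    (W.hom_eq_zero _ _ (hσ.ne hμν) _ _ hM hN f.hom)
  decomp M := by
    obtain ⟨s, N, hN, ⟨D⟩⟩ := M.property
    refine ⟨s, fun y => ⟨N y, directSum_of_wt W hσ y.1 _ (hN y)⟩, hN, ⟨?_⟩⟩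
    refine ⟨fun y => ObjectProperty.homMk (D.ι y), fun y => ObjectProperty.homMk (D.π y),
      fun y => ObjectProperty.hom_ext _ (D.ι_π_self y),
      fun a b hab => ObjectProperty.hom_ext _ (D.ι_π_ne a b hab), ?_⟩
    apply (directSum fun y => wt (σ y)).ι.map_injective
    rw [Functor.map_sum]
    exact D.sum_π_ι

omit hσ in
/-- There are no natural transformations between functors with different shifts of the weights. -/
theorem natTrans_eq_zero {G G' : C ⥤ C} [G.Additive] {s s' : X → X} (hs : ∀ x, s x ≠ s' x)
    (hG : ∀ x M, wt x M → wt (s x) (G.obj M)) (hG' : ∀ x M, wt x M → wt (s' x) (G'.obj M))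
    (t : G ⟶ G') : t = 0 := by
  ext M
  obtain ⟨J, N, hN, ⟨D⟩⟩ := W.decomp M
  refine (D.map G).hom_ext_left fun y => ?_
  have h0 : t.app (N y) = 0 := W.hom_eq_zero _ _ (hs y.1) _ _ (hG _ _ (hN y)) (hG' _ _ (hN y)) _
  change G.map (D.ι y) ≫ t.app M = G.map (D.ι y) ≫ 0
  rw [t.naturality, h0, zero_comp, comp_zero]

end Weights

/-! ### Abelian and Hom-finite subcategories -/

section Abelian

universe v u

variable {C : Type u} [Category.{v} C] [Abelian C] {X Y : Type*} {wt : X → ObjectProperty C}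
  (W : IsWeightDecomposition wt) {σ : Y → X} (hσ : Function.Injective σ)
include W hσ

theorem isAbelianCategory_directSum :
    IsAbelianCategory (directSum fun y => wt (σ y)).FullSubcategory := by
  have := directSum_isClosedUnderSubobjects W hσ
  have := directSum_isClosedUnderQuotients W hσ
  have := directSum_isClosedUnderFiniteProducts W hσ
  have := directSum_containsZero W hσ
  exact ⟨inferInstance, rfl⟩

omit W hσ in
theorem finite_hom_fullSubcategory {K : Type*} [Field K] [Linear K C]
    (hfin : ∀ X Y : C, Module.Finite K (X ⟶ Y)) (P : ObjectProperty C) (X Y : P.FullSubcategory) :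
    Module.Finite K (X ⟶ Y) := by
  have := hfin X.obj Y.obj
  exact Module.Finite.of_injective (P.ι.mapLinearMap K (X := X) (Y := Y)) P.ι.map_injective

end Abelian

/-! ### Direct sums of functors and adjunctions -/

section Adjunctions

universe v u v' u'

variable {C : Type u} [Category.{v} C] [Preadditive C] {D : Type u'} [Category.{v'} D]
  [Preadditive D] {J : Type*} [Fintype J] {L : C ⥤ D} {G : D ⥤ C} {Li : J → C ⥤ D}
  {Gi : J → D ⥤ C} (dL : SumDecomposition L Li) (dG : SumDecomposition G Gi)

namespace SumDecomposition
include dL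

theorem ι_π_self_app (j : J) (X : C) : (dL.ι j).app X ≫ (dL.π j).app X = 𝟙 _ :=
  congrArg (fun t => t.app X) (dL.ι_π_self j)

theorem ι_π_ne_app (i j : J) (hij : i ≠ j) (X : C) : (dL.ι i).app X ≫ (dL.π j).app X = 0 :=
  congrArg (fun t => t.app X) (dL.ι_π_ne i j hij)

/-- The decomposition of the values of a direct sum of functors. -/
def app (X : C) : SumDecomposition (L.obj X) fun j => (Li j).obj X where
  ι j := (dL.ι j).app X
  π j := (dL.π j).app X
  ι_π_self j := dL.ι_π_self_app j X
  ι_π_ne i j hij := dL.ι_π_ne_app i j hij X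
  sum_π_ι := by
    have := congrArg (fun t => t.app X) dL.sum_π_ι
    rw [NatTrans.app_sum] at this
    exact this

theorem map_eq {X Y : C} (f : X ⟶ Y) (j : J) :
    (Li j).map f = (dL.ι j).app X ≫ L.map f ≫ (dL.π j).app Y := by
  rw [(dL.π j).naturality, ← Category.assoc, dL.ι_π_self_app, Category.id_comp]

theorem additive_of_sum (h : ∀ j, (Li j).Additive) : L.Additive where
  map_add {X Y f g} := (dL.app X).hom_ext_left fun j => by
    change (dL.ι j).app X ≫ _ = (dL.ι j).app X ≫ _
    rw [← (dL.ι j).naturality, (Li j).map_add, Preadditive.comp_add, ← (dL.ι j).naturality,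
      ← (dL.ι j).naturality, Preadditive.add_comp]

theorem additive_component (h : L.Additive) (j : J) : (Li j).Additive where
  map_add {X Y f g} := by
    rw [dL.map_eq, dL.map_eq, dL.map_eq, L.map_add, Preadditive.add_comp, Preadditive.comp_add]

theorem linear_of_sum (K : Type*) [Field K] [Linear K C] [Linear K D]
    (h : ∀ j, (Li j).Linear K) : L.Linear K where
  map_smul {X Y} f c := (dL.app X).hom_ext_left fun j => by
    change (dL.ι j).app X ≫ _ = (dL.ι j).app X ≫ _
    rw [← (dL.ι j).naturality, (Li j).map_smul, Linear.comp_smul, ← (dL.ι j).naturality,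
      Linear.smul_comp]

theorem linear_component (K : Type*) [Field K] [Linear K C] [Linear K D]
    (h : L.Linear K) (j : J) : (Li j).Linear K where
  map_smul {X Y} f c := by
    rw [dL.map_eq, dL.map_eq, L.map_smul, Linear.smul_comp, Linear.comp_smul]

end SumDecomposition

/-- A direct sum of adjoint functors is adjoint to the direct sum of the adjoints. -/
noncomputable def adjunctionOfSum (adj : ∀ j, Li j ⊣ Gi j) : L ⊣ G :=
  Adjunction.mkOfHomEquiv
    { homEquiv := fun X Y =>
        { toFun := fun f => ∑ j, (adj j).homEquiv X Y ((dL.ι j).app X ≫ f) ≫ (dG.ι j).app Y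
          invFun := fun g => ∑ j, (dL.π j).app X ≫ ((adj j).homEquiv X Y).symm (g ≫ (dG.π j).app Y)
          left_inv := fun f => by
            refine (dL.app X).hom_ext_left fun i => ?_
            change (dL.ι i).app X ≫ _ = (dL.ι i).app X ≫ _
            rw [Preadditive.comp_sum, Finset.sum_eq_single i, ← Category.assoc, dL.ι_π_self_app,
              Category.id_comp, Preadditive.sum_comp, Finset.sum_eq_single i, Category.assoc,
              dG.ι_π_self_app, Category.comp_id, Equiv.symm_apply_apply]
            · intro j _ hj
              rw [Category.assoc, dG.ι_π_ne_app _ _ hj, comp_zero]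
            · simp
            · intro j _ hj
              rw [← Category.assoc, dL.ι_π_ne_app _ _ (Ne.symm hj), zero_comp]
            · simp
          right_inv := fun g => by
            refine (dG.app Y).hom_ext_right fun i => ?_
            change _ ≫ (dG.π i).app Y = _ ≫ (dG.π i).app Y
            rw [Preadditive.sum_comp, Finset.sum_eq_single i, Category.assoc, dG.ι_π_self_app,
              Category.comp_id, Preadditive.comp_sum, Finset.sum_eq_single i, ← Category.assoc,
              dL.ι_π_self_app, Category.id_comp, Equiv.apply_symm_apply]
            · intro j _ hj
              rw [← Category.assoc, dL.ι_π_ne_app _ _ (Ne.symm hj), zero_comp]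
            · simp
            · intro j _ hj
              rw [Category.assoc, dG.ι_π_ne_app _ _ hj, comp_zero]
            · simp }
      homEquiv_naturality_left_symm := fun {X' X Y} f g => by
        change ∑ j, _ = L.map f ≫ ∑ j, _
        rw [Preadditive.comp_sum]
        refine Finset.sum_congr rfl fun j _ => ?_
        rw [Category.assoc, Adjunction.homEquiv_naturality_left_symm, ← Category.assoc,
          ← Category.assoc, (dL.π j).naturality]
      homEquiv_naturality_right := fun {X Y Y'} f g => by
        change ∑ j, _ = (∑ j, _) ≫ G.map g
        rw [Preadditive.sum_comp]
        refine Finset.sum_congr rfl fun j _ => ?_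
        rw [Category.assoc, ← (dG.ι j).naturality, ← Category.assoc, ← Category.assoc,
          Adjunction.homEquiv_naturality_right] }

/-- If the mixed components of the unit and the counit of an adjunction between direct sums of
functors vanish, then the summands are adjoint. -/
noncomputable def adjunctionComponent (adj : L ⊣ G)
    (h1 : ∀ i j, i ≠ j → ∀ t : 𝟭 C ⟶ Li i ⋙ Gi j, t = 0)
    (h2 : ∀ i j, i ≠ j → ∀ t : Gi i ⋙ Li j ⟶ 𝟭 D, t = 0) (i : J) : Li i ⊣ Gi i :=
  Adjunction.mkOfHomEquiv
    { homEquiv := fun X Y =>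
        { toFun := fun f => adj.homEquiv X Y ((dL.π i).app X ≫ f) ≫ (dG.π i).app Y
          invFun := fun g => (dL.ι i).app X ≫ (adj.homEquiv X Y).symm (g ≫ (dG.ι i).app Y)
          left_inv := fun f => by
            -- the adjoint of a morphism out of the summand `i` lands in the summand `i`
            have key : adj.homEquiv X Y ((dL.π i).app X ≫ f) ≫ (dG.π i).app Y ≫ (dG.ι i).app Y =
                adj.homEquiv X Y ((dL.π i).app X ≫ f) := by
              refine (dG.app Y).hom_ext_right fun j => ?_
              change _ ≫ (dG.π j).app Y = _ ≫ (dG.π j).app Y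
              by_cases hij : i = j
              · subst hij
                rw [Category.assoc, Category.assoc, dG.ι_π_self_app, Category.comp_id]
              · have h0 := congrArg (fun t => t.app X) (h1 i j hij
                  (adj.unit ≫ Functor.whiskerRight (dL.π i) G ≫ Functor.whiskerLeft (Li i) (dG.π j)))
                change adj.unit.app X ≫ G.map ((dL.π i).app X) ≫ (dG.π j).app _ = 0 at h0
                rw [Category.assoc, Category.assoc, dG.ι_π_ne_app _ _ hij, comp_zero, comp_zero,
                  Adjunction.homEquiv_unit, G.map_comp, Category.assoc, Category.assoc,
                  (dG.π j).naturality, ← Category.assoc (G.map _), ← Category.assoc, h0, zero_comp]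
            beta_reduce
            rw [Category.assoc, key, Equiv.symm_apply_apply, ← Category.assoc, dL.ι_π_self_app,
              Category.id_comp]
          right_inv := fun g => by
            -- the adjoint of a morphism into the summand `i` is supported on the summand `i`
            have key : ((dL.π i).app X ≫ (dL.ι i).app X) ≫
                (adj.homEquiv X Y).symm (g ≫ (dG.ι i).app Y) =
                  (adj.homEquiv X Y).symm (g ≫ (dG.ι i).app Y) := by
              refine (dL.app X).hom_ext_left fun j => ?_
              change (dL.ι j).app X ≫ _ = (dL.ι j).app X ≫ _
              by_cases hij : i = j
              · subst hij
                rw [← Category.assoc, ← Category.assoc, dL.ι_π_self_app, Category.id_comp]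
              · have h0 := congrArg (fun t => t.app Y) (h2 i j hij
                  (Functor.whiskerLeft (Gi i) (dL.ι j) ≫ Functor.whiskerRight (dG.ι i) L ≫
                    adj.counit))
                change (dL.ι j).app _ ≫ L.map ((dG.ι i).app Y) ≫ adj.counit.app Y = 0 at h0
                rw [← Category.assoc, ← Category.assoc, dL.ι_π_ne_app _ _ (Ne.symm hij), zero_comp,
                  zero_comp, Adjunction.homEquiv_counit, L.map_comp, Category.assoc,
                  ← Category.assoc, ← (dL.ι j).naturality, Category.assoc, h0, comp_zero]
            beta_reduce
            rw [← Category.assoc, key, Equiv.apply_symm_apply, Category.assoc, dG.ι_π_self_app,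
              Category.comp_id] }
      homEquiv_naturality_left_symm := fun {X' X Y} f g => by
        change (dL.ι i).app X' ≫ _ = (Li i).map f ≫ (dL.ι i).app X ≫ _
        rw [Category.assoc, Adjunction.homEquiv_naturality_left_symm, ← Category.assoc,
          ← Category.assoc, (dL.ι i).naturality]
      homEquiv_naturality_right := fun {X Y Y'} f g => by
        change _ ≫ _ = (_ ≫ _) ≫ (Gi i).map g
        rw [Category.assoc, ← (dG.π i).naturality, ← Category.assoc, ← Category.assoc,
          Adjunction.homEquiv_naturality_right] }

end Adjunctions

/-! ### Weights of the doubled functors -/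

section PhiWeights

variable {e k : ℕ} [NeZero e]

/-- The sum of the simple roots of the entries of a sequence. -/
def rootSum {n : ℕ} (l : List (ZMod n)) : ZMod n → ℤ := (l.map simpleRoot).sum

@[simp] theorem rootSum_nil {n : ℕ} : rootSum ([] : List (ZMod n)) = 0 := rfl

@[simp] theorem rootSum_cons {n : ℕ} (i : ZMod n) (l : List (ZMod n)) :
    rootSum (i :: l) = simpleRoot i + rootSum l := by simp [rootSum]

theorem rootSum_reverse {n : ℕ} (l : List (ZMod n)) : rootSum l.reverse = rootSum l := by
  simp [rootSum, List.map_reverse, List.sum_reverse]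

/-- The coordinate at `c + 1` counts the entries `c + 1` positively and the entries `c`
negatively. -/
theorem rootSum_apply_succ {n : ℕ} (c : ZMod n) (l : List (ZMod n)) :
    rootSum l (c + 1) = l.count (c + 1) - l.count c := by
  induction l with
  | nil => simp
  | cons i l ih =>
    rw [rootSum_cons, Pi.add_apply, ih, simpleRoot, Pi.sub_apply, Pi.single_apply, Pi.single_apply,
      List.count_cons, List.count_cons]
    have h1 : (c + 1 = i) ↔ (i = c + 1) := eq_comm
    have h2 : (c + 1 = i + 1) ↔ (i = c) := by rw [add_left_inj, eq_comm]
    simp only [h1, h2, beq_iff_eq]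
    push_cast
    ring

theorem simpleRoot_injective {n : ℕ} [Fact (1 < n)] :
    Function.Injective (simpleRoot : ZMod n → ZMod n → ℤ) := by
  intro i j hij
  by_contra hne
  have := congrFun hij i
  have h1 : i + 1 ≠ i := by simp
  simp only [simpleRoot, Pi.sub_apply, Pi.single_apply, if_true, if_neg h1.symm, if_neg hne] at this
  split_ifs at this <;> omega

variable (k) in
theorem phiWt_add (μ ν : ZMod e → ℤ) : phiWt k (μ + ν) = phiWt k μ + phiWt k ν := by
  simp [phiWt, Pi.single_add, Finset.sum_add_distrib]

variable (k) in
theorem phiWt_sub (μ ν : ZMod e → ℤ) : phiWt k (μ - ν) = phiWt k μ - phiWt k ν := by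
  simp [phiWt, Pi.single_sub, Finset.sum_sub_distrib]

variable (k) in
theorem phiWt_single (i : ZMod e) (c : ℤ) : phiWt k (Pi.single i c) = Pi.single (up k i) c := by
  rw [phiWt, Finset.sum_eq_single i, Pi.single_eq_same]
  · intro j _ hj
    rw [Pi.single_eq_of_ne hj, Pi.single_zero]
  · simp

variable (hk : k < e)
include hk

theorem phiWt_succ (μ : ZMod e → ℤ) : phiWt k μ ((k : ZMod (e + 1)) + 1) = 0 := by
  rw [phiWt, Finset.sum_apply]
  exact Finset.sum_eq_zero fun i _ => Pi.single_eq_of_ne (up_ne_succ hk i).symm _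

theorem phiWt_up (μ : ZMod e → ℤ) (i : ZMod e) : phiWt k μ (up k i) = μ i := by
  rw [phiWt, Finset.sum_apply, Finset.sum_eq_single i, Pi.single_eq_same]
  · intro j _ hj
    exact Pi.single_eq_of_ne (fun h => hj (up_injective h).symm) _
  · simp

theorem phiWt_injective : Function.Injective (phiWt k : (ZMod e → ℤ) → ZMod (e + 1) → ℤ) :=
  fun μ ν h => funext fun i => by rw [← phiWt_up hk μ, h, phiWt_up hk]

/-- Doubling a vertex maps the simple root of a vertex to the sum of the simple roots of its
block. -/
theorem phiWt_simpleRoot (i : ZMod e) : phiWt k (simpleRoot i) = rootSum (phiVertex k i) := by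
  rw [simpleRoot, phiWt_sub, phiWt_single, phiWt_single]
  by_cases hi : i = k
  · subst hi
    rw [phiVertex_self, up_self hk, up_succ_self hk]
    simp [simpleRoot]
  · rw [phiVertex_of_ne hi, up_succ hk hi]
    simp [simpleRoot]

end PhiWeights

section SeqWeights

universe v u

variable {C : Type u} [Category.{v} C] [Preadditive C]

theorem seqF_additive {I : Type*} {Fi : I → C ⥤ C} (h : ∀ i, (Fi i).Additive) (l : List I) :
    (seqF Fi l).Additive := by
  induction l with
  | nil => exact inferInstanceAs (𝟭 C).Additive
  | cons i l ih =>
    have := h i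
    exact inferInstanceAs (Fi i ⋙ seqF Fi l).Additive

theorem seqF_linear {I : Type*} (K : Type*) [Field K] [Linear K C] {Fi : I → C ⥤ C}
    (h' : ∀ i, (Fi i).Additive) (h : ∀ i, (Fi i).Linear K) (l : List I) :
    (seqF Fi l).Linear K := by
  induction l with
  | nil => exact inferInstanceAs ((𝟭 C).Linear K)
  | cons i l ih =>
    have := h i
    have := h' i
    have := seqF_additive h' l
    exact inferInstanceAs ((Fi i ⋙ seqF Fi l).Linear K)

variable {n : ℕ} {wt : (ZMod n → ℤ) → ObjectProperty C} {Fi : ZMod n → C ⥤ C}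

theorem seqF_wt_sub (h : ∀ i μ M, wt μ M → wt (μ - simpleRoot i) ((Fi i).obj M))
    (l : List (ZMod n)) : ∀ μ M, wt μ M → wt (μ - rootSum l) ((seqF Fi l).obj M) := by
  induction l with
  | nil => intro μ M hM; rw [rootSum_nil, sub_zero]; exact hM
  | cons i l ih =>
    intro μ M hM
    rw [rootSum_cons, ← sub_sub]
    exact ih _ _ (h i μ M hM)

theorem seqF_wt_add (h : ∀ i μ M, wt μ M → wt (μ + simpleRoot i) ((Fi i).obj M))
    (l : List (ZMod n)) : ∀ μ M, wt μ M → wt (μ + rootSum l) ((seqF Fi l).obj M) := by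
  induction l with
  | nil => intro μ M hM; rw [rootSum_nil, add_zero]; exact hM
  | cons i l ih =>
    intro μ M hM
    rw [rootSum_cons, ← add_assoc]
    exact ih _ _ (h i μ M hM)

end SeqWeights

/-! ### The functors of a categorical representation -/

section Components

universe v u

variable {C : Type u} [Category.{v} C] [Preadditive C] {K : Type*} [Field K] [Linear K C]
  {n : ℕ} [NeZero n] {wt : (ZMod n → ℤ) → ObjectProperty C} {Ei Fi : ZMod n → C ⥤ C}
  (R : CategoricalRep K n wt Ei Fi)

namespace CategoricalRep
include R

theorem E_component_additive (i : ZMod n) : (Ei i).Additive :=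
  R.decE.additive_component R.E_additive i

theorem F_component_additive (i : ZMod n) : (Fi i).Additive :=
  R.decF.additive_component R.F_additive i

theorem E_component_linear (i : ZMod n) : (Ei i).Linear K :=
  R.decE.linear_component K R.E_linear i

theorem F_component_linear (i : ZMod n) : (Fi i).Linear K :=
  R.decF.linear_component K R.F_linear i

variable [Fact (1 < n)]

/-- The functor `F_j E_i` shifts the weights if `i ≠ j`, so it receives no morphism from the
identity. The three statements which follow are analogous. -/
theorem hom_EF_eq_zero (i j : ZMod n) (hij : i ≠ j) (t : 𝟭 C ⟶ Ei i ⋙ Fi j) : t = 0 := by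
  refine natTrans_eq_zero R.weights (G := 𝟭 C) (G' := Ei i ⋙ Fi j) (s := id)
    (s' := fun μ => μ + simpleRoot i - simpleRoot j) (fun μ h => ?_) (fun _ _ hM => hM)
    (fun μ M hM => R.F_wt j _ _ (R.E_wt i _ _ hM)) t
  have h0 : simpleRoot i - simpleRoot j = 0 := by
    rw [add_sub_assoc] at h
    exact left_eq_add.mp h
  exact hij (simpleRoot_injective (sub_eq_zero.mp h0))

theorem hom_FE_eq_zero (i j : ZMod n) (hij : i ≠ j) (t : 𝟭 C ⟶ Fi i ⋙ Ei j) : t = 0 := by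
  refine natTrans_eq_zero R.weights (G := 𝟭 C) (G' := Fi i ⋙ Ei j) (s := id)
    (s' := fun μ => μ - simpleRoot i + simpleRoot j) (fun μ h => ?_) (fun _ _ hM => hM)
    (fun μ M hM => R.E_wt j _ _ (R.F_wt i _ _ hM)) t
  have h0 : simpleRoot j - simpleRoot i = 0 := by
    rw [sub_add_eq_add_sub, add_sub_assoc] at h
    exact left_eq_add.mp h
  exact hij (simpleRoot_injective (sub_eq_zero.mp h0)).symm

theorem EF_hom_eq_zero (i j : ZMod n) (hij : i ≠ j) (t : Ei i ⋙ Fi j ⟶ 𝟭 C) : t = 0 := by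
  have := R.E_component_additive i
  have := R.F_component_additive j
  refine natTrans_eq_zero R.weights (G := Ei i ⋙ Fi j) (G' := 𝟭 C) (s' := id)
    (s := fun μ => μ + simpleRoot i - simpleRoot j) (fun μ h => ?_)
    (fun μ M hM => R.F_wt j _ _ (R.E_wt i _ _ hM)) (fun _ _ hM => hM) t
  have h0 : simpleRoot i - simpleRoot j = 0 := by
    rw [add_sub_assoc] at h
    exact add_eq_left.mp h
  exact hij (simpleRoot_injective (sub_eq_zero.mp h0))

theorem FE_hom_eq_zero (i j : ZMod n) (hij : i ≠ j) (t : Fi i ⋙ Ei j ⟶ 𝟭 C) : t = 0 := by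
  have := R.F_component_additive i
  have := R.E_component_additive j
  refine natTrans_eq_zero R.weights (G := Fi i ⋙ Ei j) (G' := 𝟭 C) (s' := id)
    (s := fun μ => μ - simpleRoot i + simpleRoot j) (fun μ h => ?_)
    (fun μ M hM => R.E_wt j _ _ (R.F_wt i _ _ hM)) (fun _ _ hM => hM) t
  have h0 : simpleRoot j - simpleRoot i = 0 := by
    rw [sub_add_eq_add_sub, add_sub_assoc] at h
    exact add_eq_left.mp h
  exact hij (simpleRoot_injective (sub_eq_zero.mp h0)).symm

theorem F_hom_eq_zero (i j : ZMod n) (hij : i ≠ j) (t : Fi i ⟶ Fi j) : t = 0 := by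
  have := R.F_component_additive i
  exact natTrans_eq_zero R.weights
    (fun μ h => hij (simpleRoot_injective (sub_right_injective h))) (R.F_wt i) (R.F_wt j) t

/-- The functors `E_i` and `F_i` are adjoint. -/
noncomputable def adjComponentEF (i : ZMod n) : Ei i ⊣ Fi i :=
  adjunctionComponent R.decE R.decF R.adjEF R.hom_EF_eq_zero R.FE_hom_eq_zero i

/-- The functors `F_i` and `E_i` are adjoint. -/
noncomputable def adjComponentFE (i : ZMod n) : Fi i ⊣ Ei i :=
  adjunctionComponent R.decF R.decE R.adjFE R.hom_FE_eq_zero R.EF_hom_eq_zero i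

end CategoricalRep

end Components

section Doubled

universe v u

variable {C : Type u} [Category.{v} C] [Preadditive C] {K : Type*} [Field K] [Linear K C]
  {e k : ℕ} [NeZero e] [Fact (1 < e + 1)] {wt : (ZMod (e + 1) → ℤ) → ObjectProperty C}
  {Ei Fi : ZMod (e + 1) → C ⥤ C} (R : CategoricalRep K (e + 1) wt Ei Fi)

namespace CategoricalRep
include R

theorem nonempty_adj_doubledEF (i : ZMod e) : Nonempty (doubledE k Ei i ⊣ doubledF k Fi i) := by
  by_cases hi : i = k
  · subst hi
    rw [doubledE_self, doubledF_self]
    exact ⟨(R.adjComponentEF _).comp (R.adjComponentEF _)⟩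
  · rw [doubledE_of_ne k Ei i hi, doubledF_of_ne k Fi i hi]
    exact ⟨R.adjComponentEF _⟩

theorem nonempty_adj_doubledFE (i : ZMod e) : Nonempty (doubledF k Fi i ⊣ doubledE k Ei i) := by
  by_cases hi : i = k
  · subst hi
    rw [doubledE_self, doubledF_self]
    exact ⟨(R.adjComponentFE _).comp (R.adjComponentFE _)⟩
  · rw [doubledE_of_ne k Ei i hi, doubledF_of_ne k Fi i hi]
    exact ⟨R.adjComponentFE _⟩

variable (hk : k < e)
include hk

theorem doubledF_wt (i : ZMod e) (μ : ZMod e → ℤ) (M : C) (hM : wt (phiWt k μ) M) :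
    wt (phiWt k (μ - simpleRoot i)) ((doubledF k Fi i).obj M) := by
  rw [phiWt_sub, phiWt_simpleRoot hk]
  exact seqF_wt_sub R.F_wt _ _ _ hM

theorem doubledE_wt (i : ZMod e) (μ : ZMod e → ℤ) (M : C) (hM : wt (phiWt k μ) M) :
    wt (phiWt k (μ + simpleRoot i)) ((doubledE k Ei i).obj M) := by
  rw [phiWt_add, phiWt_simpleRoot hk, ← rootSum_reverse]
  exact seqF_wt_add R.E_wt _ _ _ hM

theorem subProp_doubledF (i : ZMod e) (M : C) (hM : subProp (e := e) k wt M) :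
    subProp (e := e) k wt ((doubledF k Fi i).obj M) := by
  have : (doubledF k Fi i).Additive := seqF_additive R.F_component_additive _
  exact directSum_obj R.weights (phiWt_injective hk) (R.doubledF_wt hk i) hM

theorem subProp_doubledE (i : ZMod e) (M : C) (hM : subProp (e := e) k wt M) :
    subProp (e := e) k wt ((doubledE k Ei i).obj M) := by
  have : (doubledE k Ei i).Additive := seqF_additive R.E_component_additive _
  exact directSum_obj R.weights (phiWt_injective hk) (R.doubledE_wt hk i) hM

/-- The functors of unordered sequences vanish on the sum of the weight subcategories `C_φ(μ)`:
some partial composition lowers a coordinate of the weights below zero. -/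
theorem isZero_of_unordered
    (hneg : ∀ μ : ZMod (e + 1) → ℤ, (∃ i, μ i < 0) → ∀ M : C, wt μ M → IsZero M)
    {l : List (ZMod (e + 1))} (hl : Unordered k l) (M : C) (hM : subProp (e := e) k wt M) :
    IsZero ((seqF Fi l).obj M) := by
  have hadd := fun l => seqF_additive R.F_component_additive l
  obtain ⟨s, N, hN, ⟨D⟩⟩ := hM
  have := hadd l
  refine (D.map (seqF Fi l)).isZero fun y => ?_
  obtain ⟨r, hr⟩ := hl
  have h1 := hneg _ ⟨(k : ZMod (e + 1)) + 1, ?_⟩ _ (seqF_wt_sub R.F_wt (l.take r) _ _ (hN y))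
  · have h2 := (seqFAppend Fi (l.take r) (l.drop r)).app (N y)
    rw [List.take_append_drop] at h2
    have := hadd (l.drop r)
    exact ((seqF Fi (l.drop r)).map_isZero h1).of_iso h2
  · rw [Pi.sub_apply, phiWt_succ hk, rootSum_apply_succ]
    omega

end CategoricalRep

end Doubled

/-! ### Restriction of functors to a full subcategory -/

section RestrictFunctors

universe v u

variable {C : Type u} [Category.{v} C] {P : ObjectProperty C} {G G' : C ⥤ C}
  {hG : ∀ M, P M → P (G.obj M)} {hG' : ∀ M, P M → P (G'.obj M)}

/-- The natural transformation between restricted functors which is induced by a natural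
transformation of functors. -/
def restrictHom (hG : ∀ M, P M → P (G.obj M)) (hG' : ∀ M, P M → P (G'.obj M)) (t : G ⟶ G') :
    restrict P G hG ⟶ restrict P G' hG' where
  app M := ObjectProperty.homMk (t.app M.obj)
  naturality _ _ f := ObjectProperty.hom_ext _ (t.naturality f.hom)

/-- An adjunction between functors which preserve a full subcategory restricts to it. -/
noncomputable def restrictAdjunction (adj : G ⊣ G') : restrict P G hG ⊣ restrict P G' hG' :=
  adj.restrictFullyFaithful P.fullyFaithfulι P.fullyFaithfulι
    (P.liftCompιIso (P.ι ⋙ G) fun M => hG M.obj M.property).symm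
    (P.liftCompιIso (P.ι ⋙ G') fun M => hG' M.obj M.property).symm

theorem restrict_additive [Preadditive C] (h : G.Additive) : (restrict P G hG).Additive where
  map_add {_ _ _ _} := ObjectProperty.hom_ext _ G.map_add

theorem restrict_linear [Preadditive C] {K : Type*} [Field K] [Linear K C] (h : G.Linear K) :
    (restrict P G hG).Linear K where
  map_smul _ _ := ObjectProperty.hom_ext _ (G.map_smul _ _)

theorem exists_sumDecomposition {D : Type*} [Category* D] [Preadditive D]
    [HasFiniteProducts D] {J : Type} [Fintype J] (f : J → D) :
    ∃ X : D, Nonempty (SumDecomposition X f) := by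
  classical
  have := HasFiniteBiproducts.of_hasFiniteProducts (C := D)
  exact ⟨⨁ f, ⟨⟨biproduct.ι f, biproduct.π f, fun j => biproduct.ι_π_self f j,
    fun i j hij => biproduct.ι_π_ne f hij, biproduct.total⟩⟩⟩

end RestrictFunctors

/-! ### Matrix entries -/

section Entries

universe v u

variable {C : Type u} [Category.{v} C] [Preadditive C] {I : Type*} [Fintype I]

namespace SumDecomposition

/-- The matrix of a composite is the product of the matrices. -/
theorem ι_comp_π {J : Type*} [Fintype J] {X : C} {f : J → C}
    (D : SumDecomposition X f) (Y Z : X ⟶ X) (i j : J) :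
    D.ι i ≫ (Y ≫ Z) ≫ D.π j = ∑ l, (D.ι i ≫ Y ≫ D.π l) ≫ D.ι l ≫ Z ≫ D.π j := by
  calc _ = D.ι i ≫ Y ≫ (∑ l, D.π l ≫ D.ι l) ≫ Z ≫ D.π j := by
        rw [D.sum_π_ι, Category.id_comp, Category.assoc]
    _ = _ := by simp [Preadditive.sum_comp, Preadditive.comp_sum]

end SumDecomposition

variable {F : C ⥤ C} {Fi : I → C ⥤ C} (D : SumDecomposition F Fi)

theorem seqIncl_cons {d : ℕ} (i : I) (l : List I) (h : (i :: l).length = d + 1) :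
    seqIncl D (d + 1) (i :: l) h = D.ι i ◫ seqIncl D d l (Nat.succ.inj h) := by
  cases h
  rfl

theorem seqProj_cons {d : ℕ} (i : I) (l : List I) (h : (i :: l).length = d + 1) :
    seqProj D (d + 1) (i :: l) h = D.π i ◫ seqProj D d l (Nat.succ.inj h) := by
  cases h
  rfl

theorem iter_additive (hF : F.Additive) (d : ℕ) : (iter F d).Additive := by
  induction d with
  | zero => exact inferInstanceAs (𝟭 C).Additive
  | succ d ih => exact inferInstanceAs (F ⋙ iter F d).Additive

theorem zero_hcomp {G G' H H' : C ⥤ C} (hH : H'.Additive) (t : H ⟶ H') :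
    (0 : G ⟶ G') ◫ t = 0 := by
  ext M
  simp

theorem hcomp_zero' {G G' H H' : C ⥤ C} (t : G ⟶ G') : t ◫ (0 : H ⟶ H') = 0 := by
  ext M
  simp

theorem id_hcomp_id' (G H : C ⥤ C) : 𝟙 G ◫ 𝟙 H = 𝟙 (G ⋙ H) := by
  ext M
  simp

theorem sum_hcomp {G G' H H' : C ⥤ C} (hH : H'.Additive) {J : Type*} (s : Finset J)
    (f : J → (G ⟶ G')) (t : H ⟶ H') : (∑ j ∈ s, f j) ◫ t = ∑ j ∈ s, f j ◫ t := by
  ext M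
  simp [NatTrans.app_sum, Preadditive.comp_sum, Functor.map_sum]

theorem hcomp_sum {G G' H H' : C ⥤ C} {J : Type*} (s : Finset J)
    (f : J → (H ⟶ H')) (t : G ⟶ G') : t ◫ (∑ j ∈ s, f j) = ∑ j ∈ s, t ◫ f j := by
  ext M
  simp [NatTrans.app_sum, Preadditive.sum_comp]

theorem seqIncl_cons_comp_seqProj_cons {d : ℕ} (i i' : I) (l l' : List I)
    (h : (i :: l).length = d + 1) (h' : (i' :: l').length = d + 1) :
    seqIncl D (d + 1) (i :: l) h ≫ seqProj D (d + 1) (i' :: l') h' =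
      (D.ι i ≫ D.π i') ◫ (seqIncl D d l (Nat.succ.inj h) ≫ seqProj D d l' (Nat.succ.inj h')) :=
  (congrArg₂ CategoryStruct.comp (seqIncl_cons D i l h) (seqProj_cons D i' l' h')).trans
    (NatTrans.exchange ..).symm

theorem seqProj_cons_comp_seqIncl_cons {d : ℕ} (i : I) (l : List I)
    (h : (i :: l).length = d + 1) :
    seqProj D (d + 1) (i :: l) h ≫ seqIncl D (d + 1) (i :: l) h =
      (D.π i ≫ D.ι i) ◫ (seqProj D d l (Nat.succ.inj h) ≫ seqIncl D d l (Nat.succ.inj h)) :=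
  (congrArg₂ CategoryStruct.comp (seqProj_cons D i l h) (seqIncl_cons D i l h)).trans
    (NatTrans.exchange ..).symm

/-- A nonempty sequence consists of its first entry and the remaining sequence. -/
def vectorConsEquiv (I : Type*) (d : ℕ) : I × List.Vector I d ≃ List.Vector I (d + 1) where
  toFun p := p.1 ::ᵥ p.2
  invFun v := (v.head, v.tail)
  left_inv p := by simp
  right_inv v := by simp

theorem sum_vector_succ {A : Type*} [AddCommMonoid A] {d : ℕ} (f : List.Vector I (d + 1) → A) :
    ∑ v, f v = ∑ i : I, ∑ v : List.Vector I d, f ⟨i :: v.1, congrArg (· + 1) v.2⟩ := by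
  rw [← (vectorConsEquiv I d).sum_comp, Fintype.sum_prod_type]
  rfl

theorem seqIncl_comp_seqProj_self (d : ℕ) (l : List I) (h : l.length = d) :
    seqIncl D d l h ≫ seqProj D d l h = 𝟙 (seqF Fi l) := by
  induction d generalizing l with
  | zero =>
    obtain rfl := List.length_eq_zero_iff.mp h
    exact Category.comp_id _
  | succ d ih =>
    obtain ⟨i, l, rfl⟩ := List.exists_cons_of_length_eq_add_one h
    rw [seqIncl_cons_comp_seqProj_cons, D.ι_π_self, ih]
    exact id_hcomp_id' _ _

theorem seqIncl_comp_seqProj_of_ne (hF : F.Additive) (d : ℕ) (l l' : List I) (h : l.length = d)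
    (h' : l'.length = d) (hne : l ≠ l') : seqIncl D d l h ≫ seqProj D d l' h' = 0 := by
  induction d generalizing l l' with
  | zero =>
    exact (hne ((List.length_eq_zero_iff.mp h).trans (List.length_eq_zero_iff.mp h').symm)).elim
  | succ d ih =>
    obtain ⟨i, l, rfl⟩ := List.exists_cons_of_length_eq_add_one h
    obtain ⟨i', l', rfl⟩ := List.exists_cons_of_length_eq_add_one h'
    rw [seqIncl_cons_comp_seqProj_cons]
    by_cases hi : i = i'
    · subst hi
      rw [ih l l' _ _ fun h => hne (by rw [h])]
      exact hcomp_zero' _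
    · rw [D.ι_π_ne i i' hi]
      exact zero_hcomp (seqF_additive (fun i => D.additive_component hF i) l') _

theorem sum_seqProj_comp_seqIncl (hF : F.Additive) (d : ℕ) :
    ∑ v : List.Vector I d, seqProj D d v.1 v.2 ≫ seqIncl D d v.1 v.2 = 𝟙 (iter F d) := by
  induction d with
  | zero =>
    rw [Fintype.sum_eq_single (List.Vector.nil : List.Vector I 0)
      fun v hv => (hv (Subsingleton.elim _ _)).elim]
    exact Category.comp_id _
  | succ d ih =>
    refine (sum_vector_succ _).trans ?_
    calc _ = ∑ i : I, (D.π i ≫ D.ι i) ◫ (𝟙 (iter F d)) := by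
          refine Finset.sum_congr rfl fun i _ => ?_
          rw [← ih]
          refine Eq.trans ?_ (hcomp_sum _ _ _).symm
          exact Finset.sum_congr rfl fun v _ => seqProj_cons_comp_seqIncl_cons ..
      _ = _ := by
          rw [← sum_hcomp (iter_additive hF d), D.sum_π_ι]
          exact id_hcomp_id' _ _

/-- The decomposition of the power `F^d` into the functors of sequences. -/
def seqDecomposition (hF : F.Additive) (d : ℕ) :
    SumDecomposition (iter F d) fun v : List.Vector I d => seqF Fi v.1 where
  ι v := seqIncl D d v.1 v.2
  π v := seqProj D d v.1 v.2
  ι_π_self _ := seqIncl_comp_seqProj_self D d _ _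
  ι_π_ne _ _ hvw := seqIncl_comp_seqProj_of_ne D hF d _ _ _ _ fun h => hvw (Subtype.ext h)
  sum_π_ι := sum_seqProj_comp_seqIncl D hF d

end Entries

section SeqEntries

universe v u

variable {C : Type u} [Category.{v} C] [Preadditive C] {I : Type*} [Fintype I]
  {F : C ⥤ C} {Fi : I → C ⥤ C} (D : SumDecomposition F Fi)

/-- The matrix entry `F_l ⟶ F_l'` of an endomorphism of `F^d`. -/
def seqEntry {d : ℕ} (Y : iter F d ⟶ iter F d) (l l' : List I) (h : l.length = d)
    (h' : l'.length = d) : seqF Fi l ⟶ seqF Fi l' :=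
  seqIncl D d l h ≫ Y ≫ seqProj D d l' h'

theorem seqEntry_comp (hF : F.Additive) {d : ℕ} (Y Z : iter F d ⟶ iter F d) (l l' : List I)
    (h : l.length = d) (h' : l'.length = d) : seqEntry D (Y ≫ Z) l l' h h' =
      ∑ u : List.Vector I d, seqEntry D Y l u.1 h u.2 ≫ seqEntry D Z u.1 l' u.2 h' :=
  (seqDecomposition D hF d).ι_comp_π Y Z ⟨l, h⟩ ⟨l', h'⟩

/-- An endomorphism of `F^d` is determined by its matrix entries. -/
theorem eq_of_seqEntry_eq (hF : F.Additive) {d : ℕ} {Y Z : iter F d ⟶ iter F d}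
    (h : ∀ v w : List.Vector I d, seqEntry D Y v.1 w.1 v.2 w.2 = seqEntry D Z v.1 w.1 v.2 w.2) :
    Y = Z :=
  (seqDecomposition D hF d).hom_ext_left fun v => (seqDecomposition D hF d).hom_ext_right fun w =>
    (Category.assoc _ _ _).trans ((h v w).trans (Category.assoc _ _ _).symm)

theorem seqEntry_add {d : ℕ} (Y Z : iter F d ⟶ iter F d) (l l' : List I)
    (h : l.length = d) (h' : l'.length = d) :
    seqEntry D (Y + Z) l l' h h' = seqEntry D Y l l' h h' + seqEntry D Z l l' h h' := by
  simp [seqEntry]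

theorem seqEntry_zero {d : ℕ} (l l' : List I) (h : l.length = d) (h' : l'.length = d) :
    seqEntry D (0 : iter F d ⟶ iter F d) l l' h h' = 0 := by
  simp [seqEntry]

theorem seqEntry_smul {K : Type*} [Field K] [Linear K C] {d : ℕ} (c : K)
    (Y : iter F d ⟶ iter F d) (l l' : List I) (h : l.length = d) (h' : l'.length = d) :
    seqEntry D (c • Y) l l' h h' = c • seqEntry D Y l l' h h' := by
  simp [seqEntry]

theorem seqEntry_id_self {d : ℕ} (l : List I) (h : l.length = d) :
    seqEntry D (𝟙 (iter F d)) l l h h = 𝟙 _ := by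
  rw [seqEntry, Category.id_comp, seqIncl_comp_seqProj_self]

theorem seqEntry_id_of_ne (hF : F.Additive) {d : ℕ} (l l' : List I) (h : l.length = d)
    (h' : l'.length = d) (hne : l ≠ l') : seqEntry D (𝟙 (iter F d)) l l' h h' = 0 := by
  rw [seqEntry, Category.id_comp, seqIncl_comp_seqProj_of_ne D hF d l l' h h' hne]

theorem seqEntry_proj_self {d : ℕ} (l : List I) (h : l.length = d) :
    seqEntry D (seqProj D d l h ≫ seqIncl D d l h) l l h h = 𝟙 _ := by
  rw [seqEntry, Category.assoc, seqIncl_comp_seqProj_self, Category.comp_id,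
    seqIncl_comp_seqProj_self]

theorem seqEntry_proj_of_ne (hF : F.Additive) {d : ℕ} (l l' m : List I) (h : l.length = d)
    (h' : l'.length = d) (hm : m.length = d) (hne : l ≠ m ∨ l' ≠ m) :
    seqEntry D (seqProj D d m hm ≫ seqIncl D d m hm) l l' h h' = 0 := by
  rw [seqEntry, Category.assoc]
  rcases hne with hne | hne
  · rw [← Category.assoc, seqIncl_comp_seqProj_of_ne D hF d l m h hm hne, zero_comp]
  · rw [seqIncl_comp_seqProj_of_ne D hF d m l' hm h' hne.symm, comp_zero, comp_zero]

/-- The component `F_i ⟶ F_j` of an endomorphism of `F`. -/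
def dotComp (x : F ⟶ F) (i j : I) : Fi i ⟶ Fi j := D.ι i ≫ x ≫ D.π j

/-- The component `F_j F_i ⟶ F_j' F_i'` of an endomorphism of `F²`. -/
def crossComp (τ : F ⋙ F ⟶ F ⋙ F) (i j i' j' : I) : Fi i ⋙ Fi j ⟶ Fi i' ⋙ Fi j' :=
  (D.ι i ◫ D.ι j) ≫ τ ≫ (D.π i' ◫ D.π j')

theorem whiskerLeft_eq_hcomp (G : C ⥤ C) {H H' : C ⥤ C} (t : H ⟶ H') :
    Functor.whiskerLeft G t = 𝟙 G ◫ t := by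
  ext M
  simp

theorem whiskerRight_eq_hcomp {G G' : C ⥤ C} (t : G ⟶ G') (H : C ⥤ C) :
    Functor.whiskerRight t H = t ◫ 𝟙 H := by
  ext M
  simp

/-- The entries of `Y` acting behind a first factor `F`. -/
theorem seqEntry_whiskerLeft {d : ℕ} (Y : iter F d ⟶ iter F d) (i i' : I) (l l' : List I)
    (h : (i :: l).length = d + 1) (h' : (i' :: l').length = d + 1) :
    seqEntry D (d := d + 1) (Functor.whiskerLeft F Y) (i :: l) (i' :: l') h h' =
      (D.ι i ≫ D.π i') ◫ seqEntry D Y l l' (Nat.succ.inj h) (Nat.succ.inj h') := by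
  have h1 : (D.ι i ◫ seqIncl D d l (Nat.succ.inj h)) ≫ Functor.whiskerLeft F Y ≫
      (D.π i' ◫ seqProj D d l' (Nat.succ.inj h')) =
      (D.ι i ≫ D.π i') ◫ seqEntry D Y l l' (Nat.succ.inj h) (Nat.succ.inj h') := by
    rw [whiskerLeft_eq_hcomp, ← NatTrans.exchange, ← NatTrans.exchange, Category.id_comp]
    rfl
  exact (congrArg₂ (fun s t => s ≫ Functor.whiskerLeft F Y ≫ t) (seqIncl_cons D i l h)
    (seqProj_cons D i' l' h')).trans h1

/-- The entries of `x` acting on the first factor `F`. -/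
theorem seqEntry_whiskerRight {d : ℕ} (x : F ⟶ F) (i i' : I) (l l' : List I)
    (h : (i :: l).length = d + 1) (h' : (i' :: l').length = d + 1) :
    seqEntry D (d := d + 1) (Functor.whiskerRight x (iter F d)) (i :: l) (i' :: l') h h' =
      dotComp D x i i' ◫ seqEntry D (𝟙 (iter F d)) l l' (Nat.succ.inj h) (Nat.succ.inj h') := by
  have h1 : (D.ι i ◫ seqIncl D d l (Nat.succ.inj h)) ≫ Functor.whiskerRight x (iter F d) ≫
      (D.π i' ◫ seqProj D d l' (Nat.succ.inj h')) =
      dotComp D x i i' ◫ seqEntry D (𝟙 (iter F d)) l l' (Nat.succ.inj h) (Nat.succ.inj h') := by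
    rw [whiskerRight_eq_hcomp, ← NatTrans.exchange, ← NatTrans.exchange]
    rfl
  exact (congrArg₂ (fun s t => s ≫ Functor.whiskerRight x (iter F d) ≫ t) (seqIncl_cons D i l h)
    (seqProj_cons D i' l' h')).trans h1

/-- The entries of `τ` acting on the first two factors `F`. Both sides have the same source and
target only up to associativity of the composition of functors, whence the values at objects. -/
theorem seqEntry_cross_app {d : ℕ} (τ : F ⋙ F ⟶ F ⋙ F) (i j i' j' : I) (l l' : List I)
    (h : (i :: j :: l).length = d + 2) (h' : (i' :: j' :: l').length = d + 2) (M : C) :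
    (seqEntry D (iterT τ (d + 2) 0) (i :: j :: l) (i' :: j' :: l') h h').app M =
      (crossComp D τ i j i' j' ◫ seqEntry D (𝟙 (iter F d)) l l' (Nat.succ.inj (Nat.succ.inj h))
        (Nat.succ.inj (Nat.succ.inj h'))).app M := by
  have hl := Nat.succ.inj (Nat.succ.inj h)
  have hl' := Nat.succ.inj (Nat.succ.inj h')
  have h1 : ((D.ι i ◫ D.ι j) ◫ seqIncl D d l hl) ≫ Functor.whiskerRight τ (iter F d) ≫
      ((D.π i' ◫ D.π j') ◫ seqProj D d l' hl') =
      crossComp D τ i j i' j' ◫ seqEntry D (𝟙 (iter F d)) l l' hl hl' := by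
    rw [whiskerRight_eq_hcomp, ← NatTrans.exchange, ← NatTrans.exchange]
    rfl
  rw [← h1]
  have h2 : seqIncl D (d + 2) (i :: j :: l) h = D.ι i ◫ (D.ι j ◫ seqIncl D d l hl) := by
    rw [seqIncl_cons, seqIncl_cons]
    rfl
  have h3 : seqProj D (d + 2) (i' :: j' :: l') h' = D.π i' ◫ (D.π j' ◫ seqProj D d l' hl') := by
    rw [seqProj_cons, seqProj_cons]
    rfl
  refine (congrArg₂ (fun s t => (s ≫ iterT τ (d + 2) 0 ≫ t).app M) h2 h3).trans ?_
  change ((D.ι i ◫ (D.ι j ◫ seqIncl D d l hl)) ≫ ((Functor.associator F F (iter F d)).inv ≫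
    Functor.whiskerRight τ (iter F d) ≫ (Functor.associator F F (iter F d)).hom) ≫
    (D.π i' ◫ (D.π j' ◫ seqProj D d l' hl'))).app M = _
  simp

end SeqEntries

/-! ### Matrix entries of the action of a KLR algebra -/

section RepEntries

universe v u

variable {C : Type u} [Category.{v} C] [Preadditive C] {K : Type*} [Field K] [Linear K C]
  {n : ℕ} [NeZero n] {wt : (ZMod n → ℤ) → ObjectProperty C} {Ei Fi : ZMod n → C ⥤ C}
  (R : CategoricalRep K n wt Ei Fi)

namespace CategoricalRep

theorem entry_eq {d : ℕ} (a : KLR K (cyc n) d) (v w : List.Vector (ZMod n) d) :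
    R.entry a v w = seqEntry R.decF (show iter R.F d ⟶ iter R.F d from (R.ψ d a).unop)
      v.1 w.1 v.2 w.2 := rfl

/-- The action is contravariant, so the product `a b` acts first by `a` and then by `b`. -/
theorem entry_mul {d : ℕ} (a b : KLR K (cyc n) d) (v w : List.Vector (ZMod n) d) :
    R.entry (a * b) v w = ∑ u, R.entry a v u ≫ R.entry b u w := by
  rw [entry_eq, map_mul]
  exact seqEntry_comp R.decF R.F_additive _ _ v.1 w.1 v.2 w.2

theorem entry_mul_app {d : ℕ} (a b : KLR K (cyc n) d) (v w : List.Vector (ZMod n) d) (M : C) :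
    (R.entry (a * b) v w).app M = ∑ u, (R.entry a v u).app M ≫ (R.entry b u w).app M := by
  rw [entry_mul, NatTrans.app_sum]
  rfl

theorem entry_add {d : ℕ} (a b : KLR K (cyc n) d) (v w : List.Vector (ZMod n) d) :
    R.entry (a + b) v w = R.entry a v w + R.entry b v w := by
  rw [entry_eq, map_add]
  exact seqEntry_add R.decF _ _ v.1 w.1 v.2 w.2

theorem entry_smul {d : ℕ} (c : K) (a : KLR K (cyc n) d) (v w : List.Vector (ZMod n) d) :
    R.entry (c • a) v w = c • R.entry a v w := by
  rw [entry_eq, map_smul]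
  exact seqEntry_smul R.decF c _ v.1 w.1 v.2 w.2

theorem entry_zero {d : ℕ} (v w : List.Vector (ZMod n) d) :
    R.entry (0 : KLR K (cyc n) d) v w = 0 := by
  rw [entry_eq, map_zero]
  exact seqEntry_zero R.decF v.1 w.1 v.2 w.2

theorem entry_neg {d : ℕ} (a : KLR K (cyc n) d) (v w : List.Vector (ZMod n) d) :
    R.entry (-a) v w = -R.entry a v w := by
  rw [eq_neg_iff_add_eq_zero, ← entry_add, neg_add_cancel, entry_zero]

theorem entry_klrE_self {d : ℕ} (v : List.Vector (ZMod n) d) :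
    R.entry (klrE K (cyc n) v) v v = 𝟙 _ := by
  rw [entry_eq, R.ψ_e]
  exact seqEntry_proj_self R.decF v.1 v.2

theorem entry_klrE_of_ne {d : ℕ} (u v w : List.Vector (ZMod n) d) (hne : v ≠ u ∨ w ≠ u) :
    R.entry (klrE K (cyc n) u) v w = 0 := by
  rw [entry_eq, R.ψ_e]
  exact seqEntry_proj_of_ne R.decF R.F_additive v.1 w.1 u.1 v.2 w.2 u.2
    (hne.imp (fun h h' => h (Subtype.ext h')) fun h h' => h (Subtype.ext h'))

theorem entry_mul_klrE_self {d : ℕ} (a : KLR K (cyc n) d) (v w : List.Vector (ZMod n) d) :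
    R.entry (a * klrE K (cyc n) w) v w = R.entry a v w := by
  rw [entry_mul, Fintype.sum_eq_single w, entry_klrE_self, Category.comp_id]
  intro u hu
  rw [entry_klrE_of_ne _ _ _ _ (Or.inl hu), comp_zero]

theorem entry_mul_klrE_of_ne {d : ℕ} (a : KLR K (cyc n) d) (u v w : List.Vector (ZMod n) d)
    (hw : w ≠ u) : R.entry (a * klrE K (cyc n) u) v w = 0 := by
  rw [entry_mul]
  refine Finset.sum_eq_zero fun u' _ => ?_
  rw [entry_klrE_of_ne _ _ _ _ (Or.inr hw), comp_zero]

theorem entry_klrE_mul_self {d : ℕ} (a : KLR K (cyc n) d)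
    (v w : List.Vector (ZMod n) d) :
    R.entry (klrE K (cyc n) v * a) v w = R.entry a v w := by
  rw [entry_mul, Fintype.sum_eq_single v, entry_klrE_self, Category.id_comp]
  intro u hu
  rw [entry_klrE_of_ne _ _ _ _ (Or.inr hu), zero_comp]

theorem entry_klrE_mul_of_ne {d : ℕ} (a : KLR K (cyc n) d) (u v w : List.Vector (ZMod n) d)
    (hv : v ≠ u) : R.entry (klrE K (cyc n) u * a) v w = 0 := by
  rw [entry_mul]
  refine Finset.sum_eq_zero fun u' _ => ?_
  rw [entry_klrE_of_ne _ _ _ _ (Or.inl hv), zero_comp]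

/-- The matrix entry, for sequences given as lists. -/
def ent {d : ℕ} (a : KLR K (cyc n) d) (l l' : List (ZMod n)) (h : l.length = d)
    (h' : l'.length = d) : seqF Fi l ⟶ seqF Fi l' :=
  seqEntry R.decF (show iter R.F d ⟶ iter R.F d from (R.ψ d a).unop) l l' h h'

theorem ent_mul_app {d : ℕ} (a b : KLR K (cyc n) d) (l l' : List (ZMod n)) (h : l.length = d)
    (h' : l'.length = d) (M : C) : (R.ent (a * b) l l' h h').app M =
      ∑ u : List.Vector (ZMod n) d, (R.ent a l u.1 h u.2).app M ≫ (R.ent b u.1 l' u.2 h').app M :=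
  R.entry_mul_app a b ⟨l, h⟩ ⟨l', h'⟩ M

theorem ent_neg {d : ℕ} (a : KLR K (cyc n) d) (l l' : List (ZMod n)) (h : l.length = d)
    (h' : l'.length = d) : R.ent (-a) l l' h h' = -R.ent a l l' h h' :=
  R.entry_neg a ⟨l, h⟩ ⟨l', h'⟩

theorem ent_klrX_cons_zero {d : ℕ} (i i' : ZMod n) (l l' : List (ZMod n))
    (h : (i :: l).length = d + 1) (h' : (i' :: l').length = d + 1) :
    R.ent (klrX K (cyc n) (d + 1) 0) (i :: l) (i' :: l') h h' =
      dotComp R.decF R.x i i' ◫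
        seqEntry R.decF (𝟙 (iter R.F d)) l l' (Nat.succ.inj h) (Nat.succ.inj h') := by
  rw [ent, R.ψ_x _ _ (Nat.succ_pos d)]
  exact seqEntry_whiskerRight R.decF R.x i i' l l' h h'

theorem ent_klrX_cons_succ {d r : ℕ} (hr : r < d) (i i' : ZMod n) (l l' : List (ZMod n))
    (h : (i :: l).length = d + 1) (h' : (i' :: l').length = d + 1) :
    R.ent (klrX K (cyc n) (d + 1) (r + 1)) (i :: l) (i' :: l') h h' =
      (R.decF.ι i ≫ R.decF.π i') ◫
        R.ent (klrX K (cyc n) d r) l l' (Nat.succ.inj h) (Nat.succ.inj h') := by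
  rw [ent, ent, R.ψ_x _ _ (Nat.succ_lt_succ hr), R.ψ_x _ _ hr]
  exact seqEntry_whiskerLeft R.decF (iterX R.x d r) i i' l l' h h'

theorem ent_klrT_cons_zero_app {d : ℕ} (i j i' j' : ZMod n) (l l' : List (ZMod n))
    (h : (i :: j :: l).length = d + 2) (h' : (i' :: j' :: l').length = d + 2) (M : C) :
    (R.ent (klrT K (cyc n) (d + 2) 0) (i :: j :: l) (i' :: j' :: l') h h').app M =
      (crossComp R.decF R.τ i j i' j' ◫ seqEntry R.decF (𝟙 (iter R.F d)) l l'
        (Nat.succ.inj (Nat.succ.inj h)) (Nat.succ.inj (Nat.succ.inj h'))).app M := by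
  rw [ent, R.ψ_t _ _ (by omega)]
  exact seqEntry_cross_app R.decF R.τ i j i' j' l l' h h' M

theorem ent_klrT_cons_succ {d r : ℕ} (hr : r + 1 < d) (i i' : ZMod n) (l l' : List (ZMod n))
    (h : (i :: l).length = d + 1) (h' : (i' :: l').length = d + 1) :
    R.ent (klrT K (cyc n) (d + 1) (r + 1)) (i :: l) (i' :: l') h h' =
      (R.decF.ι i ≫ R.decF.π i') ◫
        R.ent (klrT K (cyc n) d r) l l' (Nat.succ.inj h) (Nat.succ.inj h') := by
  obtain ⟨d, rfl⟩ : ∃ m, d = m + 1 := ⟨d - 1, by omega⟩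
  rw [ent, ent, R.ψ_t _ _ (Nat.succ_lt_succ hr), R.ψ_t _ _ hr]
  exact seqEntry_whiskerLeft R.decF (iterT R.τ (d + 1) r) i i' l l' h h'

end CategoricalRep

end RepEntries

/-! ### Locality of the action -/

section Append

universe v u

variable {C : Type u} [Category.{v} C] {I : Type*} (Fi : I → C ⥤ C)

/-- The value at an object of the identification of `F_{l ++ l'}` with `F_l' F_l`. -/
def appendIso (l l' : List I) (M : C) :
    (seqF Fi (l ++ l')).obj M ≅ (seqF Fi l').obj ((seqF Fi l).obj M) :=
  (seqFAppend Fi l l').app M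

theorem appendIso_cons (i : I) (l l' : List I) (M : C) :
    appendIso Fi (i :: l) l' M = appendIso Fi l l' ((Fi i).obj M) := by
  ext
  exact Category.comp_id _

theorem appendIso_hom_naturality (l l' : List I) {M N : C} (f : M ⟶ N) :
    (seqF Fi (l ++ l')).map f ≫ (appendIso Fi l l' N).hom =
      (appendIso Fi l l' M).hom ≫ (seqF Fi l').map ((seqF Fi l).map f) :=
  (seqFAppend Fi l l').hom.naturality f

/-- The identification of the functor of a concatenation is associative. -/
theorem appendIso_assoc (a b c : List I) (M : C) :
    (appendIso Fi a (b ++ c) M).hom ≫ (appendIso Fi b c ((seqF Fi a).obj M)).hom =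
      eqToHom (by rw [List.append_assoc]) ≫ (appendIso Fi (a ++ b) c M).hom ≫
        (seqF Fi c).map (appendIso Fi a b M).hom := by
  induction a generalizing M with
  | nil =>
    have h1 : (appendIso Fi b c M).hom ≫ (seqF Fi c).map (𝟙 ((seqF Fi b).obj M)) =
        (appendIso Fi b c M).hom := by
      rw [CategoryTheory.Functor.map_id, Category.comp_id]
    exact (Category.id_comp _).trans (h1.symm.trans (Category.id_comp _).symm)
  | cons i a ih =>
    have h1 : appendIso Fi (i :: a ++ b) c M = appendIso Fi (a ++ b) c ((Fi i).obj M) :=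
      appendIso_cons Fi i (a ++ b) c M
    rw [appendIso_cons, appendIso_cons Fi i a b, h1]
    exact ih ((Fi i).obj M)

end Append

theorem id_hcomp_app {C : Type*} [Category* C] {G H H' : C ⥤ C} (t : H ⟶ H') (M : C) :
    (𝟙 G ◫ t).app M = t.app (G.obj M) := by simp

theorem hcomp_id_app {C : Type*} [Category* C] {G G' H : C ⥤ C} (t : G ⟶ G') (M : C) :
    (t ◫ 𝟙 H).app M = H.map (t.app M) := by simp

section Locality

universe v u

variable {C : Type u} [Category.{v} C] [Preadditive C] {K : Type*} [Field K] [Linear K C]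
  {n : ℕ} [NeZero n] {wt : (ZMod n → ℤ) → ObjectProperty C} {Ei Fi : ZMod n → C ⥤ C}
  (R : CategoricalRep K n wt Ei Fi)

namespace CategoricalRep

/-- The element `B` acts on the sequences with the initial part `A` as `b` acts on the remaining
parts of these sequences. -/
structure IsLeftLocal (A : List (ZMod n)) {d N : ℕ} (b : KLR K (cyc n) d)
    (B : KLR K (cyc n) N) : Prop where
  ent_append : ∀ (l l' : List (ZMod n)) (hl : l.length = d) (hl' : l'.length = d)
    (h : (A ++ l).length = N) (h' : (A ++ l').length = N) (M : C),
    (R.ent B (A ++ l) (A ++ l') h h').app M = (appendIso Fi A l M).hom ≫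
      (R.ent b l l' hl hl').app ((seqF Fi A).obj M) ≫ (appendIso Fi A l' M).inv
  ent_eq_zero : ∀ (l w : List (ZMod n)) (h : (A ++ l).length = N) (hw : w.length = N),
    (∀ l', w ≠ A ++ l') → ∀ M, (R.ent B (A ++ l) w h hw).app M = 0

/-- The element `B` acts on the sequences with the final part `A` as `b` acts on the remaining
parts of these sequences. -/
structure IsRightLocal (A : List (ZMod n)) {d N : ℕ} (b : KLR K (cyc n) d)
    (B : KLR K (cyc n) N) : Prop where
  ent_append : ∀ (l l' : List (ZMod n)) (hl : l.length = d) (hl' : l'.length = d)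
    (h : (l ++ A).length = N) (h' : (l' ++ A).length = N) (M : C),
    (R.ent B (l ++ A) (l' ++ A) h h').app M = (appendIso Fi l A M).hom ≫
      (seqF Fi A).map ((R.ent b l l' hl hl').app M) ≫ (appendIso Fi l' A M).inv
  ent_eq_zero : ∀ (l w : List (ZMod n)) (_ : l.length = d) (h : (l ++ A).length = N)
    (hw : w.length = N), (∀ l', w ≠ l' ++ A) → ∀ M, (R.ent B (l ++ A) w h hw).app M = 0

variable {R} {A : List (ZMod n)} {d N : ℕ} {b b' : KLR K (cyc n) d} {B B' : KLR K (cyc n) N}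

theorem IsLeftLocal.neg (hb : R.IsLeftLocal A b B) : R.IsLeftLocal A (-b) (-B) where
  ent_append l l' hl hl' h h' M := by
    rw [ent_neg, ent_neg]
    change -(R.ent B _ _ h h').app M = _ ≫ (-(R.ent b l l' hl hl').app _) ≫ _
    rw [hb.ent_append l l' hl hl', Preadditive.neg_comp, Preadditive.comp_neg]
  ent_eq_zero l w h hw hlw M := by
    rw [ent_neg]
    change -(R.ent B _ _ h hw).app M = 0
    rw [hb.ent_eq_zero l w h hw hlw, neg_zero]

theorem IsLeftLocal.mul (hN : A.length + d = N) (hb : R.IsLeftLocal A b B)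
    (hb' : R.IsLeftLocal A b' B') : R.IsLeftLocal A (b * b') (B * B') where
  ent_append l l' hl hl' h h' M := by
    have key : ∀ u : List.Vector (ZMod n) d, (A ++ u.1).length = N := fun u =>
      (List.length_append ..).trans ((congrArg (A.length + ·) u.2).trans hN)
    rw [ent_mul_app, ent_mul_app, Preadditive.sum_comp, Preadditive.comp_sum]
    let j : List.Vector (ZMod n) d → List.Vector (ZMod n) N := fun u => ⟨A ++ u.1, key u⟩
    refine (Fintype.sum_of_injective j
      (fun u u' huu => ?_) _ _ (fun w hw => ?_) fun u => ?_).symm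
    · exact Subtype.ext (List.append_cancel_left (congrArg Subtype.val huu))
    · rw [hb.ent_eq_zero l w.1 h w.2, zero_comp]
      rintro l₁ hl₁
      have h1 : l₁.length = d := by
        have := w.2
        rw [hl₁, List.length_append] at this
        omega
      exact hw ⟨⟨l₁, h1⟩, Subtype.ext hl₁.symm⟩
    · refine Eq.trans ?_ (congrArg₂ CategoryStruct.comp (hb.ent_append l u.1 hl u.2 h (key u) M)
        (hb'.ent_append u.1 l' u.2 hl' (key u) h' M)).symm
      simp only [Category.assoc, Iso.inv_hom_id_assoc]
  ent_eq_zero l w h hw hlw M := by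
    rw [ent_mul_app]
    refine Finset.sum_eq_zero fun u _ => ?_
    by_cases hu : ∃ l', u.1 = A ++ l'
    · obtain ⟨u, h1⟩ := u
      obtain ⟨l', rfl⟩ := hu
      exact (congrArg _ (hb'.ent_eq_zero l' w h1 hw hlw M)).trans comp_zero
    · rw [hb.ent_eq_zero l u.1 h u.2 (not_exists.mp hu), zero_comp]

theorem IsRightLocal.neg (hb : R.IsRightLocal A b B) : R.IsRightLocal A (-b) (-B) where
  ent_append l l' hl hl' h h' M := by
    have := seqF_additive R.F_component_additive A
    rw [ent_neg, ent_neg]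
    change -(R.ent B _ _ h h').app M = _ ≫ (seqF Fi A).map (-(R.ent b l l' hl hl').app M) ≫ _
    rw [hb.ent_append l l' hl hl', Functor.map_neg, Preadditive.neg_comp, Preadditive.comp_neg]
  ent_eq_zero l w hl h hw hlw M := by
    rw [ent_neg]
    change -(R.ent B _ _ h hw).app M = 0
    rw [hb.ent_eq_zero l w hl h hw hlw, neg_zero]

theorem IsRightLocal.mul (hN : d + A.length = N) (hb : R.IsRightLocal A b B)
    (hb' : R.IsRightLocal A b' B') : R.IsRightLocal A (b * b') (B * B') where
  ent_append l l' hl hl' h h' M := by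
    have := seqF_additive R.F_component_additive A
    have key : ∀ u : List.Vector (ZMod n) d, (u.1 ++ A).length = N := fun u =>
      (List.length_append ..).trans ((congrArg (· + A.length) u.2).trans hN)
    rw [ent_mul_app, ent_mul_app, Functor.map_sum, Preadditive.sum_comp, Preadditive.comp_sum]
    let j : List.Vector (ZMod n) d → List.Vector (ZMod n) N := fun u => ⟨u.1 ++ A, key u⟩
    refine (Fintype.sum_of_injective j
      (fun u u' huu => ?_) _ _ (fun w hw => ?_) fun u => ?_).symm
    · exact Subtype.ext (List.append_cancel_right (congrArg Subtype.val huu))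
    · rw [hb.ent_eq_zero l w.1 hl h w.2, zero_comp]
      rintro l₁ hl₁
      have h1 : l₁.length = d := by
        have := w.2
        rw [hl₁, List.length_append] at this
        omega
      exact hw ⟨⟨l₁, h1⟩, Subtype.ext hl₁.symm⟩
    · refine Eq.trans ?_ (congrArg₂ CategoryStruct.comp (hb.ent_append l u.1 hl u.2 h (key u) M)
        (hb'.ent_append u.1 l' u.2 hl' (key u) h' M)).symm
      simp only [Category.assoc, Iso.inv_hom_id_assoc, Functor.map_comp]
  ent_eq_zero l w hl h hw hlw M := by
    rw [ent_mul_app]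
    refine Finset.sum_eq_zero fun u _ => ?_
    by_cases hu : ∃ l', u.1 = l' ++ A
    · obtain ⟨u, h1⟩ := u
      obtain ⟨l', rfl⟩ := hu
      rw [List.length_append] at h1
      exact (congrArg _ (hb'.ent_eq_zero l' w (by omega) _ hw hlw M)).trans comp_zero
    · rw [hb.ent_eq_zero l u.1 hl h u.2 (not_exists.mp hu), zero_comp]

theorem isLeftLocal_nil (b : KLR K (cyc n) d) : R.IsLeftLocal [] b b where
  ent_append _ _ _ _ _ _ _ := ((Category.id_comp _).trans (Category.comp_id _)).symm
  ent_eq_zero _ w _ _ hlw := (hlw w rfl).elim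

/-- It suffices to know the action on sequences with a common first entry. -/
theorem IsLeftLocal.cons {i : ZMod n} {B₁ : KLR K (cyc n) (N + 1)} (hb : R.IsLeftLocal A b B)
    (hB : ∀ (i' : ZMod n) (l l' : List (ZMod n)) (h : (i :: l).length = N + 1)
      (h' : (i' :: l').length = N + 1), R.ent B₁ (i :: l) (i' :: l') h h' =
        (R.decF.ι i ≫ R.decF.π i') ◫ R.ent B l l' (Nat.succ.inj h) (Nat.succ.inj h')) :
    R.IsLeftLocal (i :: A) b B₁ where
  ent_append l l' hl hl' h h' M := by
    refine (congrArg (fun t => t.app M) (hB i (A ++ l) (A ++ l') h h')).trans ?_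
    rw [R.decF.ι_π_self, appendIso_cons, appendIso_cons]
    refine (id_hcomp_app _ M).trans ?_
    exact hb.ent_append l l' hl hl' _ _ _
  ent_eq_zero l w h hw hlw M := by
    obtain ⟨i', w, rfl⟩ := List.exists_cons_of_length_eq_add_one hw
    refine (congrArg (fun t => t.app M) (hB i' (A ++ l) w h hw)).trans ?_
    by_cases hi : i = i'
    · subst hi
      rw [R.decF.ι_π_self]
      refine (id_hcomp_app _ M).trans ?_
      exact hb.ent_eq_zero l w _ _ (fun l' hl' => hlw l' (congrArg (i :: ·) hl')) _
    · rw [R.decF.ι_π_ne i i' hi, zero_hcomp (seqF_additive R.F_component_additive _)]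
      rfl

theorem isLeftLocal_klrX (A : List (ZMod n)) {d N r s : ℕ} (hr : r < d) (hN : A.length + d = N)
    (hs : A.length + r = s) : R.IsLeftLocal A (klrX K (cyc n) d r) (klrX K (cyc n) N s) := by
  induction A generalizing N s with
  | nil =>
    obtain rfl : d = N := by simpa using hN
    obtain rfl : r = s := by simpa using hs
    exact isLeftLocal_nil _
  | cons i A ih =>
    obtain ⟨N, rfl⟩ : ∃ m, N = m + 1 := ⟨N - 1, by simp at hN; omega⟩
    obtain ⟨s, rfl⟩ : ∃ m, s = m + 1 := ⟨s - 1, by simp at hs; omega⟩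
    simp only [List.length_cons] at hN hs
    exact (ih (N := N) (s := s) (by omega) (by omega)).cons fun i' l l' h h' =>
      R.ent_klrX_cons_succ (by omega) i i' l l' h h'

theorem isLeftLocal_klrT (A : List (ZMod n)) {d N r s : ℕ} (hr : r + 1 < d)
    (hN : A.length + d = N) (hs : A.length + r = s) :
    R.IsLeftLocal A (klrT K (cyc n) d r) (klrT K (cyc n) N s) := by
  induction A generalizing N s with
  | nil =>
    obtain rfl : d = N := by simpa using hN
    obtain rfl : r = s := by simpa using hs
    exact isLeftLocal_nil _
  | cons i A ih =>
    obtain ⟨N, rfl⟩ : ∃ m, N = m + 1 := ⟨N - 1, by simp at hN; omega⟩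
    obtain ⟨s, rfl⟩ : ∃ m, s = m + 1 := ⟨s - 1, by simp at hs; omega⟩
    simp only [List.length_cons] at hN hs
    exact (ih (N := N) (s := s) (by omega) (by omega)).cons fun i' l l' h h' =>
      R.ent_klrT_cons_succ (by omega) i i' l l' h h'

/-- It suffices to know the action on sequences with a common first entry. -/
theorem IsRightLocal.cons {b₁ : KLR K (cyc n) (d + 1)} {B₁ : KLR K (cyc n) (N + 1)}
    (hb : R.IsRightLocal A b B)
    (hb₁ : ∀ (i i' : ZMod n) (l l' : List (ZMod n)) (h : (i :: l).length = d + 1)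
      (h' : (i' :: l').length = d + 1), R.ent b₁ (i :: l) (i' :: l') h h' =
        (R.decF.ι i ≫ R.decF.π i') ◫ R.ent b l l' (Nat.succ.inj h) (Nat.succ.inj h'))
    (hB₁ : ∀ (i i' : ZMod n) (l l' : List (ZMod n)) (h : (i :: l).length = N + 1)
      (h' : (i' :: l').length = N + 1), R.ent B₁ (i :: l) (i' :: l') h h' =
        (R.decF.ι i ≫ R.decF.π i') ◫ R.ent B l l' (Nat.succ.inj h) (Nat.succ.inj h')) :
    R.IsRightLocal A b₁ B₁ where
  ent_append l l' hl hl' h h' M := by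
    have hadd := seqF_additive R.F_component_additive
    obtain ⟨i, l, rfl⟩ := List.exists_cons_of_length_eq_add_one hl
    obtain ⟨i', l', rfl⟩ := List.exists_cons_of_length_eq_add_one hl'
    refine (congrArg (fun t => t.app M) (hB₁ i i' (l ++ A) (l' ++ A) h h')).trans ?_
    rw [hb₁]
    by_cases hi : i = i'
    · subst hi
      rw [R.decF.ι_π_self, appendIso_cons, appendIso_cons]
      refine (id_hcomp_app _ M).trans ((hb.ent_append l l' (Nat.succ.inj hl) (Nat.succ.inj hl')
        _ _ _).trans ?_)
      exact congrArg (fun t => _ ≫ (seqF Fi A).map t ≫ _) (id_hcomp_app _ M).symm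
    · rw [R.decF.ι_π_ne i i' hi, zero_hcomp (hadd _), zero_hcomp (hadd _)]
      have := hadd A
      refine Eq.symm ?_
      refine (congrArg (fun t => _ ≫ t ≫ _) ((seqF Fi A).map_zero _ _)).trans ?_
      rw [zero_comp, comp_zero]
      rfl
  ent_eq_zero l w hl h hw hlw M := by
    obtain ⟨i, l, rfl⟩ := List.exists_cons_of_length_eq_add_one hl
    obtain ⟨i', w, rfl⟩ := List.exists_cons_of_length_eq_add_one hw
    refine (congrArg (fun t => t.app M) (hB₁ i i' (l ++ A) w h hw)).trans ?_
    by_cases hi : i = i'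
    · subst hi
      rw [R.decF.ι_π_self]
      refine (id_hcomp_app _ M).trans ?_
      exact hb.ent_eq_zero l w (Nat.succ.inj hl) _ _
        (fun l' hl' => hlw (i :: l') (congrArg (i :: ·) hl')) _
    · rw [R.decF.ι_π_ne i i' hi, zero_hcomp (seqF_additive R.F_component_additive _)]
      rfl

variable (R) in
/-- Horizontal composites with an identity of `F^N` restrict to final parts of the sequences. -/
theorem hcomp_seqEntry_append {G G' : C ⥤ C} (t : G ⟶ G') {d N : ℕ} (l l' : List (ZMod n))
    (hl : l.length = d) (hl' : l'.length = d) (h : (l ++ A).length = N)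
    (h' : (l' ++ A).length = N) (M : C) :
    (t ◫ seqEntry R.decF (𝟙 (iter R.F N)) (l ++ A) (l' ++ A) h h').app M =
      (appendIso Fi l A (G.obj M)).hom ≫ (seqF Fi A).map
        ((t ◫ seqEntry R.decF (𝟙 (iter R.F d)) l l' hl hl').app M) ≫
          (appendIso Fi l' A (G'.obj M)).inv := by
  have := seqF_additive R.F_component_additive A
  by_cases hll : l = l'
  · subst hll
    rw [seqEntry_id_self, seqEntry_id_self, hcomp_id_app, hcomp_id_app, ← Category.assoc,
      Iso.eq_comp_inv]
    exact appendIso_hom_naturality Fi l A (t.app M)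
  · rw [seqEntry_id_of_ne _ R.F_additive _ _ _ _ fun h => hll (List.append_cancel_right h),
      seqEntry_id_of_ne _ R.F_additive _ _ _ _ hll, hcomp_zero', hcomp_zero']
    refine Eq.symm ?_
    refine (congrArg (fun t => _ ≫ t ≫ _) ((seqF Fi A).map_zero _ _)).trans ?_
    rw [zero_comp, comp_zero]
    rfl

theorem isRightLocal_klrX_zero (A : List (ZMod n)) :
    R.IsRightLocal A (klrX K (cyc n) (d + 1) 0) (klrX K (cyc n) (N + 1) 0) where
  ent_append l l' hl hl' h h' M := by
    obtain ⟨i, l, rfl⟩ := List.exists_cons_of_length_eq_add_one hl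
    obtain ⟨i', l', rfl⟩ := List.exists_cons_of_length_eq_add_one hl'
    refine (congrArg (fun t => t.app M)
      (R.ent_klrX_cons_zero i i' (l ++ A) (l' ++ A) h h')).trans ?_
    rw [ent_klrX_cons_zero, appendIso_cons, appendIso_cons]
    exact R.hcomp_seqEntry_append _ l l' (Nat.succ.inj hl) (Nat.succ.inj hl') _ _ M
  ent_eq_zero l w hl h hw hlw M := by
    obtain ⟨i, l, rfl⟩ := List.exists_cons_of_length_eq_add_one hl
    obtain ⟨i', w, rfl⟩ := List.exists_cons_of_length_eq_add_one hw
    have hne : l ++ A ≠ w := fun h => hlw (i' :: l) (congrArg (i' :: ·) h.symm)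
    refine (congrArg (fun t => t.app M) (R.ent_klrX_cons_zero i i' (l ++ A) w h hw)).trans ?_
    rw [seqEntry_id_of_ne _ R.F_additive _ _ _ _ hne, hcomp_zero']
    rfl

theorem isRightLocal_klrT_zero (A : List (ZMod n)) :
    R.IsRightLocal A (klrT K (cyc n) (d + 2) 0) (klrT K (cyc n) (N + 2) 0) where
  ent_append l l' hl hl' h h' M := by
    obtain ⟨i, l, rfl⟩ := List.exists_cons_of_length_eq_add_one hl
    obtain ⟨i', l', rfl⟩ := List.exists_cons_of_length_eq_add_one hl'
    obtain ⟨j, l, rfl⟩ := List.exists_cons_of_length_eq_add_one (Nat.succ.inj hl)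
    obtain ⟨j', l', rfl⟩ := List.exists_cons_of_length_eq_add_one (Nat.succ.inj hl')
    refine (R.ent_klrT_cons_zero_app i j i' j' (l ++ A) (l' ++ A) h h' M).trans ?_
    rw [ent_klrT_cons_zero_app, appendIso_cons, appendIso_cons, appendIso_cons, appendIso_cons]
    exact R.hcomp_seqEntry_append _ l l' (Nat.succ.inj (Nat.succ.inj hl))
      (Nat.succ.inj (Nat.succ.inj hl')) _ _ M
  ent_eq_zero l w hl h hw hlw M := by
    obtain ⟨i, l, rfl⟩ := List.exists_cons_of_length_eq_add_one hl
    obtain ⟨i', w, rfl⟩ := List.exists_cons_of_length_eq_add_one hw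
    obtain ⟨j, l, rfl⟩ := List.exists_cons_of_length_eq_add_one (Nat.succ.inj hl)
    obtain ⟨j', w, rfl⟩ := List.exists_cons_of_length_eq_add_one (Nat.succ.inj hw)
    have hne : l ++ A ≠ w := fun h =>
      hlw (i' :: j' :: l) (congrArg (fun m => i' :: j' :: m) h.symm)
    refine (R.ent_klrT_cons_zero_app i j i' j' (l ++ A) w h hw M).trans ?_
    rw [seqEntry_id_of_ne _ R.F_additive _ _ _ _ hne, hcomp_zero']
    rfl

theorem isRightLocal_klrT (A : List (ZMod n)) {d N r : ℕ} (hr : r + 1 < d)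
    (hN : d + A.length = N) : R.IsRightLocal A (klrT K (cyc n) d r) (klrT K (cyc n) N r) := by
  induction r generalizing d N with
  | zero =>
    obtain ⟨d, rfl⟩ : ∃ m, d = m + 2 := ⟨d - 2, by omega⟩
    obtain ⟨N, rfl⟩ : ∃ m, N = m + 2 := ⟨N - 2, by omega⟩
    exact isRightLocal_klrT_zero A
  | succ r ih =>
    obtain ⟨d, rfl⟩ : ∃ m, d = m + 1 := ⟨d - 1, by omega⟩
    obtain ⟨N, rfl⟩ : ∃ m, N = m + 1 := ⟨N - 1, by omega⟩
    exact (ih (d := d) (N := N) (by omega) (by omega)).cons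
      (fun i i' l l' h h' => R.ent_klrT_cons_succ (by omega) i i' l l' h h')
      fun i i' l l' h h' => R.ent_klrT_cons_succ (by omega) i i' l l' h h'

end CategoricalRep

end Locality

/-! ### Doubled dots and crossings -/

section DoubledOps

universe v u

variable {C : Type u} [Category.{v} C] [Preadditive C] {K : Type*} [Field K] [Linear K C]
  {e k : ℕ} [NeZero e] {wt : (ZMod (e + 1) → ℤ) → ObjectProperty C}
  {Ei Fi : ZMod (e + 1) → C ⥤ C} (R : CategoricalRep K (e + 1) wt Ei Fi)

namespace CategoricalRep

/-- The entries of the words for crossings of doubled strands vanish unless the blocks are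
exchanged. -/
theorem entry_crossStar_of_ne (hk : k < e) {N : ℕ} (a b : ZMod e) (l m : List (ZMod e))
    (h : (phi k m).length = N) (h' : (phi k (a :: b :: l)).length = N) (hm : m ≠ b :: a :: l) :
    R.ent (crossStar k K N 0 a b) (phi k m) (phi k (a :: b :: l)) h h' = 0 := by
  have hact : act (starWord k 0 a b) (phi k (a :: b :: l)) = phi k (b :: a :: l) :=
    act_starWord [] (phiVertex k a) (phiVertex k b) (phi k l) (length_phiVertex a)
      (length_phiVertex b)
  let w : List.Vector (ZMod (e + 1)) N := ⟨phi k (a :: b :: l), h'⟩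
  have h1 : crossStar k K N 0 a b * klrE K (cyc (e + 1)) w =
      klrE K (cyc (e + 1)) (actVec (starWord k 0 a b) w) * crossStar k K N 0 a b := by
    rw [crossStar_eq, smul_mul_assoc, tauWord_mul_klrE, mul_smul_comm]
  refine (R.entry_mul_klrE_self (crossStar k K N 0 a b) ⟨phi k m, h⟩ w).symm.trans ?_
  rw [h1]
  refine R.entry_klrE_mul_of_ne _ _ _ _ fun h2 => hm (phi_injective hk ?_)
  exact (congrArg Subtype.val h2).trans hact

/-- The dots do not change the sequences. -/
theorem ent_klrX_of_ne {N r : ℕ} (l l' : List (ZMod (e + 1))) (h : l.length = N)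
    (h' : l'.length = N) (hne : l ≠ l') : R.ent (klrX K (cyc (e + 1)) N r) l l' h h' = 0 := by
  let w : List.Vector (ZMod (e + 1)) N := ⟨l', h'⟩
  refine (R.entry_mul_klrE_self _ ⟨l, h⟩ w).symm.trans ?_
  rw [klrX_mul_klrE]
  exact R.entry_klrE_mul_of_ne _ _ _ _ fun h2 => hne (congrArg Subtype.val h2)

variable {R}

/-- The crossings of blocks are local, since they are products of crossings. -/
theorem isLeftLocal_crossStar (A : List (ZMod (e + 1))) {d N p q : ℕ} (a b : ZMod e)
    (hp : p + ((phiVertex k a).length + (phiVertex k b).length) ≤ d) (hN : A.length + d = N)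
    (hq : A.length + p = q) :
    R.IsLeftLocal A (crossStar k K d p a b) (crossStar k K N q a b) := by
  have key : ∀ r s, r + 1 < d → A.length + r = s →
    R.IsLeftLocal A (klrT K (cyc (e + 1)) d r) (klrT K (cyc (e + 1)) N s) :=
    fun r s hr hs => isLeftLocal_klrT A hr hN hs
  rw [length_phiVertex, length_phiVertex] at hp
  unfold crossStar
  split_ifs at hp ⊢
  · exact ((((key _ _ (by omega) (by omega)).mul hN (key _ _ (by omega) (by omega))).mul hN
      (key _ _ (by omega) (by omega))).mul hN (key _ _ (by omega) (by omega))).neg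
  · exact (key _ _ (by omega) (by omega)).mul hN (key _ _ (by omega) (by omega))
  · exact (key _ _ (by omega) (by omega)).mul hN (key _ _ (by omega) (by omega))
  · exact key _ _ (by omega) (by omega)

theorem isRightLocal_crossStar (A : List (ZMod (e + 1))) {d N : ℕ} (a b : ZMod e)
    (hp : (phiVertex k a).length + (phiVertex k b).length ≤ d) (hN : d + A.length = N) :
    R.IsRightLocal A (crossStar k K d 0 a b) (crossStar k K N 0 a b) := by
  have key : ∀ r, r + 1 < d →
    R.IsRightLocal A (klrT K (cyc (e + 1)) d r) (klrT K (cyc (e + 1)) N r) :=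
    fun r hr => isRightLocal_klrT A hr hN
  rw [length_phiVertex, length_phiVertex] at hp
  unfold crossStar
  split_ifs at hp ⊢
  · exact ((((key _ (by omega)).mul hN (key _ (by omega))).mul hN (key _ (by omega))).mul hN
      (key _ (by omega))).neg
  · exact (key _ (by omega)).mul hN (key _ (by omega))
  · exact (key _ (by omega)).mul hN (key _ (by omega))
  · exact key _ (by omega)

variable (R k)

/-- The endomorphism of the functor of a block which is given by the dot on its first strand. -/
def doubledDot (i : ZMod e) : doubledF k Fi i ⟶ doubledF k Fi i :=
  R.ent (klrX K (cyc (e + 1)) (phiVertex k i).length 0) (phiVertex k i) (phiVertex k i) rfl rfl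

/-- The crossing of two blocks. -/
def doubledCross (i j : ZMod e) :
    doubledF k Fi i ⋙ doubledF k Fi j ⟶ doubledF k Fi j ⋙ doubledF k Fi i :=
  (seqFAppend Fi (phiVertex k i) (phiVertex k j)).inv ≫
    R.ent (crossStar k K (phiVertex k i ++ phiVertex k j).length 0 j i)
      (phiVertex k i ++ phiVertex k j) (phiVertex k j ++ phiVertex k i) rfl
      (by rw [List.length_append, List.length_append, add_comm]) ≫
    (seqFAppend Fi (phiVertex k j) (phiVertex k i)).hom

end CategoricalRep

end DoubledOps

/-! ### Comparison of the matrix entries -/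

section Match

universe v u

variable {C : Type u} [Category.{v} C] {e k : ℕ} {P : ObjectProperty C}
  {Fi : ZMod (e + 1) → C ⥤ C}
  (hF : ∀ (i : ZMod e) (M : C), P M → P ((doubledF k Fi i).obj M))

/-- The functors on the full subcategory `P` which are induced by the doubled functors. -/
abbrev restrictF (i : ZMod e) : P.FullSubcategory ⥤ P.FullSubcategory :=
  restrict P (doubledF k Fi i) (hF i)

/-- The value at an object of the identification `restrictIso`. -/
def restrictObjIso (l : List (ZMod e)) (M : P.FullSubcategory) :
    ((seqF (restrictF hF) l).obj M).obj ≅ (seqF Fi (phi k l)).obj M.obj :=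
  (restrictIso k P Fi hF l).app M

theorem restrictObjIso_cons (i : ZMod e) (l : List (ZMod e)) (M : P.FullSubcategory) :
    restrictObjIso hF (i :: l) M = restrictObjIso hF l ((restrictF hF i).obj M) ≪≫
      (appendIso Fi (phiVertex k i) (phi k l) M.obj).symm := by
  ext
  have h1 : ∀ {X Y Z : C} (f : X ⟶ Y) (g : Y ⟶ Z), 𝟙 _ ≫ f ≫ 𝟙 _ ≫ 𝟙 _ ≫ 𝟙 _ ≫ g = f ≫ g :=
    fun f g => by simp
  refine Eq.trans ?_ (h1 ((restrictIso k P Fi hF l).hom.app ((restrictF hF i).obj M))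
    ((seqFAppend Fi (phiVertex k i) (phi k l)).inv.app M.obj))
  exact congrArg (fun t => 𝟙 _ ≫ (restrictIso k P Fi hF l).hom.app ((restrictF hF i).obj M) ≫
    𝟙 _ ≫ t ≫ 𝟙 _ ≫ (seqFAppend Fi (phiVertex k i) (phi k l)).inv.app M.obj)
    ((seqF Fi (phi k l)).map_id _)

end Match

section MatchLemmas

universe v u

variable {C : Type u} [Category.{v} C] {e k : ℕ} {P : ObjectProperty C}
  {Fi : ZMod (e + 1) → C ⥤ C}
  (hF : ∀ (i : ZMod e) (M : C), P M → P ((doubledF k Fi i).obj M))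

theorem restrictObjIso_naturality (l : List (ZMod e)) {M N : P.FullSubcategory} (f : M ⟶ N) :
    ((seqF (restrictF hF) l).map f).hom ≫ (restrictObjIso hF l N).hom =
      (restrictObjIso hF l M).hom ≫ (seqF Fi (phi k l)).map f.hom :=
  (restrictIso k P Fi hF l).hom.naturality f

/-- The natural transformations `f` between the functors of sequences on the full subcategory and
`g` between the functors of the doubled sequences are identified by `restrictIso`. -/
def Match (v w : List (ZMod e)) (f : seqF (restrictF hF) v ⟶ seqF (restrictF hF) w)
    (g : seqF Fi (phi k v) ⟶ seqF Fi (phi k w)) : Prop :=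
  ∀ M : P.FullSubcategory, (f.app M).hom ≫ (restrictObjIso hF w M).hom =
    (restrictObjIso hF v M).hom ≫ g.app M.obj

variable {hF} {v w u : List (ZMod e)} {f f' : seqF (restrictF hF) v ⟶ seqF (restrictF hF) w}
  {g g' : seqF Fi (phi k v) ⟶ seqF Fi (phi k w)}

theorem match_iff : Match hF v w f g ↔ Functor.whiskerRight f P.ι ≫ (restrictIso k P Fi hF w).hom =
    (restrictIso k P Fi hF v).hom ≫ Functor.whiskerLeft P.ι g :=
  ⟨fun h => NatTrans.ext (funext h), fun h M => congrArg (fun t => t.app M) h⟩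

/-- A natural transformation between functors on the full subcategory is determined by a matching
one. -/
theorem Match.eq (h : Match hF v w f g) (h' : Match hF v w f' g') (hg : ∀ M, P M →
    g.app M = g'.app M) : f = f' := by
  ext M
  have h1 := (h M).trans ((congrArg _ (hg M.obj M.property)).trans (h' M).symm)
  exact (cancel_mono (restrictObjIso hF w M).hom).mp h1

theorem match_id (v : List (ZMod e)) : Match hF v v (𝟙 _) (𝟙 _) := fun _ =>
  (Category.id_comp _).trans (Category.comp_id _).symm

theorem Match.comp {f₁ : seqF (restrictF hF) w ⟶ seqF (restrictF hF) u}
    {g₁ : seqF Fi (phi k w) ⟶ seqF Fi (phi k u)} (h : Match hF v w f g)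
    (h₁ : Match hF w u f₁ g₁) : Match hF v u (f ≫ f₁) (g ≫ g₁) := fun M => by
  change ((f.app M).hom ≫ (f₁.app M).hom) ≫ _ = _ ≫ g.app M.obj ≫ g₁.app M.obj
  rw [Category.assoc, h₁ M, ← Category.assoc, h M, Category.assoc]

theorem comp_iso_square {X Y Z X' Y' Z' : C} (r : X ≅ Y) (a : Z ≅ Y) (r' : X' ≅ Y') (a' : Z' ≅ Y')
    {f : X ⟶ X'} {g : Y ⟶ Y'} {g₁ : Z ⟶ Z'} (h : f ≫ r'.hom = r.hom ≫ g)
    (hg : g₁ = a.hom ≫ g ≫ a'.inv) :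
    f ≫ (r' ≪≫ a'.symm).hom = (r ≪≫ a.symm).hom ≫ g₁ := by
  subst hg
  simp [reassoc_of% h]

/-- The case of an operator acting behind the first block. -/
theorem Match.cons (i : ZMod e) {g₁ : seqF Fi (phi k (i :: v)) ⟶ seqF Fi (phi k (i :: w))}
    (h : Match hF v w f g)
    (hg : ∀ M, g₁.app M = (appendIso Fi (phiVertex k i) (phi k v) M).hom ≫
      g.app ((doubledF k Fi i).obj M) ≫ (appendIso Fi (phiVertex k i) (phi k w) M).inv) :
    Match hF (i :: v) (i :: w) (𝟙 (restrictF hF i) ◫ f) g₁ := fun M => by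
  rw [restrictObjIso_cons, restrictObjIso_cons]
  exact (congrArg (fun t => t ≫ _) (congrArg InducedCategory.Hom.hom (id_hcomp_app f M))).trans
    (comp_iso_square _ _ _ _ (h ((restrictF hF i).obj M)) (hg M.obj))

/-- The case of an operator acting on the first block. -/
theorem Match.head {i j : ZMod e} (l : List (ZMod e)) (t : restrictF hF i ⟶ restrictF hF j)
    {g₁ : seqF Fi (phi k (i :: l)) ⟶ seqF Fi (phi k (j :: l))}
    (hg : ∀ M : P.FullSubcategory, g₁.app M.obj =
      (appendIso Fi (phiVertex k i) (phi k l) M.obj).hom ≫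
      (seqF Fi (phi k l)).map (t.app M).hom ≫
        (appendIso Fi (phiVertex k j) (phi k l) M.obj).inv) :
    Match hF (i :: l) (j :: l) (t ◫ 𝟙 (seqF (restrictF hF) l)) g₁ := fun M => by
  rw [restrictObjIso_cons, restrictObjIso_cons]
  exact (congrArg (fun t => t ≫ _) (congrArg InducedCategory.Hom.hom (hcomp_id_app t M))).trans
    (comp_iso_square _ _ _ _ (restrictObjIso_naturality hF l (t.app M)) (hg M))

theorem restrictObjIso_cons_cons (i j : ZMod e) (l : List (ZMod e)) (M : P.FullSubcategory) :
    restrictObjIso hF (i :: j :: l) M =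
      restrictObjIso hF l ((restrictF hF j).obj ((restrictF hF i).obj M)) ≪≫
        (appendIso Fi (phiVertex k i) (phi k (j :: l)) M.obj ≪≫
          appendIso Fi (phiVertex k j) (phi k l) ((doubledF k Fi i).obj M.obj)).symm := by
  rw [restrictObjIso_cons, restrictObjIso_cons]
  exact Iso.trans_assoc _ _ _

/-- The case of an operator acting on the first two blocks. -/
theorem Match.head₂ {i j a b : ZMod e} (l : List (ZMod e))
    (t : restrictF hF i ⋙ restrictF hF j ⟶ restrictF hF a ⋙ restrictF hF b)
    {f₁ : seqF (restrictF hF) (i :: j :: l) ⟶ seqF (restrictF hF) (a :: b :: l)}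
    {g₁ : seqF Fi (phi k (i :: j :: l)) ⟶ seqF Fi (phi k (a :: b :: l))}
    (hf : ∀ M, f₁.app M = (t ◫ 𝟙 (seqF (restrictF hF) l)).app M)
    (hg : ∀ M : P.FullSubcategory, g₁.app M.obj =
      (appendIso Fi (phiVertex k i) (phi k (j :: l)) M.obj ≪≫
        appendIso Fi (phiVertex k j) (phi k l) ((doubledF k Fi i).obj M.obj)).hom ≫
      (seqF Fi (phi k l)).map (t.app M).hom ≫
        (appendIso Fi (phiVertex k a) (phi k (b :: l)) M.obj ≪≫
          appendIso Fi (phiVertex k b) (phi k l) ((doubledF k Fi a).obj M.obj)).inv) :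
    Match hF (i :: j :: l) (a :: b :: l) f₁ g₁ := fun M => by
  rw [restrictObjIso_cons_cons, restrictObjIso_cons_cons]
  exact (congrArg (fun t => t ≫ _) (congrArg InducedCategory.Hom.hom
    ((hf M).trans (hcomp_id_app t M)))).trans
    (comp_iso_square _ _ _ _ (restrictObjIso_naturality hF l (t.app M)) (hg M))

end MatchLemmas

section MatchLinear

universe v u

variable {C : Type u} [Category.{v} C] [Preadditive C] {K : Type*} [Field K] [Linear K C]
  {e k : ℕ} {P : ObjectProperty C} {Fi : ZMod (e + 1) → C ⥤ C}
  {hF : ∀ (i : ZMod e) (M : C), P M → P ((doubledF k Fi i).obj M)}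
  {v w : List (ZMod e)} {f f' : seqF (restrictF hF) v ⟶ seqF (restrictF hF) w}
  {g g' : seqF Fi (phi k v) ⟶ seqF Fi (phi k w)}

theorem match_zero (v w : List (ZMod e)) : Match hF v w 0 0 := fun _ =>
  zero_comp.trans comp_zero.symm

theorem Match.add (h : Match hF v w f g) (h' : Match hF v w f' g') :
    Match hF v w (f + f') (g + g') := fun M => by
  change ((f.app M).hom + (f'.app M).hom) ≫ _ = _ ≫ (g.app M.obj + g'.app M.obj)
  rw [Preadditive.add_comp, Preadditive.comp_add, h M, h' M]

theorem Match.smul (c : K) (h : Match hF v w f g) : Match hF v w (c • f) (c • g) := fun M => by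
  change (c • (f.app M).hom) ≫ _ = _ ≫ (c • g.app M.obj)
  rw [Linear.smul_comp, Linear.comp_smul, h M]

theorem match_sum {J : Type*} (s : Finset J)
    {f : J → (seqF (restrictF hF) v ⟶ seqF (restrictF hF) w)}
    {g : J → (seqF Fi (phi k v) ⟶ seqF Fi (phi k w))} (h : ∀ j ∈ s, Match hF v w (f j) (g j)) :
    Match hF v w (∑ j ∈ s, f j) (∑ j ∈ s, g j) := by
  classical
  induction s using Finset.induction_on with
  | empty => exact match_zero v w
  | insert j s hj ih =>
    rw [Finset.sum_insert hj, Finset.sum_insert hj]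
    exact (h j (by simp)).add (ih fun i hi => h i (by simp [hi]))

end MatchLinear

/-! ### The restricted dots and crossings -/

theorem shiftPos_zero {e : ℕ} (k : ℕ) (l : List (ZMod e)) : shiftPos k l 0 = 0 := rfl

theorem shiftPos_cons_succ {e : ℕ} (k : ℕ) (i : ZMod e) (l : List (ZMod e)) (r : ℕ) :
    shiftPos k (i :: l) (r + 1) = (phiVertex k i).length + shiftPos k l r := by
  simp [shiftPos, phi]

theorem shiftPos_add_length_le {e k : ℕ} (l : List (ZMod e)) {r : ℕ} (hr : r < l.length) :
    shiftPos k l r + (phiVertex k l[r]).length ≤ (phi k l).length := by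
  induction l generalizing r with
  | nil => simp at hr
  | cons i l ih =>
    rw [phi, List.length_append]
    cases r with
    | zero => simp [shiftPos_zero]
    | succ r =>
      have := ih (r := r) (by simpa using hr)
      rw [shiftPos_cons_succ]
      simp only [List.getElem_cons_succ]
      omega

theorem shiftPos_succ {e k : ℕ} (l : List (ZMod e)) {r : ℕ} (hr : r < l.length) :
    shiftPos k l (r + 1) = shiftPos k l r + (phiVertex k l[r]).length := by
  induction l generalizing r with
  | nil => simp at hr
  | cons i l ih =>
    cases r with
    | zero => simp [shiftPos_zero, shiftPos_cons_succ]
    | succ r =>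
      have := ih (r := r) (by simpa using hr)
      rw [shiftPos_cons_succ, shiftPos_cons_succ]
      simp only [List.getElem_cons_succ]
      omega

section RestrictedOps

universe v u

variable {C : Type u} [Category.{v} C] [Preadditive C] {K : Type*} [Field K] [Linear K C]
  {e k : ℕ} [NeZero e] {wt : (ZMod (e + 1) → ℤ) → ObjectProperty C}
  {Ei Fi : ZMod (e + 1) → C ⥤ C} (R : CategoricalRep K (e + 1) wt Ei Fi) {P : ObjectProperty C}
  (hF : ∀ (i : ZMod e) (M : C), P M → P ((doubledF k Fi i).obj M))
  {F' : P.FullSubcategory ⥤ P.FullSubcategory} (D : SumDecomposition F' (restrictF hF))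

namespace CategoricalRep

/-- The crossing of two blocks, on the full subcategory. -/
def restrictCrossComp (i j : ZMod e) :
    restrictF hF i ⋙ restrictF hF j ⟶ restrictF hF j ⋙ restrictF hF i where
  app M := ObjectProperty.homMk ((R.doubledCross k i j).app M.obj)
  naturality _ _ f := ObjectProperty.hom_ext _ ((R.doubledCross k i j).naturality f.hom)

/-- The endomorphism `x` of the direct sum of the restricted functors. -/
def restrictDot : F' ⟶ F' :=
  ∑ i, D.π i ≫ restrictHom (hF i) (hF i) (R.doubledDot k i) ≫ D.ι i

/-- The endomorphism `τ` of the square of the direct sum of the restricted functors. -/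
def restrictCross : F' ⋙ F' ⟶ F' ⋙ F' :=
  ∑ i, ∑ j, (D.π i ◫ D.π j) ≫ R.restrictCrossComp hF i j ≫ (D.ι j ◫ D.ι i)

theorem dotComp_restrictDot_self (i : ZMod e) : dotComp D (R.restrictDot hF D) i i =
    restrictHom (hF i) (hF i) (R.doubledDot k i) := by
  rw [dotComp, restrictDot, Preadditive.sum_comp, Preadditive.comp_sum, Fintype.sum_eq_single i]
  · rw [Category.assoc, Category.assoc, D.ι_π_self, Category.comp_id, ← Category.assoc, D.ι_π_self,
      Category.id_comp]
  · intro j hj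
    rw [Category.assoc, Category.assoc, D.ι_π_ne j i hj, comp_zero, comp_zero, comp_zero]

theorem dotComp_restrictDot_of_ne (i j : ZMod e) (hij : i ≠ j) :
    dotComp D (R.restrictDot hF D) i j = 0 := by
  rw [dotComp, restrictDot, Preadditive.sum_comp, Preadditive.comp_sum]
  refine Finset.sum_eq_zero fun l _ => ?_
  by_cases hl : l = j
  · rw [Category.assoc, ← Category.assoc (D.ι i), D.ι_π_ne i l (hl ▸ hij), zero_comp]
  · rw [Category.assoc, Category.assoc, D.ι_π_ne l j hl, comp_zero, comp_zero, comp_zero]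

include R in
theorem restrictF_additive (i : ZMod e) : (restrictF hF i).Additive :=
  restrict_additive (seqF_additive R.F_component_additive _)

theorem crossComp_restrictCross (i j a b : ZMod e) : crossComp D (R.restrictCross hF D) i j a b =
    R.restrictCrossComp hF i j ≫ ((D.ι j ≫ D.π a) ◫ (D.ι i ≫ D.π b)) := by
  have hadd := R.restrictF_additive hF
  have h0 : ∀ i' j', (D.ι i ◫ D.ι j) ≫ ((D.π i' ◫ D.π j') ≫ R.restrictCrossComp hF i' j' ≫
      (D.ι j' ◫ D.ι i')) ≫ (D.π a ◫ D.π b) = ((D.ι i ≫ D.π i') ◫ (D.ι j ≫ D.π j')) ≫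
        R.restrictCrossComp hF i' j' ≫ ((D.ι j' ≫ D.π a) ◫ (D.ι i' ≫ D.π b)) := fun i' j' => by
    rw [NatTrans.exchange, NatTrans.exchange, Category.assoc, Category.assoc, Category.assoc]
  rw [crossComp, restrictCross, Preadditive.sum_comp, Preadditive.comp_sum,
    Fintype.sum_eq_single i]
  · rw [Preadditive.sum_comp, Preadditive.comp_sum, Fintype.sum_eq_single j]
    · rw [h0, D.ι_π_self, D.ι_π_self, id_hcomp_id', Category.id_comp]
    · intro j' hj
      rw [h0, D.ι_π_ne j j' hj.symm, hcomp_zero', zero_comp]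
  · intro i' hi
    rw [Preadditive.sum_comp, Preadditive.comp_sum]
    refine Finset.sum_eq_zero fun j' _ => ?_
    rw [h0, D.ι_π_ne i i' hi.symm, zero_hcomp (hadd _), zero_comp]

theorem crossComp_restrictCross_self (i j : ZMod e) : crossComp D (R.restrictCross hF D) i j j i =
    R.restrictCrossComp hF i j := by
  rw [crossComp_restrictCross, D.ι_π_self, D.ι_π_self, id_hcomp_id', Category.comp_id]

theorem crossComp_restrictCross_of_ne (i j a b : ZMod e) (hne : j ≠ a ∨ i ≠ b) :
    crossComp D (R.restrictCross hF D) i j a b = 0 := by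
  rw [crossComp_restrictCross]
  rcases hne with hne | hne
  · rw [D.ι_π_ne j a hne, zero_hcomp (R.restrictF_additive hF _), comp_zero]
  · rw [D.ι_π_ne i b hne, hcomp_zero', comp_zero]

include R D in
theorem additive_of_restrict : F'.Additive := D.additive_of_sum (R.restrictF_additive hF)

variable (hk : k < e)
include hk

/-- The entries of the dots on the full subcategory are the entries of the dots on the first
strands of the blocks. -/
theorem match_klrX {d r N : ℕ} (hr : r < d) (v w : List (ZMod e)) (hv : v.length = d)
    (hw : w.length = d) (hv' : (phi k v).length = N) (hw' : (phi k w).length = N) :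
    Match hF v w (seqEntry D (iterX (R.restrictDot hF D) d r) v w hv hw)
      (R.ent (klrX K (cyc (e + 1)) N (shiftPos k w r)) (phi k v) (phi k w) hv' hw') := by
  have hF' := R.additive_of_restrict hF D
  have hadd := seqF_additive (R.restrictF_additive hF)
  induction r generalizing d N v w with
  | zero =>
    obtain ⟨d, rfl⟩ : ∃ m, d = m + 1 := ⟨d - 1, by omega⟩
    obtain ⟨i, v, rfl⟩ := List.exists_cons_of_length_eq_add_one hv
    obtain ⟨j, w, rfl⟩ := List.exists_cons_of_length_eq_add_one hw
    have h1 : seqEntry D (iterX (R.restrictDot hF D) (d + 1) 0) (i :: v) (j :: w) hv hw =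
      dotComp D (R.restrictDot hF D) i j ◫ seqEntry D (𝟙 (iter F' d)) v w _ _ :=
      seqEntry_whiskerRight D _ i j v w hv hw
    rw [h1]
    by_cases hij : i = j
    · subst hij
      by_cases hvw : v = w
      · subst hvw
        rw [dotComp_restrictDot_self, seqEntry_id_self]
        refine Match.head v _ fun M => ?_
        obtain ⟨q, hq⟩ : ∃ q, (phiVertex k i).length = q + 1 :=
          ⟨(phiVertex k i).length - 1, by rw [length_phiVertex]; split_ifs <;> rfl⟩
        obtain ⟨N, rfl⟩ : ∃ m, N = m + 1 := ⟨N - 1, by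
          rw [phi, List.length_append] at hv'
          omega⟩
        have h2 := (isRightLocal_klrX_zero (R := R) (d := q) (N := N) (phi k v)).ent_append
          (phiVertex k i) (phiVertex k i) hq hq hv' hv' M.obj
        refine h2.trans ?_
        have h3 : ∀ q (h : (phiVertex k i).length = q), R.ent (klrX K (cyc (e + 1)) q 0)
          (phiVertex k i) (phiVertex k i) h h = R.doubledDot k i := fun q h => by
            subst h; rfl
        rw [h3]
        rfl
      · rw [seqEntry_id_of_ne D hF' _ _ _ _ hvw, hcomp_zero',
          R.ent_klrX_of_ne _ _ _ _ fun h => hvw (List.cons_injective (phi_injective hk h))]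
        exact match_zero _ _
    · rw [R.dotComp_restrictDot_of_ne hF D i j hij, zero_hcomp (hadd w),
        R.ent_klrX_of_ne _ _ _ _ fun h => hij (List.cons.inj (phi_injective hk h)).1]
      exact match_zero _ _
  | succ r ih =>
    obtain ⟨d, rfl⟩ : ∃ m, d = m + 1 := ⟨d - 1, by omega⟩
    obtain ⟨i, v, rfl⟩ := List.exists_cons_of_length_eq_add_one hv
    obtain ⟨j, w, rfl⟩ := List.exists_cons_of_length_eq_add_one hw
    have h1 : seqEntry D (iterX (R.restrictDot hF D) (d + 1) (r + 1)) (i :: v) (j :: w) hv hw =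
      (D.ι i ≫ D.π j) ◫ seqEntry D (iterX (R.restrictDot hF D) d r) v w _ _ :=
      seqEntry_whiskerLeft D _ i j v w hv hw
    rw [h1]
    by_cases hij : i = j
    · subst hij
      rw [D.ι_π_self]
      have e1 : (phiVertex k i).length + (phi k v).length = N := by
        rw [← hv', phi, List.length_append]
      have e2 : (phiVertex k i).length + (phi k w).length = N := by
        rw [← hw', phi, List.length_append]
      have e3 : (phiVertex k i).length + shiftPos k w r = shiftPos k (i :: w) (r + 1) := by
        simp [shiftPos, phi]
      have hs : shiftPos k w r < (phi k w).length := by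
        have := shiftPos_add_length_le (k := k) w (r := r) (by have := Nat.succ.inj hw; omega)
        rw [length_phiVertex] at this
        split_ifs at this <;> omega
      refine (ih (N := (phi k w).length) (by omega) v w (Nat.succ.inj hv) (Nat.succ.inj hw)
        (by omega) rfl).cons i fun M => ?_
      exact (isLeftLocal_klrX (R := R) (phiVertex k i) hs e2 e3).ent_append _ _ _ _ hv' hw' M
    · rw [D.ι_π_ne i j hij, zero_hcomp (hadd w),
        R.ent_klrX_of_ne _ _ _ _ fun h => hij (List.cons.inj (phi_injective hk h)).1]
      exact match_zero _ _

omit hk in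
/-- Transport of the entries along equalities of the sequences. -/
theorem ent_congr_app {n : ℕ} [NeZero n] {wt : (ZMod n → ℤ) → ObjectProperty C}
    {Ei Fi : ZMod n → C ⥤ C} (R : CategoricalRep K n wt Ei Fi) {N : ℕ} (b : KLR K (cyc n) N)
    {l l' m m' : List (ZMod n)} (h : l.length = N) (h' : l'.length = N) (hm : m = l) (hm' : m' = l')
    (M : C) : (R.ent b m m' (hm ▸ h) (hm' ▸ h')).app M =
      eqToHom (by rw [hm]) ≫ (R.ent b l l' h h').app M ≫ eqToHom (by rw [hm']) := by
  subst hm hm'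
  simp

omit hk in
/-- The crossing of the first two blocks. -/
theorem ent_crossStar_app {N : ℕ} (i j : ZMod e) (l : List (ZMod e))
    (h : (phi k (i :: j :: l)).length = N) (h' : (phi k (j :: i :: l)).length = N) (M : C) :
    (R.ent (crossStar k K N 0 j i) (phi k (i :: j :: l)) (phi k (j :: i :: l)) h h').app M =
      (appendIso Fi (phiVertex k i) (phi k (j :: l)) M ≪≫
        appendIso Fi (phiVertex k j) (phi k l) ((doubledF k Fi i).obj M)).hom ≫
      (seqF Fi (phi k l)).map ((R.doubledCross k i j).app M) ≫
        (appendIso Fi (phiVertex k j) (phi k (i :: l)) M ≪≫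
          appendIso Fi (phiVertex k i) (phi k l) ((doubledF k Fi j).obj M)).inv := by
  have hlist : ∀ i j : ZMod e, phi k (i :: j :: l) = (phiVertex k i ++ phiVertex k j) ++ phi k l :=
    fun i j => (List.append_assoc _ _ _).symm
  have hiso : ∀ i j : ZMod e, (appendIso Fi (phiVertex k i) (phi k (j :: l)) M ≪≫
      appendIso Fi (phiVertex k j) (phi k l) ((doubledF k Fi i).obj M)) =
      eqToIso (congrArg (fun l => (seqF Fi l).obj M) (hlist i j)) ≪≫ appendIso Fi (phiVertex k i ++ phiVertex k j) (phi k l) M ≪≫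
        (seqF Fi (phi k l)).mapIso (appendIso Fi (phiVertex k i) (phiVertex k j) M) := fun i j => by
    ext
    exact appendIso_assoc Fi (phiVertex k i) (phiVertex k j) (phi k l) M
  have h1 := h
  have h2 := h'
  rw [hlist] at h1 h2
  refine (R.ent_congr_app _ h1 h2 (hlist i j) (hlist j i) M).trans ?_
  rw [hiso i j, hiso j i, (isRightLocal_crossStar (R := R)
    (d := (phiVertex k i ++ phiVertex k j).length) (phi k l) j i
    (by rw [List.length_append, add_comm]) (by rw [← h1, ← List.length_append])).ent_append
    (phiVertex k i ++ phiVertex k j) (phiVertex k j ++ phiVertex k i) rfl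
      (by rw [List.length_append, List.length_append, add_comm]) h1 h2 M]
  have h3 : (R.ent (crossStar k K (phiVertex k i ++ phiVertex k j).length 0 j i)
      (phiVertex k i ++ phiVertex k j) (phiVertex k j ++ phiVertex k i) rfl
      (by rw [List.length_append, List.length_append, add_comm])).app M =
      (appendIso Fi (phiVertex k i) (phiVertex k j) M).hom ≫ (R.doubledCross k i j).app M ≫
        (appendIso Fi (phiVertex k j) (phiVertex k i) M).inv := by
    refine Eq.symm ?_
    change (appendIso Fi (phiVertex k i) (phiVertex k j) M).hom ≫
      ((appendIso Fi (phiVertex k i) (phiVertex k j) M).inv ≫ _ ≫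
        (appendIso Fi (phiVertex k j) (phiVertex k i) M).hom) ≫
        (appendIso Fi (phiVertex k j) (phiVertex k i) M).inv = _
    simp
  rw [h3]
  have h4 : ∀ {A B B' A' Y Z Z' Y' : C} (G : C ⥤ C) (a : A ⟶ B) (p : B ⟶ G.obj Y) (q : Y ⟶ Z)
      (s : Z ⟶ Z') (t : Z' ⟶ Y') (p' : G.obj Y' ⟶ B') (a' : B' ⟶ A'),
      a ≫ (p ≫ G.map (q ≫ s ≫ t) ≫ p') ≫ a' =
        (a ≫ p ≫ G.map q) ≫ G.map s ≫ (G.map t ≫ p') ≫ a' := by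
    intros
    simp
  exact h4 _ _ _ _ _ _ _ _

/-- The entries of the crossings on the full subcategory are the entries of the crossings of
blocks. -/
theorem match_klrT {d r N : ℕ} (v w : List (ZMod e)) (hv : v.length = d)
    (hw : w.length = d) (hr : r + 1 < w.length) (hv' : (phi k v).length = N)
    (hw' : (phi k w).length = N) :
    Match hF v w (seqEntry D (iterT (R.restrictCross hF D) d r) v w hv hw)
      (R.ent (crossStar k K N (shiftPos k w r) w[r] w[r + 1]) (phi k v) (phi k w) hv' hw') := by
  have hF' := R.additive_of_restrict hF D
  have hadd := seqF_additive (R.restrictF_additive hF)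
  induction r generalizing d N v w with
  | zero =>
    obtain ⟨d, rfl⟩ : ∃ m, d = m + 2 := ⟨d - 2, by omega⟩
    obtain ⟨i, v, rfl⟩ := List.exists_cons_of_length_eq_add_one hv
    obtain ⟨a, w, rfl⟩ := List.exists_cons_of_length_eq_add_one hw
    obtain ⟨j, v, rfl⟩ := List.exists_cons_of_length_eq_add_one (Nat.succ.inj hv)
    obtain ⟨b, w, rfl⟩ := List.exists_cons_of_length_eq_add_one (Nat.succ.inj hw)
    have h1 := seqEntry_cross_app D (R.restrictCross hF D) i j a b v w hv hw
    change Match hF _ _ _ (R.ent (crossStar k K N 0 a b) _ _ hv' hw')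
    by_cases hvw : i :: j :: v = b :: a :: w
    · obtain ⟨rfl, rfl, rfl⟩ : i = b ∧ j = a ∧ v = w := by simpa using hvw
      rw [crossComp_restrictCross_self, seqEntry_id_self] at h1
      exact Match.head₂ v (R.restrictCrossComp hF i j) h1 fun M =>
        R.ent_crossStar_app i j v hv' hw' M.obj
    · rw [R.entry_crossStar_of_ne hk a b w (i :: j :: v) hv' hw' hvw]
      have h0 : seqEntry D (iterT (R.restrictCross hF D) (d + 2) 0) (i :: j :: v) (a :: b :: w)
          hv hw = 0 := by
        ext M : 2
        refine (h1 M).trans ?_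
        by_cases hvw' : v = w
        · rw [crossComp_restrictCross_of_ne R hF D i j a b (by
            by_contra! hab
            exact hvw (by rw [hab.1, hab.2, hvw'])), zero_hcomp (hadd w)]
          rfl
        · rw [seqEntry_id_of_ne D hF' _ _ _ _ hvw', hcomp_zero']
          rfl
      rw [h0]
      exact match_zero _ _
  | succ r ih =>
    obtain ⟨d, rfl⟩ : ∃ m, d = m + 2 := ⟨d - 2, by omega⟩
    obtain ⟨i, v, rfl⟩ := List.exists_cons_of_length_eq_add_one hv
    obtain ⟨j, w, rfl⟩ := List.exists_cons_of_length_eq_add_one hw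
    have h1 : seqEntry D (iterT (R.restrictCross hF D) (d + 2) (r + 1)) (i :: v) (j :: w) hv hw =
      (D.ι i ≫ D.π j) ◫ seqEntry D (iterT (R.restrictCross hF D) (d + 1) r) v w _ _ :=
      seqEntry_whiskerLeft D _ i j v w hv hw
    have hr' : r + 1 < w.length := by simpa using hr
    rw [h1]
    simp only [List.getElem_cons_succ]
    have e2 : (phiVertex k j).length + (phi k w).length = N := by
      rw [← hw', phi, List.length_append]
    have e3 : (phiVertex k j).length + shiftPos k w r = shiftPos k (j :: w) (r + 1) :=
      (shiftPos_cons_succ k j w r).symm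
    have hs : shiftPos k w r + ((phiVertex k w[r]).length + (phiVertex k w[r + 1]).length) ≤
        (phi k w).length := by
      have h1 := shiftPos_succ (k := k) w (Nat.lt_of_succ_lt hr')
      have h2 := shiftPos_add_length_le (k := k) w hr'
      omega
    by_cases hij : i = j
    · subst hij
      rw [D.ι_π_self]
      have e1 : (phiVertex k i).length + (phi k v).length = N := by
        rw [← hv', phi, List.length_append]
      refine (ih (N := (phi k w).length) v w (Nat.succ.inj hv) (Nat.succ.inj hw) hr'
        (by omega) rfl).cons i fun M => ?_
      exact (isLeftLocal_crossStar (R := R) (phiVertex k i) w[r] w[r + 1] hs e2 e3).ent_append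
        _ _ _ _ hv' hw' M
    · have h0 : R.ent (crossStar k K N (shiftPos k (j :: w) (r + 1)) w[r] w[r + 1])
          (phi k (i :: v)) (phi k (j :: w)) hv' hw' = 0 := by
        obtain ⟨m, hm⟩ := exists_phiVertex_eq_cons hk i
        obtain ⟨m', hm'⟩ := exists_phiVertex_eq_cons hk j
        have hlen : (phiVertex k j).length = m'.length + 1 := by rw [hm', List.length_cons]
        have hi : phi k (i :: v) = [up k i] ++ (m ++ phi k v) := by rw [phi, hm]; rfl
        have hlocal := isLeftLocal_crossStar (R := R) (k := k) (d := N - 1) (N := N)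
          (p := m'.length + shiftPos k w r) (q := shiftPos k (j :: w) (r + 1)) [up k i]
          w[r] w[r + 1] (by omega) (by rw [List.length_singleton]; omega)
          (by rw [List.length_singleton]; omega)
        ext M
        refine (R.ent_congr_app (m' := phi k (j :: w)) _ (hi ▸ hv') hw' hi rfl M).trans ?_
        rw [hlocal.ent_eq_zero (m ++ phi k v) _ _ _ fun l' hl' => hij (up_injective (k := k) ?_),
          zero_comp, comp_zero]
        · rfl
        · have hj : phi k (j :: w) = up k j :: (m' ++ phi k w) := by rw [phi, hm']; rfl
          exact (List.cons.inj (hl'.symm.trans hj)).1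
      rw [D.ι_π_ne i j hij, zero_hcomp (hadd w), h0]
      exact match_zero _ _

end CategoricalRep

end RestrictedOps

/-! ### Nilpotency of the restricted dots -/

section Nilpotent

universe v u

variable {C : Type u} [Category.{v} C] [Preadditive C]

theorem comp_pow_of_comp_eq {X Z : C} (f : X ⟶ Z) (y : End X) (z : End Z)
    (h : f ≫ z = y ≫ f) (m : ℕ) :
    f ≫ (show Z ⟶ Z from z ^ m) = (show X ⟶ X from y ^ m) ≫ f := by
  induction m with
  | zero => exact (Category.comp_id _).trans (Category.id_comp _).symm
  | succ m ih =>
    rw [pow_succ, pow_succ]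
    change f ≫ (show Z ⟶ Z from z) ≫ (show Z ⟶ Z from z ^ m) =
      ((show X ⟶ X from y) ≫ (show X ⟶ X from y ^ m)) ≫ f
    rw [← Category.assoc, h, Category.assoc, ih, Category.assoc]

theorem isNilpotent_of_retract {X Z : C} {i : Z ⟶ X} {p : X ⟶ Z} (hip : i ≫ p = 𝟙 Z) {y : End X}
    {z : End Z} (h : p ≫ z = y ≫ p) (hy : IsNilpotent y) : IsNilpotent z := by
  obtain ⟨m, hm⟩ := hy
  refine ⟨m, ?_⟩
  have h1 := comp_pow_of_comp_eq p y z h m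
  rw [hm] at h1
  calc (show Z ⟶ Z from z ^ m) = (i ≫ p) ≫ (show Z ⟶ Z from z ^ m) := by
        rw [hip, Category.id_comp]
    _ = i ≫ (0 : X ⟶ X) ≫ p := by rw [Category.assoc, h1]
    _ = 0 := by rw [zero_comp, comp_zero]

theorem SumDecomposition.isNilpotent {J : Type*} [Fintype J] {X : C} {f : J → C}
    (D : SumDecomposition X f) {y : End X} {z : ∀ j, End (f j)}
    (h : ∀ j, D.ι j ≫ y = z j ≫ D.ι j) (hz : ∀ j, IsNilpotent (z j)) : IsNilpotent y := by
  choose m hm using hz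
  refine ⟨∑ j, m j, D.hom_ext_left fun j => ?_⟩
  have h1 : z j ^ ∑ j, m j = 0 :=
    pow_eq_zero_of_le (Finset.single_le_sum (f := m) (fun _ _ => Nat.zero_le _)
      (Finset.mem_univ j)) (hm j)
  refine (comp_pow_of_comp_eq (D.ι j) (z j) y (h j) _).trans ?_
  rw [h1]
  exact zero_comp.trans comp_zero.symm

theorem isNilpotent_map {D : Type*} [Category* D] [Preadditive D] (G : C ⥤ D) [G.Additive] {X : C}
    {z : End X} (hz : IsNilpotent z) : IsNilpotent (show End (G.obj X) from G.map z) := by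
  obtain ⟨m, hm⟩ := hz
  refine ⟨m, ?_⟩
  have h1 := map_pow (G.mapEnd X) z m
  rw [hm] at h1
  exact h1.symm.trans (G.map_zero X X)

end Nilpotent

section RestrictedNilpotent

universe v u

variable {C : Type u} [Category.{v} C] [Preadditive C] {K : Type*} [Field K] [Linear K C]
  {e k : ℕ} [NeZero e] {wt : (ZMod (e + 1) → ℤ) → ObjectProperty C}
  {Ei Fi : ZMod (e + 1) → C ⥤ C} (R : CategoricalRep K (e + 1) wt Ei Fi) {P : ObjectProperty C}
  (hF : ∀ (i : ZMod e) (M : C), P M → P ((doubledF k Fi i).obj M))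
  {F' : P.FullSubcategory ⥤ P.FullSubcategory} (D : SumDecomposition F' (restrictF hF))

namespace CategoricalRep

/-- The dot preserves the summands `F_i` of `F`, as these have different weights; hence its
components are nilpotent. -/
theorem isNilpotent_dotComp {n : ℕ} [NeZero n] [Fact (1 < n)]
    {wt : (ZMod n → ℤ) → ObjectProperty C} {Ei Fi : ZMod n → C ⥤ C}
    (R : CategoricalRep K n wt Ei Fi) (i : ZMod n) (M : C) :
    IsNilpotent (show End ((Fi i).obj M) from (dotComp R.decF R.x i i).app M) := by
  refine isNilpotent_of_retract (R.decF.ι_π_self_app i M) ?_ (R.x_nilpotent M)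
  have h : R.decF.π i ≫ dotComp R.decF R.x i i = R.x ≫ R.decF.π i := by
    refine R.decF.hom_ext_left fun j => ?_
    rw [← Category.assoc]
    by_cases hij : j = i
    · subst hij
      rw [R.decF.ι_π_self, Category.id_comp]
      rfl
    · rw [R.decF.ι_π_ne j i hij, zero_comp]
      exact (R.F_hom_eq_zero j i hij (R.decF.ι j ≫ R.x ≫ R.decF.π i)).symm
  exact congrArg (fun t => t.app M) h

theorem isNilpotent_doubledDot [Fact (1 < e + 1)] (hk : k < e) (i : ZMod e) (M : C) :
    IsNilpotent (show End ((doubledF k Fi i).obj M) from (R.doubledDot k i).app M) := by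
  obtain ⟨m, hm⟩ := exists_phiVertex_eq_cons hk i
  have := seqF_additive R.F_component_additive m
  have key : ∀ l (_ : l = up k i :: m), IsNilpotent (show End ((seqF Fi l).obj M) from
      (R.ent (klrX K (cyc (e + 1)) l.length 0) l l rfl rfl).app M) := by
    rintro l rfl
    have h1 : (R.ent (klrX K (cyc (e + 1)) (up k i :: m).length 0) (up k i :: m) (up k i :: m)
        rfl rfl).app M = (seqF Fi m).map ((dotComp R.decF R.x (up k i) (up k i)).app M) := by
      refine (congrArg (fun t => t.app M)
        (R.ent_klrX_cons_zero (up k i) (up k i) m m rfl rfl)).trans ?_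
      rw [seqEntry_id_self]
      exact hcomp_id_app _ M
    rw [h1]
    exact isNilpotent_map (seqF Fi m) (R.isNilpotent_dotComp (up k i) M)
  exact key _ hm

theorem isNilpotent_restrictDot [Fact (1 < e + 1)] (hk : k < e) (M : P.FullSubcategory) :
    IsNilpotent (show End (F'.obj M) from (R.restrictDot hF D).app M) := by
  refine (D.app M).isNilpotent
    (z := fun i => (restrictHom (hF i) (hF i) (R.doubledDot k i)).app M) (fun i => ?_) fun i => ?_
  · have h : D.ι i ≫ R.restrictDot hF D =
        restrictHom (hF i) (hF i) (R.doubledDot k i) ≫ D.ι i := by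
      refine D.hom_ext_right fun j => ?_
      rw [Category.assoc, Category.assoc]
      change dotComp D (R.restrictDot hF D) i j = _
      by_cases hij : i = j
      · subst hij
        rw [dotComp_restrictDot_self, D.ι_π_self, Category.comp_id]
      · rw [dotComp_restrictDot_of_ne R hF D i j hij, D.ι_π_ne i j hij, comp_zero]
    exact congrArg (fun t => t.app M) h
  · obtain ⟨m, hm⟩ := R.isNilpotent_doubledDot hk i M.obj
    refine ⟨m, ObjectProperty.hom_ext _ ?_⟩
    have h1 := map_pow (P.ι.mapEnd ((restrictF hF i).obj M))
      (show End ((restrictF hF i).obj M) from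
        (restrictHom (hF i) (hF i) (R.doubledDot k i)).app M) m
    exact h1.trans hm

end CategoricalRep

end RestrictedNilpotent

/-! ### The action of the KLR algebras on the restricted functors -/

section FreeAction

universe v u

variable {C : Type u} [Category.{v} C] [Preadditive C] {I : Type*} [Fintype I]
  {F : C ⥤ C} {Fi : I → C ⥤ C} (D : SumDecomposition F Fi)

/-- The action of the free algebra on the generators of a KLR algebra. -/
def freeAction (K : Type*) [Field K] [Linear K C] (x : F ⟶ F) (τ : F ⋙ F ⟶ F ⋙ F) (d : ℕ) :
    FreeAlgebra K (KLRGen I d) →ₐ[K] (End (iter F d))ᵐᵒᵖ :=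
  FreeAlgebra.lift K fun g => match g with
    | .idem v => MulOpposite.op (seqProj D d v.1 v.2 ≫ seqIncl D d v.1 v.2 : End (iter F d))
    | .dot r _ => MulOpposite.op (iterX x d r : End (iter F d))
    | .cross r _ => MulOpposite.op (iterT τ d r : End (iter F d))

theorem freeAction_idem (K : Type*) [Field K] [Linear K C] (x : F ⟶ F) (τ : F ⋙ F ⟶ F ⋙ F) (d : ℕ)
    (v : List.Vector I d) : freeAction D K x τ d (genE K v) =
      MulOpposite.op (seqProj D d v.1 v.2 ≫ seqIncl D d v.1 v.2 : End (iter F d)) :=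
  FreeAlgebra.lift_ι_apply _ _

theorem freeAction_dot (K : Type*) [Field K] [Linear K C] (x : F ⟶ F) (τ : F ⋙ F ⟶ F ⋙ F)
    (d r : ℕ) (hr : r < d) : freeAction D K x τ d (genX K I d r) =
      MulOpposite.op (iterX x d r : End (iter F d)) := by
  rw [genX, dif_pos hr]
  exact FreeAlgebra.lift_ι_apply _ _

theorem freeAction_cross (K : Type*) [Field K] [Linear K C] (x : F ⟶ F) (τ : F ⋙ F ⟶ F ⋙ F)
    (d r : ℕ) (hr : r + 1 < d) : freeAction D K x τ d (genT K I d r) =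
      MulOpposite.op (iterT τ d r : End (iter F d)) := by
  rw [genT, dif_pos hr]
  exact FreeAlgebra.lift_ι_apply _ _

/-- The dots have no entries between sequences of different dimension vectors. -/
theorem seqEntry_iterX_of_not_perm (hF : F.Additive) {x : F ⟶ F}
    (hx : ∀ i j, i ≠ j → dotComp D x i j = 0) {d r : ℕ} (hr : r < d) (l l' : List I)
    (h : l.length = d) (h' : l'.length = d) (hll : ¬ l.Perm l') :
    seqEntry D (iterX x d r) l l' h h' = 0 := by
  have hadd := seqF_additive fun i => D.additive_component hF i
  induction r generalizing d l l' with
  | zero =>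
    obtain ⟨d, rfl⟩ : ∃ m, d = m + 1 := ⟨d - 1, by omega⟩
    obtain ⟨i, l, rfl⟩ := List.exists_cons_of_length_eq_add_one h
    obtain ⟨i', l', rfl⟩ := List.exists_cons_of_length_eq_add_one h'
    refine (seqEntry_whiskerRight D x i i' l l' h h').trans ?_
    by_cases hi : i = i'
    · rw [seqEntry_id_of_ne D hF l l' _ _ fun h => hll (by rw [hi, h])]
      exact hcomp_zero' _
    · rw [hx i i' hi]
      exact zero_hcomp (hadd l') _
  | succ r ih =>
    obtain ⟨d, rfl⟩ : ∃ m, d = m + 1 := ⟨d - 1, by omega⟩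
    obtain ⟨i, l, rfl⟩ := List.exists_cons_of_length_eq_add_one h
    obtain ⟨i', l', rfl⟩ := List.exists_cons_of_length_eq_add_one h'
    refine (seqEntry_whiskerLeft D (iterX x d r) i i' l l' h h').trans ?_
    by_cases hi : i = i'
    · rw [ih (by omega) l l' _ _ fun h => hll (by rw [hi]; exact h.cons i')]
      exact hcomp_zero' _
    · rw [D.ι_π_ne i i' hi]
      exact zero_hcomp (hadd l') _

/-- The crossings have no entries between sequences of different dimension vectors. -/
theorem seqEntry_iterT_of_not_perm (hF : F.Additive) {τ : F ⋙ F ⟶ F ⋙ F}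
    (hτ : ∀ i j a b, j ≠ a ∨ i ≠ b → crossComp D τ i j a b = 0) {d r : ℕ} (hr : r + 1 < d)
    (l l' : List I) (h : l.length = d) (h' : l'.length = d) (hll : ¬ l.Perm l') :
    seqEntry D (iterT τ d r) l l' h h' = 0 := by
  have hadd := seqF_additive fun i => D.additive_component hF i
  induction r generalizing d l l' with
  | zero =>
    obtain ⟨d, rfl⟩ : ∃ m, d = m + 2 := ⟨d - 2, by omega⟩
    obtain ⟨i, l, rfl⟩ := List.exists_cons_of_length_eq_add_one h
    obtain ⟨a, l', rfl⟩ := List.exists_cons_of_length_eq_add_one h'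
    obtain ⟨j, l, rfl⟩ := List.exists_cons_of_length_eq_add_one (Nat.succ.inj h)
    obtain ⟨b, l', rfl⟩ := List.exists_cons_of_length_eq_add_one (Nat.succ.inj h')
    ext M : 2
    refine (seqEntry_cross_app D τ i j a b l l' h h' M).trans ?_
    by_cases hab : j ≠ a ∨ i ≠ b
    · rw [hτ i j a b hab, zero_hcomp (hadd l')]
      rfl
    · push Not at hab
      rw [seqEntry_id_of_ne D hF l l' _ _ fun h => hll (by
        rw [hab.1, hab.2, h]
        exact List.Perm.swap a b l'), hcomp_zero']
      rfl
  | succ r ih =>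
    obtain ⟨d, rfl⟩ : ∃ m, d = m + 2 := ⟨d - 2, by omega⟩
    obtain ⟨i, l, rfl⟩ := List.exists_cons_of_length_eq_add_one h
    obtain ⟨i', l', rfl⟩ := List.exists_cons_of_length_eq_add_one h'
    refine (seqEntry_whiskerLeft D (iterT τ (d + 1) r) i i' l l' h h').trans ?_
    by_cases hi : i = i'
    · rw [ih (by omega) l l' _ _ fun h => hll (by rw [hi]; exact h.cons i')]
      exact hcomp_zero' _
    · rw [D.ι_π_ne i i' hi]
      exact zero_hcomp (hadd l') _

end FreeAction

/-! ### Intertwining with the KLR algebra of the doubled quiver -/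

section Compare

universe v u

variable {C : Type u} [Category.{v} C] [Preadditive C] {K : Type*} [Field K] [Linear K C]
  {e k : ℕ} [NeZero e] {wt : (ZMod (e + 1) → ℤ) → ObjectProperty C}
  {Ei Fi : ZMod (e + 1) → C ⥤ C} (R : CategoricalRep K (e + 1) wt Ei Fi)
  {P : ObjectProperty C} {hF : ∀ (i : ZMod e) (M : C), P M → P ((doubledF k Fi i).obj M)}
  {F' : P.FullSubcategory ⥤ P.FullSubcategory} (D : SumDecomposition F' (restrictF hF))
  {α : ZMod e → ℕ}

namespace CategoricalRep

theorem entry_sub {n : ℕ} [NeZero n] {wt : (ZMod n → ℤ) → ObjectProperty C}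
    {Ei Fi : ZMod n → C ⥤ C} (R : CategoricalRep K n wt Ei Fi) {d : ℕ} (a b : KLR K (cyc n) d)
    (v w : List.Vector (ZMod n) d) : R.entry (a - b) v w = R.entry a v w - R.entry b v w := by
  rw [sub_eq_add_neg, entry_add, entry_neg, sub_eq_add_neg]

/-- Elements factoring through unordered sequences act by zero on objects which are killed by the
functors of unordered sequences. -/
theorem entry_app_eq_zero_of_mem_nilSpan
    (hun : ∀ l, Unordered k l → ∀ M, P M → IsZero ((seqF Fi l).obj M))
    {β : ZMod (e + 1) → ℕ} {x} (hx : x ∈ nilSpan k K β) (v w) (M : C) (hM : P M) :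
    (R.entry x v w).app M = 0 := by
  induction hx using Submodule.span_induction with
  | mem x hx =>
    obtain ⟨un, -, hu, a, b, rfl⟩ := hx
    have h1 : ordIdem k K β * (a * klrE K _ un * b) * ordIdem k K β =
        (ordIdem k K β * a * klrE K _ un) * (b * ordIdem k K β) := by
      simp only [mul_assoc]
    rw [h1, entry_mul_app]
    refine Finset.sum_eq_zero fun u _ => ?_
    by_cases huu : u = un
    · subst huu
      rw [(hun _ hu M hM).eq_of_tgt ((R.entry (ordIdem k K β * a * klrE K _ u) v u).app M) 0,
        zero_comp]
    · rw [R.entry_mul_klrE_of_ne _ _ _ _ huu]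
      exact zero_comp
  | zero => rw [entry_zero]; rfl
  | add x y _ _ hx hy =>
    rw [entry_add]
    change (R.entry x v w).app M + (R.entry y v w).app M = 0
    rw [hx, hy, add_zero]
  | smul c x _ hx =>
    rw [entry_smul]
    change c • (R.entry x v w).app M = 0
    rw [hx, smul_zero]

/-- The endomorphism `Y` of a power of the sum of the restricted functors has the same entries as
the element `B` of the corner given by the well-ordered sequences. -/
structure Intertwines (α : ZMod e → ℕ) (Y : iter F' (∑ i, α i) ⟶ iter F' (∑ i, α i))
    (B : KLR K (cyc (e + 1)) (∑ j, phiDim k α j)) : Prop where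
  match_entry : ∀ v w (hv : v ∈ seqsOf α) (hw : w ∈ seqsOf α), Match hF v.1 w.1
    (seqEntry D Y v.1 w.1 v.2 w.2) (R.entry B (phiVec k v hv) (phiVec k w hw))
  entry_eq_zero : ∀ v w, v ∈ seqsOf α → w ∉ seqsOf α → seqEntry D Y v.1 w.1 v.2 w.2 = 0
  ordIdem_mul : ordIdem k K (phiDim k α) * B = B
  mul_ordIdem : B * ordIdem k K (phiDim k α) = B

variable {R D} {Y Y' : iter F' (∑ i, α i) ⟶ iter F' (∑ i, α i)}
  {B B' : KLR K (cyc (e + 1)) (∑ j, phiDim k α j)}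

theorem Intertwines.add (h : R.Intertwines D α Y B) (h' : R.Intertwines D α Y' B') :
    R.Intertwines D α (Y + Y') (B + B') where
  match_entry v w hv hw := by
    rw [seqEntry_add, entry_add]
    exact (h.match_entry v w hv hw).add (h'.match_entry v w hv hw)
  entry_eq_zero v w hv hw := by
    rw [seqEntry_add, h.entry_eq_zero v w hv hw, h'.entry_eq_zero v w hv hw, add_zero]
  ordIdem_mul := by rw [mul_add, h.ordIdem_mul, h'.ordIdem_mul]
  mul_ordIdem := by rw [add_mul, h.mul_ordIdem, h'.mul_ordIdem]

theorem entry_eq_zero_of_notMem (hB : B * ordIdem k K (phiDim k α) = B) (v)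
    {w : List.Vector (ZMod (e + 1)) (∑ j, phiDim k α j)} (hw : w ∉ ordSeqs k (phiDim k α)) :
    R.entry B v w = 0 := by
  rw [← entry_mul_klrE_self, ← hB, mul_assoc, idemSum_mul_klrE, if_neg hw, mul_zero, entry_zero]

theorem Intertwines.comp (hk : k < e) (hF' : F'.Additive) (h : R.Intertwines D α Y B)
    (h' : R.Intertwines D α Y' B') : R.Intertwines D α (Y ≫ Y') (B * B') where
  match_entry v w hv hw := by
    rw [seqEntry_comp D hF', entry_mul]
    have h1 : ∑ u : List.Vector (ZMod e) (∑ i, α i), seqEntry D Y v.1 u.1 v.2 u.2 ≫ seqEntry D Y' u.1 w.1 u.2 w.2 =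
        ∑ u ∈ (seqsOf α).attach, seqEntry D Y v.1 u.1.1 v.2 u.1.2 ≫
          seqEntry D Y' u.1.1 w.1 u.1.2 w.2 := by
      rw [Finset.sum_attach (seqsOf α) fun u : List.Vector (ZMod e) (∑ i, α i) =>
        seqEntry D Y v.1 u.1 v.2 u.2 ≫ seqEntry D Y' u.1 w.1 u.2 w.2]
      refine (Finset.sum_subset (Finset.subset_univ _) fun u _ hu => ?_).symm
      rw [h.entry_eq_zero v u hv hu, zero_comp]
    have h2 : ∑ u, R.entry B (phiVec k v hv) u ≫ R.entry B' u (phiVec k w hw) =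
        ∑ u ∈ (seqsOf α).attach, R.entry B (phiVec k v hv) (phiVec k u.1 u.2) ≫
          R.entry B' (phiVec k u.1 u.2) (phiVec k w hw) := by
      rw [← Finset.sum_subset (Finset.subset_univ (ordSeqs k (phiDim k α)))]
      · symm
        refine Finset.sum_bij (fun u _ => phiVec k u.1 u.2) (fun u _ => phiVec_mem_ordSeqs hk _ _)
          (fun u _ u' _ h => Subtype.ext (phiVec_injective hk h)) (fun u hu => ?_) fun _ _ => rfl
        obtain ⟨u', hu', rfl⟩ := exists_phiVec_eq hk hu
        exact ⟨⟨u', hu'⟩, Finset.mem_attach _ _, rfl⟩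
      · intro u _ hu
        rw [entry_eq_zero_of_notMem h.mul_ordIdem _ hu, zero_comp]
    rw [h1, h2]
    exact match_sum _ fun u _ => (h.match_entry v u.1 hv u.2).comp (h'.match_entry u.1 w u.2 hw)
  entry_eq_zero v w hv hw := by
    rw [seqEntry_comp D hF']
    refine Finset.sum_eq_zero fun u _ => ?_
    by_cases hu : u ∈ seqsOf α
    · rw [h'.entry_eq_zero u w hu hw, comp_zero]
    · rw [h.entry_eq_zero v u hv hu, zero_comp]
  ordIdem_mul := by rw [← mul_assoc, h.ordIdem_mul]
  mul_ordIdem := by rw [mul_assoc, h'.mul_ordIdem]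

/-- A matching element of the KLR algebra may be replaced by its corner. -/
theorem intertwines_corner (hk : k < e)
    (h : ∀ v w (hv : v ∈ seqsOf α) (hw : w ∈ seqsOf α), Match hF v.1 w.1
      (seqEntry D Y v.1 w.1 v.2 w.2) (R.entry B (phiVec k v hv) (phiVec k w hw)))
    (h' : ∀ v w, v ∈ seqsOf α → w ∉ seqsOf α → seqEntry D Y v.1 w.1 v.2 w.2 = 0) :
    R.Intertwines D α Y (ordIdem k K (phiDim k α) * B * ordIdem k K (phiDim k α)) where
  match_entry v w hv hw := by
    rw [← entry_mul_klrE_self, mul_assoc, ordIdem_mul_klrE_phiVec hk, mul_assoc,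
      ← entry_klrE_mul_self, ← mul_assoc, klrE_phiVec_mul_ordIdem hk, entry_klrE_mul_self,
      entry_mul_klrE_self]
    exact h v w hv hw
  entry_eq_zero := h'
  ordIdem_mul := by
    rw [← mul_assoc, ← mul_assoc, (isIdempotentElem_idemSum K (cyc (e + 1)) _).eq]
  mul_ordIdem := by
    rw [mul_assoc _ (ordIdem k K _) (ordIdem k K _),
      (isIdempotentElem_idemSum K (cyc (e + 1)) _).eq]

/-- If `a` is related to an element which intertwines with `Y`, then every element of the corner
related to `a` has the same entries as `Y`: the difference of two related elements factors through
unordered sequences. -/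
theorem Intertwines.match_of_related (hk : k < e) (he : 1 < e)
    (hun : ∀ l, Unordered k l → ∀ M, P M → IsZero ((seqF Fi l).obj M))
    {a : KLR K (cyc e) (∑ i, α i)} (h : R.Intertwines D α Y B) (ha : Related k α a B)
    (b : OrdCorner k K (phiDim k α)) (hb : Related k α a b.1) (v w) (hv : v ∈ seqsOf α)
    (hw : w ∈ seqsOf α) : Match hF v.1 w.1 (seqEntry D Y v.1 w.1 v.2 w.2)
      (R.entry b.1 (phiVec k v hv) (phiVec k w hw)) := by
  have hcorner : ordIdem k K (phiDim k α) * (b.1 - B) * ordIdem k K (phiDim k α) = b.1 - B := by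
    obtain ⟨h1, h2⟩ := (Subsemigroup.mem_corner_iff
      (isIdempotentElem_idemSum K (cyc (e + 1)) (ordSeqs k (phiDim k α)))).mp b.2
    rw [mul_sub, h.ordIdem_mul, h1, sub_mul, h.mul_ordIdem, h2]
  have h0 : Related k α 0 (b.1 - B) := by simpa using hb.sub ha
  have hnil := mem_nilSpan_of_related_zero hk he (K := K) (α := α) ⟨b.1 - B, b.1 - B, hcorner⟩ h0
  intro M
  have h2 := R.entry_app_eq_zero_of_mem_nilSpan hun hnil (phiVec k v hv) (phiVec k w hw) M.obj
    M.property
  rw [entry_sub] at h2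
  have h3 : (R.entry b.1 (phiVec k v hv) (phiVec k w hw)).app M.obj =
      (R.entry B (phiVec k v hv) (phiVec k w hw)).app M.obj := sub_eq_zero.mp h2
  rw [h3]
  exact h.match_entry v w hv hw M

end CategoricalRep

end Compare

section Generators

universe v u

variable {C : Type u} [Category.{v} C] [Preadditive C] {K : Type*} [Field K] [Linear K C]
  {e k : ℕ} [NeZero e] {wt : (ZMod (e + 1) → ℤ) → ObjectProperty C}
  {Ei Fi : ZMod (e + 1) → C ⥤ C} (R : CategoricalRep K (e + 1) wt Ei Fi)
  {P : ObjectProperty C} (hF : ∀ (i : ZMod e) (M : C), P M → P ((doubledF k Fi i).obj M))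
  {F' : P.FullSubcategory ⥤ P.FullSubcategory} (D : SumDecomposition F' (restrictF hF))

namespace CategoricalRep

theorem not_perm_of_mem_seqsOf {α : ZMod e → ℕ} {v w : List.Vector (ZMod e) (∑ i, α i)}
    (hv : v ∈ seqsOf α) (hw : w ∉ seqsOf α) : ¬ v.1.Perm w.1 := fun h =>
  hw (mem_seqsOf.mpr fun i => (h.count_eq i).symm.trans (mem_seqsOf.mp hv i))

/-- A sum of elements of the KLR algebra with prescribed columns. -/
theorem sum_mul_klrE_phiVec_mul (hk : k < e) {α : ZMod e → ℕ}
    (c : List.Vector (ZMod e) (∑ i, α i) → KLR K (cyc (e + 1)) (∑ j, phiDim k α j))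
    (w : List.Vector (ZMod e) (∑ i, α i)) (hw : w ∈ seqsOf α) :
    (∑ u ∈ (seqsOf α).attach, c u.1 * klrE K _ (phiVec k u.1 u.2)) * klrE K _ (phiVec k w hw) =
      c w * klrE K _ (phiVec k w hw) := by
  rw [Finset.sum_mul, Finset.sum_eq_single_of_mem ⟨w, hw⟩ (Finset.mem_attach _ _), mul_assoc,
    klrE_mul_self]
  intro u _ hu
  rw [mul_assoc, klrE_mul_of_ne fun h => hu (Subtype.ext (phiVec_injective hk h)), mul_zero]

theorem related_sum_mul_klrE {α : ZMod e → ℕ} {a : KLR K (cyc e) (∑ i, α i)}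
    {c : List.Vector (ZMod e) (∑ i, α i) → KLR K (cyc (e + 1)) (∑ j, phiDim k α j)}
    (h : ∀ u (hu : u ∈ seqsOf α), Related k α (a * klrE K _ u) (c u * klrE K _ (phiVec k u hu))) :
    Related k α a (∑ u ∈ (seqsOf α).attach, c u.1 * klrE K _ (phiVec k u.1 u.2)) := by
  rw [← related_mul_idemSum_iff, idemSum, Finset.mul_sum, ← Finset.sum_attach]
  exact Related.sum fun u _ => h u.1 u.2

theorem entry_one_self {n : ℕ} [NeZero n] {wt : (ZMod n → ℤ) → ObjectProperty C}
    {Ei Fi : ZMod n → C ⥤ C} (R : CategoricalRep K n wt Ei Fi) {d : ℕ}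
    (v : List.Vector (ZMod n) d) : R.entry 1 v v = 𝟙 _ := by
  rw [entry_eq, map_one]
  exact seqEntry_id_self R.decF v.1 v.2

theorem entry_one_of_ne {n : ℕ} [NeZero n] {wt : (ZMod n → ℤ) → ObjectProperty C}
    {Ei Fi : ZMod n → C ⥤ C} (R : CategoricalRep K n wt Ei Fi) {d : ℕ}
    (v w : List.Vector (ZMod n) d) (hne : v ≠ w) : R.entry 1 v w = 0 := by
  rw [entry_eq, map_one]
  exact seqEntry_id_of_ne R.decF R.F_additive v.1 w.1 v.2 w.2 fun h => hne (Subtype.ext h)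

variable {α : ZMod e → ℕ}

theorem exists_intertwines_of_match (hk : k < e) {a : KLR K (cyc e) (∑ i, α i)}
    {Y : iter F' (∑ i, α i) ⟶ iter F' (∑ i, α i)} {B : KLR K (cyc (e + 1)) (∑ j, phiDim k α j)}
    (hB : Related k α a B)
    (h : ∀ v w (hv : v ∈ seqsOf α) (hw : w ∈ seqsOf α), Match hF v.1 w.1
      (seqEntry D Y v.1 w.1 v.2 w.2) (R.entry B (phiVec k v hv) (phiVec k w hw)))
    (h' : ∀ v w, v ∈ seqsOf α → w ∉ seqsOf α → seqEntry D Y v.1 w.1 v.2 w.2 = 0) :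
    ∃ B, Related k α a B ∧ R.Intertwines D α Y B :=
  ⟨_, hB.corner hk, intertwines_corner hk h h'⟩

theorem exists_intertwines_one (hk : k < e) :
    ∃ B, Related k α (1 : KLR K (cyc e) (∑ i, α i)) B ∧
      R.Intertwines D α (𝟙 (iter F' (∑ i, α i))) B := by
  have hF' := R.additive_of_restrict hF D
  refine R.exists_intertwines_of_match hF D hk related_one (fun v w hv hw => ?_)
    fun v w hv hw => ?_
  · by_cases hvw : v = w
    · subst hvw
      rw [seqEntry_id_self, entry_one_self]
      exact match_id v.1
    · rw [seqEntry_id_of_ne D hF' _ _ _ _ fun h => hvw (Subtype.ext h),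
        entry_one_of_ne _ _ _ fun h => hvw (phiVec_injective hk h)]
      exact match_zero v.1 w.1
  · exact seqEntry_id_of_ne D hF' _ _ _ _ fun h => hw (Subtype.ext h ▸ hv)

theorem exists_intertwines_idem (hk : k < e) (u : List.Vector (ZMod e) (∑ i, α i)) :
    ∃ B, Related k α (klrE K (cyc e) u) B ∧
      R.Intertwines D α (seqProj D _ u.1 u.2 ≫ seqIncl D _ u.1 u.2) B := by
  have hF' := R.additive_of_restrict hF D
  have hne : ∀ v w : List.Vector (ZMod e) (∑ i, α i), v ≠ u ∨ w ≠ u →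
      seqEntry D (seqProj D _ u.1 u.2 ≫ seqIncl D _ u.1 u.2) v.1 w.1 v.2 w.2 = 0 :=
    fun v w h => seqEntry_proj_of_ne D hF' _ _ _ _ _ _
      (h.imp (fun h h' => h (Subtype.ext h')) fun h h' => h (Subtype.ext h'))
  by_cases hu : u ∈ seqsOf α
  · refine R.exists_intertwines_of_match hF D hk (related_klrE hk u hu) (fun v w hv hw => ?_)
      fun v w hv hw => hne v w (Or.inr fun h => hw (h ▸ hu))
    by_cases h : v = u ∧ w = u
    · obtain ⟨rfl, rfl⟩ := h
      rw [seqEntry_proj_self, entry_klrE_self]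
      exact match_id _
    · rw [not_and_or] at h
      rw [hne v w h, entry_klrE_of_ne _ _ _ _ (h.imp (fun h h' => h (phiVec_injective hk h'))
        fun h h' => h (phiVec_injective hk h'))]
      exact match_zero v.1 w.1
  · refine R.exists_intertwines_of_match (B := 0) hF D hk ?_ (fun v w hv hw => ?_)
      fun v w hv hw => hne v w (Or.inl fun h => hu (h ▸ hv))
    · rw [← related_mul_idemSum_iff, klrE_mul_idemSum, if_neg hu]
      exact related_zero
    · rw [hne v w (Or.inl fun h => hu (h ▸ hv)), entry_zero]
      exact match_zero v.1 w.1

theorem exists_intertwines_dot (hk : k < e) {r : ℕ} (hr : r < ∑ i, α i) :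
    ∃ B, Related k α (klrX K (cyc e) (∑ i, α i) r) B ∧
      R.Intertwines D α (iterX (R.restrictDot hF D) _ r) B := by
  refine R.exists_intertwines_of_match hF D hk (related_sum_mul_klrE
    (c := fun u => klrX K _ _ (shiftPos k u.1 r)) fun u hu => related_klrX hk u hu r hr)
    (fun v w hv hw => ?_) fun v w hv hw => ?_
  · rw [← entry_mul_klrE_self, sum_mul_klrE_phiVec_mul hk
      (fun u => klrX K _ _ (shiftPos k u.1 r)) w hw, entry_mul_klrE_self]
    exact R.match_klrX hF D hk hr v.1 w.1 v.2 w.2 (phiVec k v hv).2 (phiVec k w hw).2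
  · exact seqEntry_iterX_of_not_perm D (R.additive_of_restrict hF D)
      (R.dotComp_restrictDot_of_ne hF D) hr _ _ _ _ (not_perm_of_mem_seqsOf hv hw)

theorem exists_intertwines_cross (hk : k < e) (he : 1 < e) {r : ℕ} (hr : r + 1 < ∑ i, α i) :
    ∃ B, Related k α (klrT K (cyc e) (∑ i, α i) r) B ∧
      R.Intertwines D α (iterT (R.restrictCross hF D) _ r) B := by
  refine R.exists_intertwines_of_match hF D hk (related_sum_mul_klrE
    (c := fun u => crossStar k K _ (shiftPos k u.1 r) (u.get ⟨r, Nat.lt_of_succ_lt hr⟩)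
      (u.get ⟨r + 1, hr⟩)) fun u hu => related_klrT hk he u hu r hr)
    (fun v w hv hw => ?_) fun v w hv hw => ?_
  · rw [← entry_mul_klrE_self, sum_mul_klrE_phiVec_mul hk (fun u => crossStar k K _
      (shiftPos k u.1 r) (u.get ⟨r, Nat.lt_of_succ_lt hr⟩) (u.get ⟨r + 1, hr⟩)) w hw,
      entry_mul_klrE_self]
    exact R.match_klrT hF D hk v.1 w.1 v.2 w.2 (hr.trans_eq w.2.symm) (phiVec k v hv).2
      (phiVec k w hw).2
  · exact seqEntry_iterT_of_not_perm D (R.additive_of_restrict hF D)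
      (R.crossComp_restrictCross_of_ne hF D) hr _ _ _ _ (not_perm_of_mem_seqsOf hv hw)

theorem Intertwines.smul {R : CategoricalRep K (e + 1) wt Ei Fi}
    {D : SumDecomposition F' (restrictF hF)} {Y : iter F' (∑ i, α i) ⟶ iter F' (∑ i, α i)}
    {B : KLR K (cyc (e + 1)) (∑ j, phiDim k α j)} (c : K) (h : R.Intertwines D α Y B) :
    R.Intertwines D α (c • Y) (c • B) where
  match_entry v w hv hw := by
    rw [seqEntry_smul, entry_smul]
    exact (h.match_entry v w hv hw).smul c
  entry_eq_zero v w hv hw := by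
    rw [seqEntry_smul, h.entry_eq_zero v w hv hw, smul_zero]
  ordIdem_mul := by rw [mul_smul_comm, h.ordIdem_mul]
  mul_ordIdem := by rw [smul_mul_assoc, h.mul_ordIdem]

/-- The action of a noncommutative polynomial in the generators on the powers of the sum of the
restricted functors has the same entries as a related element of the KLR algebra of
`Γ_{e + 1}`. -/
theorem exists_intertwines (hk : k < e) (he : 1 < e)
    (y : FreeAlgebra K (KLRGen (ZMod e) (∑ i, α i))) :
    ∃ B, Related k α (RingQuot.mkAlgHom K (KLRRel K (cyc e) _) y) B ∧ R.Intertwines D α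
      (freeAction D K (R.restrictDot hF D) (R.restrictCross hF D) _ y).unop B := by
  have hF' := R.additive_of_restrict hF D
  induction y using FreeAlgebra.induction with
  | grade0 c =>
    obtain ⟨B, h1, h2⟩ := R.exists_intertwines_one (α := α) hF D hk
    refine ⟨c • B, ?_, ?_⟩
    · rw [AlgHom.commutes, Algebra.algebraMap_eq_smul_one]
      exact h1.smul c
    · rw [AlgHom.commutes, Algebra.algebraMap_eq_smul_one]
      exact h2.smul hF c
  | grade1 g =>
    cases g with
    | idem u =>
      have h := freeAction_idem D K (R.restrictDot hF D) (R.restrictCross hF D) _ u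
      change ∃ B, Related k α (klrE K (cyc e) u) B ∧
        R.Intertwines D α (freeAction D K _ _ _ (genE K u)).unop B
      rw [h]
      exact R.exists_intertwines_idem hF D hk u
    | dot r hr =>
      have h := freeAction_dot D K (R.restrictDot hF D) (R.restrictCross hF D) _ r hr
      have h1 := R.exists_intertwines_dot hF D hk hr
      rw [genX, dif_pos hr] at h
      rw [klrX, genX, dif_pos hr] at h1
      rw [h]
      exact h1
    | cross r hr =>
      have h := freeAction_cross D K (R.restrictDot hF D) (R.restrictCross hF D) _ r hr
      have h1 := R.exists_intertwines_cross hF D hk he hr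
      rw [genT, dif_pos hr] at h
      rw [klrT, genT, dif_pos hr] at h1
      rw [h]
      exact h1
  | mul a b ha hb =>
    obtain ⟨B, h1, h2⟩ := ha
    obtain ⟨B', h1', h2'⟩ := hb
    refine ⟨B * B', ?_, ?_⟩
    · rw [map_mul]
      exact h1.mul h1'
    · rw [map_mul]
      exact h2.comp hk hF' h2'
  | add a b ha hb =>
    obtain ⟨B, h1, h2⟩ := ha
    obtain ⟨B', h1', h2'⟩ := hb
    refine ⟨B + B', ?_, ?_⟩
    · rw [map_add]
      exact h1.add h1'
    · rw [map_add]
      exact h2.add h2'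

/-- The defining relations of the KLR algebra hold for the action on the powers of the sum of the
restricted functors: both sides of a relation have the same class in the KLR algebra of `Γ_e`, so
the elements with which they intertwine are related to the same element. -/
theorem freeAction_rel (hk : k < e) (he : 1 < e)
    (hun : ∀ l, Unordered k l → ∀ M, P M → IsZero ((seqF Fi l).obj M)) (d : ℕ)
    {y y' : FreeAlgebra K (KLRGen (ZMod e) d)} (hy : KLRRel K (cyc e) d y y') :
    freeAction D K (R.restrictDot hF D) (R.restrictCross hF D) d y =
      freeAction D K (R.restrictDot hF D) (R.restrictCross hF D) d y' := by
  have hF' := R.additive_of_restrict hF D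
  refine MulOpposite.unop_injective (eq_of_seqEntry_eq D hF' fun v w => ?_)
  -- the entry starts at a sequence of some dimension vector `α`
  obtain ⟨α, rfl, hv⟩ : ∃ α : ZMod e → ℕ, ∃ h : d = ∑ i, α i, ∀ i, v.1.count i = α i :=
    ⟨fun i => v.1.count i, v.2.symm.trans (length_eq_of_count fun _ => rfl), fun _ => rfl⟩
  obtain ⟨B, h1, h2⟩ := R.exists_intertwines hF D hk he y
  obtain ⟨B', h1', h2'⟩ := R.exists_intertwines hF D hk he y'
  rw [RingQuot.mkAlgHom_rel K hy] at h1
  have hv := mem_seqsOf.mpr hv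
  by_cases hw : w ∈ seqsOf α
  · exact (h2.match_entry v w hv hw).eq (h2'.match_of_related hk he hun h1'
      ⟨B, B, (congrArg (· * _) h2.ordIdem_mul).trans h2.mul_ordIdem⟩ h1 v w hv hw) fun _ _ => rfl
  · exact (h2.entry_eq_zero v w hv hw).trans (h2'.entry_eq_zero v w hv hw).symm

/-- The action of the KLR algebra of `Γ_e` on the powers of the sum of the restricted functors. -/
noncomputable def restrictAction (hk : k < e) (he : 1 < e)
    (hun : ∀ l, Unordered k l → ∀ M, P M → IsZero ((seqF Fi l).obj M)) (d : ℕ) :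
    KLR K (cyc e) d →ₐ[K] (End (iter F' d))ᵐᵒᵖ :=
  RingQuot.liftAlgHom K ⟨freeAction D K (R.restrictDot hF D) (R.restrictCross hF D) d,
    fun _ _ hy => R.freeAction_rel hF D hk he hun d hy⟩

theorem restrictAction_mk (hk : k < e) (he : 1 < e)
    (hun : ∀ l, Unordered k l → ∀ M, P M → IsZero ((seqF Fi l).obj M)) (d : ℕ)
    (y : FreeAlgebra K (KLRGen (ZMod e) d)) :
    R.restrictAction hF D hk he hun d (RingQuot.mkAlgHom K (KLRRel K (cyc e) d) y) =
      freeAction D K (R.restrictDot hF D) (R.restrictCross hF D) d y :=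
  RingQuot.liftAlgHom_mkAlgHom_apply K _ _ _

end CategoricalRep

end Generators

/-! ### The restricted categorical representation -/

section Restricted

universe v u

variable {C : Type u} [Category.{v} C] [Abelian C] {K : Type*} [Field K] [Linear K C]
  {e k : ℕ} [NeZero e] {wt : (ZMod (e + 1) → ℤ) → ObjectProperty C}
  {Ei Fi : ZMod (e + 1) → C ⥤ C} (R : CategoricalRep K (e + 1) wt Ei Fi)

namespace CategoricalRep

include R in
theorem hasFiniteProducts_subProp (hk : k < e) :
    HasFiniteProducts (subProp (e := e) k wt).FullSubcategory := by
  have := directSum_isClosedUnderFiniteProducts R.weights (phiWt_injective (e := e) hk)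
  exact inferInstanceAs
    (HasFiniteProducts (directSum fun μ : ZMod e → ℤ => wt (phiWt k μ)).FullSubcategory)

/-- The categorical representation given by the direct sums of the restricted functors. -/
noncomputable def restricted (he : 1 < e) (hk : k < e) [Fact (1 < e + 1)]
    (hneg : ∀ μ : ZMod (e + 1) → ℤ, (∃ i, μ i < 0) → ∀ M : C, wt μ M → IsZero M)
    {E' F' : (subProp (e := e) k wt).FullSubcategory ⥤ (subProp (e := e) k wt).FullSubcategory}
    (dE : SumDecomposition E' fun i : ZMod e =>
      restrict (subProp (e := e) k wt) (doubledE k Ei i) (R.subProp_doubledE hk i))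
    (dF : SumDecomposition F' fun i : ZMod e =>
      restrict (subProp (e := e) k wt) (doubledF k Fi i) (R.subProp_doubledF hk i)) :
    CategoricalRep K e (fun μ => (wt (phiWt k μ)).inverseImage (subProp (e := e) k wt).ι)
      (fun i => restrict (subProp (e := e) k wt) (doubledE k Ei i) (R.subProp_doubledE hk i))
      (fun i => restrict (subProp (e := e) k wt) (doubledF k Fi i) (R.subProp_doubledF hk i)) :=
  have adjEF : E' ⊣ F' := adjunctionOfSum dE dF fun i =>
    restrictAdjunction (R.nonempty_adj_doubledEF i).some
  have adjFE : F' ⊣ E' := adjunctionOfSum dF dE fun i =>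
    restrictAdjunction (R.nonempty_adj_doubledFE i).some
  have hun := fun l hl M hM => R.isZero_of_unordered (k := k) (e := e) hk hneg (l := l) hl M hM
  { weights := isWeightDecomposition_directSum R.weights (phiWt_injective hk)
    E := E'
    F := F'
    E_additive := dE.additive_of_sum fun _ =>
      restrict_additive (seqF_additive R.E_component_additive _)
    F_additive := dF.additive_of_sum fun _ =>
      restrict_additive (seqF_additive R.F_component_additive _)
    E_linear := dE.linear_of_sum K fun _ =>
      restrict_linear (seqF_linear K R.E_component_additive R.E_component_linear _)
    F_linear := dF.linear_of_sum K fun _ =>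
      restrict_linear (seqF_linear K R.F_component_additive R.F_component_linear _)
    E_left_exact := by
      have := adjFE.rightAdjoint_preservesLimits
      infer_instance
    E_right_exact := by
      have := adjEF.leftAdjoint_preservesColimits
      infer_instance
    F_left_exact := by
      have := adjEF.rightAdjoint_preservesLimits
      infer_instance
    F_right_exact := by
      have := adjFE.leftAdjoint_preservesColimits
      infer_instance
    adjEF := adjEF
    adjFE := adjFE
    x := R.restrictDot (R.subProp_doubledF hk) dF
    τ := R.restrictCross (R.subProp_doubledF hk) dF
    decE := dE
    decF := dF
    E_wt := fun i μ M hM => R.doubledE_wt hk i μ M.obj hM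
    F_wt := fun i μ M hM => R.doubledF_wt hk i μ M.obj hM
    ψ := R.restrictAction (R.subProp_doubledF hk) dF hk he hun
    ψ_e := fun d v => (R.restrictAction_mk _ dF hk he hun d _).trans (freeAction_idem dF K _ _ d v)
    ψ_x := fun d r hr =>
      (R.restrictAction_mk _ dF hk he hun d _).trans (freeAction_dot dF K _ _ d r hr)
    ψ_t := fun d r hr =>
      (R.restrictAction_mk _ dF hk he hun d _).trans (freeAction_cross dF K _ _ d r hr)
    x_nilpotent := R.isNilpotent_restrictDot (R.subProp_doubledF hk) dF hk }

/-- The action of `R_α` on the restricted functors has the same entries as the action of the related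
elements of the corner. -/
theorem entry_restricted (he : 1 < e) (hk : k < e) [Fact (1 < e + 1)]
    (hneg : ∀ μ : ZMod (e + 1) → ℤ, (∃ i, μ i < 0) → ∀ M : C, wt μ M → IsZero M)
    {E' F' : (subProp (e := e) k wt).FullSubcategory ⥤ (subProp (e := e) k wt).FullSubcategory}
    (dE : SumDecomposition E' fun i : ZMod e =>
      restrict (subProp (e := e) k wt) (doubledE k Ei i) (R.subProp_doubledE hk i))
    (dF : SumDecomposition F' fun i : ZMod e =>
      restrict (subProp (e := e) k wt) (doubledF k Fi i) (R.subProp_doubledF hk i))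
    {α : ZMod e → ℕ} {a : KLR K (cyc e) (∑ i, α i)} (b : OrdCorner k K (phiDim k α))
    (hab : Related k α a b.1) (v w : List.Vector (ZMod e) (∑ i, α i)) (hv : v ∈ seqsOf α)
    (hw : w ∈ seqsOf α) :
    Match (R.subProp_doubledF hk) v.1 w.1 ((R.restricted he hk hneg dE dF).entry a v w)
      (R.entry b.1 (phiVec k v hv) (phiVec k w hw)) := by
  have hun := fun l hl M hM => R.isZero_of_unordered (k := k) (e := e) hk hneg (l := l) hl M hM
  obtain ⟨y, rfl⟩ := RingQuot.mkAlgHom_surjective K (KLRRel K (cyc e) _) a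
  obtain ⟨B, h1, h2⟩ := R.exists_intertwines (R.subProp_doubledF hk) dF hk he y
  have h3 := h2.match_of_related hk he hun h1 b hab v w hv hw
  rw [← R.restrictAction_mk (R.subProp_doubledF hk) dF hk he hun] at h3
  exact h3

end CategoricalRep

end Restricted

end KLRCat

theorem mainTheorem2 {K : Type*} [Field K] (e : ℕ) [NeZero e] (he : 1 < e)
    (k : ℕ) (hk : k < e)
    {C : Type*} [Category* C] [Abelian C] [Linear K C]
    (hfin : ∀ X Y : C, Module.Finite K (X ⟶ Y))
    (wt : (ZMod (e + 1) → ℤ) → ObjectProperty C) (Ei Fi : ZMod (e + 1) → (C ⥤ C))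
    (R : CategoricalRep K (e + 1) wt Ei Fi)
    (hneg : ∀ μ : ZMod (e + 1) → ℤ, (∃ i, μ i < 0) → ∀ M : C, wt μ M → IsZero M) :
    -- the full subcategory on `subProp (e := e) k wt` is abelian and Hom-finite
    IsAbelianCategory (subProp (e := e) k wt).FullSubcategory ∧
    (∀ X Y : (subProp (e := e) k wt).FullSubcategory, Module.Finite K (X ⟶ Y)) ∧
    -- it is stable under the functors, and it carries the categorical representation
    ∃ (hE : ∀ (i : ZMod e) (M : C), subProp (e := e) k wt M →
        subProp (e := e) k wt ((doubledE k Ei i).obj M))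
      (hF : ∀ (i : ZMod e) (M : C), subProp (e := e) k wt M →
        subProp (e := e) k wt ((doubledF k Fi i).obj M))
      (R' : CategoricalRep K e
        (fun μ => (wt (phiWt k μ)).inverseImage (subProp (e := e) k wt).ι)
        (fun i => restrict (subProp (e := e) k wt) (doubledE k Ei i) (hE i))
        (fun i => restrict (subProp (e := e) k wt) (doubledF k Fi i) (hF i))),
      -- the action of `R_α` is obtained by composing with the isomorphism `Φ`
      ∀ α : ZMod e → ℕ,
        ∃ Φ : KLRAlpha K (cyc e) α ≃ₐ[K] BalancedKLR k K (phiDim k α),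
          IsPhi k K α Φ ∧
          ∀ (a : KLRAlpha K (cyc e) α) (b : OrdCorner k K (phiDim k α)),
            toBalanced k K (phiDim k α) b = Φ a →
            ∀ (i j : List.Vector (ZMod e) (∑ l, α l)) (hi : i ∈ seqsOf α) (hj : j ∈ seqsOf α),
              Functor.whiskerRight (R'.entry a.1 i j) (subProp (e := e) k wt).ι ≫
                  (restrictIso k (subProp (e := e) k wt) Fi hF j.1).hom =
                (restrictIso k (subProp (e := e) k wt) Fi hF i.1).hom ≫
                  Functor.whiskerLeft (subProp (e := e) k wt).ι
                    (R.entry b.1 (phiVec k i hi) (phiVec k j hj)) := by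
  have hσ : Function.Injective (phiWt k : (ZMod e → ℤ) → ZMod (e + 1) → ℤ) := phiWt_injective hk
  have : Fact (1 < e + 1) := ⟨by omega⟩
  have := R.hasFiniteProducts_subProp (e := e) hk
  obtain ⟨E', ⟨dE⟩⟩ := exists_sumDecomposition fun i : ZMod e =>
    restrict (subProp (e := e) k wt) (doubledE k Ei i) (R.subProp_doubledE hk i)
  obtain ⟨F', ⟨dF⟩⟩ := exists_sumDecomposition fun i : ZMod e =>
    restrict (subProp (e := e) k wt) (doubledF k Fi i) (R.subProp_doubledF hk i)
  refine ⟨isAbelianCategory_directSum R.weights hσ, finite_hom_fullSubcategory hfin _,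
    R.subProp_doubledE hk, R.subProp_doubledF hk, R.restricted he hk hneg dE dF, fun α => ?_⟩
  obtain ⟨Φ, hΦ, hrel⟩ := exists_isPhi (K := K) hk he α
  exact ⟨Φ, hΦ, fun a b hab i j hi hj =>
    match_iff.mp (R.entry_restricted he hk hneg dE dF b ((hrel a b).mp hab) i j hi hj)⟩
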